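/- Let $K$ be a complete discretely valued field of mixed characteristic $(0,p)$ with ring of integers $\mathcal O_K$ and perfect residue field $k$, let $\varpi\in\mathcal O_K$ be a uniformizer and $E\in W(k)[x]$ its Eisenstein polynomial. Let $\mathcal O_{\mathbb C_p}$ be the $p$-adic completion of the ring of integers of $\overline K$, $A_{\inf}=W(\mathcal O_{\mathbb C_p}^\flat)$ with Fontaine's map $\theta:A_{\inf}\to\mathcal O_{\mathbb C_p}$, and let $B_{\mathrm{dR}}^+$ be the $\ker\theta$-adic completion of $A_{\inf}[\frac1p]$, with $\mathrm{Fil}^iB_{\mathrm{dR}}^+=(\ker\theta)^iB_{\mathrm{dR}}^+$. Choose $\varpi_n\in\mathcal O_{\overline K}$ with $\varpi_0=\varpi$, $\varpi_{n+1}^p=\varpi_n$, and primitive $p^n$-th roots of unity $\zeta_n$ with $\zeta_{n+1}^p=\zeta_n$. Put $\varpi^\flat=(\varpi_n)_n$, $\zeta^\flat=(\zeta_n)_n$ in $\mathcal O_{\mathbb C_p}^\flat$, $u=[\varpi^\flat]$, $\epsilon=[\zeta^\flat]$; in $A_{\inf}$ write $E$ for $E(u)$. Let $\mathbf A_{\max}$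 be the $p$-adic completion of the subring $A_{\inf}[\frac Ep]$ of $B_{\mathrm{dR}}^+$. Let $A=W(k)[\![x]\!]$ with the Frobenius lift $\varphi(x)=x^p$; on $W(k)[\![x,y]\!]=A[\![y-x]\!]$ let $\varphi(y)=y^p$, and on $W(k)[\![x,\mathfrak y]\!]$ let $\varphi(\mathfrak y)=(1+\mathfrak y)^p-1$. Define $$A^{(2)}=W(k)[\![x,y]\!]\{z\}_\delta^\wedge,\quad z=\tfrac{y-x}{E},\qquad A^{(2)}_{\mathrm{st}}=W(k)[\![x,\mathfrak y]\!]\{w\}_\delta^\wedge,\quad w=\tfrac{\mathfrak y}{E},$$ the $(p,E)$-completions of the $\delta$-rings obtained by freely adjoining $z$ with $Ez=y-x$, respectively $w$ with $Ew=\mathfrak y$. Let $A^{(2)}_{\max}$ be the $p$-adic completion of the $A$-subalgebra of $A[\frac1p][z]$ generated by $\frac Ep$ and $\gamma_i(z)=z^i/i!$ $(i\ge1)$, with the $A$-algebra map $W(k)[\![x,y]\!]\to A^{(2)}_{\max}$, $y-x\mapsto Ez$, and let $A^{(2)}_{\mathrm{st},\max}$ be the $p$-adic completion of $W(k)[\![x,\mathfrak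 y]\!][w,\frac Ep,\gamma_i(w),\,i\ge0]$. For $R$ one of these two rings put $\mathrm{Fil}^iR=R\cap E^iR[\frac1p]$. Then: 1. There are unique ring homomorphisms $W(k)[\![x,y]\!]\to A_{\inf}$ with $x\mapsto u$, $y\mapsto\epsilon u$, and $W(k)[\![x,\mathfrak y]\!]\to A_{\inf}$ with $x\mapsto u$, $\mathfrak y\mapsto\epsilon-1$, compatible with the canonical map $W(k)\to A_{\inf}$, and both are injective. The map $A_{\inf}\to\mathbf A_{\max}$ is injective, and the inclusion $A_{\inf}[\frac Ep]\subset B_{\mathrm{dR}}^+$ has a unique continuous extension to a ring homomorphism $\mathbf A_{\max}\to B_{\mathrm{dR}}^+$ (for the $p$-adic topology of $\mathbf A_{\max}$ and the canonical topology of $B_{\mathrm{dR}}^+$), which is injective. 2. There is a unique ring homomorphism $A^{(2)}_{\max}\to\mathbf A_{\max}$ which is compatible with $W(k)[\![x,y]\!]\to A_{\inf}$; it is injective, and $\mathrm{Fil}^iB_{\mathrm{dR}}^+\cap A^{(2)}_{\max}=\mathrm{Fil}^iA^{(2)}_{\max}$ for all $i\ge0$. The same holds for $A^{(2)}_{\mathrm{st},\max}$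 and $W(k)[\![x,\mathfrak y]\!]\to A_{\inf}$. 3. There is a unique ring homomorphism $\iota_A:A^{(2)}\to A_{\inf}$ extending $W(k)[\![x,y]\!]\to A_{\inf}$ (so $x\mapsto[\varpi^\flat]$, $y\mapsto\epsilon[\varpi^\flat]$), and a unique ring homomorphism $\iota_{\mathrm{st}}:A^{(2)}_{\mathrm{st}}\to A_{\inf}$ extending $W(k)[\![x,\mathfrak y]\!]\to A_{\inf}$. Writing $\varphi$ for the Witt vector Frobenius of $A_{\inf}$, they satisfy $\varphi(\iota_A(\delta^n(z)))=\iota_A(\delta^n(z))^p+p\,\iota_A(\delta^{n+1}(z))$ and $\varphi(\iota_{\mathrm{st}}(\delta^n(w)))=\iota_{\mathrm{st}}(\delta^n(w))^p+p\,\iota_{\mathrm{st}}(\delta^{n+1}(w))$ for all $n\ge0$, that is, they are maps of $\delta$-rings; and both are injective. 4. $\epsilon-1$ is divisible by $E$ in $A_{\inf}$, and $\theta\bigl(\frac{\epsilon-1}E\bigr)$ is transcendental over $K$. -/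

import Mathlib

noncomputable section

namespace PrismEmb

/-! ## Power series rings with Frobenius, and prismatic envelopes -/

section Envelope

variable (p : ℕ) [Fact p.Prime]

/-- The ring endomorphism of `A⟦t⟧` which is `φ` on `A` and sends `t` to `s`, where `s` is a power
series without constant term. -/
def frobSubst {A : Type*} [CommRing A] (φ : A →+* A) (s : PowerSeries A)
    (hs : PowerSeries.HasSubst s) : PowerSeries A →+* PowerSeries A :=
  (PowerSeries.substAlgHom (S := A) (R := A) hs).toRingHom.comp (PowerSeries.map φ)

section General

variable {B : Type*} [CommRing B]

/-- The Frobenius lift on `B[z₀, z₁, z₂, …]` which extends `φ` on `B` and for which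
`δ(zₙ) = zₙ₊₁`, that is, `zₙ ↦ zₙ ^ p + p zₙ₊₁`.  If `φ` is a Frobenius lift on the `p`-torsion free
ring `B`, this is the free `δ`-`B`-algebra `B{z}` on `z = z₀`, and `zₙ = δⁿ(z)`. -/
def freeDeltaFrob (φ : B →+* B) : MvPolynomial ℕ B →+* MvPolynomial ℕ B :=
  MvPolynomial.eval₂Hom ((MvPolynomial.C : B →+* MvPolynomial ℕ B).comp φ)
    fun n => MvPolynomial.X n ^ p + (p : MvPolynomial ℕ B) * MvPolynomial.X (n + 1)

/-- The `δ`-ideal of `B{z}` generated by `E z - t`: the smallest ideal which contains `E z - t` and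
is stable under `δ`.  Here `g = δ(f)` is expressed by `p g = φ(f) - f ^ p`. -/
def deltaIdeal (φ : B →+* B) (E t : B) : Ideal (MvPolynomial ℕ B) :=
  sInf {I | MvPolynomial.C E * MvPolynomial.X 0 - MvPolynomial.C t ∈ I ∧
    ∀ f ∈ I, ∀ g, (p : MvPolynomial ℕ B) * g = freeDeltaFrob p φ f - f ^ p → g ∈ I}

/-- The `δ`-`B`-algebra `B{t/E}` before completion. -/
abbrev PreEnvelope (φ : B →+* B) (E t : B) : Type _ :=
  MvPolynomial ℕ B ⧸ deltaIdeal p φ E t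

/-- The `(p, E)`-completion `B{t/E}^∧` of `B{t/E}`. -/
def Envelope (φ : B →+* B) (E t : B) : Type _ :=
  AdicCompletion
    (Ideal.span {(p : PreEnvelope p φ E t), algebraMap B (PreEnvelope p φ E t) E})
    (PreEnvelope p φ E t)

instance (φ : B →+* B) (E t : B) : CommRing (Envelope p φ E t) :=
  inferInstanceAs <| CommRing (AdicCompletion
    (Ideal.span {(p : PreEnvelope p φ E t), algebraMap B (PreEnvelope p φ E t) E})
    (PreEnvelope p φ E t))

/-- The completion map `B{t/E} → B{t/E}^∧`. -/
def ofPreEnvelope (φ : B →+* B) (E t : B) : PreEnvelope p φ E t →+* Envelope p φ E t :=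
  algebraMap (PreEnvelope p φ E t) (AdicCompletion
    (Ideal.span {(p : PreEnvelope p φ E t), algebraMap B (PreEnvelope p φ E t) E})
    (PreEnvelope p φ E t))

/-- The structure map `B → B{t/E}^∧`. -/
def toEnvelope (φ : B →+* B) (E t : B) : B →+* Envelope p φ E t :=
  (ofPreEnvelope p φ E t).comp (algebraMap B (PreEnvelope p φ E t))

/-- The element `δⁿ(t/E)` of `B{t/E}^∧`. -/
def envelopeDelta (φ : B →+* B) (E t : B) (n : ℕ) : Envelope p φ E t :=
  ofPreEnvelope p φ E t (Ideal.Quotient.mk (deltaIdeal p φ E t) (MvPolynomial.X n))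

end General

variable (k : Type*) [CommRing k]

/-- The Breuil–Kisin ring `A = W(k)⟦x⟧`. -/
abbrev BK : Type _ := PowerSeries (WittVector p k)

/-- The ring `W(k)⟦x⟧⟦t⟧`.  With `t = y - x` it is `A⟦y - x⟧ = W(k)⟦x, y⟧`; with `t = 𝔶` it is
`W(k)⟦x, 𝔶⟧`. -/
abbrev BK2 : Type _ := PowerSeries (BK p k)

/-- The variable `x` of `W(k)⟦x⟧⟦t⟧`. -/
def xVar : BK2 p k := PowerSeries.C PowerSeries.X

/-- The variable `t` of `W(k)⟦x⟧⟦t⟧`. -/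
def tVar : BK2 p k := PowerSeries.X

/-- The Frobenius of `A = W(k)⟦x⟧`: the Witt vector Frobenius on `W(k)`, and `x ↦ x ^ p`. -/
def frobBK : BK p k →+* BK p k :=
  (PowerSeries.expand p (Fact.out : p.Prime).ne_zero).toRingHom.comp
    (PowerSeries.map WittVector.frobenius)

/-- `(x + t) ^ p - x ^ p`, which is `y ^ p - x ^ p` for `t = y - x`. -/
def frobT : BK2 p k := (xVar p k + tVar p k) ^ p - xVar p k ^ p

/-- `(1 + t) ^ p - 1`. -/
def frobTst : BK2 p k := (1 + tVar p k) ^ p - 1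

lemma hasSubst_frobT : PowerSeries.HasSubst (frobT p k) :=
  PowerSeries.HasSubst.of_constantCoeff_zero' (by simp [frobT, xVar, tVar])

lemma hasSubst_frobTst : PowerSeries.HasSubst (frobTst p k) :=
  PowerSeries.HasSubst.of_constantCoeff_zero' (by simp [frobTst, tVar])

/-- The Frobenius of `W(k)⟦x, y⟧` (with `t = y - x`): `x ↦ x ^ p`, `y ↦ y ^ p`. -/
def frobCrys : BK2 p k →+* BK2 p k :=
  frobSubst (frobBK p k) (frobT p k) (hasSubst_frobT p k)

/-- The Frobenius of `W(k)⟦x, 𝔶⟧` (with `t = 𝔶`): `x ↦ x ^ p`, `𝔶 ↦ (1 + 𝔶) ^ p - 1`. -/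
def frobSt : BK2 p k →+* BK2 p k :=
  frobSubst (frobBK p k) (frobTst p k) (hasSubst_frobTst p k)

variable {k}

/-- `E = E(x)` as an element of `A = W(k)⟦x⟧`. -/
def eBK (E : Polynomial (WittVector p k)) : BK p k := (E : PowerSeries (WittVector p k))

/-- `E = E(x)` as an element of `W(k)⟦x⟧⟦t⟧`. -/
def eBK2 (E : Polynomial (WittVector p k)) : BK2 p k := PowerSeries.C (eBK p E)

/-- `A⁽²⁾ = W(k)⟦x, y⟧{(y - x)/E}^∧`. -/
abbrev A2 (E : Polynomial (WittVector p k)) : Type _ :=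
  Envelope p (frobCrys p k) (eBK2 p E) (tVar p k)

/-- `A⁽²⁾_st = W(k)⟦x, 𝔶⟧{𝔶/E}^∧`. -/
abbrev A2st (E : Polynomial (WittVector p k)) : Type _ :=
  Envelope p (frobSt p k) (eBK2 p E) (tVar p k)

/-- The structure map `W(k)⟦x, y⟧ → A⁽²⁾`. -/
def toA2 (E : Polynomial (WittVector p k)) : BK2 p k →+* A2 p E :=
  toEnvelope p (frobCrys p k) (eBK2 p E) (tVar p k)

/-- The structure map `W(k)⟦x, 𝔶⟧ → A⁽²⁾_st`. -/
def toA2st (E : Polynomial (WittVector p k)) : BK2 p k →+* A2st p E :=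
  toEnvelope p (frobSt p k) (eBK2 p E) (tVar p k)

/-- The element `δⁿ(z)` of `A⁽²⁾`, where `z = (y - x)/E`. -/
def deltaZ (E : Polynomial (WittVector p k)) (n : ℕ) : A2 p E :=
  envelopeDelta p (frobCrys p k) (eBK2 p E) (tVar p k) n

/-- The element `δⁿ(w)` of `A⁽²⁾_st`, where `w = 𝔶/E`. -/
def deltaW (E : Polynomial (WittVector p k)) (n : ℕ) : A2st p E :=
  envelopeDelta p (frobSt p k) (eBK2 p E) (tVar p k) n

end Envelope

/-! ## Evaluating power series in adic completions -/

section Eval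

variable {A S : Type*} [CommRing A] [CommRing S]

/-- If `s ^ n = 0`, then `Σ aᵢ tⁱ ↦ Σ_{i < n} φ(aᵢ) sⁱ` is a ring homomorphism. -/
def evalNil (φ : A →+* S) (s : S) (n : ℕ) (hs : s ^ n = 0) : PowerSeries A →+* S where
  toFun f := (PowerSeries.trunc n f).eval₂ φ s
  map_one' := by
    cases n with
    | zero =>
      have h : (1 : S) = 0 := by simpa using hs
      simp [h]
    | succ n => simp
  map_zero' := by simp
  map_add' f g := by simp [Polynomial.eval₂_add]
  map_mul' f g := by
    have key : ∀ q : Polynomial A,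
        (PowerSeries.trunc n (q : PowerSeries A)).eval₂ φ s = q.eval₂ φ s := by
      intro q
      have hd : (Polynomial.X : Polynomial A) ^ n ∣
          q - PowerSeries.trunc n (q : PowerSeries A) := by
        rw [Polynomial.X_pow_dvd_iff]
        intro d hd
        simp [PowerSeries.coeff_trunc, hd]
      obtain ⟨r, hr⟩ := hd
      have := congrArg (Polynomial.eval₂ φ s) hr
      rw [Polynomial.eval₂_sub, Polynomial.eval₂_mul, Polynomial.eval₂_X_pow, hs, zero_mul,
        sub_eq_zero] at this
      exact this.symm
    rw [← Polynomial.eval₂_mul, ← key (_ * _), Polynomial.coe_mul,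
      PowerSeries.trunc_trunc_mul_trunc]

/-- For `s ∈ I`, the ring homomorphism `A⟦t⟧ → S^∧`, `Σ aᵢ tⁱ ↦ Σ φ(aᵢ) sⁱ`, to the `I`-adic
completion of `S`. -/
def evalAdic (φ : A →+* S) (I : Ideal S) (s : S) (hs : s ∈ I) :
    PowerSeries A →+* AdicCompletion I S :=
  AdicCompletion.liftRingHom I
    (fun n => evalNil ((Ideal.Quotient.mk (I ^ n)).comp φ) (Ideal.Quotient.mk (I ^ n) s) n
      (by rw [← map_pow]; exact Ideal.Quotient.eq_zero_iff_mem.2 (Ideal.pow_mem_pow hs n)))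
    (by
      intro m n hmn
      ext f
      obtain ⟨d, rfl⟩ := Nat.exists_eq_add_of_le hmn
      have hs0 : (Ideal.Quotient.mk (I ^ m) s) ^ m = 0 := by
        rw [← map_pow]; exact Ideal.Quotient.eq_zero_iff_mem.2 (Ideal.pow_mem_pow hs m)
      simp only [RingHom.comp_apply, evalNil, RingHom.coe_mk, MonoidHom.coe_mk, OneHom.coe_mk,
        Polynomial.hom_eval₂]
      rw [show ((Ideal.Quotient.factorPow I hmn).comp ((Ideal.Quotient.mk (I ^ (m + d))).comp φ))
          = (Ideal.Quotient.mk (I ^ m)).comp φ from rfl,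
        show Ideal.Quotient.factorPow I hmn (Ideal.Quotient.mk (I ^ (m + d)) s)
          = Ideal.Quotient.mk (I ^ m) s from rfl]
      simp only [PowerSeries.eval₂_trunc_eq_sum_range]
      rw [Finset.sum_range_add]
      simp [pow_add, hs0])

end Eval

/-! ## The rings `A⁽²⁾_max` and `A⁽²⁾_st,max` -/

section Max

variable (p : ℕ) {A : Type*} [CommRing A]

/-- The `A`-subalgebra of `A[1/p][z]` generated by `E/p` and the divided powers
`γᵢ(z) = zⁱ/i!`, `i ≥ 1`.  (For `A = W(k)⟦x⟧` the ring `A[1/p][z]` is a `ℚ`-algebra, so that `E/p` and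
`zⁱ/i!` are the unique elements `g` with `p g = E`, respectively `i! g = zⁱ`.) -/
def preMax (E : A) : Subalgebra A (Polynomial (Localization.Away (p : A))) :=
  Algebra.adjoin A
    ({g | (p : Polynomial (Localization.Away (p : A))) * g =
        Polynomial.C (algebraMap A (Localization.Away (p : A)) E)} ∪
      {g | ∃ i : ℕ, 1 ≤ i ∧
        (i.factorial : Polynomial (Localization.Away (p : A))) * g = Polynomial.X ^ i})

/-- The `p`-adic completion of `A[E/p, γᵢ(z), i ≥ 1]`. -/
def MaxRing (E : A) : Type _ :=
  AdicCompletion (Ideal.span {(p : preMax p E)}) (preMax p E)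

instance (E : A) : CommRing (MaxRing p E) :=
  inferInstanceAs <| CommRing (AdicCompletion (Ideal.span {(p : preMax p E)}) (preMax p E))

/-- The element `z` of `A[E/p, γᵢ(z), i ≥ 1]`. -/
def zMax (E : A) : preMax p E :=
  ⟨Polynomial.X, Algebra.subset_adjoin (Or.inr ⟨1, le_rfl, by simp⟩)⟩

/-- The element `E z` of `A[E/p, γᵢ(z), i ≥ 1]` is a multiple of `p`. -/
lemma mul_zMax_mem (E : A) :
    algebraMap A (preMax p E) E * zMax p E ∈ Ideal.span {(p : preMax p E)} := by
  let g : Polynomial (Localization.Away (p : A)) :=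
    Polynomial.C (IsLocalization.Away.invSelf (p : A)) *
      Polynomial.C (algebraMap A (Localization.Away (p : A)) E)
  have hg : (p : Polynomial (Localization.Away (p : A))) * g =
      Polynomial.C (algebraMap A (Localization.Away (p : A)) E) := by
    have h1 : (p : Localization.Away (p : A)) *
        IsLocalization.Away.invSelf (S := Localization.Away (p : A)) (p : A) = 1 := by
      simpa using IsLocalization.Away.mul_invSelf (S := Localization.Away (p : A)) (p : A)
    have h2 : (p : Polynomial (Localization.Away (p : A))) *
        Polynomial.C (IsLocalization.Away.invSelf (p : A)) = 1 := by
      rw [← Polynomial.C_eq_natCast, ← Polynomial.C_mul, h1, Polynomial.C_1]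
    simp only [g, ← mul_assoc, h2, one_mul]
  have hmem : g ∈ preMax p E := Algebra.subset_adjoin (Or.inl hg)
  have : algebraMap A (preMax p E) E = (p : preMax p E) * ⟨g, hmem⟩ := by
    apply Subtype.ext
    simpa [Polynomial.algebraMap_apply] using hg.symm
  rw [this, mul_assoc]
  exact Ideal.mul_mem_right _ _ (Ideal.mem_span_singleton_self _)

/-- The `A`-algebra map `A⟦t⟧ → A[E/p, γᵢ(z), i ≥ 1]^∧` with `t ↦ E z`. -/
def toMaxRing (E : A) : PowerSeries A →+* MaxRing p E :=
  evalAdic (algebraMap A (preMax p E)) _ _ (mul_zMax_mem p E)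

end Max

section MaxSt

variable (p : ℕ) {B : Type*} [CommRing B] [IsDomain B]

/-- The `B`-subalgebra `B[w, E/p, γᵢ(w), i ≥ 0]` of the fraction field of `B`, where `w = t/E` and
`γᵢ(w) = wⁱ/i!`. -/
def preStMax (E t : B) : Subalgebra B (FractionRing B) :=
  Algebra.adjoin B
    ({algebraMap B (FractionRing B) E / (p : FractionRing B)} ∪
      Set.range fun i : ℕ =>
        (algebraMap B (FractionRing B) t / algebraMap B (FractionRing B) E) ^ i /
          (i.factorial : FractionRing B))

/-- The `p`-adic completion of `B[w, E/p, γᵢ(w), i ≥ 0]`, where `w = t/E`. -/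
def StMaxRing (E t : B) : Type _ :=
  AdicCompletion (Ideal.span {(p : preStMax p E t)}) (preStMax p E t)

instance (E t : B) : CommRing (StMaxRing p E t) :=
  inferInstanceAs <| CommRing (AdicCompletion (Ideal.span {(p : preStMax p E t)}) (preStMax p E t))

/-- The structure map `B → B[w, E/p, γᵢ(w), i ≥ 0]^∧`. -/
def toStMaxRing (E t : B) : B →+* StMaxRing p E t :=
  (algebraMap (preStMax p E t)
    (AdicCompletion (Ideal.span {(p : preStMax p E t)}) (preStMax p E t))).comp
      (algebraMap B (preStMax p E t))

end MaxSt

section MaxBK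

variable (p : ℕ) [Fact p.Prime]

/-- `A⁽²⁾_max`: the `p`-adic completion of `A[E/p, γᵢ(z), i ≥ 1]`, where `A = W(k)⟦x⟧`. -/
abbrev A2max {k : Type*} [CommRing k] (E : Polynomial (WittVector p k)) : Type _ :=
  MaxRing p (eBK p E)

/-- The structure map `W(k)⟦x, y⟧ = A⟦y - x⟧ → A⁽²⁾_max`: the `A`-algebra map with
`y - x ↦ E z`. -/
def toA2max {k : Type*} [CommRing k] (E : Polynomial (WittVector p k)) :
    BK2 p k →+* A2max p E :=
  toMaxRing p (eBK p E)

/-- `A⁽²⁾_st,max`: the `p`-adic completion of `W(k)⟦x, 𝔶⟧[w, E/p, γᵢ(w), i ≥ 0]`, `w = 𝔶/E`. -/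
abbrev A2stmax {k : Type*} [CommRing k] [IsDomain k] [CharP k p] (E : Polynomial (WittVector p k)) : Type _ :=
  StMaxRing p (eBK2 p E) (tVar p k)

/-- The structure map `W(k)⟦x, 𝔶⟧ → A⁽²⁾_st,max`. -/
def toA2stmax {k : Type*} [CommRing k] [IsDomain k] [CharP k p] (E : Polynomial (WittVector p k)) :
    BK2 p k →+* A2stmax p E :=
  toStMaxRing p (eBK2 p E) (tVar p k)

end MaxBK

/-- `Filⁱ R = R ∩ Eⁱ R[1/p]`. -/
def filMax {R : Type*} [CommRing R] (p : ℕ) (E : R) (i : ℕ) : Ideal R :=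
  (Ideal.span {algebraMap R (Localization.Away (p : R)) E ^ i}).comap
    (algebraMap R (Localization.Away (p : R)))

/-! ## The ring of integers of `ℂ_p`, and `A_inf` -/

lemma not_isUnit_p_OK (p : ℕ) (OK : Type*) [CommRing OK] [IsLocalRing OK]
    [CharP (IsLocalRing.ResidueField OK) p] : ¬ IsUnit (p : OK) := by
  have h : IsLocalRing.residue OK (p : OK) = 0 := by simp
  exact (IsLocalRing.residue_eq_zero_iff _).1 h

section Periods

variable (p : ℕ) (OK : Type*) [CommRing OK] [IsDomain OK] [IsDiscreteValuationRing OK]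
variable [CharP (IsLocalRing.ResidueField OK) p]
variable (K : Type*) [Field K] [Algebra OK K] [IsFractionRing OK K]

/-- The ring of integers of the algebraic closure of `K`. -/
abbrev OKbar : Type _ := integralClosure OK (AlgebraicClosure K)

/-- The ring of integers of `ℂ_p`: the `p`-adic completion of the ring of integers of the
algebraic closure of `K`. -/
abbrev OC : Type _ := AdicCompletion (Ideal.span {(p : OKbar OK K)}) (OKbar OK K)

instance fact_OK : Fact (¬ IsUnit (p : OK)) := ⟨not_isUnit_p_OK p OK⟩

lemma not_isUnit_p_OKbar : ¬ IsUnit (p : OKbar OK K) := by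
  intro h
  obtain ⟨b, hb⟩ := h.exists_right_inv
  have hinj : Function.Injective (algebraMap K (AlgebraicClosure K)) :=
    (algebraMap K (AlgebraicClosure K)).injective
  have hb' : (p : AlgebraicClosure K) * (b : AlgebraicClosure K) = 1 := by
    simpa using congrArg (Subtype.val) hb
  have hbK : (b : AlgebraicClosure K) = algebraMap K (AlgebraicClosure K) ((p : K)⁻¹) := by
    rw [map_inv₀, map_natCast]
    exact eq_inv_of_mul_eq_one_right hb'
  have hint : IsIntegral OK ((p : K)⁻¹) := by
    rw [← isIntegral_algebraMap_iff hinj, ← hbK]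
    exact b.2
  obtain ⟨c, hc⟩ := IsIntegrallyClosed.isIntegral_iff.1 hint
  have hp0 : (p : K) ≠ 0 := by
    intro h0
    have : (p : AlgebraicClosure K) = 0 := by
      rw [← map_natCast (algebraMap K (AlgebraicClosure K)), h0, map_zero]
    rw [this, zero_mul] at hb'
    exact zero_ne_one hb'
  apply not_isUnit_p_OK p OK
  refine IsUnit.of_mul_eq_one c ?_
  apply IsFractionRing.injective OK K
  rw [map_mul, map_natCast, hc, map_one, mul_inv_cancel₀ hp0]

instance fact_OC : Fact (¬ IsUnit (p : OC p OK K)) := by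
  refine ⟨fun h => not_isUnit_p_OKbar p OK K ?_⟩
  have h1 := h.map (AdicCompletion.evalOneₐ (Ideal.span {(p : OKbar OK K)}))
  have h0 : (p : OKbar OK K ⧸ Ideal.span {(p : OKbar OK K)}) = 0 := by
    rw [← map_natCast (Ideal.Quotient.mk (Ideal.span {(p : OKbar OK K)}))]
    exact Ideal.Quotient.eq_zero_iff_mem.2 (Ideal.mem_span_singleton_self _)
  rw [map_natCast, h0, isUnit_zero_iff] at h1
  rw [← Ideal.span_singleton_eq_top]
  exact Ideal.Quotient.zero_eq_one_iff.1 h1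

instance isAdicComplete_OC : IsAdicComplete (Ideal.span {(p : OC p OK K)}) (OC p OK K) := by
  have h := AdicCompletion.isAdicComplete (M := OKbar OK K)
    (Submodule.fg_span_singleton (p : OKbar OK K) : (Ideal.span {(p : OKbar OK K)}).FG)
  have h2 := (IsAdicComplete.map_algebraMap_iff (S := OC p OK K)
    (I := Ideal.span {(p : OKbar OK K)}) (M := OC p OK K)).2 h
  simpa [Ideal.map_span] using h2

variable [Fact p.Prime]

/-- `A_inf = W(𝒪_{ℂ_p}^♭)`. -/
abbrev Ainf : Type _ := WittVector p (PreTilt (OC p OK K) p)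

variable {OK K}

/-- The element `(aₙ mod p)ₙ` of `𝒪_{ℂ_p}^♭` for a sequence `aₙ` in the ring of integers of the
algebraic closure of `K` with `aₙ₊₁ ^ p = aₙ`. -/
def flatOfSeq (a : ℕ → OKbar OK K) (ha : ∀ n, a (n + 1) ^ p = a n) : PreTilt (OC p OK K) p :=
  ⟨fun n => Ideal.Quotient.mk _ (algebraMap (OKbar OK K) (OC p OK K) (a n)), fun n => by
    rw [← map_pow, ← map_pow, ha]⟩

variable (OK K)

/-! ### Coefficient rings: `k → 𝒪_K^♭`, `W(k) → 𝒪_K` and `W(k) → A_inf` -/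

/-- The reduction `𝒪_K / p → k`. -/
def modPToResidue : ModP OK p →+* IsLocalRing.ResidueField OK :=
  Ideal.Quotient.lift _ (IsLocalRing.residue OK) (by
    intro a ha
    obtain ⟨b, rfl⟩ := Ideal.mem_span_singleton'.1 ha
    simp)

lemma exists_pow_eq_zero_of_modPToResidue [CharZero OK] :
    ∃ N : ℕ, ∀ a : ModP OK p, modPToResidue p OK a = 0 → a ^ p ^ N = 0 := by
  obtain ⟨ϖ, hϖ⟩ := IsDiscreteValuationRing.exists_irreducible OK
  have hp0 : (p : OK) ≠ 0 := Nat.cast_ne_zero.2 (Fact.out : p.Prime).ne_zero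
  obtain ⟨n, u, hn⟩ := IsDiscreteValuationRing.eq_unit_mul_pow_irreducible hp0 hϖ
  refine ⟨n, fun a ha => ?_⟩
  obtain ⟨a, rfl⟩ := Ideal.Quotient.mk_surjective a
  have ha' : IsLocalRing.residue OK a = 0 := ha
  rw [IsLocalRing.residue_eq_zero_iff, hϖ.maximalIdeal_eq, Ideal.mem_span_singleton] at ha'
  obtain ⟨b, rfl⟩ := ha'
  rw [← map_pow, Ideal.Quotient.eq_zero_iff_mem, Ideal.mem_span_singleton, hn]
  have h1 : n ≤ p ^ n := (Nat.lt_pow_self (Fact.out : p.Prime).one_lt).le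
  have h2 : ϖ ^ n ∣ (ϖ * b) ^ p ^ n := by
    rw [mul_pow]
    exact Dvd.dvd.mul_right (pow_dvd_pow _ h1) _
  exact (Units.mul_left_dvd (u := u) (a := ϖ ^ n)).2 h2

/-- The map `𝒪_K^♭ = lim 𝒪_K / p → k`, `(aₙ)ₙ ↦ a₀ mod ϖ`. -/
def tiltToResidue : PreTilt OK p →+* IsLocalRing.ResidueField OK :=
  (modPToResidue p OK).comp (PreTilt.coeff 0)

variable [CharZero OK] [PerfectRing (IsLocalRing.ResidueField OK) p]

lemma tiltToResidue_bijective : Function.Bijective (tiltToResidue p OK) := by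
  obtain ⟨N, hN⟩ := exists_pow_eq_zero_of_modPToResidue p OK
  constructor
  · rw [injective_iff_map_eq_zero]
    intro f hf
    have hpow : ∀ n m : ℕ, (PreTilt.coeff (n + m) f) ^ p ^ m = PreTilt.coeff n f := by
      intro n m
      induction m with
      | zero => simp
      | succ m ih => rw [pow_succ', pow_mul, ← add_assoc, PreTilt.coeff_pow_p, ih]
    have h0 : ∀ n, modPToResidue p OK (PreTilt.coeff n f) = 0 := by
      intro n
      have : (modPToResidue p OK (PreTilt.coeff n f)) ^ p ^ n = 0 := by
        rw [← map_pow]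
        have := hpow 0 n
        rw [zero_add] at this
        rw [this]
        exact hf
      exact eq_zero_of_pow_eq_zero this
    apply Perfection.ext
    intro n
    have := hN _ (h0 (n + N))
    rw [hpow n N] at this
    exact this
  · intro a
    have hsurj : Function.Surjective (modPToResidue p OK) := by
      intro b
      obtain ⟨c, hc⟩ := IsLocalRing.residue_surjective b
      exact ⟨Ideal.Quotient.mk _ c, hc⟩
    choose r hr using hsurj
    let c : ℕ → ModP OK p := fun n =>
      (r ((frobeniusEquiv (IsLocalRing.ResidueField OK) p).symm^[n + N] a)) ^ p ^ N
    have hc : ∀ n, c (n + 1) ^ p = c n := by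
      intro n
      simp only [c]
      rw [← pow_mul, mul_comm, pow_mul, ← sub_eq_zero, ← sub_pow_char_pow]
      apply hN
      rw [map_sub, map_pow, hr, hr, sub_eq_zero, show n + 1 + N = (n + N) + 1 by ring,
        Function.iterate_succ_apply', frobeniusEquiv_symm_pow_p]
    refine ⟨⟨c, hc⟩, ?_⟩
    change modPToResidue p OK (c 0) = a
    simp only [c]
    rw [map_pow, hr, zero_add, ← iterate_frobenius, ← coe_frobeniusEquiv, ← Function.comp_apply (f := _^[N])]
    exact (Function.LeftInverse.iterate
      (frobeniusEquiv (IsLocalRing.ResidueField OK) p).right_inv N) a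

/-- The canonical isomorphism `k ≃ 𝒪_K^♭`, for perfect `k`. -/
def residueEquivTilt : IsLocalRing.ResidueField OK ≃+* PreTilt OK p :=
  (RingEquiv.ofBijective (tiltToResidue p OK) (tiltToResidue_bijective p OK)).symm

/-- The canonical map `W(k) → 𝒪_K`, where `𝒪_K` is `p`-adically complete. -/
def wittToOK [IsAdicComplete (Ideal.span {(p : OK)}) OK] :
    WittVector p (IsLocalRing.ResidueField OK) →+* OK :=
  (WittVector.fontaineTheta OK p).comp (WittVector.map (residueEquivTilt p OK).toRingHom)

/-- The canonical map `W(k) → 𝒪_K` lifts the identity of `k`. -/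
lemma residue_wittToOK [IsAdicComplete (Ideal.span {(p : OK)}) OK]
    (a : WittVector p (IsLocalRing.ResidueField OK)) :
    IsLocalRing.residue OK (wittToOK p OK a) = a.coeff 0 := by
  have h1 := WittVector.mk_fontaineTheta
    (WittVector.map (residueEquivTilt p OK).toRingHom a)
  have h2 := congrArg (modPToResidue p OK) h1
  have h3 : modPToResidue p OK (PreTilt.coeff 0
      ((WittVector.map (residueEquivTilt p OK).toRingHom a).coeff 0)) = a.coeff 0 := by
    rw [WittVector.map_coeff]
    exact (residueEquivTilt p OK).symm_apply_apply (a.coeff 0)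
  rw [h3] at h2
  exact h2

/-- The map `𝒪_K / p → 𝒪_{ℂ_p} / p`. -/
def modPMap : ModP OK p →+* ModP (OC p OK K) p :=
  Ideal.quotientMap _ (algebraMap OK (OC p OK K)) (by
    rw [Ideal.span_singleton_le_iff_mem, Ideal.mem_comap, map_natCast]
    exact Ideal.mem_span_singleton_self _)

/-- The map `𝒪_K^♭ → 𝒪_{ℂ_p}^♭`. -/
def tiltMap : PreTilt OK p →+* PreTilt (OC p OK K) p :=
  Perfection.map p (modPMap p OK K)

/-- The canonical map `W(k) → A_inf`. -/
def wittToAinf : WittVector p (IsLocalRing.ResidueField OK) →+* Ainf p OK K :=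
  WittVector.map ((tiltMap p OK K).comp (residueEquivTilt p OK).toRingHom)

/-! ### Elements of `A_inf` -/

variable {OK K}

/-- The element `E([ϖ^♭])` of `A_inf`, where `x = ϖ^♭`. -/
def eAinf (E : Polynomial (WittVector p (IsLocalRing.ResidueField OK)))
    (x : PreTilt (OC p OK K) p) : Ainf p OK K :=
  E.eval₂ (wittToAinf p OK K) (WittVector.teichmuller p x)

/-- `κ : W(k)⟦x⟧⟦t⟧ → A_inf` is compatible with `W(k) → A_inf` and sends `x` to `u`, and the element
`s` to `v`. -/
def IsEval (κ : BK2 p (IsLocalRing.ResidueField OK) →+* Ainf p OK K) (u : Ainf p OK K)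
    (s : BK2 p (IsLocalRing.ResidueField OK)) (v : Ainf p OK K) : Prop :=
  (∀ a, κ (PowerSeries.C (PowerSeries.C a)) = wittToAinf p OK K a) ∧
    κ (xVar p _) = u ∧ κ s = v

/-! ### `B_dR^+` and `A_max` -/

variable (OK K)

/-- `B_dR^+`, the `ker θ`-adic completion of `A_inf[1/p]`. -/
abbrev BdR : Type _ := BDeRhamPlus (OC p OK K) p

/-- The map `A_inf[1/p] → B_dR^+`. -/
def invToBdR : Localization.Away (p : Ainf p OK K) →+* BdR p OK K :=
  algebraMap (Localization.Away (p : Ainf p OK K))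
    (AdicCompletion (RingHom.ker (fontaineThetaInvertP (OC p OK K) p))
      (Localization.Away (p : Ainf p OK K)))

/-- The map `A_inf → B_dR^+`. -/
def ainfToBdR : Ainf p OK K →+* BdR p OK K :=
  (invToBdR p OK K).comp (algebraMap _ _)

/-- `Filⁱ B_dR^+ = (ker θ)ⁱ B_dR^+`. -/
def filBdR (i : ℕ) : Ideal (BdR p OK K) :=
  ((RingHom.ker (fontaineThetaInvertP (OC p OK K) p)).map (invToBdR p OK K)) ^ i

variable {OK K}

/-- The `A_inf`-subalgebra `A_inf[E/p]` of `B_dR^+`, for `E ∈ A_inf`.  (As `p` is invertible in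
`B_dR^+`, `E/p` is the unique element `g` with `p g = E`.) -/
def preAmax (E : Ainf p OK K) : Subring (BdR p OK K) :=
  Subring.closure (Set.range (ainfToBdR p OK K) ∪
    {g | (p : BdR p OK K) * g = ainfToBdR p OK K E})

/-- `A_max`: the `p`-adic completion of `A_inf[E/p]`. -/
def Amax (E : Ainf p OK K) : Type _ :=
  AdicCompletion (Ideal.span {(p : preAmax p E)}) (preAmax p E)

instance (E : Ainf p OK K) : CommRing (Amax p E) :=
  inferInstanceAs <| CommRing (AdicCompletion (Ideal.span {(p : preAmax p E)}) (preAmax p E))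

/-- The completion map `A_inf[E/p] → A_max`. -/
def ofPreAmax (E : Ainf p OK K) : preAmax p E →+* Amax p E :=
  algebraMap (preAmax p E) (AdicCompletion (Ideal.span {(p : preAmax p E)}) (preAmax p E))

/-- The map `A_inf → A_max`. -/
def ainfToAmax (E : Ainf p OK K) : Ainf p OK K →+* Amax p E :=
  (ofPreAmax p E).comp
    ((ainfToBdR p OK K).codRestrict (preAmax p E)
      fun a => Subring.subset_closure (Or.inl ⟨a, rfl⟩))

/-- `j : A_max → B_dR^+` is the continuous extension of the inclusion of `A_inf[E/p]`: it restricts to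
the inclusion, and for each `n` its image in `B_dR^+ / Filⁿ = A_inf[1/p] / (ker θ)ⁿ` lies in `p⁻ᴺ` times
the image of `A_inf`, for some `N`.  (Equivalently, `j` is continuous for the `p`-adic topology of
`A_max` and the canonical topology of `B_dR^+`, the limit of the `p`-adic Banach topologies of the
quotients `A_inf[1/p] / (ker θ)ⁿ`.) -/
def IsBdRInclusion (E : Ainf p OK K) (j : Amax p E →+* BdR p OK K) : Prop :=
  (∀ s : preAmax p E, j (ofPreAmax p E s) = (s : BdR p OK K)) ∧
    ∀ n : ℕ, ∃ N : ℕ, ∀ a : Amax p E, ∃ b : Ainf p OK K,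
      (p : BdR p OK K) ^ N * j a - ainfToBdR p OK K b ∈ filBdR p OK K n

end Periods

end PrismEmb

end

open PrismEmb

set_option linter.unusedSectionVars false

noncomputable section

namespace PrismEmb

/-! ## Adically complete rings -/

section Complete

variable {R : Type*} [CommRing R] {I : Ideal R}

/-! Two facts carry the proof. The kernel of `θ` on `A_inf` is generated by `e = E(u)`
(`BKData.e_dvd_of_theta`), so that `w = (ε - 1) / e` exists; and `ω = θ(w)` is transcendental over
`𝒪_K` (`BKData.transcendental_ω`). The maps out of `A⁽²⁾`, `A⁽²⁾_st` and their `max` versions send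
`z` to `u w` and the formal `w` to `w`. These two elements are called periods, and their images
under `θ` are `ϖ ω` and `ω`.

Transcendence. On the elements `x` of the tilt with untilt `1`, the assignment `l(x) = θ(([x] - 1) /
e)` is additive, like a logarithm. Applying a Galois automorphism `σ` to `e w = ε - 1`, writing `σ
ϖ^♭ = ϖ^♭ c` and expanding `E(u [c])` to first order gives `σ(ω) (1 + ϖ E'(ϖ) l(c)) = l(σ ζ^♭)`
(`BKData.galC_ω`). If `ω` were algebraic, an open subgroup would fix it, and on that subgroup the
Kummer cocycle of `ϖ` would be a nonzero constant times the cyclotomic character minus one, so a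
coboundary up to bounded denominators. Then one power `ϖ ^ p ^ m` would have `p ^ n`-th roots for
all `n` in a single finite extension of `K`, which the norm to `K` forbids.

Unique expansions. Let `s` be `ω` or `ϖ ω`. A convergent sum of divided powers of `s`, with
coefficients in `𝒪_K` tending to zero, vanishes only if all coefficients do
(`BKData.hasUniqueExpansions`). Indeed `s` is divisible by `ζ₁ - 1`, so up to units of `𝒪_K` each
term is a monomial in a root `r` of `ϖ` and a fixed element `τ`. After division by the least power
of `r`, a relation has a polynomial in `τ` with unit leading coefficient as its term of degree zero
in `r`, and this forces `τ` to be integral over `𝒪_K`.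

Injectivity. Let `R` be one of the four source rings and let `T` be `E/p` for the `max` rings and
`E` for the envelopes. Modulo `T`, every element of `R` is a convergent combination over `W(k)⟦x⟧`
of certain elements which `θ` maps to divided powers of `s` up to units. By unique expansions an
element killed by `θ` has all coefficients divisible by `E`, so it is divisible by `T`
(`BKData.dvd_of_reduction_eq_zero`). For the envelopes, repeated division by `E` and `E`-adic
separatedness finish the proof. For the `max` rings separatedness for `T` is not known in advance;
`injective_of_dvd` works instead modulo `p`, where every element is a polynomial in `T`. Repeated
division by `T` also yields the statement on filtrations.

For the `max` rings the spanning elements are the divided powers themselves; the maps exist because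
`w ^ p` lies in `p w A_max`. For the envelopes they are products of the `δⁿ(z)` with exponents the
digits of `m` in base `p`. They span because `δⁿ(z) ^ p` lies in `(p, E)`
(`FrobLift.iterate_δ_pow_mem`), and they become divided powers because the relation `p θ(δⁿ⁺¹ v) =
-θ(δⁿ v) ^ p` holds for the period `v` (`theta_iterate_δ`). The injectivity of the two maps from
`W(k)⟦x⟧⟦t⟧` needs only transcendence and division by powers of `e` (`BKData.IsStd.injective`). -/

lemma exists_limit [h : IsPrecomplete I R] (f : ℕ → R) (hf : ∀ n, f (n + 1) - f n ∈ I ^ n) :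
    ∃ L, ∀ n, f n - L ∈ I ^ n := by
  obtain ⟨L, hL⟩ := h.prec' f (by
    intro m n hmn
    rw [SModEq.sub_mem, smul_eq_mul, Ideal.mul_top]
    induction n, hmn using Nat.le_induction with
    | base => simp
    | succ n hmn ih =>
      have := Ideal.sub_mem _ ih (Ideal.pow_le_pow_right hmn (hf n))
      rwa [sub_sub_sub_cancel_right, ← sub_sub_sub_cancel_right _ _ (f n),
        sub_sub_sub_cancel_right] at this)
  refine ⟨L, fun n => ?_⟩
  have := hL n
  rwa [SModEq.sub_mem, smul_eq_mul, Ideal.mul_top] at this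

lemma eq_zero_of_forall_mem_pow [h : IsHausdorff I R] {x : R} (hx : ∀ n, x ∈ I ^ n) : x = 0 :=
  h.haus' x fun n => by
    rw [SModEq.zero, smul_eq_mul, Ideal.mul_top]
    exact hx n

lemma eq_of_forall_sub_mem_pow [IsHausdorff I R] {x y : R} (hx : ∀ n, x - y ∈ I ^ n) : x = y :=
  sub_eq_zero.1 (eq_zero_of_forall_mem_pow hx)

lemma isHausdorff_of_forall (h : ∀ x : R, (∀ n, x ∈ I ^ n) → x = 0) : IsHausdorff I R where
  haus' x hx := h x fun n => by
    have := hx n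
    rwa [SModEq.zero, smul_eq_mul, Ideal.mul_top] at this

lemma isPrecomplete_of_forall
    (h : ∀ f : ℕ → R, (∀ n, f (n + 1) - f n ∈ I ^ n) → ∃ L, ∀ n, f n - L ∈ I ^ n) :
    IsPrecomplete I R where
  prec' f hf := by
    obtain ⟨L, hL⟩ := h f fun n => by
      have := (hf (Nat.le_succ n)).symm
      rwa [SModEq.sub_mem, smul_eq_mul, Ideal.mul_top] at this
    refine ⟨L, fun n => ?_⟩
    rw [SModEq.sub_mem, smul_eq_mul, Ideal.mul_top]
    exact hL n

lemma exists_sum [IsPrecomplete I R] (d : ℕ → R) (hd : ∀ n, d n ∈ I ^ n) :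
    ∃ L, ∀ n, L - ∑ i ∈ Finset.range n, d i ∈ I ^ n := by
  obtain ⟨L, hL⟩ := exists_limit (I := I) (fun n => ∑ i ∈ Finset.range n, d i) fun n => by
    simpa [Finset.sum_range_succ] using hd n
  exact ⟨L, fun n => by rw [← neg_sub]; exact neg_mem (hL n)⟩

lemma mem_span_pow_iff {q x : R} {n : ℕ} : x ∈ Ideal.span {q} ^ n ↔ q ^ n ∣ x := by
  rw [Ideal.span_singleton_pow, Ideal.mem_span_singleton]

lemma isUnit_of_isUnit_mk [IsAdicComplete I R] {x y : R} (h : x * y - 1 ∈ I) : IsUnit x := by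
  have h1 := IsAdicComplete.le_jacobson_bot I h
  rw [Ideal.mem_jacobson_bot] at h1
  have := h1 1
  rw [mul_one, sub_add_cancel] at this
  exact isUnit_of_mul_isUnit_left this

lemma pow_map_mem {S : Type*} [CommRing S] (f : R →+* S) {J : Ideal S}
    (h : ∀ x ∈ I, f x ∈ J) {n : ℕ} {x : R} (hx : x ∈ I ^ n) : f x ∈ J ^ n := by
  have h1 : I.map f ≤ J := Ideal.map_le_iff_le_comap.2 h
  have h2 := Ideal.pow_right_mono h1 n
  rw [← Ideal.map_pow] at h2
  exact h2 (Ideal.mem_map_of_mem f hx)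

end Complete

/-! ## Completion maps -/

/-- `i : S → R` is the completion of `S` for the finitely generated ideal `I`. -/
structure IsCompletion {S R : Type*} [CommRing S] [CommRing R] (I : Ideal S) (i : S →+* R) :
    Prop where
  complete : IsAdicComplete (I.map i) R
  dense : ∀ (x : R) (n : ℕ), ∃ s, x - i s ∈ I.map i ^ n
  mem_iff : ∀ (s : S) (n : ℕ), i s ∈ I.map i ^ n ↔ s ∈ I ^ n

/-- For a finitely generated ideal, the kernel of the projection to level `n` is `I ^ n` times the
completion; all three properties are read off from this. -/
lemma isCompletion_adicCompletion {S : Type*} [CommRing S] {I : Ideal S} (h : I.FG) :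
    IsCompletion I (algebraMap S (AdicCompletion I S)) := by
  have hc : IsAdicComplete I (AdicCompletion I S) := AdicCompletion.isAdicComplete h
  have key : ∀ (n : ℕ) (x : AdicCompletion I S),
      x ∈ I.map (algebraMap S (AdicCompletion I S)) ^ n ↔ AdicCompletion.evalₐ I n x = 0 := by
    intro n x
    have h1 := AdicCompletion.pow_smul_top_eq_ker_eval (I := I) (M := S) (n := n) h
    have h2 : x ∈ (I ^ n • ⊤ : Submodule S (AdicCompletion I S)) ↔
        x ∈ I.map (algebraMap S (AdicCompletion I S)) ^ n := by
      rw [← Ideal.map_pow, Ideal.smul_top_eq_map]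
      rfl
    rw [← h2, h1, LinearMap.mem_ker]
    have h3 : AdicCompletion.evalₐ I n x =
        Ideal.Quotient.factor (by simp) (AdicCompletion.eval I S n x) :=
      (AdicCompletion.factor_eval_eq_evalₐ I x (by simp)).symm
    constructor
    · intro h4
      rw [h3, h4, map_zero]
    · intro h4
      have h5 := AdicCompletion.factor_evalₐ_eq_eval I x (n := n) (by simp)
      rw [h4, map_zero] at h5
      exact h5.symm
  refine ⟨(IsAdicComplete.map_algebraMap_iff I _).2 hc, fun x n => ?_, fun s n => ?_⟩
  · obtain ⟨s, hs⟩ := Ideal.Quotient.mk_surjective (AdicCompletion.evalₐ I n x)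
    refine ⟨s, (key n _).2 ?_⟩
    rw [map_sub, ← hs, AdicCompletion.algebraMap_apply, sub_eq_zero]
    exact (AdicCompletion.evalₐ_of I n s).symm
  · rw [key, AdicCompletion.algebraMap_apply]
    rw [show algebraMap S S s = s from rfl]
    erw [AdicCompletion.evalₐ_of I n s]
    exact Ideal.Quotient.eq_zero_iff_mem

namespace IsCompletion

variable {S R T : Type*} [CommRing S] [CommRing R] [CommRing T] {I : Ideal S} {i : S →+* R}

lemma map_mem (f : R →+* T) {J : Ideal T} (hf : ∀ s ∈ I, f (i s) ∈ J) :
    ∀ x ∈ I.map i, f x ∈ J := by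
  intro x hx
  have : I.map i ≤ J.comap f := Ideal.map_le_iff_le_comap.2 hf
  exact this hx

/-- Sending `I` into `J` makes `f` continuous, so its values on the dense image of `i` determine it.
No such hypothesis is needed for `g`, which agrees with `f` there. -/
lemma hom_ext (hi : IsCompletion I i) {J : Ideal T} [IsHausdorff J T] {f g : R →+* T}
    (hJ : ∀ s ∈ I, f (i s) ∈ J) (h : ∀ s, f (i s) = g (i s)) : f = g := by
  ext x
  apply eq_of_forall_sub_mem_pow (I := J)
  intro n
  obtain ⟨s, hs⟩ := hi.dense x n
  have h1 := pow_map_mem f (map_mem f hJ) hs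
  have h2 := pow_map_mem g (map_mem g (J := J) fun s hs => h s ▸ hJ s hs) hs
  have := sub_mem h1 h2
  rwa [map_sub, map_sub, h, sub_sub_sub_cancel_right] at this

/-- Modulo `J ^ n` the map `h` kills `I ^ n`, and by density `S` surjects onto the quotient of `R`
at level `n`, with kernel exactly `I ^ n`. The induced maps are compatible in `n` and glue. -/
lemma exists_lift (hi : IsCompletion I i) {J : Ideal T} [IsAdicComplete J T] (h : S →+* T)
    (hJ : ∀ s ∈ I, h s ∈ J) : ∃ f : R →+* T, ∀ s, f (i s) = h s := by
  have hsurj : ∀ n, Function.Surjective ((Ideal.Quotient.mk (I.map i ^ n)).comp i) := by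
    intro n x
    obtain ⟨x, rfl⟩ := Ideal.Quotient.mk_surjective x
    obtain ⟨s, hs⟩ := hi.dense x n
    exact ⟨s, (Ideal.Quotient.eq.2 hs).symm⟩
  have hker : ∀ n, RingHom.ker ((Ideal.Quotient.mk (I.map i ^ n)).comp i) ≤
      RingHom.ker ((Ideal.Quotient.mk (J ^ n)).comp h) := by
    intro n s hs
    rw [RingHom.mem_ker, RingHom.comp_apply, Ideal.Quotient.eq_zero_iff_mem] at hs ⊢
    exact pow_map_mem h hJ ((hi.mem_iff s n).1 hs)
  let F : (n : ℕ) → R →+* T ⧸ J ^ n := fun n =>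
    (RingHom.liftOfSurjective _ (hsurj n) ⟨_, hker n⟩).comp (Ideal.Quotient.mk (I.map i ^ n))
  have hF : ∀ n s, F n (i s) = Ideal.Quotient.mk (J ^ n) (h s) := fun n s =>
    RingHom.liftOfSurjective_comp_apply ((Ideal.Quotient.mk (I.map i ^ n)).comp i) (hsurj n)
      ⟨_, hker n⟩ s
  have hF0 : ∀ n x, x ∈ I.map i ^ n → F n x = 0 := by
    intro n x hx
    simp only [F, RingHom.comp_apply]
    rw [Ideal.Quotient.eq_zero_iff_mem.2 hx, map_zero]
  have hcomp : ∀ {m n : ℕ} (hle : m ≤ n), (Ideal.Quotient.factorPow J hle).comp (F n) = F m := by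
    intro m n hle
    ext x
    obtain ⟨s, hs⟩ := hi.dense x n
    have h1 := hF0 n _ hs
    have h2 := hF0 m _ (Ideal.pow_le_pow_right hle hs)
    rw [map_sub, sub_eq_zero] at h1 h2
    rw [RingHom.comp_apply, h1, h2, hF, hF]
    rfl
  refine ⟨IsAdicComplete.liftRingHom J F hcomp, fun s => ?_⟩
  apply eq_of_forall_sub_mem_pow (I := J)
  intro n
  rw [← Ideal.Quotient.eq, IsAdicComplete.mk_liftRingHom, hF]

lemma map_span_natCast (p : ℕ) (i : S →+* R) :
    (Ideal.span {(p : S)}).map i = Ideal.span {(p : R)} := by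
  rw [Ideal.map_span, Set.image_singleton, map_natCast]

end IsCompletion

/-! ## Homomorphisms from power series rings -/

section PowerSeries

variable {A D : Type*} [CommRing A] [CommRing D]

/-- Continuity is automatic: the tail of a power series beyond degree `n` is a multiple of `X ^ n`,
so it lands in `J ^ n`. -/
lemma powerSeries_hom_ext {J : Ideal D} [IsHausdorff J D] {f g : PowerSeries A →+* D}
    (hC : ∀ a, f (PowerSeries.C a) = g (PowerSeries.C a))
    (hX : f PowerSeries.X = g PowerSeries.X) (hJ : f PowerSeries.X ∈ J) : f = g := by
  ext q
  apply eq_of_forall_sub_mem_pow (I := J)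
  intro n
  have hpoly : ∀ r : Polynomial A, f r = g r := by
    intro r
    induction r using Polynomial.induction_on' with
    | add a b ha hb => simp [ha, hb]
    | monomial n a =>
      rw [← Polynomial.C_mul_X_pow_eq_monomial]
      simp [hC, hX]
  rw [PowerSeries.eq_shift_mul_X_pow_add_trunc n q]
  simp only [map_add, map_mul, map_pow, hpoly, ← hX]
  rw [add_sub_add_right_eq_sub, ← sub_mul]
  exact Ideal.mul_mem_left _ _ (Ideal.pow_mem_pow hJ n)

lemma evalₐ_evalAdic (φ : A →+* D) (I : Ideal D) (s : D) (hs : s ∈ I) (q : PowerSeries A) (n : ℕ) :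
    AdicCompletion.evalₐ I n (evalAdic φ I s hs q) =
      (PowerSeries.trunc n q).eval₂ ((Ideal.Quotient.mk (I ^ n)).comp φ)
        (Ideal.Quotient.mk (I ^ n) s) := by
  unfold evalAdic
  generalize_proofs h1 h2 h3 h4 h5 h6 h7 h
  exact AdicCompletion.evalₐ_liftRingHom I _ (by assumption) n q

lemma evalAdic_C (φ : A →+* D) (I : Ideal D) (s : D) (hs : s ∈ I) (a : A) :
    evalAdic φ I s hs (PowerSeries.C a) = algebraMap D (AdicCompletion I D) (φ a) := by
  refine AdicCompletion.ext_evalₐ fun n => ?_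
  rw [evalₐ_evalAdic, AdicCompletion.algebraMap_apply]
  erw [AdicCompletion.evalₐ_of I n (φ a)]
  rcases n with _ | n
  · have : Subsingleton (D ⧸ I ^ 0) := Ideal.Quotient.subsingleton_iff.2 (by simp)
    exact Subsingleton.elim _ _
  · simp

lemma evalAdic_X (φ : A →+* D) (I : Ideal D) (s : D) (hs : s ∈ I) :
    evalAdic φ I s hs PowerSeries.X = algebraMap D (AdicCompletion I D) s := by
  refine AdicCompletion.ext_evalₐ fun n => ?_
  rw [evalₐ_evalAdic, AdicCompletion.algebraMap_apply]
  erw [AdicCompletion.evalₐ_of I n s]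
  rcases n with _ | _ | n
  · have : Subsingleton (D ⧸ I ^ 0) := Ideal.Quotient.subsingleton_iff.2 (by simp)
    exact Subsingleton.elim _ _
  · have : PowerSeries.trunc 1 (PowerSeries.X : PowerSeries A) = 0 := by
      ext m; simp [PowerSeries.coeff_X]
    rw [zero_add, this, Polynomial.eval₂_zero]
    exact (Ideal.Quotient.eq_zero_iff_mem.2 (by simpa using hs)).symm
  · rw [PowerSeries.trunc_X]; simp

lemma exists_powerSeries_hom (φ : A →+* D) (I : Ideal D) [IsAdicComplete I D] (s : D)
    (hs : s ∈ I) : ∃ f : PowerSeries A →+* D,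
      (∀ a, f (PowerSeries.C a) = φ a) ∧ f PowerSeries.X = s := by
  refine ⟨((AdicCompletion.ofAlgEquiv I).symm : AdicCompletion I D →+* D).comp
    (evalAdic φ I s hs), fun a => ?_, ?_⟩
  · rw [RingHom.comp_apply, evalAdic_C]
    exact AdicCompletion.ofAlgEquiv_symm_of I (φ a)
  · rw [RingHom.comp_apply, evalAdic_X]
    exact AdicCompletion.ofAlgEquiv_symm_of I s

end PowerSeries

/-! ## The integral closure of a complete discrete valuation ring is a valuation ring -/

section ValuationRing

/-- In an Artinian quotient the powers of `a` stabilise, which produces an idempotent `(a y) ^ n`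
modulo `I`. Henselianity lifts it to an idempotent of the domain `R`, so to `0` or `1`. In the first
case `a` is nilpotent modulo `I` and `1 - a` is a unit; in the second `a` is a unit. -/
lemma isLocalRing_of_complete_of_artinian {R : Type*} [CommRing R] [IsDomain R] (I : Ideal R)
    [IsAdicComplete I R] [IsArtinianRing (R ⧸ I)] : IsLocalRing R := by
  refine IsLocalRing.of_isUnit_or_isUnit_one_sub_self fun a => ?_
  obtain ⟨n, y, hy⟩ := IsArtinian.exists_pow_succ_smul_dvd (Ideal.Quotient.mk I a)
    (1 : R ⧸ I)
  obtain ⟨y, rfl⟩ := Ideal.Quotient.mk_surjective y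
  simp only [smul_eq_mul, mul_one, Nat.succ_eq_add_one] at hy
  have h1 : ∀ m, Ideal.Quotient.mk I a ^ n * (Ideal.Quotient.mk I a * Ideal.Quotient.mk I y) ^ m =
      Ideal.Quotient.mk I a ^ n := by
    intro m
    induction m with
    | zero => simp
    | succ m ih => rw [pow_succ, ← mul_assoc, ih, ← mul_assoc, ← pow_succ, hy]
  set e : R := (a * y) ^ n with he
  have hidem : Ideal.Quotient.mk I e * Ideal.Quotient.mk I e = Ideal.Quotient.mk I e := by
    have := h1 n
    simp only [he, map_pow, map_mul]
    rw [mul_pow] at this ⊢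
    calc _ = (Ideal.Quotient.mk I a ^ n * (Ideal.Quotient.mk I a ^ n * Ideal.Quotient.mk I y ^ n)) *
          Ideal.Quotient.mk I y ^ n := by ring
      _ = _ := by rw [this]
  have hH : HenselianRing R I := inferInstance
  have hmem : e * e - e ∈ I := Ideal.Quotient.eq.1 (by rw [map_mul, hidem])
  -- The derivative `2 e - 1` of `X ^ 2 - X` at an idempotent is its own inverse, as `(2 e - 1) ^ 2
  -- = 1 + 4 (e ^ 2 - e)`.
  obtain ⟨r, hr, hre⟩ := hH.is_henselian (Polynomial.X ^ 2 - Polynomial.X)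
    (by monicity!) e (by simpa [pow_two] using hmem) (by
      refine IsUnit.of_mul_eq_one (Ideal.Quotient.mk I
        ((Polynomial.derivative (Polynomial.X ^ 2 - Polynomial.X)).eval e)) ?_
      have : Ideal.Quotient.mk I ((Polynomial.derivative (Polynomial.X ^ 2 - Polynomial.X)).eval e)
          = 2 * Ideal.Quotient.mk I e - 1 := by
        simp; ring
      rw [this]
      linear_combination 4 * hidem)
  have hr' : r * (r - 1) = 0 := by
    have : r ^ 2 - r = 0 := by simpa using hr
    linear_combination this
  rcases mul_eq_zero.1 hr' with h0 | h0
  · right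
    rw [h0, zero_sub, neg_mem_iff] at hre
    have han : Ideal.Quotient.mk I a ^ n = 0 := by
      have h2 := h1 n
      have h3 : (Ideal.Quotient.mk I a * Ideal.Quotient.mk I y) ^ n = 0 := by
        rw [← map_mul, ← map_pow]
        exact Ideal.Quotient.eq_zero_iff_mem.2 hre
      rw [h3, mul_zero] at h2
      exact h2.symm
    have han' : a ^ n ∈ I := by
      rw [← Ideal.Quotient.eq_zero_iff_mem, map_pow, han]
    refine isUnit_of_isUnit_mk (I := I) (y := ∑ i ∈ Finset.range n, a ^ i) ?_
    rw [mul_neg_geom_sum]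
    simpa using neg_mem han'
  · left
    rw [sub_eq_zero] at h0
    subst h0
    rcases n with _ | n
    · refine isUnit_of_isUnit_mk (I := I) (y := y) ?_
      rw [← Ideal.Quotient.eq, map_mul, map_one]
      simpa using hy
    · refine isUnit_of_isUnit_mk (I := I) (y := y * (a * y) ^ n) ?_
      rw [← mul_assoc, ← pow_succ', ← he, ← neg_sub]
      exact neg_mem hre

lemma isAdicComplete_of_basis {R B ι : Type*} [CommRing R] [CommRing B] [Algebra R B] [Fintype ι]
    (b : Module.Basis ι R B) (q : R) [IsAdicComplete (Ideal.span {q}) R] :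
    IsAdicComplete (Ideal.span {algebraMap R B q}) B := by
  have key : ∀ (n : ℕ) (x : B), x ∈ Ideal.span {algebraMap R B q} ^ n ↔
      ∀ i, b.repr x i ∈ Ideal.span {q} ^ n := by
    intro n x
    simp only [mem_span_pow_iff, ← map_pow]
    constructor
    · rintro ⟨y, rfl⟩ i
      rw [← Algebra.smul_def, map_smul]
      exact ⟨b.repr y i, rfl⟩
    · intro h
      choose c hc using h
      refine ⟨∑ i, c i • b i, ?_⟩
      rw [← Algebra.smul_def, Finset.smul_sum, ← b.sum_repr x]
      refine Finset.sum_congr rfl fun i _ => ?_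
      rw [smul_smul, ← hc]
  have h1 : IsHausdorff (Ideal.span {algebraMap R B q}) B := isHausdorff_of_forall fun x hx => by
    apply b.repr.injective
    ext i
    rw [map_zero, Finsupp.coe_zero, Pi.zero_apply]
    exact eq_zero_of_forall_mem_pow (I := Ideal.span {q}) fun n => (key n x).1 (hx n) i
  have h2 : IsPrecomplete (Ideal.span {algebraMap R B q}) B := isPrecomplete_of_forall
    fun f hf => by
      have : ∀ i, ∃ L, ∀ n, b.repr (f n) i - L ∈ Ideal.span {q} ^ n := fun i =>
        exists_limit _ fun n => by
          have := (key n _).1 (hf n) i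
          rwa [map_sub] at this
      choose L hL using this
      refine ⟨∑ i, L i • b i, fun n => (key n _).2 fun i => ?_⟩
      rw [map_sub, Finsupp.sub_apply, b.repr_sum_self]
      exact hL i n
  exact { h1, h2 with }

variable (OK : Type*) [CommRing OK] [IsDomain OK] [IsDiscreteValuationRing OK] [CharZero OK]
variable (p : ℕ) [hp : Fact p.Prime] [IsAdicComplete (Ideal.span {(p : OK)}) OK]
variable (K : Type*) [Field K] [Algebra OK K] [IsFractionRing OK K]

lemma charZero_fractionField (OK K : Type*) [CommRing OK] [IsDomain OK] [CharZero OK] [Field K]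
    [Algebra OK K] [IsFractionRing OK K] : CharZero K :=
  charZero_of_injective_algebraMap (IsFractionRing.injective OK K)

include p in
-- The integral closure is finite free over `OK`, so it is `p`-adically complete with Artinian
-- reduction modulo `p`, and it is local. A local Dedekind domain has at most two primes, so it is
-- principal, and a local Bézout domain is a valuation ring.
lemma valuationRing_integralClosure (L : Type*) [Field L] [Algebra K L] [Algebra OK L]
    [IsScalarTower OK K L] [FiniteDimensional K L] : ValuationRing (integralClosure OK L) := by
  have := charZero_fractionField OK K
  have htf : Module.IsTorsionFree OK L := Module.IsTorsionFree.trans_faithfulSMul OK K L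
  have hfin : Module.Finite OK (integralClosure OK L) :=
    IsIntegralClosure.finite OK K L (integralClosure OK L)
  have hfree : Module.Free OK (integralClosure OK L) :=
    IsIntegralClosure.module_free OK K L (integralClosure OK L)
  have hded : IsDedekindDomain (integralClosure OK L) :=
    IsIntegralClosure.isDedekindDomain OK K L (integralClosure OK L)
  have hcomp : IsAdicComplete (Ideal.span {algebraMap OK (integralClosure OK L) p})
      (integralClosure OK L) :=
    isAdicComplete_of_basis (Module.Free.chooseBasis OK (integralClosure OK L)) (p : OK)
  have hp0 : (p : OK) ≠ 0 := Nat.cast_ne_zero.2 hp.1.ne_zero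
  set I := Ideal.span {algebraMap OK (integralClosure OK L) p} with hI
  have hart : IsArtinian OK (OK ⧸ Ideal.span {(p : OK)}) :=
    (isFiniteLength_iff_isNoetherian_isArtinian.1 (isFiniteLength_quotient_span_singleton OK
      (mem_nonZeroDivisors_of_ne_zero hp0))).2
  have hart1 : IsArtinianRing (OK ⧸ Ideal.span {(p : OK)}) := isArtinian_of_tower OK hart
  have hart2 : IsArtinianRing (integralClosure OK L ⧸ I) := by
    have hle : Ideal.span {(p : OK)} ≤ I.comap (algebraMap OK (integralClosure OK L)) := by
      rw [Ideal.span_singleton_le_iff_mem]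
      exact Ideal.mem_span_singleton_self _
    let g : OK ⧸ Ideal.span {(p : OK)} →+* integralClosure OK L ⧸ I :=
      Ideal.quotientMap I (algebraMap OK (integralClosure OK L)) hle
    let : Algebra (OK ⧸ Ideal.span {(p : OK)}) (integralClosure OK L ⧸ I) := g.toAlgebra
    have : IsScalarTower OK (OK ⧸ Ideal.span {(p : OK)}) (integralClosure OK L ⧸ I) :=
      IsScalarTower.of_algebraMap_eq fun x => rfl
    have : Module.Finite (OK ⧸ Ideal.span {(p : OK)}) (integralClosure OK L ⧸ I) :=
      Module.Finite.of_restrictScalars_finite OK _ _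
    exact IsArtinianRing.of_finite (OK ⧸ Ideal.span {(p : OK)}) _
  have hloc := isLocalRing_of_complete_of_artinian I
  have hpid : IsPrincipalIdealRing (integralClosure OK L) := by
    apply IsPrincipalIdealRing.of_finite_primes
    refine Set.Finite.subset (Set.toFinite {⊥, IsLocalRing.maximalIdeal (integralClosure OK L)}) ?_
    intro P hP
    by_cases h : P = ⊥
    · exact Or.inl h
    · right
      have hP' : P.IsPrime := hP
      exact IsLocalRing.eq_maximalIdeal (hP'.isMaximal h)
  exact ValuationRing.iff_local_bezout_domain.2 ⟨hloc, inferInstance⟩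

include p in
/-- Every element of the algebraic closure is integral or has integral inverse. -/
lemma isIntegral_or_inv (x : AlgebraicClosure K) : IsIntegral OK x ∨ IsIntegral OK x⁻¹ := by
  have := charZero_fractionField OK K
  let L := IntermediateField.adjoin K {x}
  have hL : FiniteDimensional K L :=
    IntermediateField.adjoin.finiteDimensional (Algebra.IsAlgebraic.isAlgebraic x).isIntegral
  have hV := valuationRing_integralClosure OK p K L
  let y : L := ⟨x, IntermediateField.mem_adjoin_simple_self K x⟩
  have : IsScalarTower OK L (AlgebraicClosure K) := IsScalarTower.of_algebraMap_eq fun r => by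
    rw [IsScalarTower.algebraMap_apply OK K L, ← IsScalarTower.algebraMap_apply K L,
      ← IsScalarTower.algebraMap_apply]
  have hfr : IsFractionRing (integralClosure OK L) L :=
    IsIntegralClosure.isFractionRing_of_finite_extension OK K L _
  rcases (ValuationRing.isInteger_or_isInteger (integralClosure OK L) y) with ⟨z, hz⟩ | ⟨z, hz⟩
  · left
    have := z.2.map (IsScalarTower.toAlgHom OK L (AlgebraicClosure K))
    rw [show (z : L) = y from hz] at this
    exact this
  · right
    have := z.2.map (IsScalarTower.toAlgHom OK L (AlgebraicClosure K))
    rw [show (z : L) = y⁻¹ from hz] at this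
    rw [map_inv₀] at this
    exact this

include p in
lemma OKbar_dvd_or_dvd (x y : OKbar OK K) : x ∣ y ∨ y ∣ x := by
  by_cases hx : x = 0
  · right; simp [hx]
  by_cases hy : y = 0
  · left; simp [hy]
  have hx' : (x : AlgebraicClosure K) ≠ 0 := by simpa using hx
  have hy' : (y : AlgebraicClosure K) ≠ 0 := by simpa using hy
  rcases isIntegral_or_inv OK p K ((x : AlgebraicClosure K) / y) with h | h
  · right
    exact ⟨⟨_, h⟩, Subtype.ext (by simp [mul_div_cancel₀ _ hy'])⟩
  · left
    refine ⟨⟨_, h⟩, Subtype.ext ?_⟩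
    simp [mul_div_cancel₀ _ hx']

end ValuationRing

/-! ## Tilts of integrally closed domains -/

section Tilt

variable {C : Type*} [CommRing C] {p : ℕ} [Fact p.Prime] [Fact (¬ IsUnit (p : C))]
variable [IsAdicComplete (Ideal.span {(p : C)}) C]

namespace PreTilt

open _root_.PreTilt

lemma ext_coeff {x y : PreTilt C p} (h : ∀ n, coeff n x = coeff n y) : x = y := Perfection.ext h

/-- The `p ^ n`-th root of an element of the tilt. -/
def root (x : PreTilt C p) (n : ℕ) : PreTilt C p := (frobeniusEquiv (PreTilt C p) p).symm^[n] x

lemma root_zero (x : PreTilt C p) : root x 0 = x := rfl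

lemma root_succ_pow (x : PreTilt C p) (n : ℕ) : root x (n + 1) ^ p = root x n := by
  rw [root, Function.iterate_succ_apply', frobeniusEquiv_symm_pow_p]; rfl

lemma root_pow (x : PreTilt C p) (n : ℕ) : root x n ^ p ^ n = x := by
  induction n with
  | zero => simp [root_zero]
  | succ n ih => rw [pow_succ', pow_mul, root_succ_pow, ih]

lemma coeff_root (x : PreTilt C p) (m n : ℕ) : coeff m (root x n) = coeff (m + n) x :=
  coeff_iterate_frobeniusEquiv_symm m n x

lemma mk_untilt_root (x : PreTilt C p) (n : ℕ) :
    Ideal.Quotient.mk (Ideal.span {(p : C)}) (root x n).untilt = coeff n x := by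
  rw [mk_untilt_eq_coeff_zero, coeff_root, zero_add]

/-- Congruent elements modulo `p` have `p ^ m`-th powers congruent modulo `p ^ (m + 1)`, so a
compatible system of `p`-power roots in `C` is recovered from its reductions. -/
lemma untilt_eq_of_coeff {x : PreTilt C p} {c : ℕ → C} (hc : ∀ n, c (n + 1) ^ p = c n)
    (h : ∀ n, coeff n x = Ideal.Quotient.mk _ (c n)) (n : ℕ) : (root x n).untilt = c n := by
  apply eq_of_forall_sub_mem_pow (I := Ideal.span {(p : C)})
  intro m
  have h1 : (p : C) ∣ (root x (n + m)).untilt - c (n + m) := by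
    rw [← Ideal.mem_span_singleton, ← Ideal.Quotient.eq, mk_untilt_root, h]
  have h2 := dvd_sub_pow_of_dvd_sub h1 m
  have h3 : ∀ k, c (n + k) ^ p ^ k = c n := by
    intro k
    induction k with
    | zero => simp
    | succ k ih => rw [pow_succ', pow_mul, ← add_assoc, hc, ih]
  have h4 : ∀ k, root x (n + k) ^ p ^ k = root x n := by
    intro k
    induction k with
    | zero => simp
    | succ k ih => rw [pow_succ', pow_mul, ← add_assoc, root_succ_pow, ih]
  rw [h3, ← map_pow, h4] at h2
  rw [mem_span_pow_iff]
  exact (pow_dvd_pow _ (Nat.le_succ m)).trans h2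

variable [IsDomain C]

lemma untilt_eq_zero_iff {x : PreTilt C p} : x.untilt = 0 ↔ x = 0 := by
  constructor
  · intro h
    apply ext_coeff
    intro n
    rw [map_zero]
    have h1 : (root x n).untilt ^ p ^ n = 0 := by rw [← map_pow, root_pow, h]
    have h2 := eq_zero_of_pow_eq_zero h1
    have h3 := mk_untilt_root x n
    rw [h2, map_zero] at h3
    exact h3.symm
  · rintro rfl
    have := untilt_eq_of_coeff (x := (0 : PreTilt C p)) (c := fun _ => 0)
      (fun n => zero_pow (Fact.out : p.Prime).ne_zero) (fun n => by simp) 0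
    rwa [root_zero] at this

instance : IsDomain (PreTilt C p) := by
  have h1 : NoZeroDivisors (PreTilt C p) := ⟨fun {a b} h => by
    have := untilt_eq_zero_iff.2 h
    rw [map_mul, mul_eq_zero, untilt_eq_zero_iff, untilt_eq_zero_iff] at this
    exact this⟩
  have h2 : Nontrivial (PreTilt C p) := CharP.nontrivial_of_char_ne_one
    (v := p) (Fact.out : p.Prime).ne_one
  exact NoZeroDivisors.to_isDomain _

variable [IsIntegrallyClosed C]

/-- As `C` is integrally closed, divisibility of untilts passes to all `p ^ n`-th roots. The
quotients again form a compatible system of roots, which is the quotient in the tilt. -/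
lemma dvd_of_untilt_dvd {x y : PreTilt C p} (h : x.untilt ∣ y.untilt) : x ∣ y := by
  by_cases hx : x = 0
  · rw [hx, untilt_eq_zero_iff.2 rfl, zero_dvd_iff, untilt_eq_zero_iff] at h
    rw [h]; exact dvd_zero _
  have hpos : ∀ n, p ^ n ≠ 0 := fun n => pow_ne_zero _ (Fact.out : p.Prime).ne_zero
  have h1 : ∀ n, (root x n).untilt ∣ (root y n).untilt := by
    intro n
    rw [← IsIntegrallyClosed.pow_dvd_pow_iff (hpos n), ← map_pow, ← map_pow, root_pow, root_pow]
    exact h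
  choose q hq using h1
  have hx' : ∀ n, (root x n).untilt ≠ 0 := by
    intro n hn
    rw [untilt_eq_zero_iff] at hn
    apply hx
    rw [← root_pow x n, hn, zero_pow (hpos n)]
  have hq' : ∀ n, q (n + 1) ^ p = q n := by
    intro n
    apply mul_left_cancel₀ (hx' n)
    rw [← hq n, ← root_succ_pow y n, map_pow, hq (n + 1), mul_pow, ← map_pow, root_succ_pow]
  let t : PreTilt C p := ⟨fun n => Ideal.Quotient.mk _ (q n), fun n => by rw [← map_pow, hq']⟩
  have ht : ∀ n, coeff n t = Ideal.Quotient.mk _ (q n) := fun n => rfl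
  refine ⟨t, ext_coeff fun n => ?_⟩
  rw [map_mul, ht]
  have h2 := mk_untilt_root y n
  rw [hq n, map_mul, mk_untilt_root] at h2
  exact h2.symm

lemma untilt_dvd_iff {x y : PreTilt C p} : x.untilt ∣ y.untilt ↔ x ∣ y :=
  ⟨dvd_of_untilt_dvd, fun ⟨c, hc⟩ => ⟨c.untilt, by rw [hc, map_mul]⟩⟩

/-- If `s ^ m` untilts to a unit multiple of `p`, the powers of `s` are the kernels of the
coefficient maps. -/
lemma pow_dvd_iff_coeff {s : PreTilt C p} {m : ℕ} (hs : Associated (p : C) (s ^ m).untilt)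
    (n : ℕ) (x : PreTilt C p) : s ^ (m * p ^ n) ∣ x ↔ coeff n x = 0 := by
  have h1 : s ^ (m * p ^ n) ∣ x ↔ s ^ m ∣ root x n := by
    rw [← untilt_dvd_iff, ← untilt_dvd_iff (y := root x n), pow_mul, map_pow _ _ (p ^ n)]
    nth_rw 1 [← root_pow x n]
    rw [map_pow _ (root x n)]
    exact IsIntegrallyClosed.pow_dvd_pow_iff (R := C) (pow_ne_zero _ (Fact.out : p.Prime).ne_zero)
  rw [h1, ← untilt_dvd_iff, ← mk_untilt_root, Ideal.Quotient.eq_zero_iff_mem,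
    Ideal.mem_span_singleton, hs.dvd_iff_dvd_left]

/-- By `pow_dvd_iff_coeff` the `s`-adic topology is the inverse limit topology. The limit of a
Cauchy sequence is built coefficient by coefficient: the `n`-th coefficient no longer changes from
index `m * p ^ n` on. -/
lemma isAdicComplete_tilt {s : PreTilt C p} {m : ℕ} (hm : m ≠ 0)
    (hs : Associated (p : C) (s ^ m).untilt) :
    IsAdicComplete (Ideal.span {s}) (PreTilt C p) := by
  have hle : ∀ n, n ≤ m * p ^ n := fun n =>
    (Nat.lt_pow_self (Fact.out : p.Prime).one_lt).le.trans (Nat.le_mul_of_pos_left _ hm.bot_lt)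
  have h1 : IsHausdorff (Ideal.span {s}) (PreTilt C p) := isHausdorff_of_forall fun x hx => by
    apply ext_coeff
    intro n
    rw [map_zero]
    exact (pow_dvd_iff_coeff hs n x).1 (mem_span_pow_iff.1 (hx _))
  have h2 : IsPrecomplete (Ideal.span {s}) (PreTilt C p) := isPrecomplete_of_forall
    fun f hf => by
      have hf' : ∀ a b, a ≤ b → s ^ a ∣ f b - f a := by
        intro a b hab
        induction b, hab using Nat.le_induction with
        | base => simp
        | succ b hab ih =>
          have := (pow_dvd_pow s hab).trans (mem_span_pow_iff.1 (hf b))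
          simpa using dvd_add this ih
      have hmono : ∀ n, m * p ^ n ≤ m * p ^ (n + 1) := fun n =>
        Nat.mul_le_mul_left _ (Nat.pow_le_pow_right (Fact.out : p.Prime).pos (Nat.le_succ n))
      let L : PreTilt C p := ⟨fun n => coeff n (f (m * p ^ n)), fun n => by
        rw [coeff_pow_p, ← sub_eq_zero, ← map_sub]
        exact (pow_dvd_iff_coeff hs n _).1 (hf' _ _ (hmono n))⟩
      have hL : ∀ n, coeff n L = coeff n (f (m * p ^ n)) := fun n => rfl
      refine ⟨L, fun n => mem_span_pow_iff.2 ?_⟩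
      have h3 : s ^ (m * p ^ n) ∣ f (m * p ^ n) - L := by
        rw [pow_dvd_iff_coeff hs, map_sub, hL, sub_self]
      have h4 := dvd_sub ((pow_dvd_pow s (hle n)).trans h3) (hf' _ _ (hle n))
      simpa using h4
  exact { h1, h2 with }

end PreTilt

end Tilt

/-! ## The ring of integers of `ℂ_p` -/

section OC

variable (p : ℕ) [hp : Fact p.Prime] (OK : Type*) [CommRing OK] [IsDomain OK]
variable [IsDiscreteValuationRing OK] [CharZero OK] [CharP (IsLocalRing.ResidueField OK) p]
variable [IsAdicComplete (Ideal.span {(p : OK)}) OK]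
variable (K : Type*) [Field K] [Algebra OK K] [IsFractionRing OK K]

lemma isCompletion_OC :
    IsCompletion (Ideal.span {(p : OKbar OK K)}) (algebraMap (OKbar OK K) (OC p OK K)) :=
  isCompletion_adicCompletion (Submodule.fg_span_singleton _)

lemma algebraMap_OC_dvd (n : ℕ) (x : OKbar OK K) :
    (p : OC p OK K) ^ n ∣ algebraMap (OKbar OK K) (OC p OK K) x ↔ (p : OKbar OK K) ^ n ∣ x := by
  have := (isCompletion_OC p OK K).mem_iff x n
  rwa [IsCompletion.map_span_natCast, mem_span_pow_iff, mem_span_pow_iff] at this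

lemma exists_sub_dvd_OC (n : ℕ) (x : OC p OK K) :
    ∃ a : OKbar OK K, (p : OC p OK K) ^ n ∣ x - algebraMap (OKbar OK K) (OC p OK K) a := by
  obtain ⟨s, hs⟩ := (isCompletion_OC p OK K).dense x n
  rw [IsCompletion.map_span_natCast, mem_span_pow_iff] at hs
  exact ⟨s, hs⟩

lemma algebraMap_OK_Kbar_injective : Function.Injective (algebraMap OK (AlgebraicClosure K)) := by
  rw [IsScalarTower.algebraMap_eq OK K (AlgebraicClosure K)]
  exact (algebraMap K (AlgebraicClosure K)).injective.comp (IsFractionRing.injective OK K)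

lemma algebraMap_OK_OKbar_injective : Function.Injective (algebraMap OK (OKbar OK K)) := by
  intro x y h
  apply algebraMap_OK_Kbar_injective OK K
  have := congrArg (algebraMap (OKbar OK K) (AlgebraicClosure K)) h
  rwa [← IsScalarTower.algebraMap_apply, ← IsScalarTower.algebraMap_apply] at this

instance : CharZero (OKbar OK K) :=
  charZero_of_injective_algebraMap (algebraMap_OK_OKbar_injective OK K)

/-- A nonzero element of `𝒪_K` divides a power of `p`. -/
lemma exists_dvd_p_pow_OK {c : OK} (hc : c ≠ 0) : ∃ n, c ∣ (p : OK) ^ n := by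
  obtain ⟨ϖ, hϖ⟩ := IsDiscreteValuationRing.exists_irreducible OK
  obtain ⟨n, u, hn⟩ := IsDiscreteValuationRing.eq_unit_mul_pow_irreducible hc hϖ
  refine ⟨n, ?_⟩
  rw [hn, Units.mul_left_dvd]
  apply pow_dvd_pow_of_dvd
  have h := not_isUnit_p_OK p OK
  rwa [← mem_nonunits_iff, ← IsLocalRing.mem_maximalIdeal, hϖ.maximalIdeal_eq,
    Ideal.mem_span_singleton] at h

/-- A nonzero integral element of the algebraic closure divides a power of `p`. -/
lemma exists_dvd_p_pow {x : OKbar OK K} (hx : x ≠ 0) : ∃ n, x ∣ (p : OKbar OK K) ^ n := by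
  have hint : IsIntegral OK x := (integralClosure.isIntegral x)
  obtain ⟨c, hc0, hc⟩ := Submodule.exists_mem_ne_zero_of_ne_bot
    (Ideal.comap_ne_bot_of_integral_mem (R := OK) hx (Ideal.mem_span_singleton_self x) hint)
  rw [Ideal.mem_comap, Ideal.mem_span_singleton] at hc0
  have hc1 : c ≠ 0 := hc
  obtain ⟨n, hn⟩ := exists_dvd_p_pow_OK p OK hc1
  refine ⟨n, hc0.trans ?_⟩
  simpa using map_dvd (algebraMap OK (OKbar OK K)) hn

lemma eq_zero_of_p_pow_dvd {x : OKbar OK K} (h : ∀ n, (p : OKbar OK K) ^ n ∣ x) : x = 0 := by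
  by_contra hx
  obtain ⟨n, hn⟩ := exists_dvd_p_pow p OK K hx
  have h1 := (h (n + 1)).trans hn
  obtain ⟨c, hc⟩ := h1
  apply not_isUnit_p_OKbar p OK K
  refine IsUnit.of_mul_eq_one c ?_
  have hp0 : (p : OKbar OK K) ^ n ≠ 0 := pow_ne_zero _ (Nat.cast_ne_zero.2 hp.1.ne_zero)
  apply mul_left_cancel₀ hp0
  rw [mul_one, ← mul_assoc, ← pow_succ, ← hc]

lemma algebraMap_OC_injective : Function.Injective (algebraMap (OKbar OK K) (OC p OK K)) := by
  rw [injective_iff_map_eq_zero]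
  intro x hx
  apply eq_zero_of_p_pow_dvd p OK K
  intro n
  rw [← algebraMap_OC_dvd, hx]
  exact dvd_zero _

/-- Every element of `𝒪_ℂ` is associated to an element of `𝒪_K̄`. -/
lemma exists_associated (x : OC p OK K) :
    ∃ a : OKbar OK K, Associated x (algebraMap (OKbar OK K) (OC p OK K) a) := by
  by_cases hx : x = 0
  · exact ⟨0, by rw [hx, map_zero]⟩
  have h1 : ∃ n, ¬ (p : OC p OK K) ^ n ∣ x := by
    by_contra! h
    exact hx (eq_zero_of_forall_mem_pow (I := Ideal.span {(p : OC p OK K)}) fun n =>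
      mem_span_pow_iff.2 (h n))
  obtain ⟨n, hn⟩ := h1
  -- One power of `p` beyond the one that fails to divide `x`: as `a` divides `p ^ n`, the error is
  -- then a multiple of `p a`, and `x` is `a` times a unit congruent to `1`.
  obtain ⟨a, y, hy⟩ := exists_sub_dvd_OC p OK K (n + 1) x
  have h2 : ¬ (p : OKbar OK K) ^ n ∣ a := by
    intro h
    apply hn
    rw [← algebraMap_OC_dvd] at h
    have h3 : (p : OC p OK K) ^ n ∣ x - algebraMap (OKbar OK K) (OC p OK K) a :=
      hy ▸ ((pow_dvd_pow _ (Nat.le_succ n)).mul_right y)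
    simpa using dvd_add h3 h
  obtain ⟨b, hb⟩ := (OKbar_dvd_or_dvd OK p K a (p ^ n)).resolve_right h2
  have hb' := congrArg (algebraMap (OKbar OK K) (OC p OK K)) hb
  rw [map_mul, map_pow, map_natCast] at hb'
  have h3 : x = algebraMap (OKbar OK K) (OC p OK K) a *
      (1 + p * (algebraMap (OKbar OK K) (OC p OK K) b * y)) := by
    rw [pow_succ, hb'] at hy
    linear_combination hy
  have h4 : IsUnit (1 + p * (algebraMap (OKbar OK K) (OC p OK K) b * y)) := by
    refine isUnit_of_isUnit_mk (I := Ideal.span {(p : OC p OK K)}) (y := 1) ?_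
    rw [mul_one, add_sub_cancel_left]
    exact Ideal.mul_mem_right _ _ (Ideal.mem_span_singleton_self _)
  refine ⟨a, (Associated.symm ⟨h4.unit, ?_⟩)⟩
  rw [h3]; rfl

lemma OC_dvd_or_dvd (x y : OC p OK K) : x ∣ y ∨ y ∣ x := by
  obtain ⟨a, ha⟩ := exists_associated p OK K x
  obtain ⟨b, hb⟩ := exists_associated p OK K y
  rw [ha.dvd_iff_dvd_left, hb.dvd_iff_dvd_right, hb.dvd_iff_dvd_left, ha.dvd_iff_dvd_right]
  exact (OKbar_dvd_or_dvd OK p K a b).imp (map_dvd _) (map_dvd _)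

instance : IsDomain (OC p OK K) := by
  have h1 : NoZeroDivisors (OC p OK K) := ⟨fun {x y} h => by
    obtain ⟨a, ha⟩ := exists_associated p OK K x
    obtain ⟨b, hb⟩ := exists_associated p OK K y
    have h2 := ha.mul_mul hb
    rw [h, ← map_mul] at h2
    have h3 := algebraMap_OC_injective p OK K (a₂ := 0)
      ((associated_zero_iff_eq_zero _).1 h2.symm |>.trans (map_zero _).symm)
    rcases mul_eq_zero.1 h3 with h4 | h4
    · left; rw [h4, map_zero] at ha; exact (associated_zero_iff_eq_zero _).1 ha
    · right; rw [h4, map_zero] at hb; exact (associated_zero_iff_eq_zero _).1 hb⟩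
  have h2 : Nontrivial (OC p OK K) := (algebraMap_OC_injective p OK K).nontrivial
  exact NoZeroDivisors.to_isDomain _

instance : CharZero (OC p OK K) :=
  charZero_of_injective_algebraMap (algebraMap_OC_injective p OK K)

instance : ValuationRing (OC p OK K) :=
  ValuationRing.iff_dvd_total.2 ⟨OC_dvd_or_dvd p OK K⟩

variable {OK K}

lemma coeff_flatOfSeq (a : ℕ → OKbar OK K) (ha : ∀ n, a (n + 1) ^ p = a n) (n : ℕ) :
    PreTilt.coeff n (flatOfSeq p a ha) =
      Ideal.Quotient.mk _ (algebraMap (OKbar OK K) (OC p OK K) (a n)) := rfl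

lemma untilt_root_flatOfSeq (a : ℕ → OKbar OK K) (ha : ∀ n, a (n + 1) ^ p = a n) (n : ℕ) :
    (PreTilt.root (flatOfSeq p a ha) n).untilt = algebraMap (OKbar OK K) (OC p OK K) (a n) :=
  PreTilt.untilt_eq_of_coeff (c := fun n => algebraMap (OKbar OK K) (OC p OK K) (a n))
    (fun n => by rw [← map_pow, ha]) (fun n => coeff_flatOfSeq p a ha n) n

lemma untilt_flatOfSeq (a : ℕ → OKbar OK K) (ha : ∀ n, a (n + 1) ^ p = a n) :
    (flatOfSeq p a ha).untilt = algebraMap (OKbar OK K) (OC p OK K) (a 0) :=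
  untilt_root_flatOfSeq p a ha 0

end OC

/-! ## More on adically complete rings -/

section Complete

variable {R : Type*} [CommRing R]

/-- Successive approximation: an ideal whose elements are multiples of `e` modulo `q` times
the ideal consists of multiples of `e`. -/
lemma dvd_of_successive {e q : R} [IsAdicComplete (Ideal.span {q}) R] {P : R → Prop}
    (h : ∀ x, P x → ∃ y x', P x' ∧ x = e * y + q * x') {x : R} (hx : P x) : e ∣ x := by
  choose! y g hg hy using h
  have hP : ∀ n, P (g^[n] x) := by
    intro n
    induction n with
    | zero => exact hx
    | succ n ih => rw [Function.iterate_succ_apply']; exact hg _ ih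
  have hsum : ∀ n, x = e * ∑ i ∈ Finset.range n, q ^ i * y (g^[i] x) + q ^ n * g^[n] x := by
    intro n
    induction n with
    | zero => simp
    | succ n ih =>
      rw [Finset.sum_range_succ, Function.iterate_succ_apply']
      have := hy _ (hP n)
      linear_combination ih + q ^ n * this
  obtain ⟨L, hL⟩ := exists_sum (I := Ideal.span {q}) (fun i => q ^ i * y (g^[i] x))
    fun n => mem_span_pow_iff.2 (Dvd.intro _ rfl)
  refine ⟨L, eq_of_forall_sub_mem_pow (I := Ideal.span {q}) fun n => ?_⟩
  rw [mem_span_pow_iff]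
  have h1 := (mem_span_pow_iff.1 (hL n)).mul_left e
  have h2 := dvd_sub (Dvd.intro (g^[n] x) rfl : q ^ n ∣ q ^ n * g^[n] x) h1
  convert h2 using 1
  linear_combination hsum n

lemma isAdicComplete_of_pow_le {I J : Ideal R} {d : ℕ} (hd : d ≠ 0) [IsAdicComplete J R]
    (hJI : J ≤ I) (hIJ : I ^ d ≤ J) : IsAdicComplete I R := by
  have hIJ' : ∀ n, I ^ (d * n) ≤ J ^ n := fun n => by
    rw [pow_mul]; exact Ideal.pow_right_mono hIJ n
  have h1 : IsHausdorff I R := isHausdorff_of_forall fun x hx =>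
    eq_zero_of_forall_mem_pow (I := J) fun n => hIJ' n (hx _)
  have h2 : IsPrecomplete I R := isPrecomplete_of_forall fun f hf => by
    have hf' : ∀ a b, a ≤ b → f b - f a ∈ I ^ a := by
      intro a b hab
      induction b, hab using Nat.le_induction with
      | base => simp
      | succ b hab ih =>
        simpa using add_mem (Ideal.pow_le_pow_right hab (hf b)) ih
    obtain ⟨L, hL⟩ := exists_limit (I := J) (fun n => f (d * n)) fun n =>
      hIJ' n (hf' _ _ (Nat.mul_le_mul_left _ (Nat.le_succ n)))
    refine ⟨L, fun n => ?_⟩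
    have h3 := sub_mem (Ideal.pow_right_mono hJI n (hL n))
      (hf' n (d * n) (Nat.le_mul_of_pos_left _ hd.bot_lt))
    simpa using h3
  exact { h1, h2 with }

lemma span_pair_mem_iff {p v x : R} : x ∈ Ideal.span {p, v} ↔ ∃ a b, x = p * a + v * b := by
  rw [Ideal.mem_span_pair]
  exact ⟨fun ⟨a, b, h⟩ => ⟨a, b, by rw [← h]; ring⟩, fun ⟨a, b, h⟩ => ⟨a, b, by rw [h]; ring⟩⟩

lemma span_pair_pow_succ {p v x : R} {n : ℕ} (hx : x ∈ Ideal.span {p, v} ^ (n + 1)) :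
    ∃ a ∈ Ideal.span {p, v} ^ n, ∃ b, x = p * a + v ^ (n + 1) * b := by
  induction n generalizing x with
  | zero =>
    rw [zero_add, pow_one, span_pair_mem_iff] at hx
    obtain ⟨a, b, h⟩ := hx
    exact ⟨a, by simp, b, by rw [h, zero_add, pow_one]⟩
  | succ n ih =>
    rw [pow_succ] at hx
    refine Submodule.mul_induction_on hx ?_ ?_
    · intro y hy z hz
      obtain ⟨a, ha, b, rfl⟩ := ih hy
      obtain ⟨c, d, hcd⟩ := span_pair_mem_iff.1 hz
      refine ⟨a * z + v ^ (n + 1) * b * c, add_mem ?_ ?_, b * d, ?_⟩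
      · rw [pow_succ]; exact Ideal.mul_mem_mul ha hz
      · rw [mul_assoc]
        exact Ideal.mul_mem_right _ _
          (Ideal.pow_mem_pow (Ideal.subset_span (by simp)) (n + 1))
      · rw [add_mul, mul_assoc p a z]
        nth_rw 2 [hcd]
        ring
    · rintro y z ⟨a, ha, b, rfl⟩ ⟨c, hc, d, rfl⟩
      exact ⟨a + c, add_mem ha hc, b + d, by ring⟩

/-- The ideal `(p, v) ^ (n + 1)` is `p (p, v) ^ n + (v ^ (n + 1))` and `v` is a nonzerodivisor
modulo `p`, so division by `p` costs exactly one power. -/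
lemma mem_pow_of_mul_mem {p v x : R} (hp : ∀ x : R, p * x = 0 → x = 0)
    (hv : ∀ (n : ℕ) (x : R), p ∣ v ^ n * x → p ∣ x) {n : ℕ}
    (hx : p * x ∈ Ideal.span {p, v} ^ (n + 1)) : x ∈ Ideal.span {p, v} ^ n := by
  obtain ⟨a, ha, b, h⟩ := span_pair_pow_succ hx
  obtain ⟨c, rfl⟩ := hv (n + 1) b ⟨x - a, by linear_combination -h⟩
  have h1 : x = a + v ^ (n + 1) * c := by
    rw [← sub_eq_zero]
    apply hp
    linear_combination h
  rw [h1, pow_succ v, mul_assoc]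
  exact add_mem ha (Ideal.mul_mem_right _ _ (Ideal.pow_mem_pow (Ideal.subset_span (by simp)) n))

/-- A `p`-complete, `p`-torsion free ring is `(p, v)`-complete if its reduction modulo `p` is
`v`-torsion free and `v`-complete. -/
lemma isAdicComplete_span_pair {D : Type*} [CommRing D] (π : R →+* D)
    (hπ : Function.Surjective π) {p v : R} (hker : ∀ x, π x = 0 ↔ p ∣ x)
    [IsAdicComplete (Ideal.span {p}) R] [IsAdicComplete (Ideal.span {π v}) D]
    (hp : ∀ x : R, p * x = 0 → x = 0) (hv : ∀ x : D, π v * x = 0 → x = 0) :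
    IsAdicComplete (Ideal.span {p, v}) R := by
  have hv' : ∀ (n : ℕ) (x : R), p ∣ v ^ n * x → p ∣ x := by
    intro n x
    induction n with
    | zero => simp
    | succ n ih =>
      intro h
      apply ih
      rw [← hker] at h ⊢
      apply hv
      rw [← map_mul, ← mul_assoc, ← pow_succ', h]
  have hmod : ∀ (n : ℕ) (x : R), π v ^ n ∣ π x ↔ ∃ a b, x = v ^ n * a + p * b := by
    intro n x
    constructor
    · rintro ⟨y, hy⟩
      obtain ⟨y, rfl⟩ := hπ y
      rw [← map_pow, ← map_mul, ← sub_eq_zero, ← map_sub, hker] at hy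
      obtain ⟨b, hb⟩ := hy
      exact ⟨y, b, by linear_combination hb⟩
    · rintro ⟨a, b, rfl⟩
      rw [map_add, (hker (p * b)).2 (Dvd.intro _ rfl), add_zero, map_mul, map_pow]
      exact Dvd.intro _ rfl
  have hmem : ∀ (n : ℕ) (x : R), x ∈ Ideal.span {p, v} ^ n → π v ^ n ∣ π x := by
    intro n x hx
    rcases n with _ | n
    · simp
    · obtain ⟨a, -, b, rfl⟩ := span_pair_pow_succ hx
      exact (hmod _ _).2 ⟨b, a, add_comm _ _⟩
  have hpJ : ∀ (n : ℕ) (x : R), p ^ n ∣ x → x ∈ Ideal.span {p, v} ^ n := fun n x ⟨c, hc⟩ =>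
    hc ▸ Ideal.mul_mem_right _ _ (Ideal.pow_mem_pow (Ideal.subset_span (by simp)) n)
  have hvJ : ∀ (n : ℕ) (x : R), v ^ n ∣ x → x ∈ Ideal.span {p, v} ^ n := fun n x ⟨c, hc⟩ =>
    hc ▸ Ideal.mul_mem_right _ _ (Ideal.pow_mem_pow (Ideal.subset_span (by simp)) n)
  have h1 : IsHausdorff (Ideal.span {p, v}) R := isHausdorff_of_forall fun x hx => by
    have key : ∀ x : R, (∀ n, x ∈ Ideal.span {p, v} ^ n) →
        ∃ y x', (∀ n, x' ∈ Ideal.span {p, v} ^ n) ∧ x = 0 * y + p * x' := by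
      intro x hx
      have h0 : π x = 0 := eq_zero_of_forall_mem_pow (I := Ideal.span {π v}) fun n =>
        mem_span_pow_iff.2 (hmem n x (hx n))
      obtain ⟨c, rfl⟩ := (hker x).1 h0
      exact ⟨0, c, fun n => mem_pow_of_mul_mem hp hv' (hx (n + 1)), by ring⟩
    exact zero_dvd_iff.1 (dvd_of_successive (q := p) key hx)
  have h2 : IsPrecomplete (Ideal.span {p, v}) R := isPrecomplete_of_forall fun f hf => by
    let P : (ℕ → R) → Prop := fun f => ∀ n, f (n + 1) - f n ∈ Ideal.span {p, v} ^ n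
    -- A Cauchy sequence has a limit `L` modulo `p`, and what remains is `p` times another Cauchy
    -- sequence `g`. Passing from index `n` to `n + 1` pays for the power lost in dividing by `p`.
    have step : ∀ f : ℕ → R, P f → ∃ (L : R) (g : ℕ → R), P g ∧
        ∀ n, f (n + 1) - L - p * g n ∈ Ideal.span {p, v} ^ (n + 1) := by
      intro f hf
      obtain ⟨L, hL⟩ := exists_limit (I := Ideal.span {π v}) (fun n => π (f n)) fun n => by
        rw [← map_sub, mem_span_pow_iff]
        exact hmem n _ (hf n)
      obtain ⟨L, rfl⟩ := hπ L
      have h3 : ∀ n, ∃ a b, f n - L = v ^ n * a + p * b := fun n => by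
        rw [← hmod, map_sub, ← mem_span_pow_iff]
        exact hL n
      choose a b hab using h3
      refine ⟨L, fun n => b (n + 1), fun n => ?_, fun n => ?_⟩
      · apply mem_pow_of_mul_mem hp hv'
        have h4 : p * (b (n + 1 + 1) - b (n + 1)) = (f (n + 1 + 1) - f (n + 1)) -
            v ^ (n + 1) * (v * a (n + 1 + 1) - a (n + 1)) := by
          have e1 := hab (n + 1 + 1)
          have e2 := hab (n + 1)
          rw [pow_succ] at e1
          linear_combination e2 - e1
        rw [h4]
        exact sub_mem (hf (n + 1)) (hvJ _ _ (Dvd.intro _ rfl))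
      · have h5 : f (n + 1) - L - p * b (n + 1) = v ^ (n + 1) * a (n + 1) := by
          linear_combination hab (n + 1)
        rw [h5]
        exact hvJ _ _ (Dvd.intro _ rfl)
    choose! L g hg hstep using step
    have hP : ∀ n, P (g^[n] f) := by
      intro n
      induction n with
      | zero => exact hf
      | succ n ih => rw [Function.iterate_succ_apply']; exact hg _ ih
    obtain ⟨M, hM⟩ := exists_sum (I := Ideal.span {p}) (fun i => p ^ i * L (g^[i] f))
      fun n => mem_span_pow_iff.2 (Dvd.intro _ rfl)
    refine ⟨M, fun N => ?_⟩
    -- Each round lowers the index by one, so `f N` is compared with the `i`-th derived sequence at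
    -- `N - i`; the factor `p ^ i` restores the missing powers.
    have h6 : ∀ i ≤ N, f N - ∑ j ∈ Finset.range i, p ^ j * L (g^[j] f) -
        p ^ i * (g^[i] f) (N - i) ∈ Ideal.span {p, v} ^ N := by
      intro i
      induction i with
      | zero => intro _; simp
      | succ i ih =>
        intro hi
        have h7 := ih (by omega)
        have h8 := hstep _ (hP i) (N - (i + 1))
        rw [show N - (i + 1) + 1 = N - i by omega] at h8
        have h9 := Ideal.mul_mem_mul (hpJ i _ dvd_rfl) h8
        rw [← pow_add, show i + (N - i) = N by omega] at h9
        have h10 := add_mem h7 h9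
        convert h10 using 1
        rw [Finset.sum_range_succ, Function.iterate_succ_apply']
        ring
    have h11 := h6 N le_rfl
    have h12 := hpJ N _ (mem_span_pow_iff.1 (hM N))
    have h13 := hpJ N _ (Dvd.intro ((g^[N] f) (N - N)) rfl)
    have h14 := sub_mem (add_mem h11 h13) h12
    convert h14 using 1
    ring
  exact { h1, h2 with }

end Complete

/-! ## Power series over a complete ring -/

section PowerSeries

variable {W : Type*} [CommRing W]

lemma C_pow_dvd_iff_coeff {q : W} {n : ℕ} {f : PowerSeries W} :
    PowerSeries.C q ^ n ∣ f ↔ ∀ i, q ^ n ∣ PowerSeries.coeff i f := by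
  constructor
  · rintro ⟨g, rfl⟩ i
    rw [← map_pow, PowerSeries.coeff_C_mul]
    exact Dvd.intro _ rfl
  · intro h
    choose c hc using h
    refine ⟨PowerSeries.mk c, ?_⟩
    ext i
    rw [← map_pow, PowerSeries.coeff_C_mul, PowerSeries.coeff_mk, hc]

lemma C_dvd_iff_coeff {q : W} {f : PowerSeries W} :
    PowerSeries.C q ∣ f ↔ ∀ i, q ∣ PowerSeries.coeff i f := by
  simpa using C_pow_dvd_iff_coeff (q := q) (n := 1) (f := f)

lemma isAdicComplete_powerSeries (q : W) [IsAdicComplete (Ideal.span {q}) W] :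
    IsAdicComplete (Ideal.span {PowerSeries.C q}) (PowerSeries W) := by
  have h1 : IsHausdorff (Ideal.span {PowerSeries.C q}) (PowerSeries W) :=
    isHausdorff_of_forall fun x hx => by
      ext i
      rw [map_zero]
      exact eq_zero_of_forall_mem_pow (I := Ideal.span {q}) fun n => mem_span_pow_iff.2
        (C_pow_dvd_iff_coeff.1 (mem_span_pow_iff.1 (hx n)) i)
  have h2 : IsPrecomplete (Ideal.span {PowerSeries.C q}) (PowerSeries W) :=
    isPrecomplete_of_forall fun f hf => by
      have : ∀ i, ∃ L, ∀ n, PowerSeries.coeff i (f n) - L ∈ Ideal.span {q} ^ n := fun i =>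
        exists_limit _ fun n => by
          have := C_pow_dvd_iff_coeff.1 (mem_span_pow_iff.1 (hf n)) i
          rwa [map_sub, ← mem_span_pow_iff] at this
      choose L hL using this
      refine ⟨PowerSeries.mk L, fun n => mem_span_pow_iff.2 (C_pow_dvd_iff_coeff.2 fun i => ?_)⟩
      rw [map_sub, PowerSeries.coeff_mk, ← mem_span_pow_iff]
      exact hL i n
  exact { h1, h2 with }

lemma C_dvd_of_X_pow_mul {q : W} {d : ℕ} {f : PowerSeries W}
    (h : PowerSeries.C q ∣ PowerSeries.X ^ d * f) : PowerSeries.C q ∣ f := by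
  rw [C_dvd_iff_coeff] at h ⊢
  intro i
  have := h (i + d)
  rwa [PowerSeries.coeff_X_pow_mul] at this

/-- An Eisenstein polynomial is `X ^ d + q F` with `F(0)` prime to `q`. -/
lemma exists_eisenstein_eq [IsDomain W] {q : W} {E : Polynomial W} (hm : E.Monic)
    (hE : E.IsEisensteinAt (Ideal.span {q})) (hd : E.natDegree ≠ 0) :
    ∃ F : Polynomial W, E = Polynomial.X ^ E.natDegree + Polynomial.C q * F ∧ ¬ q ∣ F.coeff 0 := by
  have h1 : Polynomial.C q ∣ E - Polynomial.X ^ E.natDegree := by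
    rw [Polynomial.C_dvd_iff_dvd_coeff]
    intro i
    rw [Polynomial.coeff_sub, Polynomial.coeff_X_pow]
    split_ifs with h
    · rw [h, hm.coeff_natDegree, sub_self]; exact dvd_zero _
    · rw [sub_zero, ← Ideal.mem_span_singleton]
      exact hE.coeff_mem h
  obtain ⟨F, hF⟩ := h1
  refine ⟨F, by rw [← hF]; ring, fun h2 => hE.notMem ?_⟩
  have h3 := congrArg (fun f => Polynomial.coeff f 0) hF
  simp only [Polynomial.coeff_sub, Polynomial.coeff_X_pow, Polynomial.coeff_C_mul] at h3
  rw [if_neg hd.symm, sub_zero] at h3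
  rw [mem_span_pow_iff, h3, pow_two]
  exact mul_dvd_mul_left q h2

end PowerSeries

/-! ## Functoriality of the tilt -/

section TiltHom

variable {p : ℕ} [hp : Fact p.Prime] {C C' : Type*} [CommRing C] [CommRing C']
variable [Fact (¬ IsUnit (p : C))] [Fact (¬ IsUnit (p : C'))]

/-- The map of tilts induced by a ring homomorphism. -/
def tiltHom (f : C →+* C') : PreTilt C p →+* PreTilt C' p :=
  Perfection.map p (Ideal.quotientMap (Ideal.span {(p : C')}) f (by
    rw [Ideal.span_singleton_le_iff_mem, Ideal.mem_comap, map_natCast]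
    exact Ideal.mem_span_singleton_self _) : ModP C p →+* ModP C' p)

variable [IsAdicComplete (Ideal.span {(p : C)}) C] [IsAdicComplete (Ideal.span {(p : C')}) C']

lemma coeff_tiltHom (f : C →+* C') (x : PreTilt C p) (n : ℕ) :
    PreTilt.coeff n (tiltHom f x) = Ideal.Quotient.mk _ (f (PreTilt.root x n).untilt) := by
  have h : PreTilt.coeff n (tiltHom f x) =
      Ideal.quotientMap (Ideal.span {(p : C')}) f (by
    rw [Ideal.span_singleton_le_iff_mem, Ideal.mem_comap, map_natCast]
    exact Ideal.mem_span_singleton_self _) (PreTilt.coeff n x) := rfl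
  rw [h, ← PreTilt.mk_untilt_root]
  rfl

lemma untilt_root_tiltHom (f : C →+* C') (x : PreTilt C p) (n : ℕ) :
    (PreTilt.root (tiltHom f x) n).untilt = f (PreTilt.root x n).untilt :=
  PreTilt.untilt_eq_of_coeff (c := fun n => f (PreTilt.root x n).untilt)
    (fun n => by rw [← map_pow, ← map_pow, PreTilt.root_succ_pow])
    (fun n => coeff_tiltHom f x n) n

lemma untilt_tiltHom (f : C →+* C') (x : PreTilt C p) : (tiltHom f x).untilt = f x.untilt :=
  untilt_root_tiltHom f x 0

/-- Fontaine's map is functorial. -/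
lemma fontaineTheta_map (f : C →+* C') (x : WittVector p (PreTilt C p)) :
    WittVector.fontaineTheta C' p (WittVector.map (tiltHom f) x) =
      f (WittVector.fontaineTheta C p x) := by
  apply eq_of_forall_sub_mem_pow (I := Ideal.span {(p : C')})
  intro n
  rw [← Ideal.Quotient.eq]
  have h : ((Ideal.Quotient.mk (Ideal.span {(p : C')} ^ n)).comp
      ((WittVector.fontaineTheta C' p).comp (WittVector.map (tiltHom f)))) =
      ((Ideal.Quotient.mk (Ideal.span {(p : C')} ^ n)).comp
        (f.comp (WittVector.fontaineTheta C p))) := by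
    refine WittVector.eq_of_apply_teichmuller_eq _ _ ⟨n, ?_⟩ fun x => ?_
    · rw [← map_natCast (Ideal.Quotient.mk (Ideal.span {(p : C')} ^ n)), ← map_pow,
        Ideal.Quotient.eq_zero_iff_mem]
      exact Ideal.pow_mem_pow (Ideal.mem_span_singleton_self _) n
    · simp only [RingHom.comp_apply, WittVector.map_teichmuller,
        WittVector.fontaineTheta_teichmuller, untilt_tiltHom]
  exact RingHom.congr_fun h x

end TiltHom

/-! ## Fontaine's map -/

section Theta

variable (p : ℕ) [hp : Fact p.Prime] (OK : Type*) [CommRing OK] [IsDomain OK]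
variable [IsDiscreteValuationRing OK] [CharZero OK] [CharP (IsLocalRing.ResidueField OK) p]
variable [PerfectRing (IsLocalRing.ResidueField OK) p]
variable [IsAdicComplete (Ideal.span {(p : OK)}) OK]
variable (K : Type*) [Field K] [Algebra OK K] [IsFractionRing OK K]

lemma isIntegrallyClosed_of_valuationRing (C : Type*) [CommRing C] [IsDomain C]
    [ValuationRing C] : IsIntegrallyClosed C := inferInstance

instance : IsIntegrallyClosed (OC p OK K) := isIntegrallyClosed_of_valuationRing _

/-- A uniformizer and its Eisenstein polynomial, with compatible systems of `p`-power roots of the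
uniformizer and of `1`. -/
structure BKData where
  ϖ : OK
  irreducible : Irreducible ϖ
  E : Polynomial (WittVector p (IsLocalRing.ResidueField OK))
  monic : E.Monic
  eisenstein : E.IsEisensteinAt
    (Ideal.span {(p : WittVector p (IsLocalRing.ResidueField OK))})
  root : E.eval₂ (wittToOK p OK) ϖ = 0
  a : ℕ → OKbar OK K
  a_zero : a 0 = algebraMap OK (OKbar OK K) ϖ
  a_pow : ∀ n, a (n + 1) ^ p = a n
  ζ : ℕ → OKbar OK K
  ζ_pow : ∀ n, ζ (n + 1) ^ p = ζ n
  primitive : ∀ n, IsPrimitiveRoot (ζ n) (p ^ n)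

/-- The map `𝒪_K → 𝒪_ℂ`. -/
def okToOC : OK →+* OC p OK K :=
  (algebraMap (OKbar OK K) (OC p OK K)).comp (algebraMap OK (OKbar OK K))

lemma okToOC_injective : Function.Injective (okToOC p OK K) :=
  (algebraMap_OC_injective p OK K).comp (algebraMap_OK_OKbar_injective OK K)

/-- Fontaine's map. -/
def theta : Ainf p OK K →+* OC p OK K := WittVector.fontaineTheta (OC p OK K) p

lemma theta_teichmuller (x : PreTilt (OC p OK K) p) :
    theta p OK K (WittVector.teichmuller p x) = x.untilt :=
  WittVector.fontaineTheta_teichmuller x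

lemma tiltMap_eq : tiltMap p OK K = tiltHom (okToOC p OK K) := rfl

lemma theta_wittToAinf (c : WittVector p (IsLocalRing.ResidueField OK)) :
    theta p OK K (wittToAinf p OK K c) = okToOC p OK K (wittToOK p OK c) := by
  rw [wittToOK, RingHom.comp_apply, ← fontaineTheta_map, theta, wittToAinf, tiltMap_eq]
  congr 1

variable {OK K}

lemma Ainf_dvd_p_iff (x : Ainf p OK K) :
    WittVector.constantCoeff x = 0 ↔ (p : Ainf p OK K) ∣ x := by
  rw [← Ideal.mem_span_singleton, ← WittVector.ker_constantCoeff, RingHom.mem_ker]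

lemma mk_theta (x : Ainf p OK K) :
    Ideal.Quotient.mk (Ideal.span {(p : OC p OK K)}) (theta p OK K x) =
      PreTilt.coeff 0 (WittVector.constantCoeff x) :=
  WittVector.mk_fontaineTheta x

instance : CharZero (Ainf p OK K) := by
  refine charZero_of_inj_zero fun n hn => ?_
  have := congrArg (theta p OK K) hn
  rw [map_natCast, map_zero] at this
  exact_mod_cast this

instance : IsAdicComplete (Ideal.span {(p : Ainf p OK K)}) (Ainf p OK K) :=
  WittVector.isAdicCompleteIdealSpanP

lemma p_ne_zero_Ainf : (p : Ainf p OK K) ≠ 0 := Nat.cast_ne_zero.2 hp.1.ne_zero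

lemma p_ne_zero_OC : (p : OC p OK K) ≠ 0 := Nat.cast_ne_zero.2 hp.1.ne_zero

namespace BKData

variable {p} (D : BKData p OK K)

/-- The element `ϖ^♭`. -/
def piFlat : PreTilt (OC p OK K) p := flatOfSeq p D.a D.a_pow

/-- The element `ζ^♭`. -/
def zetaFlat : PreTilt (OC p OK K) p := flatOfSeq p D.ζ D.ζ_pow

/-- `u = [ϖ^♭]`. -/
def u : Ainf p OK K := WittVector.teichmuller p D.piFlat

/-- `ε = [ζ^♭]`. -/
def ε : Ainf p OK K := WittVector.teichmuller p D.zetaFlat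

/-- `E(u)`. -/
def e : Ainf p OK K := eAinf p D.E D.piFlat

/-- The degree of `E`. -/
def deg : ℕ := D.E.natDegree

lemma deg_ne_zero : D.deg ≠ 0 := by
  intro h
  have h1 := D.root
  rw [D.monic.natDegree_eq_zero.1 h, Polynomial.eval₂_one] at h1
  exact one_ne_zero h1

lemma exists_F : ∃ F : Polynomial (WittVector p (IsLocalRing.ResidueField OK)),
    D.E = Polynomial.X ^ D.deg + Polynomial.C (p : WittVector p _) * F ∧
      ¬ (p : WittVector p (IsLocalRing.ResidueField OK)) ∣ F.coeff 0 :=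
  exists_eisenstein_eq D.monic D.eisenstein D.deg_ne_zero

/-- The polynomial `(E - X ^ d) / p`. -/
def F : Polynomial (WittVector p (IsLocalRing.ResidueField OK)) := D.exists_F.choose

lemma E_eq : D.E = Polynomial.X ^ D.deg + Polynomial.C (p : WittVector p _) * D.F :=
  D.exists_F.choose_spec.1

lemma isUnit_F_coeff : IsUnit (D.F.coeff 0) := by
  refine WittVector.isUnit_of_coeff_zero_ne_zero _ fun h => D.exists_F.choose_spec.2 ?_
  rwa [← Ideal.mem_span_singleton, WittVector.mem_span_p_iff_coeff_zero_eq_zero]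

lemma isUnit_F_eval : IsUnit (D.F.eval₂ (wittToOK p OK) D.ϖ) := by
  rw [← Polynomial.divX_mul_X_add D.F, Polynomial.eval₂_add, Polynomial.eval₂_mul,
    Polynomial.eval₂_X, Polynomial.eval₂_C]
  have h1 := D.isUnit_F_coeff.map (wittToOK p OK)
  by_contra h2
  have h3 : D.ϖ ∈ IsLocalRing.maximalIdeal OK := D.irreducible.not_isUnit
  have h4 := sub_mem ((IsLocalRing.mem_maximalIdeal _).2 h2)
    (Ideal.mul_mem_left _ (D.F.divX.eval₂ (wittToOK p OK) D.ϖ) h3)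
  rw [add_sub_cancel_left] at h4
  exact h4 h1

/-- Total ramification: `E(ϖ) = 0` reads `ϖ ^ deg = -p F(ϖ)`, where `F(ϖ)` is a unit because `F(0)`
is. -/
lemma associated_p : Associated (p : OK) (D.ϖ ^ D.deg) := by
  have h1 := D.root
  rw [D.E_eq, Polynomial.eval₂_add, Polynomial.eval₂_mul, Polynomial.eval₂_X_pow,
    Polynomial.eval₂_C, map_natCast] at h1
  refine ⟨-D.isUnit_F_eval.unit, ?_⟩
  rw [Units.val_neg, IsUnit.unit_spec]
  linear_combination -h1

lemma ϖ_ne_zero : D.ϖ ≠ 0 := D.irreducible.ne_zero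

lemma ϖ_mem : D.ϖ ∈ IsLocalRing.maximalIdeal OK := D.irreducible.not_isUnit

lemma untilt_piFlat : D.piFlat.untilt = okToOC p OK K D.ϖ := by
  rw [piFlat, untilt_flatOfSeq, D.a_zero]; rfl

lemma theta_u : theta p OK K D.u = okToOC p OK K D.ϖ := by
  rw [u, theta_teichmuller, untilt_piFlat]

lemma theta_eval₂ (P : Polynomial (WittVector p (IsLocalRing.ResidueField OK))) :
    theta p OK K (P.eval₂ (wittToAinf p OK K) D.u) =
      okToOC p OK K (P.eval₂ (wittToOK p OK) D.ϖ) := by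
  rw [Polynomial.hom_eval₂, Polynomial.hom_eval₂, D.theta_u]
  congr 1
  ext c : 1
  exact theta_wittToAinf p OK K c

lemma theta_e : theta p OK K D.e = 0 := by
  rw [e, eAinf]
  exact (D.theta_eval₂ D.E).trans (by rw [D.root, map_zero])

lemma e_eq : D.e = D.u ^ D.deg + p * D.F.eval₂ (wittToAinf p OK K) D.u := by
  rw [e, eAinf, D.E_eq, Polynomial.eval₂_add, Polynomial.eval₂_mul, Polynomial.eval₂_X_pow,
    Polynomial.eval₂_C, map_natCast]
  rfl

lemma constantCoeff_u : WittVector.constantCoeff D.u = D.piFlat :=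
  WittVector.teichmuller_coeff_zero p _

lemma constantCoeff_e : WittVector.constantCoeff D.e = D.piFlat ^ D.deg := by
  rw [D.e_eq, map_add, (Ainf_dvd_p_iff p _).2 (Dvd.intro _ rfl), add_zero, map_pow,
    constantCoeff_u]

lemma associated_untilt : Associated (p : OC p OK K) (D.piFlat ^ D.deg).untilt := by
  rw [map_pow, untilt_piFlat, ← map_pow, ← map_natCast (okToOC p OK K)]
  exact D.associated_p.map (okToOC p OK K)

lemma piFlat_ne_zero : D.piFlat ≠ 0 := by
  intro h
  have h1 := D.untilt_piFlat
  rw [h, PreTilt.untilt_eq_zero_iff.2 rfl] at h1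
  exact D.ϖ_ne_zero (okToOC_injective p OK K (h1.symm.trans (map_zero _).symm))

lemma isAdicComplete_tilt : IsAdicComplete (Ideal.span {D.piFlat}) (PreTilt (OC p OK K) p) :=
  PreTilt.isAdicComplete_tilt D.deg_ne_zero D.associated_untilt

/-- Modulo `p` the ring `A_inf` is the tilt and `e` becomes `ϖ^♭ ^ deg`, whose untilt is `p` up to a
unit. -/
lemma isAdicComplete_p_e : IsAdicComplete (Ideal.span {(p : Ainf p OK K), D.e}) (Ainf p OK K) := by
  have : IsAdicComplete (Ideal.span {WittVector.constantCoeff D.e}) (PreTilt (OC p OK K) p) := by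
    rw [constantCoeff_e]
    refine PreTilt.isAdicComplete_tilt one_ne_zero ?_
    rw [pow_one]
    exact D.associated_untilt
  refine isAdicComplete_span_pair WittVector.constantCoeff (WittVector.constantCoeff_surjective p)
    (Ainf_dvd_p_iff p) (fun x hx => (mul_eq_zero.1 hx).resolve_left (p_ne_zero_Ainf p))
    fun x hx => (mul_eq_zero.1 hx).resolve_left ?_
  rw [constantCoeff_e]
  exact pow_ne_zero _ D.piFlat_ne_zero

lemma isAdicComplete_p_u : IsAdicComplete (Ideal.span {(p : Ainf p OK K), D.u}) (Ainf p OK K) := by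
  have : IsAdicComplete (Ideal.span {WittVector.constantCoeff D.u}) (PreTilt (OC p OK K) p) := by
    rw [constantCoeff_u]
    exact D.isAdicComplete_tilt
  refine isAdicComplete_span_pair WittVector.constantCoeff (WittVector.constantCoeff_surjective p)
    (Ainf_dvd_p_iff p) (fun x hx => (mul_eq_zero.1 hx).resolve_left (p_ne_zero_Ainf p))
    fun x hx => (mul_eq_zero.1 hx).resolve_left ?_
  rw [constantCoeff_u]
  exact D.piFlat_ne_zero

/-- If `θ(x) = 0`, the reduction of `x` modulo `p` has zeroth coefficient `0`, so it is a multiple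
of `ϖ^♭ ^ deg`, the reduction of `e`. Hence `x = e y + p x'`, again with `θ(x') = 0` since `𝒪_ℂ` is
`p`-torsion free, and successive approximation applies. -/
lemma e_dvd_of_theta {x : Ainf p OK K} (hx : theta p OK K x = 0) : D.e ∣ x := by
  refine dvd_of_successive (q := (p : Ainf p OK K)) (P := fun x => theta p OK K x = 0)
    (fun x hx => ?_) hx
  have h1 := mk_theta p x
  rw [hx, map_zero, eq_comm, ← PreTilt.pow_dvd_iff_coeff D.associated_untilt 0, pow_zero,
    mul_one, ← constantCoeff_e] at h1
  obtain ⟨y, hy⟩ := h1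
  obtain ⟨y, rfl⟩ := WittVector.constantCoeff_surjective p y
  rw [← map_mul, ← sub_eq_zero, ← map_sub, Ainf_dvd_p_iff] at hy
  obtain ⟨x', hx'⟩ := hy
  refine ⟨y, x', ?_, by linear_combination hx'⟩
  have h2 := congrArg (theta p OK K) hx'
  rw [map_sub, map_mul, map_mul, hx, theta_e, zero_mul, sub_zero, map_natCast, eq_comm] at h2
  exact (mul_eq_zero.1 h2).resolve_left (p_ne_zero_OC p)

lemma theta_eq_zero_iff {x : Ainf p OK K} : theta p OK K x = 0 ↔ D.e ∣ x :=
  ⟨D.e_dvd_of_theta, fun ⟨y, hy⟩ => by rw [hy, map_mul, theta_e, zero_mul]⟩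

lemma e_ne_zero : D.e ≠ 0 := by
  intro h
  have h1 := D.constantCoeff_e
  rw [h, map_zero] at h1
  exact pow_ne_zero _ D.piFlat_ne_zero h1.symm

lemma p_dvd_of_dvd_e_mul {x : Ainf p OK K} (h : (p : Ainf p OK K) ∣ D.e * x) :
    (p : Ainf p OK K) ∣ x := by
  rw [← Ainf_dvd_p_iff, map_mul, constantCoeff_e] at h
  exact (Ainf_dvd_p_iff p x).1 ((mul_eq_zero.1 h).resolve_left (pow_ne_zero _ D.piFlat_ne_zero))

lemma ζ_zero : D.ζ 0 = 1 := by
  have := D.primitive 0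
  rwa [pow_zero, IsPrimitiveRoot.one_right_iff] at this

lemma theta_ε : theta p OK K D.ε = 1 := by
  rw [ε, theta_teichmuller, zetaFlat, untilt_flatOfSeq, ζ_zero, map_one]

lemma exists_w : ∃ w, D.e * w = D.ε - 1 := by
  have := D.e_dvd_of_theta (x := D.ε - 1) (by rw [map_sub, theta_ε, map_one, sub_self])
  obtain ⟨w, hw⟩ := this
  exact ⟨w, hw.symm⟩

/-- The quotient `(ε - 1) / E`. -/
def w : Ainf p OK K := D.exists_w.choose

lemma e_mul_w : D.e * D.w = D.ε - 1 := D.exists_w.choose_spec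

/-! ### The maps `W(k)⟦x⟧⟦t⟧ → A_inf` -/

lemma exists_bkToAinf : ∃ f : BK p (IsLocalRing.ResidueField OK) →+* Ainf p OK K,
    (∀ a, f (PowerSeries.C a) = wittToAinf p OK K a) ∧ f PowerSeries.X = D.u := by
  have := D.isAdicComplete_p_u
  exact exists_powerSeries_hom _ (Ideal.span {(p : Ainf p OK K), D.u}) _
    (Ideal.subset_span (by simp))

/-- The map `W(k)⟦x⟧ → A_inf`, `x ↦ u`. -/
def bkToAinf : BK p (IsLocalRing.ResidueField OK) →+* Ainf p OK K := D.exists_bkToAinf.choose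

lemma bkToAinf_C (c) : D.bkToAinf (PowerSeries.C c) = wittToAinf p OK K c :=
  D.exists_bkToAinf.choose_spec.1 c

lemma bkToAinf_X : D.bkToAinf PowerSeries.X = D.u := D.exists_bkToAinf.choose_spec.2

lemma bkToAinf_eBK : D.bkToAinf (eBK p D.E) = D.e := by
  have h : ∀ P : Polynomial (WittVector p (IsLocalRing.ResidueField OK)),
      D.bkToAinf (P : PowerSeries _) = P.eval₂ (wittToAinf p OK K) D.u := by
    intro P
    induction P using Polynomial.induction_on' with
    | add a b ha hb => simp [ha, hb, Polynomial.eval₂_add]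
    | monomial n a =>
      rw [← Polynomial.C_mul_X_pow_eq_monomial]
      simp [bkToAinf_C, bkToAinf_X]
  exact h D.E

lemma bkToAinf_unique {f : BK p (IsLocalRing.ResidueField OK) →+* Ainf p OK K}
    (hC : ∀ a, f (PowerSeries.C a) = wittToAinf p OK K a) (hX : f PowerSeries.X = D.u) :
    f = D.bkToAinf := by
  have := D.isAdicComplete_p_u
  refine powerSeries_hom_ext (J := Ideal.span {(p : Ainf p OK K), D.u})
    (fun a => by rw [hC, bkToAinf_C]) (by rw [hX, bkToAinf_X]) ?_
  rw [hX]
  exact Ideal.subset_span (by simp)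

/-- `κ` is the map `W(k)⟦x⟧⟦t⟧ → A_inf`, `x ↦ u`, `t ↦ e v`. -/
structure IsStd (κ : BK2 p (IsLocalRing.ResidueField OK) →+* Ainf p OK K) (v : Ainf p OK K) :
    Prop where
  map_C : ∀ c, κ (PowerSeries.C c) = D.bkToAinf c
  map_X : κ PowerSeries.X = D.e * v

lemma exists_isStd (v : Ainf p OK K) : ∃ κ, D.IsStd κ v := by
  have := D.isAdicComplete_p_e
  obtain ⟨f, h1, h2⟩ := exists_powerSeries_hom D.bkToAinf (Ideal.span {(p : Ainf p OK K), D.e})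
    (D.e * v) (Ideal.mul_mem_right _ _ (Ideal.subset_span (by simp)))
  exact ⟨f, h1, h2⟩

lemma IsStd.unique {D : BKData p OK K} {κ κ' : BK2 p (IsLocalRing.ResidueField OK) →+* Ainf p OK K}
    {v : Ainf p OK K} (h : D.IsStd κ v) (h' : D.IsStd κ' v) : κ = κ' := by
  have := D.isAdicComplete_p_e
  refine powerSeries_hom_ext (J := Ideal.span {(p : Ainf p OK K), D.e})
    (fun a => by rw [h.map_C, h'.map_C]) (by rw [h.map_X, h'.map_X]) ?_
  rw [h.map_X]
  exact Ideal.mul_mem_right _ _ (Ideal.subset_span (by simp))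

lemma isStd_iff_isEval {κ : BK2 p (IsLocalRing.ResidueField OK) →+* Ainf p OK K}
    {v : Ainf p OK K} : D.IsStd κ v ↔ IsEval p κ D.u (tVar p _) (D.e * v) := by
  constructor
  · rintro ⟨h1, h2⟩
    exact ⟨fun a => by rw [h1, bkToAinf_C], by rw [xVar, h1, bkToAinf_X], h2⟩
  · rintro ⟨h1, h2, h3⟩
    refine ⟨fun c => ?_, h3⟩
    have := D.bkToAinf_unique (f := κ.comp PowerSeries.C) h1 h2
    rw [← this]; rfl

/-- The image of `y - x` is `ε u - u = e (u w)`, so `u w` is the value of `(y - x) / E`. -/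
lemma isStd_iff_isEval_crys {κ : BK2 p (IsLocalRing.ResidueField OK) →+* Ainf p OK K} :
    D.IsStd κ (D.u * D.w) ↔ IsEval p κ D.u (xVar p _ + tVar p _) (D.ε * D.u) := by
  rw [isStd_iff_isEval]
  have h : D.e * (D.u * D.w) = D.ε * D.u - D.u := by
    linear_combination D.u * D.e_mul_w
  simp only [IsEval, h, map_add]
  constructor
  · rintro ⟨h1, h2, h3⟩
    exact ⟨h1, h2, by rw [h2, h3]; ring⟩
  · rintro ⟨h1, h2, h3⟩
    exact ⟨h1, h2, by rw [← h3, h2]; ring⟩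

/-! ### Evaluation at `ϖ` -/

lemma isAdicComplete_ϖ : IsAdicComplete (Ideal.span {D.ϖ}) OK := by
  refine isAdicComplete_of_pow_le (J := Ideal.span {(p : OK)}) D.deg_ne_zero ?_ ?_
  · rw [Ideal.span_singleton_le_span_singleton]
    exact (dvd_pow_self _ D.deg_ne_zero).trans D.associated_p.symm.dvd
  · rw [Ideal.span_singleton_pow, Ideal.span_singleton_le_span_singleton]
    exact D.associated_p.dvd

lemma exists_evϖ : ∃ f : BK p (IsLocalRing.ResidueField OK) →+* OK,
    (∀ a, f (PowerSeries.C a) = wittToOK p OK a) ∧ f PowerSeries.X = D.ϖ := by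
  have := D.isAdicComplete_ϖ
  exact exists_powerSeries_hom _ (Ideal.span {D.ϖ}) _ (Ideal.mem_span_singleton_self _)

/-- The map `W(k)⟦x⟧ → 𝒪_K`, `x ↦ ϖ`. -/
def evϖ : BK p (IsLocalRing.ResidueField OK) →+* OK := D.exists_evϖ.choose

lemma evϖ_C (c) : D.evϖ (PowerSeries.C c) = wittToOK p OK c := D.exists_evϖ.choose_spec.1 c

lemma evϖ_X : D.evϖ PowerSeries.X = D.ϖ := D.exists_evϖ.choose_spec.2

lemma evϖ_coe (P : Polynomial (WittVector p (IsLocalRing.ResidueField OK))) :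
    D.evϖ (P : PowerSeries _) = P.eval₂ (wittToOK p OK) D.ϖ := by
  induction P using Polynomial.induction_on' with
  | add a b ha hb => simp [ha, hb, Polynomial.eval₂_add]
  | monomial n a =>
    rw [← Polynomial.C_mul_X_pow_eq_monomial]
    simp [evϖ_C, evϖ_X]

lemma theta_bkToAinf (c : BK p (IsLocalRing.ResidueField OK)) :
    theta p OK K (D.bkToAinf c) = okToOC p OK K (D.evϖ c) := by
  have : IsAdicComplete (Ideal.span {okToOC p OK K D.ϖ}) (OC p OK K) := by
    refine isAdicComplete_of_pow_le (J := Ideal.span {(p : OC p OK K)}) D.deg_ne_zero ?_ ?_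
    · rw [Ideal.span_singleton_le_span_singleton, ← map_natCast (okToOC p OK K)]
      exact map_dvd _ ((dvd_pow_self _ D.deg_ne_zero).trans D.associated_p.symm.dvd)
    · rw [Ideal.span_singleton_pow, Ideal.span_singleton_le_span_singleton,
        ← map_natCast (okToOC p OK K), ← map_pow]
      exact map_dvd _ D.associated_p.dvd
  refine RingHom.congr_fun (f := (theta p OK K).comp D.bkToAinf) (g := (okToOC p OK K).comp D.evϖ)
    (powerSeries_hom_ext (J := Ideal.span {okToOC p OK K D.ϖ}) (fun a => ?_) ?_ ?_) c
  · rw [RingHom.comp_apply, RingHom.comp_apply, bkToAinf_C, evϖ_C, theta_wittToAinf]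
  · rw [RingHom.comp_apply, RingHom.comp_apply, bkToAinf_X, evϖ_X, theta_u]
  · rw [RingHom.comp_apply, bkToAinf_X, theta_u]
    exact Ideal.mem_span_singleton_self _

lemma isAdicComplete_BK :
    IsAdicComplete (Ideal.span {(p : BK p (IsLocalRing.ResidueField OK))})
      (BK p (IsLocalRing.ResidueField OK)) := by
  have := isAdicComplete_powerSeries (p : WittVector p (IsLocalRing.ResidueField OK))
  rwa [map_natCast] at this

lemma eBK_eq : eBK p D.E = PowerSeries.X ^ D.deg + (p : BK p (IsLocalRing.ResidueField OK)) *
    (D.F : PowerSeries (WittVector p (IsLocalRing.ResidueField OK))) := by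
  rw [eBK]
  nth_rw 1 [D.E_eq]
  rw [Polynomial.coe_add, Polynomial.coe_pow, Polynomial.coe_X, Polynomial.coe_mul,
    Polynomial.coe_C, map_natCast]

lemma p_dvd_of_dvd_eBK_mul {c : BK p (IsLocalRing.ResidueField OK)}
    (h : (p : BK p (IsLocalRing.ResidueField OK)) ∣ eBK p D.E * c) :
    (p : BK p (IsLocalRing.ResidueField OK)) ∣ c := by
  rw [← map_natCast PowerSeries.C] at h ⊢
  apply C_dvd_of_X_pow_mul (d := D.deg)
  obtain ⟨y, hy⟩ := h
  refine ⟨y - D.F * c, ?_⟩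
  rw [D.eBK_eq] at hy
  rw [map_natCast] at hy ⊢
  linear_combination hy

lemma evϖ_eBK : D.evϖ (eBK p D.E) = 0 := by
  apply okToOC_injective p OK K
  rw [← theta_bkToAinf, bkToAinf_eBK, theta_e, map_zero]

/-- A division argument in the style of Weierstrass. Since `p` is `ϖ ^ deg` up to a unit, reading
`c(ϖ) = 0` modulo `ϖ ^ (i + 1)` for increasing `i < deg` shows that the first `deg` coefficients are
multiples of `p`. So `c` is a multiple of `X ^ deg`, hence of `E`, modulo `p`, and successive
approximation finishes. -/
lemma eBK_dvd_of_evϖ {c : BK p (IsLocalRing.ResidueField OK)} (hc : D.evϖ c = 0) :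
    eBK p D.E ∣ c := by
  have := isAdicComplete_BK (p := p) (OK := OK)
  refine dvd_of_successive (q := (p : BK p (IsLocalRing.ResidueField OK)))
    (P := fun c => D.evϖ c = 0) (fun c hc => ?_) hc
  have h1 : ∀ i < D.deg, (p : WittVector p _) ∣ PowerSeries.coeff i c := by
    intro i
    induction i using Nat.strong_induction_on with
    | _ i ih =>
      intro hi
      have h2 := PowerSeries.eq_shift_mul_X_pow_add_trunc (i + 1) c
      have h3 := congrArg D.evϖ h2
      rw [hc, map_add, map_mul, map_pow, evϖ_X] at h3
      have h4 : ∃ q, D.evϖ (PowerSeries.trunc (i + 1) c : PowerSeries _) =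
          wittToOK p OK (PowerSeries.coeff i c) * D.ϖ ^ i + p * q := by
        have h5 : ∀ j ∈ Finset.range i, ∃ r, wittToOK p OK (PowerSeries.coeff j c) * D.ϖ ^ j
            = (p : OK) * r := by
          intro j hj
          rw [Finset.mem_range] at hj
          obtain ⟨r, hr⟩ := ih j hj (hj.trans hi)
          exact ⟨wittToOK p OK r * D.ϖ ^ j, by rw [hr, map_mul, map_natCast]; ring⟩
        have h6 : D.evϖ (PowerSeries.trunc (i + 1) c : PowerSeries _) =
            ∑ j ∈ Finset.range (i + 1), wittToOK p OK (PowerSeries.coeff j c) * D.ϖ ^ j := by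
          rw [evϖ_coe, PowerSeries.eval₂_trunc_eq_sum_range]
        rw [h6, Finset.sum_range_succ]
        have h7 : (p : OK) ∣
            ∑ j ∈ Finset.range i, wittToOK p OK (PowerSeries.coeff j c) * D.ϖ ^ j :=
          Finset.dvd_sum fun j hj => by
            obtain ⟨r, hr⟩ := h5 j hj
            exact ⟨r, hr⟩
        obtain ⟨q, hq⟩ := h7
        exact ⟨q, by rw [hq]; ring⟩
      obtain ⟨q, hq⟩ := h4
      obtain ⟨v, hv⟩ := D.associated_p
      have h8 : (p : OK) = D.ϖ ^ D.deg * (↑v⁻¹ : OK) := by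
        rw [← hv, mul_assoc, Units.mul_inv, mul_one]
      have h9 : D.ϖ ^ D.deg = D.ϖ ^ i * D.ϖ * D.ϖ ^ (D.deg - (i + 1)) := by
        rw [← pow_succ, ← pow_add]; congr 1; omega
      have h10 : D.ϖ ^ i * wittToOK p OK (PowerSeries.coeff i c) ∈
          Ideal.span {D.ϖ ^ i * D.ϖ} := by
        rw [Ideal.mem_span_singleton]
        rw [hq, h8, h9, pow_succ] at h3
        exact ⟨-(D.evϖ (PowerSeries.mk fun j => PowerSeries.coeff (j + (i + 1)) c) +
          D.ϖ ^ (D.deg - (i + 1)) * (↑v⁻¹ : OK) * q), by linear_combination -h3⟩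
      rw [Ideal.mem_span_singleton, mul_dvd_mul_iff_left (pow_ne_zero _ D.ϖ_ne_zero)] at h10
      have h11 : IsLocalRing.residue OK (wittToOK p OK (PowerSeries.coeff i c)) = 0 := by
        rw [IsLocalRing.residue_eq_zero_iff]
        exact Ideal.mem_of_dvd _ h10 D.ϖ_mem
      rw [residue_wittToOK] at h11
      rwa [← Ideal.mem_span_singleton, WittVector.mem_span_p_iff_coeff_zero_eq_zero]
  have h2 : (p : BK p (IsLocalRing.ResidueField OK)) ∣
      (PowerSeries.trunc D.deg c : PowerSeries _) := by
    rw [← map_natCast PowerSeries.C, C_dvd_iff_coeff]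
    intro i
    rw [Polynomial.coeff_coe, PowerSeries.coeff_trunc]
    split_ifs with h
    · exact h1 i h
    · exact dvd_zero _
  obtain ⟨r, hr⟩ := h2
  have h3 := PowerSeries.eq_shift_mul_X_pow_add_trunc D.deg c
  set s := PowerSeries.mk fun i => PowerSeries.coeff (i + D.deg) c
  have h4 : c = eBK p D.E * s + p * (r - D.F * s) := by
    rw [D.eBK_eq]
    linear_combination h3 + hr
  refine ⟨s, r - D.F * s, ?_, h4⟩
  have h5 := congrArg D.evϖ h4
  rw [hc, map_add, map_mul, evϖ_eBK, zero_mul, zero_add, map_mul, map_natCast, eq_comm] at h5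
  exact (mul_eq_zero.1 h5).resolve_left (Nat.cast_ne_zero.2 hp.1.ne_zero)

end BKData

end Theta

/-! ## The Galois action -/

section Galois

variable (p : ℕ) [hp : Fact p.Prime] {OK : Type*} [CommRing OK] [IsDomain OK]
variable [IsDiscreteValuationRing OK] [CharZero OK] [CharP (IsLocalRing.ResidueField OK) p]
variable [PerfectRing (IsLocalRing.ResidueField OK) p]
variable [IsAdicComplete (Ideal.span {(p : OK)}) OK]
variable {K : Type*} [Field K] [Algebra OK K] [IsFractionRing OK K]

section Action

variable (σ : AlgebraicClosure K ≃ₐ[K] AlgebraicClosure K)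

/-- The action of the Galois group on the ring of integers of the algebraic closure. -/
def galO : OKbar OK K →ₐ[OK] OKbar OK K :=
  ((σ : AlgebraicClosure K →ₐ[K] AlgebraicClosure K).restrictScalars OK).mapIntegralClosure

lemma coe_galO (x : OKbar OK K) : (galO σ x : AlgebraicClosure K) = σ x := rfl

lemma exists_galC : ∃ f : OC p OK K →+* OC p OK K, ∀ x,
    f (algebraMap (OKbar OK K) (OC p OK K) x) = algebraMap (OKbar OK K) (OC p OK K) (galO σ x) :=
  (isCompletion_OC p OK K).exists_lift (J := Ideal.span {(p : OC p OK K)})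
    ((algebraMap (OKbar OK K) (OC p OK K)).comp (galO (OK := OK) σ).toRingHom)
    (by
      intro s hs
      rw [Ideal.mem_span_singleton] at hs ⊢
      have := map_dvd ((algebraMap (OKbar OK K) (OC p OK K)).comp
        (galO (OK := OK) σ).toRingHom) hs
      rwa [map_natCast] at this)

/-- The action of the Galois group on `𝒪_ℂ`. -/
def galC : OC p OK K →+* OC p OK K := (exists_galC p σ).choose

lemma galC_algebraMap (x : OKbar OK K) :
    galC p σ (algebraMap (OKbar OK K) (OC p OK K) x) =
      algebraMap (OKbar OK K) (OC p OK K) (galO σ x) := (exists_galC p σ).choose_spec x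

lemma galC_okToOC (x : OK) : galC p σ (okToOC p OK K x) = okToOC p OK K x := by
  rw [okToOC, RingHom.comp_apply, galC_algebraMap, AlgHom.commutes]

/-- The action of the Galois group on `A_inf`. -/
def galA : Ainf p OK K →+* Ainf p OK K := WittVector.map (tiltHom (galC p σ))

lemma theta_galA (x : Ainf p OK K) : theta p OK K (galA p σ x) = galC p σ (theta p OK K x) :=
  fontaineTheta_map _ _

lemma galA_wittToAinf (c : WittVector p (IsLocalRing.ResidueField OK)) :
    galA p σ (wittToAinf p OK K c) = wittToAinf p OK K c := by
  ext n : 1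
  rw [galA, wittToAinf, WittVector.map_coeff, WittVector.map_coeff]
  refine PreTilt.ext_coeff fun m => ?_
  rw [coeff_tiltHom]
  simp only [RingHom.comp_apply, tiltMap_eq]
  rw [untilt_root_tiltHom, galC_okToOC, coeff_tiltHom]

lemma galA_teichmuller (x : PreTilt (OC p OK K) p) :
    galA p σ (WittVector.teichmuller p x) =
      WittVector.teichmuller p (tiltHom (galC p σ) x) :=
  WittVector.map_teichmuller _ _ _

end Action

variable {p}

lemma untilt_root_mul (x y : PreTilt (OC p OK K) p) (n : ℕ) :
    (PreTilt.root (x * y) n).untilt = (PreTilt.root x n).untilt * (PreTilt.root y n).untilt := by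
  rw [← map_mul]
  congr 1
  exact iterate_map_mul (frobeniusEquiv (PreTilt (OC p OK K) p) p).symm n x y

lemma untilt_root_pow (x : PreTilt (OC p OK K) p) (m n : ℕ) :
    (PreTilt.root (x ^ m) n).untilt = (PreTilt.root x n).untilt ^ m := by
  rw [← map_pow]
  congr 1
  exact iterate_map_pow (frobeniusEquiv (PreTilt (OC p OK K) p) p).symm n x m

namespace BKData

variable (D : BKData p OK K)

/-- `θ(([x] - 1) / e) = l`. -/
def HasLog (x : PreTilt (OC p OK K) p) (l : OC p OK K) : Prop :=
  ∃ y, D.e * y = WittVector.teichmuller p x - 1 ∧ theta p OK K y = l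

variable {D}

/-- In `[x x'] - 1 = ([x] - 1) + ([x'] - 1) + ([x] - 1) ([x'] - 1)` the last term is divisible by `e
^ 2`, so it disappears after division by `e` and application of `θ`. -/
lemma HasLog.mul {x x' : PreTilt (OC p OK K) p} {l l' : OC p OK K} (h : D.HasLog x l)
    (h' : D.HasLog x' l') : D.HasLog (x * x') (l + l') := by
  obtain ⟨y, hy, rfl⟩ := h
  obtain ⟨y', hy', rfl⟩ := h'
  refine ⟨y + y' + D.e * (y * y'), ?_, ?_⟩
  · rw [map_mul]
    linear_combination hy + hy' + (D.e * y') * hy + (WittVector.teichmuller p x - 1) * hy'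
  · rw [map_add, map_add, map_mul, D.theta_e, zero_mul, add_zero]

lemma HasLog.pow {x : PreTilt (OC p OK K) p} {l : OC p OK K} (h : D.HasLog x l) (n : ℕ) :
    D.HasLog (x ^ n) (n * l) := by
  induction n with
  | zero => exact ⟨0, by simp, by simp⟩
  | succ n ih =>
    have := ih.mul h
    rw [← pow_succ] at this
    convert this using 1
    push_cast
    ring

lemma HasLog.unique {x : PreTilt (OC p OK K) p} {l l' : OC p OK K} (h : D.HasLog x l)
    (h' : D.HasLog x l') : l = l' := by
  obtain ⟨y, hy, rfl⟩ := h
  obtain ⟨y', hy', rfl⟩ := h'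
  rw [mul_left_cancel₀ D.e_ne_zero (hy.trans hy'.symm)]

lemma exists_hasLog (D : BKData p OK K) {x : PreTilt (OC p OK K) p} (hx : x.untilt = 1) :
    ∃ l, D.HasLog x l := by
  obtain ⟨y, hy⟩ := D.e_dvd_of_theta (x := WittVector.teichmuller p x - 1)
    (by rw [map_sub, theta_teichmuller, hx, map_one, sub_self])
  exact ⟨_, y, hy.symm, rfl⟩

/-- The quotient `q` of `x` by `y` is the `p ^ N`-th power of an element which itself has untilt `1`
and hence a logarithm in `𝒪_ℂ`; additivity makes the logarithm of `q` a multiple of `p ^ N`. -/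
lemma HasLog.congr {x y : PreTilt (OC p OK K) p} {l l' : OC p OK K} (h : D.HasLog x l)
    (h' : D.HasLog y l') (hx : y.untilt = 1) {N : ℕ}
    (hN : (PreTilt.root x N).untilt = (PreTilt.root y N).untilt) :
    (p : OC p OK K) ^ N ∣ l - l' := by
  obtain ⟨q, rfl⟩ : y ∣ x := PreTilt.dvd_of_untilt_dvd (by rw [hx]; exact one_dvd _)
  have h1 : (PreTilt.root y N).untilt ≠ 0 := by
    intro h0
    have h2 := congrArg (· ^ p ^ N) h0
    simp only [← map_pow, PreTilt.root_pow, hx] at h2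
    rw [zero_pow (pow_ne_zero _ hp.1.ne_zero)] at h2
    exact one_ne_zero h2
  rw [untilt_root_mul] at hN
  have h2 : (PreTilt.root q N).untilt = 1 :=
    mul_left_cancel₀ h1 (by rw [hN, mul_one])
  obtain ⟨m, hm⟩ := D.exists_hasLog h2
  have h3 := hm.pow (p ^ N)
  rw [PreTilt.root_pow] at h3
  have h4 := h.unique (h'.mul h3)
  exact ⟨m, by rw [h4]; push_cast; ring⟩

variable (D)

/-- The element `θ((ε - 1) / e)`. -/
def ω : OC p OK K := theta p OK K D.w

lemma hasLog_zetaFlat : D.HasLog D.zetaFlat D.ω := ⟨D.w, D.e_mul_w, rfl⟩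

/-- The element `ϖ E'(ϖ)`. -/
def different : OK := D.E.derivative.eval₂ (wittToOK p OK) D.ϖ * D.ϖ

/-- Apply `σ` to `e w = ε - 1`. Since `σ(u) = u [c]`, the Taylor expansion of `E` at `u` gives `σ(e)
= e (1 + u E'(u) y)` modulo `e ^ 2`, where `e y = [c] - 1`. Cancelling one `e` and applying `θ`
leaves the formula. -/
lemma galC_ω (σ : AlgebraicClosure K ≃ₐ[K] AlgebraicClosure K) {c : PreTilt (OC p OK K) p}
    (hc : tiltHom (galC p σ) D.piFlat = D.piFlat * c) {l l' : OC p OK K} (hl : D.HasLog c l)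
    (hl' : D.HasLog (tiltHom (galC p σ) D.zetaFlat) l') :
    galC p σ D.ω * (1 + okToOC p OK K D.different * l) = l' := by
  obtain ⟨y, hy, rfl⟩ := hl
  obtain ⟨y', hy', rfl⟩ := hl'
  have h1 : galA p σ D.e =
      (D.E.map (wittToAinf p OK K)).eval (D.u + D.u * (WittVector.teichmuller p c - 1)) := by
    have h0 : (galA p σ).comp (wittToAinf p OK K) = wittToAinf p OK K :=
      RingHom.ext (galA_wittToAinf p σ)
    have h2 : galA p σ D.u = D.u + D.u * (WittVector.teichmuller p c - 1) := by
      rw [u, galA_teichmuller, hc, map_mul]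
      ring
    rw [Polynomial.eval_map, ← h2, e, eAinf, Polynomial.hom_eval₂, h0]
    rfl
  obtain ⟨k, hk⟩ := Polynomial.binomExpansion (D.E.map (wittToAinf p OK K)) D.u
    (D.u * (WittVector.teichmuller p c - 1))
  rw [hk, Polynomial.eval_map, Polynomial.derivative_map, Polynomial.eval_map, ← hy,
    show D.E.eval₂ (wittToAinf p OK K) D.u = D.e from rfl] at h1
  set P := D.E.derivative.eval₂ (wittToAinf p OK K) D.u with hP
  have h2 : D.e * ((1 + P * D.u * y + D.e * (k * D.u ^ 2 * y ^ 2)) * galA p σ D.w) =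
      D.e * y' := by
    have h3 := congrArg (galA p σ) D.e_mul_w
    rw [map_mul, map_sub, map_one, h1, ε, galA_teichmuller, ← hy'] at h3
    linear_combination h3
  have h4 := congrArg (theta p OK K) (mul_left_cancel₀ D.e_ne_zero h2)
  rw [map_mul, map_add, map_add, map_mul _ D.e, theta_e, zero_mul, add_zero, map_one,
    theta_galA, map_mul, map_mul, hP, D.theta_eval₂, D.theta_u, ← map_mul] at h4
  rw [← h4]
  exact mul_comm _ _

lemma isPrimitiveRoot_ζ (N : ℕ) :
    IsPrimitiveRoot (D.ζ N : AlgebraicClosure K) (p ^ N) :=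
  (D.primitive N).map_of_injective (f := algebraMap (OKbar OK K) (AlgebraicClosure K))
    Subtype.val_injective

lemma a_pow_pow (N : ℕ) : D.a N ^ p ^ N = algebraMap OK (OKbar OK K) D.ϖ := by
  induction N with
  | zero => simp [D.a_zero]
  | succ N ih => rw [pow_succ', pow_mul, D.a_pow, ih]

lemma a_ne_zero (N : ℕ) : D.a N ≠ 0 := by
  intro h
  have h1 := D.a_pow_pow N
  rw [h, zero_pow (pow_ne_zero _ hp.1.ne_zero)] at h1
  exact D.ϖ_ne_zero (algebraMap_OK_OKbar_injective OK K (h1.symm.trans (map_zero _).symm))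

lemma exists_gal_ζ (σ : AlgebraicClosure K ≃ₐ[K] AlgebraicClosure K) (N : ℕ) :
    ∃ A : ℕ, galO σ (D.ζ N) = D.ζ N ^ A := by
  have : NeZero (p ^ N) := ⟨pow_ne_zero _ hp.1.ne_zero⟩
  obtain ⟨A, -, hA⟩ := (D.primitive N).eq_pow_of_pow_eq_one (ξ := galO σ (D.ζ N))
    (by rw [← map_pow, (D.primitive N).pow_eq_one, map_one])
  exact ⟨A, hA.symm⟩

lemma exists_gal_a (σ : AlgebraicClosure K ≃ₐ[K] AlgebraicClosure K) (N : ℕ) :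
    ∃ B : ℕ, galO σ (D.a N) = D.a N * D.ζ N ^ B := by
  have : NeZero (p ^ N) := ⟨pow_ne_zero _ hp.1.ne_zero⟩
  have h0 : (D.a N : AlgebraicClosure K) ≠ 0 := by
    simpa using D.a_ne_zero N
  obtain ⟨B, -, hB⟩ := (D.isPrimitiveRoot_ζ N).eq_pow_of_pow_eq_one
    (ξ := σ (D.a N) / D.a N) (by
      rw [div_pow, ← map_pow]
      have h1 := congrArg (algebraMap (OKbar OK K) (AlgebraicClosure K)) (D.a_pow_pow N)
      rw [map_pow, ← IsScalarTower.algebraMap_apply, IsScalarTower.algebraMap_apply OK K] at h1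
      change (D.a N : AlgebraicClosure K) ^ p ^ N = _ at h1
      rw [h1, AlgEquiv.commutes, ← h1, div_self (pow_ne_zero _ h0)])
  refine ⟨B, Subtype.ext ?_⟩
  have h2 : ((D.a N * D.ζ N ^ B : OKbar OK K) : AlgebraicClosure K) =
      D.a N * (D.ζ N : AlgebraicClosure K) ^ B := rfl
  rw [h2, hB, coe_galO, mul_div_cancel₀ _ h0]

/-- The cocycle relation modulo `p ^ N` for an automorphism which fixes `ω`. -/
lemma dvd_of_galC_ω (σ : AlgebraicClosure K ≃ₐ[K] AlgebraicClosure K) (hσ : galC p σ D.ω = D.ω)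
    {N A B : ℕ} (hA : galO σ (D.ζ N) = D.ζ N ^ A) (hB : galO σ (D.a N) = D.a N * D.ζ N ^ B) :
    (p : OC p OK K) ^ N ∣
      okToOC p OK K D.different * D.ω ^ 2 * B - ((A : OC p OK K) - 1) * D.ω := by
  have h1 : (tiltHom (galC p σ) D.piFlat).untilt = D.piFlat.untilt := by
    rw [untilt_tiltHom, untilt_piFlat, galC_okToOC]
  obtain ⟨c, hc⟩ : D.piFlat ∣ tiltHom (galC p σ) D.piFlat :=
    PreTilt.dvd_of_untilt_dvd (by rw [h1])
  have h2 : c.untilt = 1 := by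
    have h3 : D.piFlat.untilt ≠ 0 := fun h => D.piFlat_ne_zero (PreTilt.untilt_eq_zero_iff.1 h)
    apply mul_left_cancel₀ h3
    rw [← map_mul, ← hc, h1, mul_one]
  have hz : D.zetaFlat.untilt = 1 := by
    rw [zetaFlat, untilt_flatOfSeq, ζ_zero, map_one]
  have h4 : (tiltHom (galC p σ) D.zetaFlat).untilt = 1 := by
    rw [untilt_tiltHom, hz, map_one]
  obtain ⟨l, hl⟩ := D.exists_hasLog h2
  obtain ⟨l', hl'⟩ := D.exists_hasLog h4
  have h5 := D.galC_ω σ hc hl hl'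
  rw [hσ] at h5
  have h6 : (PreTilt.root c N).untilt =
      algebraMap (OKbar OK K) (OC p OK K) (D.ζ N ^ B) := by
    have h7 : algebraMap (OKbar OK K) (OC p OK K) (D.a N) ≠ 0 := by
      rw [Ne, map_eq_zero_iff _ (algebraMap_OC_injective p OK K)]
      exact D.a_ne_zero N
    apply mul_left_cancel₀ h7
    have h8 := congrArg (fun x => (PreTilt.root x N).untilt) hc
    simp only [untilt_root_mul, untilt_root_tiltHom, piFlat, untilt_root_flatOfSeq,
      galC_algebraMap, hB] at h8
    rw [← h8, map_mul]
  have hzB : (D.zetaFlat ^ B).untilt = 1 := by rw [map_pow, hz, one_pow]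
  have hzA : (D.zetaFlat ^ A).untilt = 1 := by rw [map_pow, hz, one_pow]
  -- Modulo `p ^ N` the logarithms of `c` and of `σ ζ^♭` are `B ω` and `A ω`, because the `p ^ N`-th
  -- roots involved have the untilts `ζ_N ^ B` and `ζ_N ^ A`.
  obtain ⟨s, hs⟩ := hl.congr (D.hasLog_zetaFlat.pow B) hzB (N := N) (by
    rw [h6, untilt_root_pow, zetaFlat, untilt_root_flatOfSeq, map_pow])
  obtain ⟨t, ht⟩ := hl'.congr (D.hasLog_zetaFlat.pow A) hzA (N := N) (by
    rw [untilt_root_tiltHom, untilt_root_pow, zetaFlat, untilt_root_flatOfSeq, galC_algebraMap,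
      hA, map_pow])
  refine ⟨t - D.ω * okToOC p OK K D.different * s, ?_⟩
  linear_combination h5 + ht - D.ω * okToOC p OK K D.different * hs

end BKData

end Galois

/-! ## Transcendence of `θ((ε - 1) / E)` -/

section Transcendence

variable {p : ℕ} [hp : Fact p.Prime] {OK : Type*} [CommRing OK] [IsDomain OK]
variable [IsDiscreteValuationRing OK] [CharZero OK] [CharP (IsLocalRing.ResidueField OK) p]
variable [PerfectRing (IsLocalRing.ResidueField OK) p]
variable [IsAdicComplete (Ideal.span {(p : OK)}) OK]
variable {K : Type*} [Field K] [Algebra OK K] [IsFractionRing OK K]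

/-- The value at `1` of the cyclotomic polynomial is `p`, a product of factors `1 - ζ ^ i`, and `ζ -
1` divides each of them. -/
lemma sub_one_pow_dvd_p {R : Type*} [CommRing R] [IsDomain R] {ζ : R} {k : ℕ}
    (h : IsPrimitiveRoot ζ (p ^ (k + 1))) : (ζ - 1) ^ (p ^ k * (p - 1)) ∣ (p : R) := by
  have h1 := Polynomial.eval_one_cyclotomic_prime_pow (R := R) (p := p) k
  rw [Polynomial.cyclotomic_eq_prod_X_sub_primitiveRoots h, Polynomial.eval_prod] at h1
  rw [← h1, ← Nat.totient_prime_pow_succ hp.1, ← h.card_primitiveRoots, ← Finset.prod_const]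
  refine Finset.prod_dvd_prod_of_dvd _ _ fun μ hμ => ?_
  rw [Polynomial.eval_sub, Polynomial.eval_X, Polynomial.eval_C]
  have : NeZero (p ^ (k + 1)) := ⟨pow_ne_zero _ hp.1.ne_zero⟩
  obtain ⟨i, -, rfl⟩ := h.eq_pow_of_pow_eq_one
    (((mem_primitiveRoots (pow_pos hp.1.pos _)).1 hμ).pow_eq_one)
  rw [← dvd_neg, neg_sub]
  simpa using sub_dvd_pow_sub_pow ζ 1 i

variable (OK) in
lemma charZero_witt : CharZero (WittVector p (IsLocalRing.ResidueField OK)) := by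
  refine charZero_of_inj_zero fun n hn => ?_
  have := congrArg (wittToOK p OK) hn
  rw [map_natCast, map_zero] at this
  exact_mod_cast this

lemma exists_dvd_p_pow_OC {x : OC p OK K} (hx : x ≠ 0) : ∃ n, x ∣ (p : OC p OK K) ^ n := by
  obtain ⟨a, ha⟩ := exists_associated p OK K x
  have h0 : a ≠ 0 := by
    rintro rfl
    rw [map_zero] at ha
    exact hx ((associated_zero_iff_eq_zero _).1 ha)
  obtain ⟨n, hn⟩ := exists_dvd_p_pow p OK K h0
  refine ⟨n, ha.dvd_iff_dvd_left.2 ?_⟩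
  have h1 := map_dvd (algebraMap (OKbar OK K) (OC p OK K)) hn
  rwa [map_pow, map_natCast] at h1

lemma int_pow_dvd_of_OC (n : ℕ) (M : ℤ) (h : (p : OC p OK K) ^ n ∣ M) : (p : ℤ) ^ n ∣ M := by
  induction n generalizing M with
  | zero => simp
  | succ n ih =>
    have h1 : (p : ℤ) ∣ M := by
      by_contra hM
      have h2 : IsCoprime (p : ℤ) M :=
        (Nat.prime_iff_prime_int.1 hp.1).coprime_iff_not_dvd.2 hM
      obtain ⟨a, b, hab⟩ := h2
      have h3 : (p : OC p OK K) ∣ 1 := by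
        have h4 : ((a * p + b * M : ℤ) : OC p OK K) = 1 := by rw [hab]; simp
        rw [← h4]
        push_cast
        exact dvd_add (Dvd.intro_left _ rfl)
          (((dvd_pow_self _ (Nat.succ_ne_zero n)).trans h).mul_left _)
      exact (fact_OC p OK K).1 (isUnit_of_dvd_one h3)
    obtain ⟨M, rfl⟩ := h1
    rw [pow_succ']
    refine mul_dvd_mul_left _ (ih M ?_)
    push_cast at h
    rw [pow_succ'] at h
    exact (mul_dvd_mul_iff_left (p_ne_zero_OC p)).1 h

/-- An element of `𝒪_ℂ` which is integral over `𝒪_K` is algebraic. -/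
lemma exists_algebraMap_eq_of_isIntegral {x : OC p OK K} (hx : IsIntegral OK x) :
    ∃ r : OKbar OK K, algebraMap (OKbar OK K) (OC p OK K) r = x := by
  -- A monic polynomial over `OKbar` has its roots there; they are split off one at a time, and in
  -- the domain `OC` some linear factor must vanish at `x`.
  have key : ∀ (n : ℕ) (g : Polynomial (OKbar OK K)), g.Monic → g.natDegree = n →
      g.eval₂ (algebraMap (OKbar OK K) (OC p OK K)) x = 0 →
      ∃ r : OKbar OK K, algebraMap (OKbar OK K) (OC p OK K) r = x := by
    intro n
    induction n with
    | zero =>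
      intro g hg hn h0
      rw [hg.natDegree_eq_zero.1 hn, Polynomial.eval₂_one] at h0
      exact absurd h0 one_ne_zero
    | succ n ih =>
      intro g hg hn h0
      have hg' : (g.map (algebraMap (OKbar OK K) (AlgebraicClosure K))).degree ≠ 0 := by
        rw [hg.degree_map, Polynomial.degree_eq_natDegree hg.ne_zero, hn]
        exact_mod_cast Nat.succ_ne_zero n
      obtain ⟨y, hy⟩ := IsAlgClosed.exists_root _ hg'
      have h1 : IsIntegral (OKbar OK K) y := ⟨g, hg, by
        rwa [Polynomial.IsRoot, Polynomial.eval_map] at hy⟩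
      have h2 : IsIntegral OK y := isIntegral_trans y h1
      let r : OKbar OK K := ⟨y, h2⟩
      have h3 : g.IsRoot r := by
        apply FaithfulSMul.algebraMap_injective (OKbar OK K) (AlgebraicClosure K)
        rw [map_zero, ← Polynomial.eval₂_hom, ← Polynomial.eval_map]
        exact hy
      obtain ⟨q, rfl⟩ := Polynomial.dvd_iff_isRoot.2 h3
      rw [Polynomial.eval₂_mul, mul_eq_zero] at h0
      rcases h0 with h0 | h0
      · refine ⟨r, ?_⟩
        rw [Polynomial.eval₂_sub, Polynomial.eval₂_X, Polynomial.eval₂_C, sub_eq_zero] at h0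
        exact h0.symm
      · have hq : q.Monic := (Polynomial.monic_X_sub_C r).of_mul_monic_left hg
        refine ih q hq ?_ h0
        rw [(Polynomial.monic_X_sub_C r).natDegree_mul hq, Polynomial.natDegree_X_sub_C] at hn
        omega
  obtain ⟨f, hf, hfx⟩ := hx
  refine key _ (f.map (algebraMap OK (OKbar OK K))) (hf.map _) rfl ?_
  rw [Polynomial.eval₂_map]
  exact hfx

namespace BKData

variable (D : BKData p OK K)

lemma ζ_ne_one {n : ℕ} (hn : n ≠ 0) : D.ζ n ≠ 1 := fun h => by
  have h1 := D.primitive n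
  rw [h] at h1
  have h2 := h1.unique IsPrimitiveRoot.one
  exact (Nat.one_lt_pow hn hp.1.one_lt).ne' h2

/-- `[ζ^{♭, 1/p}]`. -/
def εRoot : Ainf p OK K := WittVector.teichmuller p (PreTilt.root D.zetaFlat 1)

lemma εRoot_pow : D.εRoot ^ p = D.ε := by
  rw [εRoot, ← map_pow, PreTilt.root_succ_pow]; rfl

lemma theta_εRoot : theta p OK K D.εRoot = algebraMap (OKbar OK K) (OC p OK K) (D.ζ 1) := by
  rw [εRoot, theta_teichmuller, zetaFlat, untilt_root_flatOfSeq]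

lemma algebraMap_ζ_sub_one_ne_zero :
    algebraMap (OKbar OK K) (OC p OK K) (D.ζ 1 - 1) ≠ 0 := by
  rw [Ne, map_eq_zero_iff _ (algebraMap_OC_injective p OK K), sub_eq_zero]
  exact D.ζ_ne_one one_ne_zero

/-- Factor `ε - 1` as `ε^{1/p} - 1` times the geometric sum. As `ζ₁ ≠ 1`, it is the sum that `θ`
kills, so `e` divides it; hence `w` is a multiple of `ε^{1/p} - 1` and `ω` one of `ζ₁ - 1`. -/
lemma exists_cyc : ∃ c, ∑ i ∈ Finset.range p, D.εRoot ^ i = D.e * c ∧ D.w = c * (D.εRoot - 1) := by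
  have h1 : (∑ i ∈ Finset.range p, D.εRoot ^ i) * (D.εRoot - 1) = D.ε - 1 := by
    rw [geom_sum_mul, εRoot_pow]
  have h2 : theta p OK K (∑ i ∈ Finset.range p, D.εRoot ^ i) = 0 := by
    have h3 := congrArg (theta p OK K) h1
    rw [map_mul, map_sub, map_sub, theta_ε, map_one, sub_self, theta_εRoot,
      ← map_one (algebraMap (OKbar OK K) (OC p OK K)), ← map_sub] at h3
    exact (mul_eq_zero.1 h3).resolve_right D.algebraMap_ζ_sub_one_ne_zero
  obtain ⟨c, hc⟩ := D.e_dvd_of_theta h2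
  refine ⟨c, hc, mul_left_cancel₀ D.e_ne_zero ?_⟩
  rw [D.e_mul_w, ← h1, hc, mul_assoc]

/-- The quotient of `1 + ε^{1/p} + ⋯ + ε^{(p - 1)/p}` by `e`. -/
def cyc : Ainf p OK K := D.exists_cyc.choose

lemma sum_εRoot : ∑ i ∈ Finset.range p, D.εRoot ^ i = D.e * D.cyc := D.exists_cyc.choose_spec.1

lemma w_eq : D.w = D.cyc * (D.εRoot - 1) := D.exists_cyc.choose_spec.2

lemma ω_eq : D.ω = theta p OK K D.cyc * algebraMap (OKbar OK K) (OC p OK K) (D.ζ 1 - 1) := by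
  rw [ω, w_eq, map_mul, map_sub, theta_εRoot, map_one, map_sub, map_one]

/-- Otherwise `e ^ 2` divides the geometric sum, and modulo `p` this says that `ϖ^♭ ^ (2 deg)`
divides `(ζ^{♭,1/p} - 1) ^ (p - 1)`. Reading the coefficient of index `1` and raising to the `p`-th
power, `p ^ 2` divides `(ζ₂ - 1) ^ (p (p - 1))`, which divides `p`. -/
lemma theta_cyc_ne_zero : theta p OK K D.cyc ≠ 0 := by
  intro h
  obtain ⟨c, hc⟩ := D.e_dvd_of_theta h
  set z := PreTilt.root D.zetaFlat 1 with hz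
  have h1 : (z - 1) ^ (p - 1) = D.piFlat ^ (2 * D.deg) * WittVector.constantCoeff c := by
    have h2 := congrArg WittVector.constantCoeff D.sum_εRoot
    rw [hc, map_sum, map_mul, map_mul, constantCoeff_e] at h2
    have h3 : ∀ i, WittVector.constantCoeff (D.εRoot ^ i) = z ^ i := fun i => by
      rw [map_pow]; congr 1
    simp only [h3] at h2
    have hz1 : z - 1 ≠ 0 := by
      intro h0
      have h4 := D.theta_εRoot
      rw [εRoot, theta_teichmuller, ← hz, sub_eq_zero.1 h0, map_one] at h4
      apply D.algebraMap_ζ_sub_one_ne_zero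
      rw [map_sub, ← h4, map_one, sub_self]
    apply mul_right_cancel₀ hz1
    have h5 := geom_sum_mul z p
    rw [← pow_succ, Nat.sub_add_cancel hp.1.one_le, sub_pow_char, one_pow, ← h5, h2]
    ring
  have h6 := congrArg (PreTilt.coeff 1) h1
  have h7 : PreTilt.coeff 1 z = Ideal.Quotient.mk (Ideal.span {(p : OC p OK K)})
      (algebraMap (OKbar OK K) (OC p OK K) (D.ζ 2)) := by
    rw [hz, PreTilt.coeff_root]; rfl
  obtain ⟨s, hs⟩ := Ideal.Quotient.mk_surjective (PreTilt.coeff 1 (WittVector.constantCoeff c))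
  rw [map_pow, map_sub, map_one, map_mul, map_pow, h7, piFlat, coeff_flatOfSeq, ← hs,
    ← map_pow, ← map_one (Ideal.Quotient.mk (Ideal.span {(p : OC p OK K)})), ← map_sub, ← map_pow,
    ← map_mul, Ideal.Quotient.eq, Ideal.mem_span_singleton] at h6
  set ι := algebraMap (OKbar OK K) (OC p OK K) with hι
  have h8 : ι (D.a 1) ^ (p * D.deg) = okToOC p OK K (D.ϖ ^ D.deg) := by
    rw [pow_mul, ← map_pow, D.a_pow, D.a_zero, map_pow]; rfl
  have h9 : Associated (p : OC p OK K) (ι (D.a 1) ^ (p * D.deg)) := by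
    rw [h8, ← map_natCast (okToOC p OK K)]
    exact D.associated_p.map _
  have h10 : ι (D.a 1) ^ (2 * D.deg) ∣ p :=
    (pow_dvd_pow _ (Nat.mul_le_mul_right _ hp.1.two_le)).trans h9.symm.dvd
  have h11 : ι (D.a 1) ^ (2 * D.deg) ∣ (ι (D.ζ 2) - 1) ^ (p - 1) := by
    have := dvd_add (h10.trans h6) (Dvd.intro s rfl)
    simpa using this
  have h12 := pow_dvd_pow_of_dvd h11 p
  rw [← pow_mul, ← pow_mul, show 2 * D.deg * p = p * D.deg * 2 by ring, pow_mul] at h12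
  have h13 : (ι (D.ζ 2) - 1) ^ ((p - 1) * p) ∣ (p : OC p OK K) := by
    have := map_dvd ι (sub_one_pow_dvd_p (k := 1) (D.primitive 2))
    rw [map_pow, map_sub, map_one, map_natCast, pow_one] at this
    rwa [mul_comm]
  have h14 : (p : OC p OK K) ^ 2 ∣ p := ((h9.pow_pow (n := 2)).dvd.trans h12).trans h13
  rw [pow_two] at h14
  nth_rw 3 [← mul_one (p : OC p OK K)] at h14
  rw [mul_dvd_mul_iff_left (p_ne_zero_OC p)] at h14
  exact (fact_OC p OK K).1 (isUnit_of_dvd_one h14)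

lemma ω_ne_zero : D.ω ≠ 0 := by
  rw [ω_eq]
  exact mul_ne_zero D.theta_cyc_ne_zero D.algebraMap_ζ_sub_one_ne_zero

lemma p_dvd_coeff_of_evϖ {c : BK p (IsLocalRing.ResidueField OK)} (hc : D.evϖ c = 0) {i : ℕ}
    (hi : i < D.deg) : (p : WittVector p _) ∣ PowerSeries.coeff i c := by
  obtain ⟨q, rfl⟩ := D.eBK_dvd_of_evϖ hc
  rw [eBK_eq, add_mul, map_add, PowerSeries.coeff_X_pow_mul', if_neg (by omega), zero_add,
    ← map_natCast PowerSeries.C, mul_assoc, PowerSeries.coeff_C_mul]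
  exact Dvd.intro _ rfl

/-- All coefficients are multiples of `p` by divisibility by `E`; divide by `p` and repeat. Applied
to the derivative of `E`, this gives `E'(ϖ) ≠ 0`. -/
lemma eq_zero_of_eval₂_eq_zero {P : Polynomial (WittVector p (IsLocalRing.ResidueField OK))}
    (hP : P.degree < D.deg) (h : P.eval₂ (wittToOK p OK) D.ϖ = 0) : P = 0 := by
  have := charZero_witt (p := p) OK
  have hp0 : (p : WittVector p (IsLocalRing.ResidueField OK)) ≠ 0 :=
    Nat.cast_ne_zero.2 hp.1.ne_zero
  have key : ∀ (n : ℕ) (P : Polynomial (WittVector p (IsLocalRing.ResidueField OK))),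
      P.degree < D.deg → P.eval₂ (wittToOK p OK) D.ϖ = 0 →
      ∀ i, (p : WittVector p _) ^ n ∣ P.coeff i := by
    intro n
    induction n with
    | zero => simp
    | succ n ih =>
      intro P hP h
      have h1 : Polynomial.C (p : WittVector p (IsLocalRing.ResidueField OK)) ∣ P := by
        rw [Polynomial.C_dvd_iff_dvd_coeff]
        intro i
        by_cases hi : i < D.deg
        · rw [← Polynomial.coeff_coe]
          exact D.p_dvd_coeff_of_evϖ (by rw [evϖ_coe, h]) hi
        · rw [Polynomial.coeff_eq_zero_of_degree_lt (hP.trans_le (by exact_mod_cast not_lt.1 hi))]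
          exact dvd_zero _
      obtain ⟨Q, rfl⟩ := h1
      have h2 : Q.degree < D.deg := by
        rwa [Polynomial.degree_C_mul hp0] at hP
      rw [Polynomial.eval₂_mul, Polynomial.eval₂_C, map_natCast, mul_eq_zero] at h
      intro i
      rw [Polynomial.coeff_C_mul, pow_succ']
      exact mul_dvd_mul_left _ (ih Q h2 (h.resolve_left (Nat.cast_ne_zero.2 hp.1.ne_zero)) i)
  ext i
  rw [Polynomial.coeff_zero]
  congr 1
  exact eq_zero_of_forall_mem_pow
    (I := Ideal.span {(p : WittVector p (IsLocalRing.ResidueField OK))})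
    fun n => mem_span_pow_iff.2 (key n P hP h i)

lemma different_ne_zero : D.different ≠ 0 := by
  have := charZero_witt (p := p) OK
  refine mul_ne_zero (fun h => ?_) D.ϖ_ne_zero
  have h1 := D.eq_zero_of_eval₂_eq_zero (P := D.E.derivative) ?_ h
  · have h2 := Polynomial.derivative_eq_zero.1 h1
    exact D.deg_ne_zero h2
  · have h3 := Polynomial.degree_derivative_lt D.monic.ne_zero
    rwa [Polynomial.degree_eq_natDegree D.monic.ne_zero] at h3

/-- A finite extension of `K` does not contain `p ^ n`-th roots of `ϖ ^ p ^ m` for all `n`. -/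
lemma not_forall_exists_root (L : IntermediateField K (AlgebraicClosure K)) [FiniteDimensional K L]
    (m : ℕ) : ¬ ∀ n, ∃ y ∈ L, y ^ p ^ n =
      algebraMap K (AlgebraicClosure K) (algebraMap OK K D.ϖ) ^ p ^ m := by
  intro h
  set f := Module.finrank K L with hf
  have hf0 : 0 < f := Module.finrank_pos
  -- With `n = p ^ m * f`, the norm of `y` to `K` has `p ^ n`-th power equal to `ϖ ^ n`. Comparing
  -- valuations, `p ^ n` would divide the positive number `n`, which is smaller.
  obtain ⟨y, hy, hyn⟩ := h (p ^ m * f)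
  set n := p ^ m * f with hn
  let y' : L := ⟨y, hy⟩
  have h1 : y' ^ p ^ n = algebraMap K L (algebraMap OK K D.ϖ ^ p ^ m) := by
    apply Subtype.ext
    rw [map_pow]
    exact hyn
  have h2 : Algebra.norm K y' ^ p ^ n = algebraMap OK K (D.ϖ ^ n) := by
    rw [← map_pow, h1, Algebra.norm_algebraMap, ← pow_mul, ← map_pow]
  have h3 : IsIntegral OK (Algebra.norm K y') := by
    refine IsIntegral.of_pow (pow_pos hp.1.pos n) ?_
    rw [h2]
    exact isIntegral_algebraMap
  obtain ⟨z, hz⟩ := IsIntegrallyClosed.isIntegral_iff.1 h3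
  rw [← hz, ← map_pow] at h2
  have h4 := IsFractionRing.injective OK K h2
  have hz0 : z ≠ 0 := by
    rintro rfl
    rw [zero_pow (pow_ne_zero _ hp.1.ne_zero)] at h4
    exact pow_ne_zero _ D.ϖ_ne_zero h4.symm
  obtain ⟨v, u, rfl⟩ := IsDiscreteValuationRing.eq_unit_mul_pow_irreducible hz0 D.irreducible
  rw [mul_pow, ← pow_mul, ← Units.val_pow_eq_pow_val] at h4
  have h5 := IsDiscreteValuationRing.unit_mul_pow_congr_pow D.irreducible D.irreducible
    (u ^ p ^ n) 1 (v * p ^ n) n (by rw [h4, Units.val_one, one_mul])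
  have hn0 : 0 < n := Nat.mul_pos (pow_pos hp.1.pos m) hf0
  have h6 : n < p ^ n := Nat.lt_pow_self hp.1.one_lt
  rcases Nat.eq_zero_or_pos v with rfl | hv
  · omega
  · have := Nat.le_mul_of_pos_left (p ^ n) hv
    omega

/-- `θ((ε - 1) / E)` is transcendental over `𝒪_K`. -/
theorem transcendental_ω : Transcendental OK D.ω := by
  intro halg
  -- A nonzero multiple `c ω` is integral, hence comes from some `r` in `OKbar`; every automorphism
  -- fixing `r` then fixes `ω`.
  obtain ⟨c, hc0, hc⟩ := halg.exists_integral_multiple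
  obtain ⟨r, hr⟩ := exists_algebraMap_eq_of_isIntegral hc
  have hr' : algebraMap (OKbar OK K) (OC p OK K) r = okToOC p OK K c * D.ω := by
    rw [hr, Algebra.smul_def]; rfl
  have := charZero_fractionField OK K
  let L := IntermediateField.adjoin K {(r : AlgebraicClosure K)}
  have hL : FiniteDimensional K L := IntermediateField.adjoin.finiteDimensional
    (Algebra.IsAlgebraic.isAlgebraic (r : AlgebraicClosure K)).isIntegral
  have hfix : ∀ σ ∈ L.fixingSubgroup, galC p σ D.ω = D.ω := by
    intro σ hσ
    have h1 : galO σ r = r := Subtype.ext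
      ((IntermediateField.mem_fixingSubgroup_iff L σ).1 hσ r
        (IntermediateField.mem_adjoin_simple_self K _))
    have h2 := galC_algebraMap p σ r
    rw [h1, hr', map_mul, galC_okToOC] at h2
    refine mul_left_cancel₀ (fun h => hc0 ?_) h2
    exact okToOC_injective p OK K (h.trans (map_zero _).symm)
  have hmem : ∀ y : AlgebraicClosure K, (∀ σ ∈ L.fixingSubgroup, σ y = y) → y ∈ L := by
    intro y hy
    have : IsGalois K (AlgebraicClosure K) := inferInstance
    rw [← InfiniteGalois.fixedField_fixingSubgroup L, IntermediateField.mem_fixedField_iff]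
    exact hy
  set Δ := okToOC p OK K D.different * D.ω ^ 2 with hΔ
  have hΔ0 : Δ ≠ 0 := by
    refine mul_ne_zero (fun h => D.different_ne_zero ?_) (pow_ne_zero _ D.ω_ne_zero)
    exact okToOC_injective p OK K (h.trans (map_zero _).symm)
  -- As `Δ` divides `p ^ s`, cancelling it costs at most `s` powers of `p`; the levels below are
  -- raised by `s` for this reason.
  obtain ⟨s, t, hs⟩ := exists_dvd_p_pow_OC hΔ0
  have hdvd : ∀ (n : ℕ) (M : ℤ), (p : OC p OK K) ^ (n + s) ∣ Δ * M → (p : ℤ) ^ n ∣ M := by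
    intro n M hM
    apply int_pow_dvd_of_OC (OK := OK) (K := K)
    have h1 : (p : OC p OK K) ^ s * p ^ n ∣ p ^ s * M := by
      rw [← pow_add, add_comm, hs, mul_right_comm]
      exact hM.mul_right t
    exact (mul_dvd_mul_iff_left (pow_ne_zero _ (p_ne_zero_OC p))).1 h1
  set ϖ' := algebraMap K (AlgebraicClosure K) (algebraMap OK K D.ϖ) with hϖ'
  have hα : ∀ n, (D.a n : AlgebraicClosure K) ^ p ^ n = ϖ' := by
    intro n
    have h1 := congrArg (algebraMap (OKbar OK K) (AlgebraicClosure K)) (D.a_pow_pow n)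
    rw [map_pow, ← IsScalarTower.algebraMap_apply, IsScalarTower.algebraMap_apply OK K] at h1
    exact h1
  have hα0 : ∀ n, (D.a n : AlgebraicClosure K) ≠ 0 := fun n => by
    simpa using D.a_ne_zero n
  have hz : ∀ n, (D.ζ n : AlgebraicClosure K) ^ p ^ n = 1 := fun n =>
    (D.isPrimitiveRoot_ζ n).pow_eq_one
  have hz0 : ∀ n, (D.ζ n : AlgebraicClosure K) ≠ 0 := fun n h => by
    have := hz n
    rw [h, zero_pow (pow_ne_zero _ hp.1.ne_zero)] at this
    exact zero_ne_one this
  have haN : ∀ n k, D.a (n + k) ^ p ^ k = D.a n := by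
    intro n k
    induction k with
    | zero => simp
    | succ k ih => rw [pow_succ', pow_mul, ← add_assoc, D.a_pow, ih]
  have hzN : ∀ n k, D.ζ (n + k) ^ p ^ k = D.ζ n := by
    intro n k
    induction k with
    | zero => simp
    | succ k ih => rw [pow_succ', pow_mul, ← add_assoc, D.ζ_pow, ih]
  have hlow : ∀ (σ : AlgebraicClosure K ≃ₐ[K] AlgebraicClosure K) (n k A B : ℕ),
      galO σ (D.ζ (n + k)) = D.ζ (n + k) ^ A →
      galO σ (D.a (n + k)) = D.a (n + k) * D.ζ (n + k) ^ B →
      galO σ (D.ζ n) = D.ζ n ^ A ∧ galO σ (D.a n) = D.a n * D.ζ n ^ B := by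
    intro σ n k A B hA hB
    constructor
    · rw [← hzN n k, map_pow, hA, ← pow_mul, ← pow_mul, mul_comm]
    · rw [← hzN n k, ← haN n k, map_pow, hB, mul_pow, ← pow_mul (D.ζ (n + k)),
        ← pow_mul (D.ζ (n + k)), mul_comm B]
  have hzpow : ∀ (n : ℕ) (M : ℤ), (p : ℤ) ^ n ∣ M → (D.ζ n : AlgebraicClosure K) ^ M = 1 := by
    rintro n _ ⟨M, rfl⟩
    rw [zpow_mul, ← Nat.cast_pow, zpow_natCast, hz, one_zpow]
  -- If all `p`-power roots of unity are fixed, the cocycle relation reads `Δ B ≡ 0`, so `B`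
  -- vanishes modulo `p ^ n` and `a_n` lies in `L`.
  by_cases hall : ∀ σ ∈ L.fixingSubgroup, ∀ N, galO σ (D.ζ N) = D.ζ N
  · refine D.not_forall_exists_root L 0 fun n => ⟨D.a n, hmem _ fun σ hσ => ?_, by simpa using hα n⟩
    obtain ⟨B, hB⟩ := D.exists_gal_a σ (n + s)
    have hA : galO σ (D.ζ (n + s)) = D.ζ (n + s) ^ 1 := by rw [hall σ hσ, pow_one]
    have h1 := D.dvd_of_galC_ω σ (hfix σ hσ) hA hB
    have h2 := hdvd n B (by simpa using h1)
    have h3 := congrArg Subtype.val (hlow σ n s 1 B hA hB).2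
    rw [coe_galO] at h3
    rw [h3]
    have h4 := hzpow n B h2
    rw [zpow_natCast] at h4
    change (D.a n : AlgebraicClosure K) * (D.ζ n : AlgebraicClosure K) ^ B = _
    rw [h4, mul_one]
  · push Not at hall
    -- Otherwise choose `τ` moving `ζ_m`. Eliminating between the relations for `σ` and `τ` gives `B
    -- (A₀ - 1) ≡ B₀ (A - 1)`: the cocycle is a coboundary, except for the denominator `A₀ - 1`,
    -- whose `p`-adic valuation `j` is less than `m`.
    obtain ⟨τ, hτ, m, hm⟩ := hall
    refine D.not_forall_exists_root L m fun n => ?_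
    obtain ⟨A₀, hA₀⟩ := D.exists_gal_ζ τ (n + m + s)
    obtain ⟨B₀, hB₀⟩ := D.exists_gal_a τ (n + m + s)
    have h1 := D.dvd_of_galC_ω τ (hfix τ hτ) hA₀ hB₀
    have hnd : ¬ (p : ℤ) ^ m ∣ (A₀ : ℤ) - 1 := by
      intro hd
      apply hm
      have h2 := (hlow τ m (n + s) A₀ B₀ (by rwa [show m + (n + s) = n + m + s by ring])
        (by rwa [show m + (n + s) = n + m + s by ring])).1
      rw [h2]
      apply Subtype.ext
      change (D.ζ m : AlgebraicClosure K) ^ A₀ = _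
      have h3 := hzpow m _ hd
      rw [zpow_sub₀ (hz0 m), zpow_one, zpow_natCast, div_eq_one_iff_eq (hz0 m)] at h3
      exact h3
    have hA0 : (A₀ : ℤ) - 1 ≠ 0 := fun h => hnd (h ▸ dvd_zero _)
    obtain ⟨j, a, ha, hja⟩ : ∃ (j : ℕ) (a : ℤ), ¬ (p : ℤ) ∣ a ∧ (A₀ : ℤ) - 1 = p ^ j * a := by
      obtain ⟨a, h2, h3⟩ := (Int.finiteMultiplicity_iff.2
        ⟨by simpa using hp.1.ne_one, hA0⟩).exists_eq_pow_mul_and_not_dvd (a := (p : ℤ))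
      exact ⟨_, a, h3, h2⟩
    have hjm : j < m := by
      by_contra hjm
      exact hnd (hja ▸ (pow_dvd_pow _ (not_lt.1 hjm)).mul_right a)
    have hcop : IsCoprime a ((p : ℤ) ^ n) := by
      apply IsCoprime.pow_right
      exact ((Nat.prime_iff_prime_int.1 hp.1).coprime_iff_not_dvd.2 ha).symm
    obtain ⟨u, v, huv⟩ := hcop
    -- Modulo `p ^ n` this represents `p ^ m B₀ / (A₀ - 1)`, since `A₀ - 1 = p ^ j a` and `u` is an
    -- inverse of `a`.
    set b : ℤ := p ^ (m - j) * u * B₀ with hb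
    have hkey : ∀ σ ∈ L.fixingSubgroup, ∀ A B : ℕ,
        galO σ (D.ζ (n + m + s)) = D.ζ (n + m + s) ^ A →
        galO σ (D.a (n + m + s)) = D.a (n + m + s) * D.ζ (n + m + s) ^ B →
        (p : ℤ) ^ n ∣ p ^ m * B - b * (A - 1) := by
      intro σ hσ A B hA hB
      have h2 := D.dvd_of_galC_ω σ (hfix σ hσ) hA hB
      have h3 : (p : OC p OK K) ^ (n + m + s) ∣
          Δ * ((B * (A₀ - 1) - B₀ * (A - 1) : ℤ) : OC p OK K) := by
        obtain ⟨x, hx⟩ := h1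
        obtain ⟨y, hy⟩ := h2
        refine ⟨y * (A₀ - 1) - x * (A - 1), ?_⟩
        push_cast
        linear_combination ((A₀ : OC p OK K) - 1) * hy - ((A : OC p OK K) - 1) * hx
      obtain ⟨x, hx⟩ := hdvd _ _ h3
      have h4 : (p : ℤ) ^ m = p ^ (m - j) * p ^ j := by rw [← pow_add]; congr 1; omega
      refine ⟨p ^ m * v * B + p ^ (m - j) * u * p ^ m * x, ?_⟩
      rw [pow_add] at hx
      rw [hb]
      linear_combination (p : ℤ) ^ (m - j) * u * hx - (p : ℤ) ^ m * B * huv +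
        (u * a * B) * h4 - (p : ℤ) ^ (m - j) * u * B * hja
    -- Twisting by `ζ_n ^ (-b)` cancels the coboundary, so this root of `ϖ ^ p ^ m` is fixed by the
    -- subgroup and lies in `L`.
    refine ⟨(D.a n : AlgebraicClosure K) ^ p ^ m * (D.ζ n : AlgebraicClosure K) ^ (-b),
      hmem _ fun σ hσ => ?_, ?_⟩
    · obtain ⟨A, hA⟩ := D.exists_gal_ζ σ (n + m + s)
      obtain ⟨B, hB⟩ := D.exists_gal_a σ (n + m + s)
      have h2 := hlow σ n (m + s) A B (by rwa [← add_assoc]) (by rwa [← add_assoc])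
      have h3 : σ (D.ζ n) = (D.ζ n : AlgebraicClosure K) ^ A := congrArg Subtype.val h2.1
      have h4 : σ (D.a n) = (D.a n : AlgebraicClosure K) * (D.ζ n : AlgebraicClosure K) ^ B :=
        congrArg Subtype.val h2.2
      have h5 := hzpow n _ (hkey σ hσ A B hA hB)
      rw [map_mul, map_pow, map_zpow₀, h3, h4, mul_pow, mul_assoc]
      congr 1
      have h6 : ((D.ζ n : AlgebraicClosure K) ^ B) ^ p ^ m * ((D.ζ n : AlgebraicClosure K) ^ A) ^ (-b)
          = (D.ζ n : AlgebraicClosure K) ^ ((p : ℤ) ^ m * B - b * (A - 1)) *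
            (D.ζ n : AlgebraicClosure K) ^ (-b) := by
        rw [← zpow_add₀ (hz0 n), ← pow_mul, ← zpow_natCast, ← zpow_natCast, ← zpow_mul,
          ← zpow_add₀ (hz0 n)]
        congr 1
        push_cast
        ring
      rw [h6, h5, one_mul]
    · rw [mul_pow, ← pow_mul, mul_comm (p ^ m), pow_mul, hα,
        ← zpow_natCast ((D.ζ n : AlgebraicClosure K) ^ (-b)),
        ← zpow_mul, hzpow n _ (by push_cast; exact Dvd.intro_left _ rfl), mul_one]

end BKData

end Transcendence

/-! ## Generalities -/

section General

lemma IsCompletion.torsionFree_of_span {S R : Type*} [CommRing S] [CommRing R] {q : S}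
    {i : S →+* R} (hi : IsCompletion (Ideal.span {q}) i)
    (h : ∀ s : S, q * s = 0 → s = 0) (x : R) (hx : i q * x = 0) : x = 0 := by
  have hc := hi.complete
  apply eq_zero_of_forall_mem_pow (I := (Ideal.span {q}).map i)
  intro n
  obtain ⟨s, hs⟩ := hi.dense x n
  have h1 : i (q * s) ∈ (Ideal.span {q}).map i ^ (n + 1) := by
    have : i (q * s) = -(i q * (x - i s)) := by
      rw [mul_sub, hx, map_mul]; ring
    rw [this, pow_succ']
    exact neg_mem (Ideal.mul_mem_mul (Ideal.mem_map_of_mem _ (Ideal.mem_span_singleton_self _)) hs)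
  rw [hi.mem_iff, mem_span_pow_iff] at h1
  obtain ⟨c, hc⟩ := h1
  have h2 : s = q ^ n * c := by
    rw [← sub_eq_zero]
    apply h
    rw [mul_sub, hc]; ring
  have h3 : i s ∈ (Ideal.span {q}).map i ^ n := by
    rw [hi.mem_iff, mem_span_pow_iff]
    exact ⟨c, h2⟩
  simpa using add_mem hs h3

/-- A ring homomorphism factors through an injective one if its values are in the range. -/
lemma exists_factor {R Q D : Type*} [CommRing R] [CommRing Q] [CommRing D] (f : R →+* D)
    (i : Q →+* D) (hi : Function.Injective i) (h : ∀ r, ∃ q, i q = f r) :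
    ∃ g : R →+* Q, ∀ r, i (g r) = f r := by
  choose g hg using h
  exact ⟨{ toFun := g
           map_one' := hi (by rw [hg, map_one, map_one])
           map_zero' := hi (by rw [hg, map_zero, map_zero])
           map_add' := fun x y => hi (by rw [hg, map_add, map_add, hg, hg])
           map_mul' := fun x y => hi (by rw [hg, map_mul, map_mul, hg, hg]) }, hg⟩

end General

/-! ## The ring `B_dR^+` -/

section BdR

variable {p : ℕ} [hp : Fact p.Prime] {OK : Type*} [CommRing OK] [IsDomain OK]
variable [IsDiscreteValuationRing OK] [CharZero OK] [CharP (IsLocalRing.ResidueField OK) p]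
variable [PerfectRing (IsLocalRing.ResidueField OK) p]
variable [IsAdicComplete (Ideal.span {(p : OK)}) OK]
variable {K : Type*} [Field K] [Algebra OK K] [IsFractionRing OK K]

lemma ocInv_injective : Function.Injective
    (algebraMap (OC p OK K) (Localization.Away (p : OC p OK K))) :=
  IsLocalization.injective _ (powers_le_nonZeroDivisors_of_noZeroDivisors (p_ne_zero_OC p))

lemma ainfInv_injective : Function.Injective
    (algebraMap (Ainf p OK K) (Localization.Away (p : Ainf p OK K))) :=
  IsLocalization.injective _ (powers_le_nonZeroDivisors_of_noZeroDivisors (p_ne_zero_Ainf p))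

instance : IsDomain (Localization.Away (p : OC p OK K)) :=
  IsLocalization.isDomain_localization
    (powers_le_nonZeroDivisors_of_noZeroDivisors (p_ne_zero_OC p))

lemma isUnit_p_ainfInv : IsUnit (p : Localization.Away (p : Ainf p OK K)) := by
  have := IsLocalization.Away.algebraMap_isUnit (S := Localization.Away (p : Ainf p OK K))
    (p : Ainf p OK K)
  rwa [map_natCast] at this

lemma isUnit_p_ocInv : IsUnit (p : Localization.Away (p : OC p OK K)) := by
  have := IsLocalization.Away.algebraMap_isUnit (S := Localization.Away (p : OC p OK K))
    (p : OC p OK K)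
  rwa [map_natCast] at this

lemma exists_pow_mul_eq (x : Localization.Away (p : Ainf p OK K)) :
    ∃ (n : ℕ) (a : Ainf p OK K), (p : Localization.Away (p : Ainf p OK K)) ^ n * x =
      algebraMap _ _ a := by
  obtain ⟨n, a, h⟩ := IsLocalization.Away.surj (p : Ainf p OK K) x
  exact ⟨n, a, by rw [← h, map_natCast, mul_comm]⟩

lemma thetaInv_algebraMap (a : Ainf p OK K) :
    fontaineThetaInvertP (OC p OK K) p (algebraMap _ _ a) =
      algebraMap (OC p OK K) (Localization.Away (p : OC p OK K)) (theta p OK K a) :=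
  IsLocalization.Away.lift_eq _ (by simpa using isUnit_p_ocInv) a

namespace BKData

variable (D : BKData p OK K)

lemma ker_thetaInv : RingHom.ker (fontaineThetaInvertP (OC p OK K) p) =
    Ideal.span {algebraMap (Ainf p OK K) (Localization.Away (p : Ainf p OK K)) D.e} := by
  apply le_antisymm
  · intro x hx
    rw [RingHom.mem_ker] at hx
    obtain ⟨n, a, h⟩ := exists_pow_mul_eq x
    have h1 := congrArg (fontaineThetaInvertP (OC p OK K) p) h
    rw [map_mul, hx, mul_zero, thetaInv_algebraMap] at h1
    obtain ⟨b, rfl⟩ := D.e_dvd_of_theta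
      (ocInv_injective (h1.symm.trans (map_zero _).symm))
    rw [Ideal.mem_span_singleton, ← (isUnit_p_ainfInv.pow n).dvd_mul_left, h, map_mul]
    exact Dvd.intro _ rfl
  · rw [Ideal.span_singleton_le_iff_mem, RingHom.mem_ker, thetaInv_algebraMap, theta_e, map_zero]

/-- The image of `e` in `B_dR^+`. -/
def eBdR : BdR p OK K := ainfToBdR p OK K D.e

lemma isCompletion_BdR : IsCompletion
    (Ideal.span {algebraMap (Ainf p OK K) (Localization.Away (p : Ainf p OK K)) D.e})
    (invToBdR p OK K) := by
  rw [← D.ker_thetaInv]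
  apply isCompletion_adicCompletion
  rw [D.ker_thetaInv]
  exact Submodule.fg_span_singleton _

lemma map_span_e : (Ideal.span {algebraMap (Ainf p OK K)
    (Localization.Away (p : Ainf p OK K)) D.e}).map (invToBdR p OK K) = Ideal.span {D.eBdR} := by
  rw [Ideal.map_span, Set.image_singleton]; rfl

lemma filBdR_eq (n : ℕ) : filBdR p OK K n = Ideal.span {D.eBdR} ^ n := by
  rw [filBdR, ker_thetaInv, map_span_e]

lemma mem_filBdR {n : ℕ} {x : BdR p OK K} : x ∈ filBdR p OK K n ↔ D.eBdR ^ n ∣ x := by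
  rw [filBdR_eq, mem_span_pow_iff]

lemma isAdicComplete_BdR : IsAdicComplete (Ideal.span {D.eBdR}) (BdR p OK K) := by
  rw [← map_span_e]
  exact D.isCompletion_BdR.complete

variable (p OK K) in
lemma isUnit_p_BdR : IsUnit (p : BdR p OK K) := by
  have := (isUnit_p_ainfInv (p := p) (OK := OK) (K := K)).map (invToBdR p OK K)
  rwa [map_natCast] at this

lemma eBdR_mul_eq_zero {x : BdR p OK K} (h : D.eBdR * x = 0) : x = 0 := by
  refine D.isCompletion_BdR.torsionFree_of_span (fun s hs => ?_) x h
  refine (mul_eq_zero.1 hs).resolve_left fun h0 => D.e_ne_zero ?_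
  exact ainfInv_injective (h0.trans (map_zero _).symm)

lemma eBdR_pow_mul_eq_zero {n : ℕ} {x : BdR p OK K} (h : D.eBdR ^ n * x = 0) : x = 0 := by
  induction n with
  | zero => simpa using h
  | succ n ih =>
    rw [pow_succ', mul_assoc] at h
    exact ih (D.eBdR_mul_eq_zero h)

lemma p_pow_dvd_of_dvd_e_mul {n m : ℕ} {x : Ainf p OK K}
    (h : (p : Ainf p OK K) ^ n ∣ D.e ^ m * x) : (p : Ainf p OK K) ^ n ∣ x := by
  induction n generalizing x with
  | zero => simp
  | succ n ih =>
    have h1 : ∀ (m : ℕ) (x : Ainf p OK K), (p : Ainf p OK K) ∣ D.e ^ m * x →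
        (p : Ainf p OK K) ∣ x := by
      intro m
      induction m with
      | zero => simp
      | succ m ih =>
        intro x hx
        rw [pow_succ', mul_assoc] at hx
        exact ih x (D.p_dvd_of_dvd_e_mul hx)
    obtain ⟨y, rfl⟩ := h1 m x ((dvd_pow_self _ (Nat.succ_ne_zero n)).trans h)
    rw [pow_succ']
    apply mul_dvd_mul_left
    apply ih
    rw [pow_succ', mul_left_comm, mul_dvd_mul_iff_left (p_ne_zero_Ainf p)] at h
    exact h

/-- Inverting `p` creates no new divisibility by `e ^ n`, because `e` is a nonzerodivisor modulo
every power of `p`. -/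
lemma eBdR_pow_dvd_ainfToBdR {n : ℕ} {a : Ainf p OK K} :
    D.eBdR ^ n ∣ ainfToBdR p OK K a ↔ D.e ^ n ∣ a := by
  constructor
  · intro h
    have h1 := (D.isCompletion_BdR.mem_iff (algebraMap _ _ a) n).1 (by
      rw [map_span_e, mem_span_pow_iff]; exact h)
    rw [mem_span_pow_iff] at h1
    obtain ⟨c, hc⟩ := h1
    obtain ⟨m, b, hb⟩ := exists_pow_mul_eq c
    have h2 : D.e ^ n * b = p ^ m * a := by
      apply ainfInv_injective
      rw [map_mul, map_mul, map_pow, map_pow, map_natCast, ← hb, hc]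
      ring
    obtain ⟨b', rfl⟩ := D.p_pow_dvd_of_dvd_e_mul (n := m) (m := n) (x := b) ⟨a, h2⟩
    refine ⟨b', mul_left_cancel₀ (pow_ne_zero m (p_ne_zero_Ainf p)) ?_⟩
    rw [← h2]; ring
  · intro h
    have := map_dvd (ainfToBdR p OK K) h
    rwa [map_pow] at this

include D in
lemma exists_thetaBdR : ∃ f : BdR p OK K →+* Localization.Away (p : OC p OK K),
    ∀ s, f (invToBdR p OK K s) = fontaineThetaInvertP (OC p OK K) p s :=
  D.isCompletion_BdR.exists_lift (J := ⊥) _ fun s hs => by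
    rw [← ker_thetaInv, RingHom.mem_ker] at hs
    rw [hs]; exact Ideal.zero_mem _

/-- The extension of Fontaine's map to `B_dR^+`. -/
def thetaBdR : BdR p OK K →+* Localization.Away (p : OC p OK K) := D.exists_thetaBdR.choose

lemma thetaBdR_invToBdR (s) :
    D.thetaBdR (invToBdR p OK K s) = fontaineThetaInvertP (OC p OK K) p s :=
  D.exists_thetaBdR.choose_spec s

lemma thetaBdR_ainfToBdR (a : Ainf p OK K) :
    D.thetaBdR (ainfToBdR p OK K a) = algebraMap _ _ (theta p OK K a) := by
  rw [ainfToBdR, RingHom.comp_apply, thetaBdR_invToBdR, thetaInv_algebraMap]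

lemma thetaBdR_eBdR : D.thetaBdR D.eBdR = 0 := by
  rw [eBdR, thetaBdR_ainfToBdR, theta_e, map_zero]

lemma thetaBdR_eq_zero_iff {x : BdR p OK K} : D.thetaBdR x = 0 ↔ D.eBdR ∣ x := by
  constructor
  · intro h
    obtain ⟨s, hs⟩ := D.isCompletion_BdR.dense x 1
    rw [map_span_e, mem_span_pow_iff, pow_one] at hs
    obtain ⟨y, hy⟩ := hs
    have h1 := congrArg D.thetaBdR hy
    rw [map_sub, h, map_mul, thetaBdR_eBdR, zero_mul, zero_sub, neg_eq_zero, thetaBdR_invToBdR,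
      ← RingHom.mem_ker, ker_thetaInv, Ideal.mem_span_singleton] at h1
    have h2 := map_dvd (invToBdR p OK K) h1
    have h3 := dvd_add (Dvd.intro y hy.symm) h2
    simpa using h3
  · rintro ⟨y, rfl⟩
    rw [map_mul, thetaBdR_eBdR, zero_mul]

include D in
-- By separatedness a nonzero element is `e ^ n y` with `y` not killed by `θ`; `e` is a
-- nonzerodivisor and the target `𝒪_ℂ[1/p]` of `θ` is a domain.
lemma noZeroDivisors_BdR : NoZeroDivisors (BdR p OK K) := by
  have hc := D.isAdicComplete_BdR
  have hfac : ∀ x : BdR p OK K, x ≠ 0 → ∃ n y, x = D.eBdR ^ n * y ∧ D.thetaBdR y ≠ 0 := by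
    intro x hx
    have h1 : ∃ n, ¬ D.eBdR ^ n ∣ x := by
      by_contra! h
      exact hx (eq_zero_of_forall_mem_pow (I := Ideal.span {D.eBdR}) fun n =>
        mem_span_pow_iff.2 (h n))
    classical
    have h2 := Nat.find_spec h1
    set n := Nat.find h1 with hn
    have hn0 : n ≠ 0 := by
      intro h0
      rw [h0, pow_zero] at h2
      exact h2 (one_dvd _)
    have h3 := Nat.find_min h1 (m := n - 1) (by omega)
    rw [not_not] at h3
    obtain ⟨y, hy⟩ := h3
    refine ⟨n - 1, y, hy, fun h4 => h2 ?_⟩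
    obtain ⟨z, hz⟩ := D.thetaBdR_eq_zero_iff.1 h4
    exact ⟨z, by rw [hy, hz, ← mul_assoc, ← pow_succ]; congr 2; omega⟩
  refine ⟨fun {x y} h => ?_⟩
  by_contra! hxy
  obtain ⟨n, x', rfl, hx⟩ := hfac x hxy.1
  obtain ⟨m, y', rfl, hy⟩ := hfac y hxy.2
  have h1 : x' * y' = 0 := by
    apply D.eBdR_pow_mul_eq_zero (n := n + m)
    rw [← h]; ring
  have h2 := congrArg D.thetaBdR h1
  rw [map_mul, map_zero, mul_eq_zero] at h2
  exact h2.elim hx hy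

include D in
lemma nontrivial_BdR : Nontrivial (BdR p OK K) := D.thetaBdR.domain_nontrivial

include D in
lemma isDomain_BdR : IsDomain (BdR p OK K) := by
  have := D.noZeroDivisors_BdR
  have := D.nontrivial_BdR
  exact NoZeroDivisors.to_isDomain _

/-- Write `a = e ^ n y + p c`. As `A_inf / e ^ n` is `p`-torsion free, `c` satisfies the same
hypothesis, and successive approximation applies. -/
lemma e_pow_dvd_of_forall {n : ℕ} {a : Ainf p OK K}
    (h : ∀ M : ℕ, ∃ c, D.e ^ n ∣ a - p ^ M * c) : D.e ^ n ∣ a := by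
  refine dvd_of_successive (q := (p : Ainf p OK K))
    (P := fun a => ∀ M : ℕ, ∃ c, D.e ^ n ∣ a - p ^ M * c) (fun a ha => ?_) h
  obtain ⟨c, y, hy⟩ := ha 1
  refine ⟨y, c, fun M => ?_, by linear_combination hy⟩
  obtain ⟨c', y', hy'⟩ := ha (M + 1)
  have h1 : D.e ^ n * (y' - y) = p * (c - p ^ M * c') := by
    rw [pow_succ'] at hy'
    linear_combination hy - hy'
  obtain ⟨z, hz⟩ := D.p_pow_dvd_of_dvd_e_mul (n := 1) (m := n) (x := y' - y)
    ⟨c - p ^ M * c', by rw [pow_one]; exact h1⟩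
  refine ⟨c', z, mul_left_cancel₀ (p_ne_zero_Ainf p) ?_⟩
  rw [← h1, hz]; ring

/-- Closedness of `Fil ^ n` for the `p`-adic topology of lattices. -/
lemma mem_filBdR_of_forall {n : ℕ} {x : BdR p OK K}
    (h : ∀ M : ℕ, ∃ c : Ainf p OK K, D.eBdR ^ n ∣ x - p ^ M * ainfToBdR p OK K c) :
    D.eBdR ^ n ∣ x := by
  obtain ⟨a, ha⟩ := h 0
  rw [pow_zero, one_mul] at ha
  have h1 : D.e ^ n ∣ a := by
    apply D.e_pow_dvd_of_forall
    intro M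
    obtain ⟨c, hc⟩ := h M
    refine ⟨c, D.eBdR_pow_dvd_ainfToBdR.1 ?_⟩
    rw [map_sub, map_mul, map_pow, map_natCast]
    have := dvd_sub hc ha
    simpa using this
  have h2 := dvd_add ha (D.eBdR_pow_dvd_ainfToBdR.2 h1)
  simpa using h2

lemma eq_zero_of_forall_e_pow_dvd {a : Ainf p OK K} (h : ∀ n, D.e ^ n ∣ a) : a = 0 := by
  have := D.isAdicComplete_p_e
  refine eq_zero_of_forall_mem_pow (I := Ideal.span {(p : Ainf p OK K), D.e}) fun n => ?_
  exact Ideal.mem_of_dvd _ (h n) (Ideal.pow_mem_pow (Ideal.subset_span (by simp)) n)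

include D in
lemma ainfToBdR_injective : Function.Injective (ainfToBdR p OK K) := by
  rw [injective_iff_map_eq_zero]
  intro a ha
  refine D.eq_zero_of_forall_e_pow_dvd fun n => D.eBdR_pow_dvd_ainfToBdR.1 ?_
  rw [ha]; exact dvd_zero _

/-! ### The ring `A_max` -/

/-- The element `e/p` of `B_dR^+`. -/
def tBdR : BdR p OK K := ↑(isUnit_p_BdR p OK K).unit⁻¹ * D.eBdR

lemma p_mul_tBdR : (p : BdR p OK K) * D.tBdR = D.eBdR := by
  rw [tBdR, ← mul_assoc, IsUnit.mul_val_inv, one_mul]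

lemma p_mul_cancel {x y : BdR p OK K} (h : (p : BdR p OK K) * x = p * y) : x = y :=
  (isUnit_p_BdR p OK K).mul_left_cancel h

lemma tBdR_mem : D.tBdR ∈ preAmax p D.e := Subring.subset_closure (Or.inr D.p_mul_tBdR)

lemma tBdR_mul_eq_zero {x : BdR p OK K} (h : D.tBdR * x = 0) : x = 0 := by
  apply D.eBdR_mul_eq_zero
  rw [← p_mul_tBdR, mul_assoc, h, mul_zero]

lemma tBdR_pow_dvd_iff {x : BdR p OK K} (n : ℕ) : D.tBdR ^ n ∣ x ↔ D.eBdR ^ n ∣ x := by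
  rw [← p_mul_tBdR, mul_pow]
  exact (((isUnit_p_BdR p OK K).pow n).mul_left_dvd).symm

/-- The element `e/p` of `A_inf[e/p]`. -/
def tPre : preAmax p D.e := ⟨D.tBdR, D.tBdR_mem⟩

/-- The map `A_inf → A_inf[e/p]`. -/
def ainfToPre : Ainf p OK K →+* preAmax p D.e :=
  (ainfToBdR p OK K).codRestrict (preAmax p D.e) fun a => Subring.subset_closure (Or.inl ⟨a, rfl⟩)

lemma exists_poly (s : preAmax p D.e) :
    ∃ f : Polynomial (Ainf p OK K), f.eval₂ (ainfToBdR p OK K) D.tBdR = s := by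
  have : preAmax p D.e ≤ (Polynomial.eval₂RingHom (ainfToBdR p OK K) D.tBdR).range := by
    rw [preAmax, Subring.closure_le]
    rintro x (⟨a, rfl⟩ | hx)
    · exact ⟨Polynomial.C a, by simp⟩
    · refine ⟨Polynomial.X, ?_⟩
      rw [Polynomial.coe_eval₂RingHom, Polynomial.eval₂_X]
      exact p_mul_cancel (D.p_mul_tBdR.trans hx.symm)
  obtain ⟨f, hf⟩ := this s.2
  exact ⟨f, hf⟩

lemma isCompletion_Amax : IsCompletion (Ideal.span {(p : preAmax p D.e)}) (ofPreAmax p D.e) :=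
  isCompletion_adicCompletion (Submodule.fg_span_singleton _)

lemma isAdicComplete_Amax : IsAdicComplete (Ideal.span {(p : Amax p D.e)}) (Amax p D.e) := by
  have := D.isCompletion_Amax.complete
  rwa [IsCompletion.map_span_natCast] at this

lemma exists_sub_ofPreAmax (x : Amax p D.e) (n : ℕ) :
    ∃ s y, x = ofPreAmax p D.e s + p ^ n * y := by
  obtain ⟨s, hs⟩ := D.isCompletion_Amax.dense x n
  rw [IsCompletion.map_span_natCast, mem_span_pow_iff] at hs
  obtain ⟨y, hy⟩ := hs
  exact ⟨s, y, by rw [← hy]; ring⟩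

/-- The quotient `B_dR^+ / Fil ^ n`. -/
abbrev QBdR (n : ℕ) : Type _ := BdR p OK K ⧸ Ideal.span {D.eBdR} ^ n

lemma mk_eq_zero {n : ℕ} {x : BdR p OK K} :
    Ideal.Quotient.mk (Ideal.span {D.eBdR} ^ n) x = 0 ↔ D.eBdR ^ n ∣ x := by
  rw [Ideal.Quotient.eq_zero_iff_mem, mem_span_pow_iff]

/-- The map `A_inf⟦X⟧ → B_dR^+ / Fil ^ n`, `X ↦ e/p`. -/
def evalQ (n : ℕ) : PowerSeries (Ainf p OK K) →+* D.QBdR n :=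
  evalNil ((Ideal.Quotient.mk _).comp (ainfToBdR p OK K)) (Ideal.Quotient.mk _ D.tBdR) n (by
    rw [← map_pow, mk_eq_zero, ← tBdR_pow_dvd_iff])

lemma evalQ_coe (n : ℕ) (f : Polynomial (Ainf p OK K)) :
    D.evalQ n (f : PowerSeries _) =
      Ideal.Quotient.mk _ (f.eval₂ (ainfToBdR p OK K) D.tBdR) := by
  rcases n with _ | n
  · have : Subsingleton (D.QBdR 0) := Ideal.Quotient.subsingleton_iff.2 (by simp)
    exact Subsingleton.elim _ _
  induction f using Polynomial.induction_on' with
  | add a b ha hb => rw [Polynomial.coe_add, map_add, ha, hb, Polynomial.eval₂_add, map_add]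
  | monomial i a =>
    rw [← Polynomial.C_mul_X_pow_eq_monomial, Polynomial.coe_mul, Polynomial.coe_pow, map_mul,
      map_pow, Polynomial.eval₂_mul, Polynomial.eval₂_X_pow, map_mul, map_pow, Polynomial.eval₂_C]
    congr 1
    · change Polynomial.eval₂ _ _ _ = _
      simp
    · congr 1
      change Polynomial.eval₂ _ _ _ = _
      rcases n with _ | n
      · have : PowerSeries.trunc (0 + 1) (PowerSeries.X : PowerSeries (Ainf p OK K)) = 0 := by
          ext m; simp [PowerSeries.coeff_X]
        rw [Polynomial.coe_X, this, Polynomial.eval₂_zero, eq_comm, mk_eq_zero,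
          ← tBdR_pow_dvd_iff, zero_add, pow_one]
      · rw [Polynomial.coe_X, PowerSeries.trunc_X, Polynomial.eval₂_X]

/-- Only the powers `(e/p) ^ i` with `i < n` survive modulo `Fil ^ n`, so the denominator `p ^ (n -
1)` suffices. -/
lemma p_pow_mul_eval_tBdR (n : ℕ) (f : Polynomial (Ainf p OK K)) :
    ∃ a, Ideal.Quotient.mk (Ideal.span {D.eBdR} ^ n)
      (p ^ (n - 1) * f.eval₂ (ainfToBdR p OK K) D.tBdR - ainfToBdR p OK K a) = 0 := by
  simp only [mk_eq_zero]
  induction f using Polynomial.induction_on' with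
  | add f g hf hg =>
    obtain ⟨a, ha⟩ := hf
    obtain ⟨b, hb⟩ := hg
    refine ⟨a + b, ?_⟩
    rw [Polynomial.eval₂_add, map_add]
    have := dvd_add ha hb
    convert this using 1
    ring
  | monomial i a =>
    rw [Polynomial.eval₂_monomial]
    by_cases hi : i ≤ n - 1
    · refine ⟨p ^ (n - 1 - i) * a * D.e ^ i, ?_⟩
      have h1 : (p : BdR p OK K) ^ (n - 1) = p ^ (n - 1 - i) * p ^ i := by
        rw [← pow_add]; congr 1; omega
      rw [h1, map_mul, map_mul, map_pow, map_pow, map_natCast]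
      rw [show ainfToBdR p OK K D.e = D.eBdR from rfl, ← p_mul_tBdR]
      convert dvd_zero _ using 1
      ring
    · refine ⟨0, ?_⟩
      rw [map_zero, sub_zero, ← tBdR_pow_dvd_iff]
      exact (((pow_dvd_pow _ (by omega)).mul_left _).mul_left _)

lemma evalQ_eq_mk (n : ℕ) (f : PowerSeries (Ainf p OK K)) :
    ∃ g : Polynomial (Ainf p OK K), D.evalQ n f =
      Ideal.Quotient.mk _ (g.eval₂ (ainfToBdR p OK K) D.tBdR) :=
  ⟨PowerSeries.trunc n f, by rw [Polynomial.hom_eval₂]; rfl⟩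

/-- The image of `A_inf[e/p]` in `B_dR^+ / Fil ^ n` is `p`-adically complete. -/
lemma isAdicComplete_evalQ_range (n : ℕ) :
    IsAdicComplete (Ideal.span {(p : (D.evalQ n).range)}) (D.evalQ n).range := by
  -- Separatedness: up to the bounded denominator `p ^ (n - 1)` the image lies in that of `A_inf`,
  -- where `Fil ^ n` is closed for the `p`-adic topology.
  have h1 : IsHausdorff (Ideal.span {(p : (D.evalQ n).range)}) (D.evalQ n).range :=
    isHausdorff_of_forall fun x hx => by
      obtain ⟨f, hf⟩ := x.2
      obtain ⟨f, hf'⟩ := D.evalQ_eq_mk n f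
      rw [hf] at hf'
      have h2 : D.eBdR ^ n ∣ p ^ (n - 1) * f.eval₂ (ainfToBdR p OK K) D.tBdR := by
        apply D.mem_filBdR_of_forall
        intro M
        obtain ⟨y, hy⟩ := mem_span_pow_iff.1 (hx M)
        obtain ⟨g, hg⟩ := y.2
        obtain ⟨g, hg'⟩ := D.evalQ_eq_mk n g
        rw [hg] at hg'
        obtain ⟨a, ha⟩ := D.p_pow_mul_eval_tBdR n g
        refine ⟨a, D.mk_eq_zero.1 ?_⟩
        have h3 : (x : D.QBdR n) = p ^ M * y := by
          rw [hy]; push_cast; rfl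
        rw [map_sub, sub_eq_zero] at ha ⊢
        rw [map_mul _ ((p : BdR p OK K) ^ M), ← ha, map_mul, map_mul, ← hf', ← hg', h3, map_pow,
          map_pow, map_natCast]
        ring
      have h4 := D.mk_eq_zero.2 h2
      rw [map_mul, map_pow, map_natCast, ← hf'] at h4
      have h5 : IsUnit (p : D.QBdR n) := by
        have := (isUnit_p_BdR p OK K).map (Ideal.Quotient.mk (Ideal.span {D.eBdR} ^ n))
        rwa [map_natCast] at this
      apply Subtype.ext
      exact (h5.pow (n - 1)).mul_left_cancel (h4.trans (mul_zero _).symm)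
  -- Convergence: the image of `A_inf[e/p]` is also that of the `p`-complete ring `A_inf⟦X⟧`, as
  -- `e/p` is nilpotent modulo `Fil ^ n`; series are summed there and mapped down.
  have hcomp := isAdicComplete_powerSeries (p : Ainf p OK K)
  rw [map_natCast] at hcomp
  have h2 : IsPrecomplete (Ideal.span {(p : (D.evalQ n).range)}) (D.evalQ n).range :=
    isPrecomplete_of_forall fun f hf => by
      simp only [mem_span_pow_iff] at hf ⊢
      choose y hy using hf
      choose g hg using (D.evalQ n).rangeRestrict_surjective
      obtain ⟨L, hL⟩ := exists_sum (I := Ideal.span {(p : PowerSeries (Ainf p OK K))})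
        (fun i => p ^ i * g (y i)) fun n => mem_span_pow_iff.2 (Dvd.intro _ rfl)
      refine ⟨f 0 + (D.evalQ n).rangeRestrict L, fun m => ?_⟩
      have h3 : f m = f 0 + ∑ i ∈ Finset.range m, (p : (D.evalQ n).range) ^ i * y i := by
        induction m with
        | zero => simp
        | succ m ih => rw [Finset.sum_range_succ, ← add_assoc, ← ih, ← hy]; ring
      have h4 := map_dvd (D.evalQ n).rangeRestrict (mem_span_pow_iff.1 (hL m))
      rw [map_sub, map_sum, map_pow, map_natCast] at h4
      simp only [map_mul, map_pow, map_natCast, hg] at h4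
      rw [h3, ← dvd_neg]
      convert h4 using 1
      ring
  exact { h1, h2 with }

lemma exists_jQ (n : ℕ) : ∃ F : Amax p D.e →+* D.QBdR n,
    (∀ s, F (ofPreAmax p D.e s) = Ideal.Quotient.mk _ (s : BdR p OK K)) ∧
    ∀ a, ∃ f, F a = D.evalQ n f := by
  have := D.isAdicComplete_evalQ_range n
  let h : preAmax p D.e →+* (D.evalQ n).range :=
    ((Ideal.Quotient.mk (Ideal.span {D.eBdR} ^ n)).comp (preAmax p D.e).subtype).codRestrict
      (D.evalQ n).range fun s => by
        obtain ⟨f, hf⟩ := D.exists_poly s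
        refine ⟨(f : PowerSeries _), ?_⟩
        rw [evalQ_coe, hf]; rfl
  obtain ⟨F, hF⟩ := D.isCompletion_Amax.exists_lift
    (J := Ideal.span {(p : (D.evalQ n).range)}) h (fun s hs => by
      rw [Ideal.mem_span_singleton] at hs ⊢
      have := map_dvd h hs
      rwa [map_natCast] at this)
  refine ⟨(D.evalQ n).range.subtype.comp F, fun s => ?_, fun a => ?_⟩
  · rw [RingHom.comp_apply, hF]; rfl
  · obtain ⟨f, hf⟩ := (F a).2
    exact ⟨f, hf.symm⟩

/-- A bounded family of maps from `A_max` is determined by its values on `A_inf[e/p]`. -/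
lemma hom_ext_Amax {n N : ℕ} {F G : Amax p D.e →+* D.QBdR n}
    (hF : ∀ a, ∃ b, (p : D.QBdR n) ^ N * F a = Ideal.Quotient.mk _ (ainfToBdR p OK K b))
    (hG : ∀ a, ∃ b, (p : D.QBdR n) ^ N * G a = Ideal.Quotient.mk _ (ainfToBdR p OK K b))
    (h : ∀ s, F (ofPreAmax p D.e s) = G (ofPreAmax p D.e s)) : F = G := by
  ext a
  obtain ⟨x, hx⟩ := Ideal.Quotient.mk_surjective (F a - G a)
  have h1 : D.eBdR ^ n ∣ p ^ N * x := by
    apply D.mem_filBdR_of_forall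
    intro M
    obtain ⟨s, y, hy⟩ := D.exists_sub_ofPreAmax a M
    obtain ⟨b, hb⟩ := hF y
    obtain ⟨c, hc⟩ := hG y
    refine ⟨b - c, D.mk_eq_zero.1 ?_⟩
    rw [map_sub, map_mul, map_mul, hx, map_sub, map_sub, ← hb, ← hc, map_pow, map_pow, map_natCast,
      hy]
    simp only [map_add, map_mul, map_pow, map_natCast, h]
    ring
  have h2 := D.mk_eq_zero.2 h1
  rw [map_mul, hx, map_pow, map_natCast] at h2
  have h5 : IsUnit (p : D.QBdR n) := by
    have := (isUnit_p_BdR p OK K).map (Ideal.Quotient.mk (Ideal.span {D.eBdR} ^ n))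
    rwa [map_natCast] at this
  exact sub_eq_zero.1 ((h5.pow N).mul_left_cancel (h2.trans (mul_zero _).symm))

/-- The inclusion extends modulo each `Fil ^ n` because the image there is `p`-complete, and the
extensions are compatible because bounded maps out of `A_max` are determined on `A_inf[e/p]`. For `n
= 1` no denominator is needed; this is the last clause, and it is what gives `θ` on `A_max` its
values in `𝒪_ℂ`. -/
lemma exists_isBdRInclusion : ∃ j : Amax p D.e →+* BdR p OK K, IsBdRInclusion p D.e j ∧
    ∀ a, ∃ b, D.eBdR ∣ j a - ainfToBdR p OK K b := by
  have := D.isAdicComplete_BdR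
  choose F hF hFr using D.exists_jQ
  have hbd : ∀ n a, ∃ b, (p : D.QBdR n) ^ (n - 1) * F n a =
      Ideal.Quotient.mk _ (ainfToBdR p OK K b) := by
    intro n a
    obtain ⟨f, hf⟩ := hFr n a
    obtain ⟨g, hg⟩ := D.evalQ_eq_mk n f
    obtain ⟨b, hb⟩ := D.p_pow_mul_eval_tBdR n g
    refine ⟨b, ?_⟩
    rw [map_sub, sub_eq_zero, map_mul, map_pow, map_natCast, ← hg, ← hf] at hb
    exact hb
  have hcomp : ∀ {m n : ℕ} (hle : m ≤ n),
      (Ideal.Quotient.factorPow (Ideal.span {D.eBdR}) hle).comp (F n) = F m := by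
    intro m n hle
    refine D.hom_ext_Amax (N := n - 1) (fun a => ?_) (fun a => ?_) fun s => ?_
    · obtain ⟨b, hb⟩ := hbd n a
      refine ⟨b, ?_⟩
      have := congrArg (Ideal.Quotient.factorPow (Ideal.span {D.eBdR}) hle) hb
      rw [map_mul, map_pow, map_natCast] at this
      exact this
    · obtain ⟨b, hb⟩ := hbd m a
      refine ⟨p ^ (n - m) * b, ?_⟩
      rcases Nat.eq_zero_or_pos m with rfl | hm
      · have : Subsingleton (D.QBdR 0) := Ideal.Quotient.subsingleton_iff.2 (by simp)
        exact Subsingleton.elim _ _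
      rw [show n - 1 = (n - m) + (m - 1) by omega, pow_add, mul_assoc, hb, map_mul, map_mul,
        map_pow, map_pow, map_natCast, map_natCast]
    · rw [RingHom.comp_apply, hF, hF]; rfl
  let j := IsAdicComplete.liftRingHom (Ideal.span {D.eBdR}) F hcomp
  have hj : ∀ n a, Ideal.Quotient.mk (Ideal.span {D.eBdR} ^ n) (j a) = F n a := fun n a =>
    IsAdicComplete.mk_liftRingHom _ _ _ _ _
  refine ⟨j, ⟨fun s => ?_, fun n => ⟨n - 1, fun a => ?_⟩⟩, fun a => ?_⟩
  · apply eq_of_forall_sub_mem_pow (I := Ideal.span {D.eBdR})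
    intro n
    rw [← Ideal.Quotient.eq, hj, hF]
  · obtain ⟨b, hb⟩ := hbd n a
    refine ⟨b, ?_⟩
    rw [D.filBdR_eq, ← Ideal.Quotient.eq, ← hb, map_mul, hj, map_pow, map_natCast]
  · obtain ⟨b, hb⟩ := hbd 1 a
    refine ⟨b, ?_⟩
    rw [← pow_one D.eBdR, ← mk_eq_zero, map_sub, hj, sub_eq_zero, ← hb]
    simp

lemma isBdRInclusion_unique {j j' : Amax p D.e →+* BdR p OK K} (hj : IsBdRInclusion p D.e j)
    (hj' : IsBdRInclusion p D.e j') : j = j' := by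
  have := D.isAdicComplete_BdR
  have h : ∀ n, (Ideal.Quotient.mk (Ideal.span {D.eBdR} ^ n)).comp j =
      (Ideal.Quotient.mk (Ideal.span {D.eBdR} ^ n)).comp j' := by
    intro n
    obtain ⟨N, hN⟩ := hj.2 n
    obtain ⟨N', hN'⟩ := hj'.2 n
    refine D.hom_ext_Amax (N := N + N') (fun a => ?_) (fun a => ?_) fun s => ?_
    · obtain ⟨b, hb⟩ := hN a
      rw [D.filBdR_eq, ← Ideal.Quotient.eq, map_mul, map_pow, map_natCast] at hb
      refine ⟨p ^ N' * b, ?_⟩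
      rw [add_comm, pow_add, mul_assoc, RingHom.comp_apply, hb, map_mul, map_mul, map_pow, map_pow,
        map_natCast, map_natCast]
    · obtain ⟨b, hb⟩ := hN' a
      rw [D.filBdR_eq, ← Ideal.Quotient.eq, map_mul, map_pow, map_natCast] at hb
      refine ⟨p ^ N * b, ?_⟩
      rw [pow_add, mul_assoc, RingHom.comp_apply, hb, map_mul, map_mul, map_pow, map_pow,
        map_natCast, map_natCast]
    · rw [RingHom.comp_apply, RingHom.comp_apply, hj.1, hj'.1]
  ext a
  apply eq_of_forall_sub_mem_pow (I := Ideal.span {D.eBdR})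
  intro n
  rw [← Ideal.Quotient.eq]
  exact RingHom.congr_fun (h n) a

/-- The map `A_max → B_dR^+`. -/
def jMap : Amax p D.e →+* BdR p OK K := D.exists_isBdRInclusion.choose

lemma isBdRInclusion_jMap : IsBdRInclusion p D.e D.jMap := D.exists_isBdRInclusion.choose_spec.1

lemma jMap_ofPreAmax (s : preAmax p D.e) : D.jMap (ofPreAmax p D.e s) = s :=
  D.isBdRInclusion_jMap.1 s

lemma jMap_ainfToAmax (a : Ainf p OK K) : D.jMap (ainfToAmax p D.e a) = ainfToBdR p OK K a :=
  D.jMap_ofPreAmax _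

lemma exists_thetaAmax : ∃ f : Amax p D.e →+* OC p OK K, ∀ a,
    algebraMap (OC p OK K) (Localization.Away (p : OC p OK K)) (f a) = D.thetaBdR (D.jMap a) :=
  exists_factor (D.thetaBdR.comp D.jMap) _ ocInv_injective fun a => by
    obtain ⟨b, hb⟩ := D.exists_isBdRInclusion.choose_spec.2 a
    refine ⟨theta p OK K b, ?_⟩
    rw [← thetaBdR_eq_zero_iff, map_sub, thetaBdR_ainfToBdR, sub_eq_zero] at hb
    exact hb.symm

/-- The extension of Fontaine's map to `A_max`. -/
def thetaAmax : Amax p D.e →+* OC p OK K := D.exists_thetaAmax.choose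

lemma algebraMap_thetaAmax (a : Amax p D.e) :
    algebraMap (OC p OK K) (Localization.Away (p : OC p OK K)) (D.thetaAmax a) =
      D.thetaBdR (D.jMap a) := D.exists_thetaAmax.choose_spec a

lemma thetaAmax_eq_zero_iff {a : Amax p D.e} : D.thetaAmax a = 0 ↔ D.eBdR ∣ D.jMap a := by
  rw [← thetaBdR_eq_zero_iff, ← algebraMap_thetaAmax, map_eq_zero_iff _ ocInv_injective]

lemma thetaAmax_ainfToAmax (a : Ainf p OK K) :
    D.thetaAmax (ainfToAmax p D.e a) = theta p OK K a := by
  apply ocInv_injective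
  rw [algebraMap_thetaAmax, jMap_ainfToAmax, thetaBdR_ainfToBdR]

end BKData

end BdR

/-! ## Uniqueness of expansions in divided powers of a transcendental element -/

section ClosedSpan

variable {R C : Type*} [CommRing R] [CommRing C] [Algebra R C]

/-- If `C` is separated for the powers of `q` and `R` is `q`-adically complete, then a set which is
contained in a finite span modulo `q` times itself is contained in that span. -/
lemma mem_span_range_of_successive {ι : Type*} [Fintype ι] {q : R}
    [IsAdicComplete (Ideal.span {q}) R] [IsHausdorff (Ideal.span {algebraMap R C q}) C]
    (g : ι → C) {T : Set C}
    (h : ∀ x ∈ T, ∃ n ∈ Submodule.span R (Set.range g), ∃ x' ∈ T, x = n + algebraMap R C q * x')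
    {x : C} (hx : x ∈ T) : x ∈ Submodule.span R (Set.range g) := by
  simp only [Submodule.mem_span_range_iff_exists_fun] at h ⊢
  have h' : ∀ x : T, ∃ (c : ι → R) (x' : T),
      (x : C) = ∑ i, c i • g i + algebraMap R C q * x' := by
    intro x
    obtain ⟨n, ⟨c, rfl⟩, x', hx', h1⟩ := h x x.2
    exact ⟨c, ⟨x', hx'⟩, h1⟩
  choose c next hc using h'
  let y : ℕ → T := fun n => next^[n] ⟨x, hx⟩
  choose L hL using fun i => exists_sum (I := Ideal.span {q}) (fun n => q ^ n * c (y n) i)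
    fun n => mem_span_pow_iff.2 (Dvd.intro _ rfl)
  refine ⟨L, eq_of_forall_sub_mem_pow (I := Ideal.span {algebraMap R C q}) fun n => ?_⟩
  rw [mem_span_pow_iff]
  have h1 : ∀ n, x = ∑ i, (∑ k ∈ Finset.range n, q ^ k * c (y k) i) • g i +
      algebraMap R C q ^ n * y n := by
    intro n
    induction n with
    | zero => simp [y]
    | succ n ih =>
      nth_rw 1 [ih]
      have h2 : y (n + 1) = next (y n) := Function.iterate_succ_apply' _ _ _
      rw [hc (y n), h2]
      simp only [Finset.sum_range_succ, add_smul, Finset.sum_add_distrib, mul_smul, mul_add,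
        Finset.mul_sum, pow_succ]
      simp only [Algebra.smul_def, map_pow]
      ring
  rw [h1 n, ← sub_sub, ← Finset.sum_sub_distrib]
  refine dvd_sub (Finset.dvd_sum fun i _ => ?_) (Dvd.intro _ rfl)
  rw [← sub_smul, Algebra.smul_def, ← map_pow]
  exact (map_dvd _ (mem_span_pow_iff.1 (hL i n))).mul_right _

/-- The relation says that a monic polynomial `P` takes a value at `t` in `r` times the image of
`Φ`. Division by `P` then shows that, modulo `r`, the image is spanned by the powers of `t` below
`deg P`; iterating `d` times and using `r ^ d = q`, that modulo `q` it is spanned by finitely many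
`r ^ i t ^ j`. Completeness of `R` makes the image a finite `R`-module containing `t`. -/
lemma isIntegral_of_powerSeries_relation [Nontrivial R] {q : R} {r t : C} {d : ℕ}
    (hr : r ^ d = algebraMap R C q)
    [IsAdicComplete (Ideal.span {q}) R] [IsHausdorff (Ideal.span {algebraMap R C q}) C]
    (Φ : PowerSeries (Polynomial R) →+* C) (hC : ∀ f, Φ (PowerSeries.C f) = Polynomial.aeval t f)
    (hX : Φ PowerSeries.X = r) {f : PowerSeries (Polynomial R)} (hf : Φ f = 0)
    (hlead : IsUnit (PowerSeries.coeff 0 f).leadingCoeff) : IsIntegral R t := by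
  have hsplit : ∀ f, ∃ g, Φ f = Polynomial.aeval t (PowerSeries.coeff 0 f) + r * Φ g := by
    intro f
    refine ⟨PowerSeries.mk fun n => PowerSeries.coeff (n + 1) f, ?_⟩
    conv_lhs => rw [PowerSeries.eq_X_mul_shift_add_const f]
    rw [map_add, map_mul, hX, hC, add_comm, PowerSeries.coeff_zero_eq_constantCoeff]
  obtain ⟨v, hv⟩ := hlead
  set P := Polynomial.C (↑v⁻¹ : R) * PowerSeries.coeff 0 f with hP
  have hmonic : P.Monic := by
    rw [Polynomial.Monic, hP, Polynomial.leadingCoeff_mul' , Polynomial.leadingCoeff_C, ← hv,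
      Units.inv_mul]
    rw [Polynomial.leadingCoeff_C, ← hv, Units.inv_mul]
    exact one_ne_zero
  obtain ⟨g0, hg0⟩ := hsplit f
  have hPt : Polynomial.aeval t P =
      r * (-(Polynomial.aeval t (Polynomial.C (↑v⁻¹ : R))) * Φ g0) := by
    rw [hP, map_mul]
    rw [hf] at hg0
    linear_combination (-Polynomial.aeval t (Polynomial.C (↑v⁻¹ : R))) * hg0
  set m := P.natDegree
  let S : ℕ → Set C := fun k => {y | ∃ i < k, ∃ j < m, y = r ^ i * t ^ j}
  have step : ∀ x ∈ Φ.range, ∃ n ∈ Submodule.span R (S 1), ∃ x' ∈ Φ.range, x = n + r * x' := by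
    rintro x ⟨f, rfl⟩
    obtain ⟨g, hg⟩ := hsplit f
    refine ⟨Polynomial.aeval t (PowerSeries.coeff 0 f %ₘ P), ?_,
      Φ (-(PowerSeries.C (Polynomial.C (↑v⁻¹ : R))) * g0 *
        PowerSeries.C (PowerSeries.coeff 0 f /ₘ P) + g), ⟨_, rfl⟩, ?_⟩
    · rw [Polynomial.aeval_eq_sum_range]
      refine Submodule.sum_mem _ fun j _ => ?_
      by_cases hj : j < m
      · exact Submodule.smul_mem _ _ (Submodule.subset_span ⟨0, one_pos, j, hj, by simp⟩)
      · rw [Polynomial.coeff_eq_zero_of_degree_lt, zero_smul]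
        · exact Submodule.zero_mem _
        · refine (Polynomial.degree_modByMonic_lt _ hmonic).trans_le ?_
          rw [Polynomial.degree_eq_natDegree hmonic.ne_zero]
          exact_mod_cast not_lt.1 hj
    · rw [hg]
      conv_lhs => rw [← Polynomial.modByMonic_add_div (PowerSeries.coeff 0 f) P]
      simp only [map_add, map_mul, map_neg, hPt, hC]
      ring
  have hk : ∀ k, ∀ x ∈ Φ.range, ∃ n ∈ Submodule.span R (S k), ∃ x' ∈ Φ.range,
      x = n + r ^ k * x' := by
    intro k
    induction k with
    | zero => exact fun x hx => ⟨0, Submodule.zero_mem _, x, hx, by simp⟩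
    | succ k ih =>
      intro x hx
      obtain ⟨n, hn, x', hx', rfl⟩ := ih x hx
      obtain ⟨n', hn', x'', hx'', rfl⟩ := step x' hx'
      refine ⟨n + r ^ k * n', Submodule.add_mem _ (Submodule.span_mono ?_ hn) ?_, x'', hx'', by ring⟩
      · rintro y ⟨i, hi, j, hj, rfl⟩
        exact ⟨i, by omega, j, hj, rfl⟩
      · refine Submodule.span_le (p := (Submodule.span R (S (k + 1))).comap
          (LinearMap.mulLeft R (r ^ k))) |>.2 ?_ hn'
        rintro y ⟨i, hi, j, hj, rfl⟩
        exact Submodule.subset_span ⟨k + i, by omega, j, hj, by simp; ring⟩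
  let g : Fin d × Fin m → C := fun ij => r ^ (ij.1 : ℕ) * t ^ (ij.2 : ℕ)
  have hSg : S d = Set.range g := by
    ext y
    constructor
    · rintro ⟨i, hi, j, hj, rfl⟩
      exact ⟨(⟨i, hi⟩, ⟨j, hj⟩), rfl⟩
    · rintro ⟨⟨i, j⟩, rfl⟩
      exact ⟨i, i.2, j, j.2, rfl⟩
  -- The `d`-th step reads: the range lies in the span plus `q` times the range.
  have hle : ∀ x ∈ (Φ.range : Set C), x ∈ Submodule.span R (Set.range g) := fun x hx =>
    mem_span_range_of_successive (q := q) g (T := (Φ.range : Set C)) (fun x hx => by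
      rw [← hSg, ← hr]; exact hk d x hx) hx
  let A : Subalgebra R C :=
    { Φ.range with algebraMap_mem' := fun c => ⟨PowerSeries.C (Polynomial.C c), by simp [hC]⟩ }
  have htA : t ∈ A := ⟨PowerSeries.C Polynomial.X, by rw [hC, Polynomial.aeval_X]⟩
  have hrA : r ∈ A := ⟨PowerSeries.X, hX⟩
  refine IsIntegral.of_mem_of_fg A ?_ t htA
  have : Subalgebra.toSubmodule A = Submodule.span R (Set.range g) := by
    apply le_antisymm
    · exact fun x hx => hle x hx
    · rw [Submodule.span_le]
      rintro y ⟨⟨i, j⟩, rfl⟩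
      exact A.mul_mem (A.pow_mem hrA _) (A.pow_mem htA _)
  rw [this]
  exact Submodule.fg_span (Set.finite_range g)

end ClosedSpan

section Expansions

variable {p : ℕ} [hp : Fact p.Prime]
variable {OK : Type*} [CommRing OK] [IsDomain OK] [IsDiscreteValuationRing OK] [CharZero OK]
variable [CharP (IsLocalRing.ResidueField OK) p]
  [PerfectRing (IsLocalRing.ResidueField OK) p]
variable [IsAdicComplete (Ideal.span {(p : OK)}) OK]
variable {K : Type*} [Field K] [Algebra OK K] [IsFractionRing OK K]

/-- The terms of a sequence are multiples of the divided powers of `s`, up to units. -/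
def IsDividedPowers (s : OC p OK K) (θ : ℕ → OC p OK K) : Prop :=
  ∀ m, ∃ η : OK, IsUnit η ∧ ∃ n, n * (p - 1) ≤ m ∧ okToOC p OK K η * p ^ n * θ m = s ^ m

/-- The coefficients of a convergent expansion `∑ aₘ θₘ = 0`, `aₘ → 0`, vanish. -/
def HasUniqueExpansions (θ : ℕ → OC p OK K) : Prop :=
  ∀ a : ℕ → OK, (∀ N, ∃ M₀, ∀ m ≥ M₀, (p : OK) ^ N ∣ a m) →
    (∀ N, ∃ M₀, ∀ M ≥ M₀,
      (p : OC p OK K) ^ N ∣ ∑ m ∈ Finset.range M, okToOC p OK K (a m) * θ m) → ∀ m, a m = 0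

variable (OK K) in
lemma exists_root_OC (x : OK) : ∃ r : OC p OK K, r ^ (p - 1) = okToOC p OK K x := by
  have h0 : p - 1 ≠ 0 := by have := hp.1.two_le; omega
  obtain ⟨y, hy⟩ := IsAlgClosed.exists_pow_nat_eq
    (algebraMap OK (AlgebraicClosure K) x) (Nat.pos_of_ne_zero h0)
  have hint : IsIntegral OK y := by
    refine IsIntegral.of_pow (Nat.pos_of_ne_zero h0) ?_
    rw [hy]
    exact isIntegral_algebraMap
  refine ⟨algebraMap (OKbar OK K) _ ⟨y, hint⟩, ?_⟩
  rw [← map_pow, okToOC, RingHom.comp_apply]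
  congr 1
  exact Subtype.ext hy

lemma okToOC_eq : okToOC p OK K = algebraMap OK (OC p OK K) := rfl

namespace BKData

variable (D : BKData p OK K)

lemma p_dvd_ζ_sub_one_pow : (p : OKbar OK K) ∣ (D.ζ 1 - 1) ^ (p - 1) := by
  obtain ⟨r, hr⟩ := exists_add_pow_prime_eq hp.1 (D.ζ 1 - 1) 1
  have h0 : D.ζ 1 - 1 ≠ 0 := sub_ne_zero.2 (D.ζ_ne_one one_ne_zero)
  have h1 : D.ζ 1 ^ p = 1 := by rw [D.ζ_pow, ζ_zero]
  rw [sub_add_cancel, h1, one_pow, mul_one] at hr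
  refine ⟨-r, mul_left_cancel₀ h0 ?_⟩
  rw [← pow_succ', Nat.sub_add_cancel hp.1.one_le]
  linear_combination -hr

/-- Up to a unit of `𝒪_K`, the terms `aₘ θₘ` are monomials in a root of `ϖ` and a fixed element. -/
lemma exists_monomial {r l τ : OC p OK K} (hr : r ^ (p - 1) = okToOC p OK K D.ϖ)
    (hl : l = r ^ D.deg) {θ : ℕ → OC p OK K} (hθ : IsDividedPowers (l * τ) θ) (m : ℕ) (a : OK) :
    ∃ n u, okToOC p OK K a * θ m = okToOC p OK K u * r ^ n * τ ^ m ∧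
      ((u = 0 ∧ n = m) ∨ IsUnit u) ∧ (a ≠ 0 → IsUnit u) ∧
      ∀ N, N ≤ m → (p : OK) ^ N ∣ a → N ≤ n := by
  by_cases ha : a = 0
  -- For a zero coefficient the exponent is set to `m`, so that the exponents still tend to infinity
  -- with `m`.
  · exact ⟨m, 0, by simp [ha], Or.inl ⟨rfl, rfl⟩, fun h => absurd ha h, fun N h _ => h⟩
  obtain ⟨η, hη, s, hs, h⟩ := hθ m
  obtain ⟨v, u, rfl⟩ := IsDiscreteValuationRing.eq_unit_mul_pow_irreducible ha D.irreducible
  obtain ⟨x, hx⟩ := D.associated_p.symm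
  have hp1 : 1 ≤ p - 1 := by have := hp.1.two_le; omega
  have hϖ0 : okToOC p OK K D.ϖ ≠ 0 := fun h0 =>
    D.ϖ_ne_zero (okToOC_injective p OK K (h0.trans (map_zero _).symm))
  have hr0 : r ≠ 0 := by
    rintro rfl
    rw [zero_pow (by omega)] at hr
    exact hϖ0 hr.symm
  have hl0 : l ≠ 0 := by rw [hl]; exact pow_ne_zero _ hr0
  have hpl : (p : OC p OK K) = l ^ (p - 1) * okToOC p OK K x := by
    rw [← map_natCast (okToOC p OK K), ← hx, map_mul, map_pow, ← hr, hl, ← pow_mul, ← pow_mul,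
      mul_comm (p - 1)]
  have h1 : okToOC p OK K (η * x ^ s) * θ m = l ^ (m - s * (p - 1)) * τ ^ m := by
    apply mul_left_cancel₀ (pow_ne_zero (s * (p - 1)) hl0)
    rw [hpl, mul_pow, mul_pow, ← pow_mul, mul_comm (p - 1)] at h
    rw [← mul_assoc (l ^ (s * (p - 1))) (l ^ (m - s * (p - 1))), ← pow_add,
      Nat.add_sub_cancel' hs, ← h, map_mul, map_pow]
    ring
  obtain ⟨η', hη'⟩ := (hη.mul (x.isUnit.pow s)).exists_right_inv
  -- The factor `ϖ ^ v` of `a` contributes `(p - 1) v` since `r ^ (p - 1) = ϖ`. The factor `l ^ m`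
  -- of the power loses `s (p - 1)` to `p ^ s`, and `l = r ^ deg`.
  refine ⟨(p - 1) * v + D.deg * (m - s * (p - 1)), u * η', ?_, Or.inr ?_, fun _ => ?_, ?_⟩
  · rw [pow_add, pow_mul, hr, pow_mul, ← hl, map_mul, map_mul, map_pow]
    have h2 := congrArg (okToOC p OK K) hη'
    rw [map_mul, map_one] at h2
    linear_combination (okToOC p OK K u * okToOC p OK K D.ϖ ^ v * okToOC p OK K η') * h1 -
      (okToOC p OK K u * okToOC p OK K D.ϖ ^ v * θ m) * h2
  · exact u.isUnit.mul (IsUnit.of_mul_eq_one _ ((mul_comm _ _).trans hη'))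
  · exact u.isUnit.mul (IsUnit.of_mul_eq_one _ ((mul_comm _ _).trans hη'))
  · intro N _ hN
    rw [(D.associated_p.pow_pow).dvd_iff_dvd_left, ← pow_mul] at hN
    have h3 : D.ϖ ^ (D.deg * N) ∣ D.ϖ ^ v := by
      rwa [Units.dvd_mul_left] at hN
    rw [pow_dvd_pow_iff D.ϖ_ne_zero D.irreducible.not_isUnit] at h3
    have h4 : 1 ≤ D.deg := Nat.one_le_iff_ne_zero.2 D.deg_ne_zero
    nlinarith

/-- Choose `r` with `r ^ (p - 1) = ϖ`; then `l = r ^ deg` satisfies `l ^ (p - 1) = p` up to a unit,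
and `l` divides `ζ₁ - 1`, so `s = l τ`. Each term of the expansion is a unit or zero times `r ^ n τ
^ m`. A nontrivial relation, divided by the smallest power of `r` and grouped by exponents,
satisfies the hypotheses of `isIntegral_of_powerSeries_relation`, so `τ` and hence `s` would be
integral. -/
theorem hasUniqueExpansions {s : OC p OK K} (hs : Transcendental OK s)
    (hdvd : algebraMap (OKbar OK K) (OC p OK K) (D.ζ 1 - 1) ∣ s) {θ : ℕ → OC p OK K}
    (hθ : IsDividedPowers s θ) : HasUniqueExpansions θ := by
  intro a ha hsum
  have hp1 : 1 ≤ p - 1 := by have := hp.1.two_le; omega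
  obtain ⟨r, hr⟩ := exists_root_OC (p := p) OK K D.ϖ
  set l := r ^ D.deg with hl
  have hpl : Associated (p : OC p OK K) (l ^ (p - 1)) := by
    have := D.associated_p.map (okToOC p OK K)
    rwa [map_natCast, map_pow, ← hr, ← pow_mul, mul_comm, pow_mul, ← hl] at this
  have hls : l ∣ s := by
    refine dvd_trans ?_ hdvd
    rw [← IsIntegrallyClosed.pow_dvd_pow_iff (n := p - 1) (by omega)]
    have := map_dvd (algebraMap (OKbar OK K) (OC p OK K)) D.p_dvd_ζ_sub_one_pow
    rw [map_natCast, map_pow] at this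
    exact hpl.symm.dvd.trans this
  obtain ⟨τ, rfl⟩ := hls
  have hrϖ : IsAdicComplete (Ideal.span {r}) (OC p OK K) := by
    refine isAdicComplete_of_pow_le (J := Ideal.span {(p : OC p OK K)}) (d := D.deg * (p - 1))
      (mul_ne_zero D.deg_ne_zero (by omega)) ?_ ?_
    · rw [Ideal.span_singleton_le_span_singleton]
      exact ((dvd_pow_self _ D.deg_ne_zero).trans (dvd_pow_self _ (by omega))).trans hpl.symm.dvd
    · rw [Ideal.span_singleton_pow, Ideal.span_singleton_le_span_singleton, pow_mul]
      exact hpl.dvd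
  have hrp : r ∣ (p : OC p OK K) :=
    ((dvd_pow_self _ D.deg_ne_zero).trans (dvd_pow_self _ (by omega))).trans hpl.symm.dvd
  by_contra! hne
  choose n u hmon hu hunit hn using fun m => D.exists_monomial hr hl hθ m (a m)
  have hlim : ∀ N, ∃ M₀, ∀ m ≥ M₀, N ≤ n m := by
    intro N
    obtain ⟨M₀, hM⟩ := ha N
    exact ⟨max M₀ N, fun m hm => hn m N (le_of_max_le_right hm) (hM m (le_of_max_le_left hm))⟩
  have hex : ∃ k, ∃ m, u m ≠ 0 ∧ n m = k := by
    obtain ⟨m, hm⟩ := hne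
    exact ⟨n m, m, (hunit m hm).ne_zero, rfl⟩
  classical
  -- The least exponent `n₀` of `r` among the nonzero terms.
  obtain ⟨m₁, hm₁, hn₁⟩ := Nat.find_spec hex
  set n₀ := Nat.find hex with hn₀
  have hmin : ∀ m, u m ≠ 0 → n₀ ≤ n m := fun m hm => Nat.find_min' hex ⟨m, hm, rfl⟩
  choose B hB using fun k => hlim (n₀ + k + 1)
  -- The coefficient of `r ^ (n₀ + k)`, as a polynomial in `τ`. It is finite because every index
  -- from `B k` on has a larger exponent.
  let c : ℕ → Polynomial OK := fun k =>
    ∑ m ∈ (Finset.range (B k)).filter (fun m => n m = n₀ + k), Polynomial.monomial m (u m)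
  obtain ⟨Φ, hC, hX⟩ := exists_powerSeries_hom
    (Polynomial.aeval τ : Polynomial OK →ₐ[OK] OC p OK K).toRingHom (Ideal.span {r}) r
    (Ideal.mem_span_singleton_self _)
  have hr0 : r ≠ 0 := by
    rintro rfl
    rw [zero_dvd_iff] at hrp
    exact p_ne_zero_OC p hrp
  have hc : ∀ k M, B k ≤ M → Polynomial.aeval τ (c k) =
      ∑ m ∈ Finset.range M, if n m = n₀ + k then okToOC p OK K (u m) * τ ^ m else 0 := by
    intro k M hM
    rw [← Finset.sum_filter]
    have : (Finset.range M).filter (fun m => n m = n₀ + k) =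
        (Finset.range (B k)).filter (fun m => n m = n₀ + k) := by
      ext m
      simp only [Finset.mem_filter, Finset.mem_range]
      refine ⟨fun ⟨_, h2⟩ => ⟨?_, h2⟩, fun ⟨h1, h2⟩ => ⟨h1.trans_le hM, h2⟩⟩
      by_contra h3
      have := hB k m (not_lt.1 h3)
      omega
    rw [this, map_sum]
    refine Finset.sum_congr rfl fun m _ => ?_
    rw [Polynomial.aeval_monomial]; rfl
  -- Modulo `r ^ L`, the product of `r ^ n₀` and this value is a long partial sum of the given
  -- expansion, which is a multiple of `p ^ L` and hence of `r ^ L`.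
  have hzero : Φ (PowerSeries.mk c) = 0 := by
    apply mul_left_cancel₀ (pow_ne_zero n₀ hr0)
    rw [mul_zero]
    refine eq_zero_of_forall_mem_pow (I := Ideal.span {r}) fun L => ?_
    rw [mem_span_pow_iff]
    obtain ⟨M₀, hM₀⟩ := hsum L
    let M := M₀ + ∑ k ∈ Finset.range L, B k
    have hBM : ∀ k < L, B k ≤ M := fun k hk =>
      (Finset.single_le_sum (f := B) (fun _ _ => Nat.zero_le _) (Finset.mem_range.2 hk)).trans
        (Nat.le_add_left _ _)
    have h1 := (pow_dvd_pow_of_dvd hrp L).trans (hM₀ M (Nat.le_add_right _ _))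
    have h2 : Φ (PowerSeries.mk c) = ∑ k ∈ Finset.range L, Polynomial.aeval τ (c k) * r ^ k +
        r ^ L * Φ (PowerSeries.mk fun i => c (i + L)) := by
      conv_lhs => rw [PowerSeries.eq_shift_mul_X_pow_add_trunc L (PowerSeries.mk c)]
      rw [map_add, map_mul, map_pow, hX, add_comm, mul_comm (Φ _)]
      congr 1
      · have : ((PowerSeries.trunc L (PowerSeries.mk c) : Polynomial _) : PowerSeries _) =
            ∑ k ∈ Finset.range L, PowerSeries.C (c k) * PowerSeries.X ^ k := by
          ext i : 1
          simp only [Polynomial.coeff_coe, PowerSeries.coeff_trunc, PowerSeries.coeff_mk, map_sum,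
            PowerSeries.coeff_C_mul, PowerSeries.coeff_X_pow, mul_ite, mul_one, mul_zero,
            Finset.sum_ite_eq, Finset.mem_range]
        rw [this, map_sum]
        refine Finset.sum_congr rfl fun k _ => ?_
        rw [map_mul, map_pow, hX, hC]; rfl
      · simp only [PowerSeries.coeff_mk]
    have h3 : r ^ L ∣ r ^ n₀ * ∑ k ∈ Finset.range L, Polynomial.aeval τ (c k) * r ^ k -
        ∑ m ∈ Finset.range M, okToOC p OK K (a m) * θ m := by
      have h4 : r ^ n₀ * ∑ k ∈ Finset.range L, Polynomial.aeval τ (c k) * r ^ k =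
          ∑ m ∈ Finset.range M, ∑ k ∈ Finset.range L,
            if n m = n₀ + k then okToOC p OK K (u m) * τ ^ m * r ^ (n₀ + k) else 0 := by
        rw [Finset.sum_comm, Finset.mul_sum]
        refine Finset.sum_congr rfl fun k hk => ?_
        rw [hc k M (hBM k (Finset.mem_range.1 hk)), Finset.sum_mul, Finset.mul_sum]
        refine Finset.sum_congr rfl fun m _ => ?_
        split_ifs <;> ring
      rw [h4, ← Finset.sum_sub_distrib]
      refine Finset.dvd_sum fun m _ => ?_
      rw [hmon]
      by_cases hum : u m = 0
      · simp [hum]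
      by_cases hnm : n m < n₀ + L
      · rw [Finset.sum_eq_single (n m - n₀)]
        · rw [if_pos (by have := hmin m hum; omega),
            Nat.add_sub_cancel' (hmin m hum)]
          convert dvd_zero _ using 1
          ring
        · intro k _ hk
          rw [if_neg (by omega)]
        · intro hk
          rw [Finset.mem_range] at hk
          have := hmin m hum
          omega
      · rw [Finset.sum_eq_zero]
        · rw [zero_sub, dvd_neg]
          exact ((pow_dvd_pow _ (by omega)).mul_left _).mul_right _
        · intro k hk
          rw [Finset.mem_range] at hk
          rw [if_neg (by omega)]
    rw [h2, mul_add]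
    have h5 := dvd_add h3 h1
    rw [sub_add_cancel] at h5
    exact dvd_add h5 ((Dvd.intro _ rfl).mul_left _)
  -- Distinct terms carry distinct powers of `τ`, so no two are added and each coefficient of `c 0`
  -- is zero or a unit.
  have hcoeff : ∀ i, (c 0).coeff i = 0 ∨ IsUnit ((c 0).coeff i) := by
    intro i
    simp only [c, Polynomial.finsetSum_coeff, Polynomial.coeff_monomial, Finset.sum_ite_eq']
    split_ifs
    · exact (hu i).imp (fun h => h.1) id
    · exact Or.inl rfl
  have hc0 : c 0 ≠ 0 := by
    intro h0
    have h1 := congrArg (fun f => Polynomial.coeff f m₁) h0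
    simp only [c, Polynomial.finsetSum_coeff, Polynomial.coeff_monomial, Finset.sum_ite_eq',
      Polynomial.coeff_zero] at h1
    rw [if_pos] at h1
    · exact hm₁ h1
    · rw [Finset.mem_filter, Finset.mem_range]
      refine ⟨?_, hn₁⟩
      by_contra h3
      have := hB 0 m₁ (not_lt.1 h3)
      omega
  have hτ : IsIntegral OK τ := by
    have := D.isAdicComplete_ϖ
    have : IsHausdorff (Ideal.span {algebraMap OK (OC p OK K) D.ϖ}) (OC p OK K) := by
      refine isHausdorff_of_forall fun x hx => eq_zero_of_forall_mem_pow (I := Ideal.span {r})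
        fun k => ?_
      have := hx k
      rw [mem_span_pow_iff] at this ⊢
      rw [← okToOC_eq, ← hr] at this
      exact (pow_dvd_pow_of_dvd (dvd_pow_self _ (by omega)) k).trans this
    refine isIntegral_of_powerSeries_relation (q := D.ϖ) (r := r) (d := p - 1) hr Φ (fun f => hC f)
      hX hzero ?_
    rw [PowerSeries.coeff_mk]
    exact (hcoeff _).resolve_left (Polynomial.leadingCoeff_ne_zero.2 hc0)
  have hlint : IsIntegral OK l := by
    refine IsIntegral.pow (IsIntegral.of_pow (n := p - 1) (by omega) ?_) _
    rw [hr]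
    exact isIntegral_algebraMap
  exact hs (hlint.mul hτ).isAlgebraic

end BKData

end Expansions

/-! ## Expansions in complete rings -/

section Expansion

variable {A R : Type*} [CommRing A] [CommRing R]

lemma finsuppSum_eq_sum_range (α : A →+* R) (γ : ℕ → R) (c : ℕ →₀ A) {M : ℕ}
    (hM : ∀ m ≥ M, c m = 0) :
    (c.sum fun m a => α a * γ m) = ∑ m ∈ Finset.range M, α (c m) * γ m :=
  Finsupp.sum_of_support_subset _ (fun m hm => by
    rw [Finset.mem_range]
    by_contra h
    exact Finsupp.mem_support_iff.1 hm (hM m (not_lt.1 h))) _ (by simp)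

lemma exists_forall_ge_eq_zero (c : ℕ →₀ A) : ∃ M, ∀ m ≥ M, c m = 0 :=
  ⟨c.support.sup id + 1, fun m hm => Finsupp.notMem_support_iff.1 fun h => by
    have := Finset.le_sup (f := id) h
    simp only [id] at this
    omega⟩

/-- If every element of `R` is, modulo `p` and `T`, a finite combination of the `γ m` with
coefficients in `A`, then every element is modulo `T` a convergent such combination. -/
lemma exists_expansion {p : ℕ} [IsAdicComplete (Ideal.span {(p : A)}) A] {J : Ideal R}
    [IsAdicComplete J R] (hp : (p : R) ∈ J) (α : A →+* R) (γ : ℕ → R) (T : R)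
    (H : ∀ r, ∃ (c : ℕ →₀ A) (r₁ r₂ : R),
      r = (c.sum fun m a => α a * γ m) + T * r₁ + p * r₂) (r : R) :
    ∃ (C : ℕ → A) (r' : R), (∀ N, ∃ M₀, ∀ m ≥ M₀, (p : A) ^ N ∣ C m) ∧
      ∀ N, ∃ M₀, ∀ M ≥ M₀, r - T * r' - ∑ m ∈ Finset.range M, α (C m) * γ m ∈ J ^ N := by
  choose c r₁ r₂ h using H
  let y : ℕ → R := fun k => r₂^[k] r
  have hy : ∀ k, y (k + 1) = r₂ (y k) := fun k => Function.iterate_succ_apply' _ _ _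
  choose C hC using fun m => exists_sum (I := Ideal.span {(p : A)})
    (fun k => (p : A) ^ k * c (y k) m) fun n => mem_span_pow_iff.2 (Dvd.intro _ rfl)
  obtain ⟨r', hr'⟩ := exists_sum (I := J) (fun k => (p : R) ^ k * r₁ (y k)) fun n =>
    Ideal.mul_mem_right _ _ (Ideal.pow_mem_pow hp n)
  choose B hB using fun k => exists_forall_ge_eq_zero (c (y k))
  have hB' : ∀ N k, k < N → ∀ m ≥ ∑ k ∈ Finset.range N, B k, c (y k) m = 0 := by
    intro N k hk m hm
    exact hB k m ((Finset.single_le_sum (f := B) (fun _ _ => Nat.zero_le _)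
      (Finset.mem_range.2 hk)).trans hm)
  refine ⟨C, r', fun N => ⟨∑ k ∈ Finset.range N, B k, fun m hm => ?_⟩,
    fun N => ⟨∑ k ∈ Finset.range N, B k, fun M hM => ?_⟩⟩
  · have h1 := hC m N
    rwa [Finset.sum_eq_zero (fun k hk => by
      rw [hB' N k (Finset.mem_range.1 hk) m hm, mul_zero]), sub_zero, mem_span_pow_iff] at h1
  · have h1 : ∀ n ≤ N, r = ∑ m ∈ Finset.range M, α (∑ k ∈ Finset.range n, p ^ k * c (y k) m) * γ m
        + T * ∑ k ∈ Finset.range n, p ^ k * r₁ (y k) + p ^ n * y n := by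
      intro n
      induction n with
      | zero => intro _; simp [y]
      | succ n ih =>
        intro hn
        nth_rw 1 [ih (by omega), h (y n)]
        rw [finsuppSum_eq_sum_range α γ (c (y n)) (M := M)
          (fun m hm => hB' N n (by omega) m (hM.trans hm)), hy]
        simp only [Finset.sum_range_succ, map_add, add_mul, Finset.sum_add_distrib, map_mul,
          map_pow, map_natCast, mul_add, Finset.mul_sum, pow_succ]
        simp only [mul_assoc]
        ring
    have h2 : r - T * r' - ∑ m ∈ Finset.range M, α (C m) * γ m =
        - ∑ m ∈ Finset.range M, α (C m - ∑ k ∈ Finset.range N, p ^ k * c (y k) m) * γ m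
        - T * (r' - ∑ k ∈ Finset.range N, p ^ k * r₁ (y k)) + p ^ N * y N := by
      nth_rw 1 [h1 N le_rfl]
      simp only [map_sub, sub_mul, Finset.sum_sub_distrib]
      ring
    rw [h2]
    refine add_mem (sub_mem (neg_mem (sum_mem fun m _ => Ideal.mul_mem_right _ _ ?_))
      (Ideal.mul_mem_left _ _ (hr' N))) (Ideal.mul_mem_right _ _ (Ideal.pow_mem_pow hp N))
    refine pow_map_mem (I := Ideal.span {(p : A)}) α (fun s hs => ?_) (hC m N)
    obtain ⟨z, rfl⟩ := Ideal.mem_span_singleton.1 hs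
    rw [map_mul, map_natCast]
    exact Ideal.mul_mem_right _ _ hp

/-- A criterion for the injectivity of `g : R → B`, where `ψ` plays the role of the reduction of
`g` modulo `g T`. -/
lemma injective_of_dvd {B O : Type*} [CommRing B] [CommRing O] {p : ℕ}
    [IsHausdorff (Ideal.span {(p : R)}) R] (g : R →+* B) (ψ : R →+* O) (T : R) (S₀ : Set R)
    (hψ : ∀ r, g r = 0 → ψ r = 0) (hT : ψ T = 0)
    (hgT : ∀ x, g T * x = 0 → x = 0) (hpB : ∀ x : B, (p : B) * x = 0 → x = 0)
    (hpO : ∀ x : O, (p : O) * x = 0 → x = 0)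
    (h₁ : ∀ r, ψ r = 0 → T ∣ r) (h₂ : ∀ a ∈ S₀, ∀ y, ψ a = p * ψ y → (p : R) ∣ a)
    (H : ∀ r, ∃ (d : ℕ) (a : ℕ → R) (y : R), (∀ i, a i ∈ S₀) ∧
      r = ∑ i ∈ Finset.range d, a i * T ^ i + p * y) : Function.Injective g := by
  -- Induction on the degree in `T`. Reduction by `ψ` shows first that the constant term `a 0` is `p
  -- b`, then that `T` divides `b + y`. So the whole expression is `T` times one of lower degree,
  -- which `g` again kills as `g T` is a nonzerodivisor.
  have key : ∀ (d : ℕ) (a : ℕ → R) (y : R), (∀ i, a i ∈ S₀) →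
      g (∑ i ∈ Finset.range d, a i * T ^ i + p * y) = 0 →
      (p : R) ∣ ∑ i ∈ Finset.range d, a i * T ^ i + p * y := by
    intro d
    induction d with
    | zero => intro a y _ _; simp
    | succ d ih =>
      intro a y ha h
      have h0 : ∑ i ∈ Finset.range (d + 1), a i * T ^ i =
          T * ∑ i ∈ Finset.range d, a (i + 1) * T ^ i + a 0 := by
        rw [Finset.sum_range_succ', Finset.mul_sum, pow_zero, mul_one]
        congr 1
        exact Finset.sum_congr rfl fun i _ => by ring
      rw [h0] at h ⊢
      have h3 := hψ _ h
      rw [map_add, map_add, map_mul, hT, zero_mul, zero_add, map_mul, map_natCast] at h3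
      obtain ⟨b, hb⟩ := h₂ (a 0) (ha 0) (-y) (by rw [map_neg]; linear_combination h3)
      obtain ⟨z, hz⟩ := h₁ (b + y) (hpO _ (by
        rw [hb, map_mul, map_natCast] at h3
        rw [map_add, mul_add]; exact h3))
      have h4 : T * ∑ i ∈ Finset.range d, a (i + 1) * T ^ i + a 0 + p * y =
          T * (∑ i ∈ Finset.range d, a (i + 1) * T ^ i + p * z) := by
        rw [hb]; linear_combination (p : R) * hz
      rw [h4] at h ⊢
      rw [map_mul] at h
      exact (ih _ z (fun i => ha _) (hgT _ h)).mul_left T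
  have hdvd : ∀ x, g x = 0 → ∃ y, g y = 0 ∧ x = p * y := by
    intro x hx
    obtain ⟨d, a, y, ha, rfl⟩ := H x
    obtain ⟨z, hz⟩ := key d a y ha hx
    refine ⟨z, hpB _ ?_, hz⟩
    rw [hz, map_mul, map_natCast] at hx
    exact hx
  rw [injective_iff_map_eq_zero]
  intro x hx
  refine eq_zero_of_forall_mem_pow (I := Ideal.span {(p : R)}) fun n => ?_
  rw [mem_span_pow_iff]
  induction n generalizing x with
  | zero => simp
  | succ n ih =>
    obtain ⟨y, hy, rfl⟩ := hdvd x hx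
    rw [pow_succ']
    exact mul_dvd_mul_left _ (ih y hy)

lemma isUnit_natCast_of_coprime {p n : ℕ} [IsAdicComplete (Ideal.span {(p : R)}) R]
    (h : n.Coprime p) : IsUnit (n : R) := by
  have h1 := Nat.gcd_eq_gcd_ab n p
  rw [h.gcd_eq_one] at h1
  have h2 : (1 : R) = n * (n.gcdA p : ℤ) + p * (n.gcdB p : ℤ) := by
    exact_mod_cast congrArg (Int.cast : ℤ → R) h1
  refine isUnit_of_isUnit_mk (I := Ideal.span {(p : R)}) (y := ((n.gcdA p : ℤ) : R)) ?_
  rw [Ideal.mem_span_singleton]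
  exact ⟨-(n.gcdB p : ℤ), by rw [h2]; ring⟩

lemma exists_factorial_eq (p : ℕ) [hp : Fact p.Prime] (m : ℕ) :
    ∃ n k, m.factorial = p ^ n * k ∧ k.Coprime p ∧ (m ≠ 0 → n * (p - 1) ≤ m - 1) := by
  obtain ⟨k, hk⟩ := pow_padicValNat_dvd (p := p) (n := m.factorial)
  refine ⟨padicValNat p m.factorial, k, hk, ?_, fun hm => ?_⟩
  · refine Nat.Coprime.symm ((Nat.Prime.coprime_iff_not_dvd hp.1).2 fun h => ?_)
    obtain ⟨j, rfl⟩ := h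
    exact pow_succ_padicValNat_not_dvd (p := p) (Nat.factorial_ne_zero m)
      ⟨j, by rw [pow_succ, mul_assoc]; exact hk⟩
  · have h1 := sub_one_mul_padicValNat_factorial_lt_of_ne_zero (p := p) hm
    rw [mul_comm]
    omega

/-- If `x ^ p` is divisible by `p x`, then `x` has divided powers. -/
lemma factorial_dvd_pow {p : ℕ} [hp : Fact p.Prime] [IsAdicComplete (Ideal.span {(p : R)}) R]
    {x s : R} (h : x ^ p = p * x * s) (m : ℕ) : (m.factorial : R) ∣ x ^ m := by
  rcases eq_or_ne m 0 with rfl | hm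
  · simp
  obtain ⟨n, k, hk, hcop, hn⟩ := exists_factorial_eq p m
  rw [hk, Nat.cast_mul, Nat.cast_pow, (isUnit_natCast_of_coprime hcop).mul_right_dvd]
  have h1 : ∀ n, x ^ (n * (p - 1) + 1) = p ^ n * x * s ^ n := by
    intro n
    induction n with
    | zero => simp
    | succ n ih =>
      have : (n + 1) * (p - 1) + 1 = (n * (p - 1) + 1) + (p - 1) := by ring
      rw [this, pow_add, ih]
      have h2 : x * x ^ (p - 1) = p * x * s := by
        rw [← pow_succ', Nat.sub_add_cancel hp.1.one_le, h]
      linear_combination (p : R) ^ n * s ^ n * h2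
  -- Legendre's bound `n (p - 1) ≤ m - 1` leaves the one extra factor `x` with which the
  -- divisibility in `h1` starts.
  have h2 : m = (n * (p - 1) + 1) + (m - (n * (p - 1) + 1)) := by have := hn hm; omega
  rw [h2, pow_add, h1, mul_assoc, mul_assoc]
  exact Dvd.intro _ rfl

end Expansion

/-! ### Unique expansions and divisibility by `E` -/

section Reduction

variable {p : ℕ} [hp : Fact p.Prime]
variable {OK : Type*} [CommRing OK] [IsDomain OK] [IsDiscreteValuationRing OK] [CharZero OK]
variable [CharP (IsLocalRing.ResidueField OK) p]
  [PerfectRing (IsLocalRing.ResidueField OK) p]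
variable [IsAdicComplete (Ideal.span {(p : OK)}) OK]
variable {K : Type*} [Field K] [Algebra OK K] [IsFractionRing OK K]

namespace BKData

variable (D : BKData p OK K)

lemma p_pow_dvd_of_dvd_eBK_mul {n : ℕ} {c : BK p (IsLocalRing.ResidueField OK)}
    (h : (p : BK p (IsLocalRing.ResidueField OK)) ^ n ∣ eBK p D.E * c) :
    (p : BK p (IsLocalRing.ResidueField OK)) ^ n ∣ c := by
  induction n generalizing c with
  | zero => simp
  | succ n ih =>
    obtain ⟨y, rfl⟩ := D.p_dvd_of_dvd_eBK_mul ((dvd_pow_self _ (Nat.succ_ne_zero n)).trans h)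
    rw [pow_succ']
    apply mul_dvd_mul_left
    apply ih
    rw [pow_succ', mul_left_comm] at h
    have hp0 : (p : BK p (IsLocalRing.ResidueField OK)) ≠ 0 := by
      rw [← map_natCast PowerSeries.C, Ne, map_eq_zero_iff _ PowerSeries.C_injective]
      exact WittVector.p_nonzero _ _
    exact (mul_dvd_mul_iff_left hp0).1 h

lemma eBK_dvd_of_expansion {θ : ℕ → OC p OK K} (hθ : HasUniqueExpansions θ)
    {C : ℕ → BK p (IsLocalRing.ResidueField OK)}
    (hC : ∀ N, ∃ M₀, ∀ m ≥ M₀, (p : BK p (IsLocalRing.ResidueField OK)) ^ N ∣ C m)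
    (hs : ∀ N, ∃ M₀, ∀ M ≥ M₀, (p : OC p OK K) ^ N ∣
      ∑ m ∈ Finset.range M, okToOC p OK K (D.evϖ (C m)) * θ m) (m : ℕ) :
    eBK p D.E ∣ C m := by
  refine D.eBK_dvd_of_evϖ (hθ (fun m => D.evϖ (C m)) (fun N => ?_) hs m)
  obtain ⟨M₀, h⟩ := hC N
  refine ⟨M₀, fun m hm => ?_⟩
  have := map_dvd D.evϖ (h m hm)
  rwa [map_pow, map_natCast] at this

section

variable {R : Type*} [CommRing R] {J : Ideal R} [IsAdicComplete J R] (hpJ : (p : R) ∈ J)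
  (α : BK p (IsLocalRing.ResidueField OK) →+* R) (γ : ℕ → R) (T : R)
  (H : ∀ r, ∃ (c : ℕ →₀ BK p (IsLocalRing.ResidueField OK)) (r₁ r₂ : R),
      r = (c.sum fun m a => α a * γ m) + T * r₁ + p * r₂)
  (ψ : R →+* OC p OK K) (hJ : ∀ x ∈ J, (p : OC p OK K) ∣ ψ x) (hT : ψ T = 0)
  (hα : ∀ c, ψ (α c) = okToOC p OK K (D.evϖ c))
  (hθ : HasUniqueExpansions fun m => ψ (γ m))

include hJ in
lemma p_pow_dvd_of_mem {N : ℕ} {x : R} (hx : x ∈ J ^ N) : (p : OC p OK K) ^ N ∣ ψ x := by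
  rw [← mem_span_pow_iff]
  exact pow_map_mem ψ (fun s hs => Ideal.mem_span_singleton.2 (hJ s hs)) hx

include hpJ H hJ hT hα hθ in
-- Modulo `T` the element is a convergent sum of the `α (C m) * γ m`. Applying `ψ` kills it, so `C m
-- = E C' m` by unique expansions. The `C' m` still tend to zero, as `E` is a nonzerodivisor modulo
-- `p`, so the sum is `α E`, a multiple of `T`, times a limit.
lemma dvd_of_reduction_eq_zero (hE : T ∣ α (eBK p D.E)) {r : R} (hr : ψ r = 0) : T ∣ r := by
  have := isAdicComplete_BK (p := p) (OK := OK)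
  obtain ⟨C, r', hC, hsum⟩ := exists_expansion hpJ α γ T H r
  have h1 := D.eBK_dvd_of_expansion hθ hC fun N => by
    obtain ⟨M₀, h⟩ := hsum N
    refine ⟨M₀, fun M hM => ?_⟩
    have h2 := p_pow_dvd_of_mem ψ hJ (h M hM)
    rw [map_sub, map_sub, hr, map_mul, hT, zero_mul, sub_zero, zero_sub, dvd_neg, map_sum] at h2
    simpa only [map_mul, hα] using h2
  choose C' hC' using h1
  have hlim : ∀ N, ∃ M₀, ∀ m ≥ M₀, α (C' m) * γ m ∈ J ^ N := by
    intro N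
    obtain ⟨M₀, h⟩ := hC N
    refine ⟨M₀, fun m hm => Ideal.mul_mem_right _ _ ?_⟩
    have h2 := h m hm
    rw [hC'] at h2
    obtain ⟨z, hz⟩ := D.p_pow_dvd_of_dvd_eBK_mul h2
    rw [hz, map_mul, map_pow, map_natCast]
    exact Ideal.mul_mem_right _ _ (Ideal.pow_mem_pow hpJ N)
  choose B hB using hlim
  let B' : ℕ → ℕ := fun N => ∑ k ∈ Finset.range (N + 1), B k
  have hB' : ∀ N, B N ≤ B' N := fun N =>
    Finset.single_le_sum (f := B) (fun _ _ => Nat.zero_le _) (Finset.mem_range.2 N.lt_succ_self)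
  have htail : ∀ N M M', B N ≤ M → M ≤ M' → ∑ m ∈ Finset.range M', α (C' m) * γ m -
      ∑ m ∈ Finset.range M, α (C' m) * γ m ∈ J ^ N := by
    intro N M M' hM hM'
    obtain ⟨d, rfl⟩ := Nat.exists_eq_add_of_le hM'
    rw [Finset.sum_range_add, add_sub_cancel_left]
    exact sum_mem fun i _ => hB N _ (by omega)
  obtain ⟨L, hL⟩ := exists_limit (I := J) (fun N => ∑ m ∈ Finset.range (B' N), α (C' m) * γ m)
    fun N => htail N _ _ (hB' N) (by simp only [B']; rw [Finset.sum_range_succ _ (N + 1)]; omega)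
  have h3 : r = T * r' + α (eBK p D.E) * L := by
    refine eq_of_forall_sub_mem_pow (I := J) fun N => ?_
    obtain ⟨M₀, h⟩ := hsum N
    have h4 := h (max M₀ (B' N)) (le_max_left _ _)
    have h5 := htail N _ (max M₀ (B' N)) (hB' N) (le_max_right _ _)
    have h6 := Ideal.mul_mem_left _ (α (eBK p D.E)) (add_mem h5 (hL N))
    have h7 : ∑ m ∈ Finset.range (max M₀ (B' N)), α (C m) * γ m =
        α (eBK p D.E) * ∑ m ∈ Finset.range (max M₀ (B' N)), α (C' m) * γ m := by
      rw [Finset.mul_sum]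
      exact Finset.sum_congr rfl fun m _ => by rw [hC', map_mul, mul_assoc]
    rw [h7] at h4
    convert add_mem h4 h6 using 1
    ring
  rw [h3]
  exact dvd_add (Dvd.intro _ rfl) (hE.mul_right _)

include hpJ H hJ hT hα hθ in
-- Expand `y` too, with coefficients `Y m`. Unique expansions show that `E` divides each `c m - p Y
-- m`, and the image of `E` is `p T`, so `p` divides the image of each `c m`.
lemma p_dvd_of_reduction_eq (hE : (p : R) * T = α (eBK p D.E))
    (c : ℕ →₀ BK p (IsLocalRing.ResidueField OK)) {y : R}
    (h : ψ (c.sum fun m a => α a * γ m) = p * ψ y) :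
    (p : R) ∣ c.sum fun m a => α a * γ m := by
  have := isAdicComplete_BK (p := p) (OK := OK)
  obtain ⟨Y, y', hY, hsum⟩ := exists_expansion hpJ α γ T H y
  obtain ⟨M₁, hM₁⟩ := exists_forall_ge_eq_zero c
  have h1 := D.eBK_dvd_of_expansion (C := fun m => c m - p * Y m) hθ (fun N => by
    obtain ⟨M₀, h0⟩ := hY N
    refine ⟨max M₀ M₁, fun m hm => ?_⟩
    rw [hM₁ m (le_of_max_le_right hm), zero_sub, dvd_neg]
    exact (h0 m (le_of_max_le_left hm)).mul_left _) fun N => by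
    obtain ⟨M₀, h0⟩ := hsum N
    refine ⟨max M₀ M₁, fun M hM => ?_⟩
    have h2 := (p_pow_dvd_of_mem ψ hJ (h0 M (le_of_max_le_left hM))).mul_left (p : OC p OK K)
    rw [map_sub, map_sub, map_mul ψ T, hT, zero_mul, sub_zero, mul_sub, ← h,
      finsuppSum_eq_sum_range α γ c fun m hm => hM₁ m ((le_of_max_le_right hM).trans hm)] at h2
    simpa only [map_sum, map_mul, map_sub, map_natCast, hα, sub_mul, Finset.sum_sub_distrib,
      mul_assoc, Finset.mul_sum] using h2
  refine Finset.dvd_sum fun m _ => Dvd.dvd.mul_right ?_ _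
  obtain ⟨d, hd⟩ := h1 m
  refine ⟨α (Y m) + T * α d, ?_⟩
  have h2 := congrArg α hd
  rw [map_sub, map_mul, map_natCast, map_mul, ← hE] at h2
  linear_combination h2

end

end BKData

end Reduction

/-! ### Truncated power series -/

section General

variable {R : Type*} [CommRing R]

lemma exists_eq_add_trunc (b : PowerSeries R) (N : ℕ) : ∃ b', b = PowerSeries.X ^ N * b' +
    ∑ n ∈ Finset.range N, PowerSeries.C (PowerSeries.coeff n b) * PowerSeries.X ^ n := by
  refine ⟨PowerSeries.mk fun i => PowerSeries.coeff (i + N) b,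
    (PowerSeries.eq_shift_mul_X_pow_add_trunc N b).trans ?_⟩
  rw [mul_comm]
  congr 1
  ext i : 1
  simp only [Polynomial.coeff_coe, PowerSeries.coeff_trunc, map_sum, PowerSeries.coeff_C_mul,
    PowerSeries.coeff_X_pow, mul_ite, mul_one, mul_zero, Finset.sum_ite_eq, Finset.mem_range]

/-- If the `n`-th coefficient of a series is divisible by `e ^ (N - n)`, its value at `e v` is `e ^
N` times a polynomial in `v`, up to a further multiple of `e`; this is the step that lets `θ` see
the coefficients. -/
lemma mul_pow_add_sum (e v x : R) (N : ℕ) (β : ℕ → R) :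
    (e * v) ^ (N + 1) * x + ∑ n ∈ Finset.range (N + 1), e ^ (N - n) * β n * (e * v) ^ n =
      e ^ N * (∑ n ∈ Finset.range (N + 1), β n * v ^ n + e * (v ^ (N + 1) * x)) := by
  rw [mul_add, Finset.mul_sum, add_comm]
  congr 1
  · refine Finset.sum_congr rfl fun n hn => ?_
    have : e ^ N = e ^ (N - n) * e ^ n := by
      rw [← pow_add, Nat.sub_add_cancel (Nat.lt_succ_iff.1 (Finset.mem_range.1 hn))]
    rw [this]; ring
  · ring

end General

section Amax

variable {p : ℕ} [hp : Fact p.Prime]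
variable {OK : Type*} [CommRing OK] [IsDomain OK] [IsDiscreteValuationRing OK] [CharZero OK]
variable [CharP (IsLocalRing.ResidueField OK) p]
  [PerfectRing (IsLocalRing.ResidueField OK) p]
variable [IsAdicComplete (Ideal.span {(p : OK)}) OK]
variable {K : Type*} [Field K] [Algebra OK K] [IsFractionRing OK K]

namespace BKData

variable (D : BKData p OK K)

/-! ### The structure of `A_max` -/

/-- The element `e/p` of `A_max`. -/
def tAmax : Amax p D.e := ofPreAmax p D.e D.tPre

lemma jMap_tAmax : D.jMap D.tAmax = D.tBdR := D.jMap_ofPreAmax _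

lemma p_mul_tAmax : (p : Amax p D.e) * D.tAmax = ainfToAmax p D.e D.e := by
  rw [tAmax, ← map_natCast (ofPreAmax p D.e), ← map_mul]
  exact congrArg _ (Subtype.ext D.p_mul_tBdR)

lemma thetaAmax_tAmax : D.thetaAmax D.tAmax = 0 := by
  rw [thetaAmax_eq_zero_iff, jMap_tAmax, ← pow_one D.eBdR, ← D.tBdR_pow_dvd_iff, pow_one]

lemma exists_expansion_Amax (r : Amax p D.e) : ∃ (d : ℕ) (a : ℕ → Amax p D.e) (y : Amax p D.e),
    (∀ i, a i ∈ Set.range (ainfToAmax p D.e)) ∧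
      r = ∑ i ∈ Finset.range d, a i * D.tAmax ^ i + p * y := by
  obtain ⟨s, y, rfl⟩ := D.exists_sub_ofPreAmax r 1
  obtain ⟨f, hf⟩ := D.exists_poly s
  refine ⟨f.natDegree + 1, fun i => ainfToAmax p D.e (f.coeff i), y, fun i => ⟨_, rfl⟩, ?_⟩
  have h : s = ∑ i ∈ Finset.range (f.natDegree + 1), D.ainfToPre (f.coeff i) * D.tPre ^ i := by
    apply Subtype.ext
    rw [← hf, Polynomial.eval₂_eq_sum_range, AddSubmonoidClass.coe_finsetSum]
    rfl
  nth_rw 1 [h]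
  rw [pow_one, map_sum]
  simp only [map_mul, map_pow]
  rfl

/-- `A_inf` surjects onto `A_max / (e/p)`: this is the expansion lemma for the family whose only
nonzero member is `γ 0 = 1`. -/
lemma exists_eq_add_tAmax_mul (r : Amax p D.e) :
    ∃ C r', r = ainfToAmax p D.e C + D.tAmax * r' := by
  have := D.isAdicComplete_Amax
  obtain ⟨C, r', -, h⟩ := exists_expansion (J := Ideal.span {(p : Amax p D.e)})
    (Ideal.mem_span_singleton_self _) (ainfToAmax p D.e) (fun m => if m = 0 then 1 else 0) D.tAmax
    (fun r => by
      obtain ⟨d, a, y, ha, rfl⟩ := D.exists_expansion_Amax r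
      rcases d with _ | d
      · exact ⟨0, 0, y, by simp⟩
      · obtain ⟨c, hc⟩ := ha 0
        refine ⟨Finsupp.single 0 c, ∑ i ∈ Finset.range d, a (i + 1) * D.tAmax ^ i, y, ?_⟩
        rw [Finset.sum_range_succ', Finset.mul_sum, Finsupp.sum_single_index (by simp), hc]
        have : ∑ i ∈ Finset.range d, a (i + 1) * D.tAmax ^ (i + 1) =
            ∑ i ∈ Finset.range d, D.tAmax * (a (i + 1) * D.tAmax ^ i) :=
          Finset.sum_congr rfl fun i _ => by ring
        rw [this]
        simp [add_comm]) r
  refine ⟨C 0, r', eq_of_forall_sub_mem_pow (I := Ideal.span {(p : Amax p D.e)}) fun N => ?_⟩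
  obtain ⟨M₀, hM⟩ := h N
  have h1 := hM (M₀ + 1) (by omega)
  simp only [mul_ite, mul_one, mul_zero, Finset.sum_ite_eq', Finset.mem_range] at h1
  rw [if_pos (by omega)] at h1
  convert h1 using 1
  ring

lemma tAmax_dvd_of_theta {r : Amax p D.e} (hr : D.thetaAmax r = 0) : D.tAmax ∣ r := by
  obtain ⟨C, r', rfl⟩ := D.exists_eq_add_tAmax_mul r
  rw [map_add, map_mul, thetaAmax_tAmax, zero_mul, add_zero, thetaAmax_ainfToAmax,
    D.theta_eq_zero_iff] at hr
  obtain ⟨c, rfl⟩ := hr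
  rw [map_mul, ← p_mul_tAmax]
  exact ⟨p * ainfToAmax p D.e c + r', by ring⟩

lemma p_mul_eq_zero_BdR {x : BdR p OK K} (h : (p : BdR p OK K) * x = 0) : x = 0 :=
  p_mul_cancel (h.trans (mul_zero _).symm)

/-- The criterion `injective_of_dvd` with `T = e/p` and `ψ = θ`. Both divisibility hypotheses hold
because `A_inf` surjects onto `A_max / T`, `ker θ` is generated by `e`, and `e = p T`. -/
theorem jMap_injective : Function.Injective D.jMap := by
  have := D.isAdicComplete_Amax
  refine injective_of_dvd (p := p) D.jMap D.thetaAmax D.tAmax (Set.range (ainfToAmax p D.e))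
    (fun r hr => ?_) D.thetaAmax_tAmax (fun x hx => ?_) (fun x => p_mul_eq_zero_BdR)
    (fun x hx => (mul_eq_zero.1 hx).resolve_left (p_ne_zero_OC p)) (fun r => D.tAmax_dvd_of_theta)
    ?_ D.exists_expansion_Amax
  · rw [thetaAmax_eq_zero_iff, hr]; exact dvd_zero _
  · rw [jMap_tAmax] at hx
    exact D.tBdR_mul_eq_zero hx
  · rintro _ ⟨c, rfl⟩ y h
    obtain ⟨C, y', rfl⟩ := D.exists_eq_add_tAmax_mul y
    rw [map_add, map_mul, thetaAmax_tAmax, zero_mul, add_zero, thetaAmax_ainfToAmax,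
      thetaAmax_ainfToAmax, ← sub_eq_zero, ← map_natCast (theta p OK K), ← map_mul, ← map_sub,
      theta_eq_zero_iff] at h
    obtain ⟨d, hd⟩ := h
    refine ⟨ainfToAmax p D.e C + D.tAmax * ainfToAmax p D.e d, ?_⟩
    have h2 := congrArg (ainfToAmax p D.e) hd
    rw [map_sub, map_mul, map_natCast, map_mul, ← p_mul_tAmax] at h2
    linear_combination h2

lemma ainfToAmax_injective : Function.Injective (ainfToAmax p D.e) := fun x y h => by
  have := congrArg D.jMap h
  rw [jMap_ainfToAmax, jMap_ainfToAmax] at this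
  exact D.ainfToBdR_injective this

lemma isDomain_Amax : IsDomain (Amax p D.e) := by
  have := D.isDomain_BdR
  exact D.jMap_injective.isDomain

lemma charZero_Amax : CharZero (Amax p D.e) :=
  charZero_of_injective_ringHom D.ainfToAmax_injective

lemma ainfToAmax_e_ne_zero : ainfToAmax p D.e D.e ≠ 0 := fun h =>
  D.e_ne_zero (D.ainfToAmax_injective (h.trans (map_zero _).symm))

/-! ### Periods -/

/-- The properties of the elements `w` and `u w` of `A_inf` which are used below. -/
structure IsPeriod (v : Ainf p OK K) : Prop where
  transcendental : Transcendental OK (theta p OK K v)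
  dvd : algebraMap (OKbar OK K) (OC p OK K) (D.ζ 1 - 1) ∣ theta p OK K v
  pow : ∃ s, ainfToAmax p D.e v ^ p = p * ainfToAmax p D.e v * s

/-- Let `μ = ε^{1/p} - 1`. The binomial formula gives `μ ^ p = (ε - 1) - p μ r`, and in `A_max` the
term `ε - 1 = e w` is `p (e/p) w`, where `w` is a multiple of `μ`. So `μ ^ p`, and with it `w ^ p`,
acquires a factor `p`. -/
lemma exists_w_pow : ∃ s, ainfToAmax p D.e D.w ^ p = p * ainfToAmax p D.e D.w * s := by
  obtain ⟨r, hr⟩ := exists_add_pow_prime_eq hp.1 (D.εRoot - 1) 1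
  rw [sub_add_cancel, εRoot_pow, one_pow, mul_one] at hr
  set μ := ainfToAmax p D.e (D.εRoot - 1)
  set c := ainfToAmax p D.e D.cyc
  have hw : ainfToAmax p D.e D.w = c * μ := by rw [w_eq, map_mul]
  have h1 : μ ^ p = p * μ * (D.tAmax * c - ainfToAmax p D.e r) := by
    have h2 : (D.εRoot - 1) ^ p = D.e * D.w - p * ((D.εRoot - 1) * r) := by
      rw [e_mul_w]; linear_combination -hr
    have h3 := congrArg (ainfToAmax p D.e) h2
    rw [map_pow, map_sub _ (D.e * D.w), map_mul, ← p_mul_tAmax, hw, map_mul, map_mul,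
      map_natCast] at h3
    linear_combination h3
  refine ⟨c ^ (p - 1) * (D.tAmax * c - ainfToAmax p D.e r), ?_⟩
  have hc : c ^ p = c ^ (p - 1) * c := by rw [← pow_succ, Nat.sub_add_cancel hp.1.one_le]
  rw [hw, mul_pow, h1, hc]
  ring

lemma isPeriod_w : D.IsPeriod D.w where
  transcendental := D.transcendental_ω
  dvd := by
    rw [w_eq, map_mul, map_sub (theta p OK K), theta_εRoot, map_one, map_sub, map_one]
    exact dvd_mul_left _ _
  pow := D.exists_w_pow

lemma isPeriod_u_mul_w : D.IsPeriod (D.u * D.w) where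
  transcendental := by
    rw [map_mul, theta_u, okToOC_eq, ← Algebra.smul_def]
    intro h
    apply D.transcendental_ω
    rw [IsAlgebraic.iff_exists_smul_integral] at h ⊢
    obtain ⟨y, hy, h⟩ := h
    exact ⟨y * D.ϖ, mul_ne_zero hy D.ϖ_ne_zero, by rwa [mul_smul]⟩
  dvd := by rw [map_mul]; exact D.isPeriod_w.dvd.mul_left _
  pow := by
    obtain ⟨s, hs⟩ := D.exists_w_pow
    have hc : D.u ^ p = D.u ^ (p - 1) * D.u := by rw [← pow_succ, Nat.sub_add_cancel hp.1.one_le]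
    refine ⟨ainfToAmax p D.e D.u ^ (p - 1) * s, ?_⟩
    rw [map_mul, mul_pow, hs, ← map_pow, hc, map_mul, map_pow]
    ring

/-- Modulo `p` the polynomial `E` is `X ^ deg`, so an element divisible by all its powers is a
multiple of `p`. The quotient has the same property, and `p`-adic separatedness ends the argument.
-/
lemma eq_zero_of_forall_eBK_pow_dvd {c : BK p (IsLocalRing.ResidueField OK)}
    (h : ∀ n, eBK p D.E ^ n ∣ c) : c = 0 := by
  have := isAdicComplete_BK (p := p) (OK := OK)
  have h1 : ∀ c : BK p (IsLocalRing.ResidueField OK), (∀ n, eBK p D.E ^ n ∣ c) →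
      ∃ c', c = p * c' ∧ ∀ n, eBK p D.E ^ n ∣ c' := by
    intro c h
    have h2 : (p : BK p (IsLocalRing.ResidueField OK)) ∣ c := by
      rw [← map_natCast PowerSeries.C, C_dvd_iff_coeff]
      intro i
      obtain ⟨y, hy⟩ := h (i + 1)
      have h3 : (p : BK p (IsLocalRing.ResidueField OK)) ∣
          eBK p D.E ^ (i + 1) - (PowerSeries.X ^ D.deg) ^ (i + 1) := by
        refine dvd_trans ?_ (sub_dvd_pow_sub_pow _ _ _)
        rw [D.eBK_eq, add_sub_cancel_left]
        exact Dvd.intro _ rfl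
      obtain ⟨z, hz⟩ := h3
      have h4 : c = PowerSeries.X ^ (D.deg * (i + 1)) * y +
          PowerSeries.C (p : WittVector p _) * (z * y) := by
        rw [hy, map_natCast, pow_mul]; linear_combination y * hz
      rw [h4, map_add, PowerSeries.coeff_C_mul, PowerSeries.coeff_X_pow_mul', if_neg, zero_add]
      · exact Dvd.intro _ rfl
      · have := Nat.one_le_iff_ne_zero.2 D.deg_ne_zero
        nlinarith
    obtain ⟨c', rfl⟩ := h2
    refine ⟨c', rfl, fun n => ?_⟩
    have hp0 : (p : BK p (IsLocalRing.ResidueField OK)) ≠ 0 := by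
      rw [← map_natCast PowerSeries.C, Ne, map_eq_zero_iff _ PowerSeries.C_injective]
      exact WittVector.p_nonzero _ _
    obtain ⟨y, hy⟩ := h n
    have h3 : ∀ n (y : BK p (IsLocalRing.ResidueField OK)),
        (p : BK p (IsLocalRing.ResidueField OK)) ∣ eBK p D.E ^ n * y →
        (p : BK p (IsLocalRing.ResidueField OK)) ∣ y := by
      intro n
      induction n with
      | zero => simp
      | succ n ih =>
        intro y hy
        rw [pow_succ', mul_assoc] at hy
        exact ih y (D.p_dvd_of_dvd_eBK_mul hy)
    obtain ⟨y', rfl⟩ := h3 n y ⟨c', hy.symm⟩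
    exact ⟨y', mul_left_cancel₀ hp0 (by rw [hy]; ring)⟩
  refine eq_zero_of_forall_mem_pow (I := Ideal.span {(p : BK p (IsLocalRing.ResidueField OK))})
    fun n => ?_
  rw [mem_span_pow_iff]
  induction n generalizing c with
  | zero => simp
  | succ n ih =>
    obtain ⟨c', rfl, hc'⟩ := h1 c h
    rw [pow_succ']
    exact mul_dvd_mul_left _ (ih hc')

variable {D} in
-- If `κ b = 0`, induction on `N` shows that `E ^ (N - n)` divides the `n`-th coefficient `b_n` for
-- all `n ≤ N`: after division by `e ^ N`, applying `θ` leaves a polynomial relation for `θ(v)` over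
-- `𝒪_K`, whose coefficients vanish by transcendence, and each `b_n` gains a factor `E`. So every
-- coefficient is divisible by all powers of `E`.
lemma IsStd.injective {κ : BK2 p (IsLocalRing.ResidueField OK) →+* Ainf p OK K} {v : Ainf p OK K}
    (hκ : D.IsStd κ v) (hv : Transcendental OK (theta p OK K v)) : Function.Injective κ := by
  rw [injective_iff_map_eq_zero]
  intro b hb
  have key : ∀ N, ∀ n ≤ N, eBK p D.E ^ (N - n) ∣ PowerSeries.coeff n b := by
    intro N
    induction N with
    | zero => intro n _; simp
    | succ N ih =>
      have h1 : ∀ n, ∃ c, n ≤ N → PowerSeries.coeff n b = eBK p D.E ^ (N - n) * c := by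
        intro n
        by_cases hn : n ≤ N
        · obtain ⟨c, hc⟩ := ih n hn
          exact ⟨c, fun _ => hc⟩
        · exact ⟨0, fun h => absurd h hn⟩
      choose c hc using h1
      obtain ⟨b'', hb''⟩ := exists_eq_add_trunc b (N + 1)
      have h2 : D.e ^ N * (∑ n ∈ Finset.range (N + 1), D.bkToAinf (c n) * v ^ n +
          D.e * (v ^ (N + 1) * κ b'')) = 0 := by
        rw [← hb, ← mul_pow_add_sum]
        conv_rhs => rw [hb'']
        rw [map_add, map_mul, map_pow, hκ.map_X, map_sum]
        congr 1
        refine Finset.sum_congr rfl fun n hn => ?_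
        rw [map_mul, map_pow, hκ.map_C, hκ.map_X, hc n (Nat.lt_succ_iff.1 (Finset.mem_range.1 hn)),
          map_mul, map_pow, bkToAinf_eBK]
      have h3 := congrArg (theta p OK K) ((mul_eq_zero.1 h2).resolve_left (pow_ne_zero N D.e_ne_zero))
      rw [map_add, map_mul, theta_e, zero_mul, add_zero, map_sum, map_zero] at h3
      have h4 := (transcendental_iff.1 hv) (∑ n ∈ Finset.range (N + 1),
        Polynomial.monomial n (D.evϖ (c n))) (by
          rw [map_sum, ← h3]
          refine Finset.sum_congr rfl fun n _ => ?_
          rw [Polynomial.aeval_monomial, map_mul, map_pow, theta_bkToAinf]; rfl)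
      intro n hn
      rcases Nat.lt_or_ge N n with h | h
      · rw [Nat.sub_eq_zero_of_le (by omega), pow_zero]; exact one_dvd _
      · have h5 := congrArg (fun f => Polynomial.coeff f n) h4
        simp only [Polynomial.finsetSum_coeff, Polynomial.coeff_monomial, Finset.sum_ite_eq',
          Polynomial.coeff_zero, Finset.mem_range] at h5
        rw [if_pos (by omega)] at h5
        obtain ⟨d, hd⟩ := D.eBK_dvd_of_evϖ h5
        exact ⟨d, by rw [hc n h, hd, ← mul_assoc, ← pow_succ]; congr 2; omega⟩
  ext n : 1
  rw [map_zero]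
  apply D.eq_zero_of_forall_eBK_pow_dvd
  intro M
  have := key (M + n) n (by omega)
  rwa [Nat.add_sub_cancel] at this

end BKData

end Amax

section Max

variable {p : ℕ} [hp : Fact p.Prime]
variable {OK : Type*} [CommRing OK] [IsDomain OK] [IsDiscreteValuationRing OK] [CharZero OK]
variable [CharP (IsLocalRing.ResidueField OK) p]
  [PerfectRing (IsLocalRing.ResidueField OK) p]
variable [IsAdicComplete (Ideal.span {(p : OK)}) OK]
variable {K : Type*} [Field K] [Algebra OK K] [IsFractionRing OK K]

namespace BKData

lemma p_mul_tAmax' (D : BKData p OK K) :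
    (p : Amax p D.e) * D.tAmax = ainfToAmax p D.e (D.bkToAinf (eBK p D.E)) := by
  rw [p_mul_tAmax]
  exact congrArg _ D.bkToAinf_eBK.symm

/-! ### Divided power rings over `W(k)⟦x⟧` -/

/-- A ring generated by the image of `B₀`, by `E/p`, and by the divided powers of an element. -/
structure MaxPre (D : BKData p OK K) (S B₀ : Type*) [CommRing S] [CommRing B₀] where
  /-- The structure map. -/
  β : B₀ →+* S
  /-- The map from the Breuil–Kisin ring. -/
  ι : BK p (IsLocalRing.ResidueField OK) →+* B₀
  /-- The element `E/p`. -/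
  T : S
  /-- The divided powers. -/
  γ : ℕ → S
  -- For the base `W(k)⟦x⟧⟦t⟧` this holds because `t = E w = p (E/p) w`, so that modulo `p` only the
  -- constant term in `t` matters.
  exists_eq : ∀ b, ∃ c y, β b = β (ι c) + p * y
  p_mul_T : p * T = β (ι (eBK p D.E))
  torsionFree : ∀ n : ℕ, n ≠ 0 → ∀ x : S, (n : S) * x = 0 → x = 0
  factorial : ∀ i, (i.factorial : S) * γ i = γ 1 ^ i
  gen : ∀ Q : Subring S, (∀ b, β b ∈ Q) → T ∈ Q → (∀ i, γ i ∈ Q) → Q = ⊤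

namespace MaxPre

variable {D : BKData p OK K} {S B₀ : Type*} [CommRing S] [CommRing B₀] (M : D.MaxPre S B₀)

/-- The structure map from the Breuil–Kisin ring. -/
def α : BK p (IsLocalRing.ResidueField OK) →+* S := M.β.comp M.ι

lemma γ_zero : M.γ 0 = 1 := by simpa using M.factorial 0

lemma γ_mul (i j : ℕ) : M.γ i * M.γ j = ((i + j).choose j : S) * M.γ (i + j) := by
  rw [← sub_eq_zero]
  apply M.torsionFree _ (mul_ne_zero (Nat.factorial_ne_zero i) (Nat.factorial_ne_zero j))
  have h := congrArg (Nat.cast : ℕ → S) (Nat.add_choose_mul_factorial_mul_factorial i j)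
  push_cast at h ⊢
  linear_combination (j.factorial : S) * M.γ j * M.factorial i + M.γ 1 ^ i * M.factorial j -
    M.factorial (i + j) - M.γ (i + j) * h

/-- If `i` is a map to another ring, the finite combinations of the images of the divided powers. -/
def combinations {R : Type*} [CommRing R] (i : S →+* R) : Set R :=
  Set.range fun c : ℕ →₀ BK p (IsLocalRing.ResidueField OK) =>
    c.sum fun m a => i (M.α a) * i (M.γ m)

/-- The span of the divided powers over `W(k)⟦x⟧` is a subring, because `γ i * γ j` is a binomial
multiple of `γ (i + j)`. The polynomials in `T` over it, together with the multiples of `p`, contain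
all generators. -/
lemma exists_expansion (s : S) : ∃ (d : ℕ) (a : ℕ → S) (y : S),
    (∀ i, a i ∈ M.combinations (RingHom.id S)) ∧
      s = ∑ i ∈ Finset.range d, a i * M.T ^ i + p * y := by
  let _ : Algebra (BK p (IsLocalRing.ResidueField OK)) S := M.α.toAlgebra
  set N := Submodule.span (BK p (IsLocalRing.ResidueField OK)) (Set.range M.γ) with hN
  have hγ : ∀ i, M.γ i ∈ N := fun i => Submodule.subset_span ⟨i, rfl⟩
  have hone : (1 : S) ∈ N := M.γ_zero ▸ hγ 0
  have hmul : ∀ {x y : S}, x ∈ N → y ∈ N → x * y ∈ N := by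
    intro x y hx hy
    have h1 : N * N ≤ N := by
      rw [hN, Submodule.span_mul_span, Submodule.span_le]
      rintro _ ⟨_, ⟨i, rfl⟩, _, ⟨j, rfl⟩, rfl⟩
      simp only [M.γ_mul, SetLike.mem_coe, ← nsmul_eq_mul]
      exact nsmul_mem (hγ _) _
    exact h1 (Submodule.mul_mem_mul hx hy)
  let S₀ : Subring S :=
    { carrier := N
      mul_mem' := hmul
      one_mem' := hone
      add_mem' := fun hx hy => N.add_mem hx hy
      zero_mem' := N.zero_mem
      neg_mem' := fun hx => N.neg_mem hx }
  let P : Subring S := (Polynomial.eval₂RingHom S₀.subtype M.T).range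
  let π := Ideal.Quotient.mk (Ideal.span {(p : S)})
  have hS₀ : ∀ x ∈ N, x ∈ P := fun x hx => ⟨Polynomial.C ⟨x, hx⟩, by simp⟩
  have htop : (P.map π).comap π = ⊤ := by
    refine M.gen _ (fun b => ?_) ⟨M.T, ⟨Polynomial.X, by simp⟩, rfl⟩
      fun i => ⟨M.γ i, hS₀ _ (hγ i), rfl⟩
    obtain ⟨c, y, h⟩ := M.exists_eq b
    refine ⟨M.β (M.ι c), hS₀ _ ?_, ?_⟩
    · have := N.smul_mem c hone
      rwa [Algebra.smul_def, mul_one] at this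
    · rw [h]
      refine Ideal.Quotient.eq.2 (Ideal.mem_span_singleton.2 ⟨-y, by ring⟩)
  have hs : s ∈ (P.map π).comap π := htop ▸ Subring.mem_top s
  obtain ⟨_, ⟨q, rfl⟩, h⟩ := hs
  obtain ⟨y, hy⟩ := Ideal.mem_span_singleton.1 (Ideal.Quotient.eq.1 h)
  refine ⟨q.natDegree + 1, fun i => q.coeff i, -y, fun i => ?_, ?_⟩
  · obtain ⟨c, hc⟩ := (Finsupp.mem_span_range_iff_exists_finsupp).1 (q.coeff i).2
    exact ⟨c, hc⟩
  · rw [Polynomial.coe_eval₂RingHom, Polynomial.eval₂_eq_sum_range] at hy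
    have hy' : ∑ i ∈ Finset.range (q.natDegree + 1), (q.coeff i : S) * M.T ^ i - s = p * y := hy
    linear_combination -hy'

section Completion

variable {R : Type*} [CommRing R] {i : S →+* R} (hi : IsCompletion (Ideal.span {(p : S)}) i)

include hi in
lemma isAdicComplete : IsAdicComplete (Ideal.span {(p : R)}) R := by
  have := hi.complete
  rwa [IsCompletion.map_span_natCast] at this

include hi in
lemma exists_expansion_completion (r : R) : ∃ (d : ℕ) (a : ℕ → R) (y : R),
    (∀ j, a j ∈ M.combinations i) ∧
      r = ∑ j ∈ Finset.range d, a j * i M.T ^ j + p * y := by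
  obtain ⟨s, hs⟩ := hi.dense r 1
  rw [IsCompletion.map_span_natCast, mem_span_pow_iff, pow_one] at hs
  obtain ⟨r', hr⟩ := hs
  obtain ⟨d, a, y, ha, rfl⟩ := M.exists_expansion s
  refine ⟨d, fun j => i (a j), i y + r', fun j => ?_, ?_⟩
  · obtain ⟨c, hc⟩ := ha j
    refine ⟨c, ?_⟩
    change _ = i (a j)
    rw [← hc]
    simp only [Finsupp.sum, map_sum, map_mul, RingHom.id_apply]
  · rw [map_add, map_sum, map_mul, map_natCast] at hr
    simp only [map_mul, map_pow] at hr
    linear_combination hr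

include hi in
lemma exists_expansion_completion' (r : R) :
    ∃ (c : ℕ →₀ BK p (IsLocalRing.ResidueField OK)) (r₁ r₂ : R),
      r = (c.sum fun m a => (i.comp M.α) a * i (M.γ m)) + i M.T * r₁ + p * r₂ := by
  obtain ⟨d, a, y, ha, rfl⟩ := M.exists_expansion_completion hi r
  rcases d with _ | d
  · exact ⟨0, 0, y, by simp⟩
  · obtain ⟨c, hc⟩ := ha 0
    refine ⟨c, ∑ j ∈ Finset.range d, a (j + 1) * i M.T ^ j, y, ?_⟩
    rw [Finset.sum_range_succ', Finset.mul_sum, ← hc, pow_zero, mul_one, add_comm (Finset.sum _ _)]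
    congr 2
    exact Finset.sum_congr rfl fun j _ => by ring

variable (f : R →+* Amax p D.e) {v : Ainf p OK K} (hv : D.IsPeriod v)
  (hα : ∀ c, f (i (M.α c)) = ainfToAmax p D.e (D.bkToAinf c))
  (hγ : f (i (M.γ 1)) = ainfToAmax p D.e v)

include hα in
lemma map_T : f (i M.T) = D.tAmax := by
  have := D.isDomain_Amax
  have := D.charZero_Amax
  apply mul_left_cancel₀ (Nat.cast_ne_zero.2 hp.1.ne_zero : (p : Amax p D.e) ≠ 0)
  rw [p_mul_tAmax', ← hα, ← map_natCast f, ← map_mul, ← map_natCast i, ← map_mul,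
    M.p_mul_T]
  rfl

include hv hγ in
-- Write `m! = p ^ n k` with `k` prime to `p`, hence a unit of `𝒪_K`. The case `m = 0` is separate,
-- as Legendre's bound is stated for positive `m`.
lemma hasUniqueExpansions : HasUniqueExpansions fun m => (D.thetaAmax.comp f) (i (M.γ m)) := by
  refine D.hasUniqueExpansions hv.transcendental hv.dvd fun m => ?_
  rcases eq_or_ne m 0 with rfl | hm
  · exact ⟨1, isUnit_one, 0, by simp, by simp [M.γ_zero]⟩
  obtain ⟨n, k, hk, hcop, hn⟩ := exists_factorial_eq p m
  refine ⟨k, isUnit_natCast_of_coprime hcop, n, (hn hm).trans (Nat.sub_le _ _), ?_⟩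
  have h1 := congrArg (fun s => D.thetaAmax (f (i s))) (M.factorial m)
  simp only [map_mul, map_pow, map_natCast, hγ, thetaAmax_ainfToAmax] at h1
  rw [hk] at h1
  push_cast at h1
  rw [map_natCast, RingHom.comp_apply]
  linear_combination h1

include hα in
lemma theta_α (c : BK p (IsLocalRing.ResidueField OK)) :
    (D.thetaAmax.comp f) ((i.comp M.α) c) = okToOC p OK K (D.evϖ c) := by
  rw [RingHom.comp_apply, RingHom.comp_apply, hα, thetaAmax_ainfToAmax, theta_bkToAinf]

include hα in
lemma theta_T : (D.thetaAmax.comp f) (i M.T) = 0 := by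
  rw [RingHom.comp_apply, M.map_T f hα, thetaAmax_tAmax]

lemma p_dvd_map (ψ : R →+* OC p OK K) : ∀ x ∈ Ideal.span {(p : R)}, (p : OC p OK K) ∣ ψ x := by
  intro x hx
  have := map_dvd ψ (Ideal.mem_span_singleton.1 hx)
  rwa [map_natCast] at this

include hi hv hα hγ in
lemma T_dvd_of_theta {r : R} (hr : D.thetaAmax (f r) = 0) : i M.T ∣ r := by
  have := isAdicComplete hi
  refine D.dvd_of_reduction_eq_zero (Ideal.mem_span_singleton_self _) (i.comp M.α)
    (fun m => i (M.γ m)) (i M.T) (M.exists_expansion_completion' hi) (D.thetaAmax.comp f)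
    (p_dvd_map _) (M.theta_T f hα) (M.theta_α f hα) (M.hasUniqueExpansions f hv hγ) ?_ hr
  rw [RingHom.comp_apply, α, RingHom.comp_apply, ← M.p_mul_T, map_mul]
  exact dvd_mul_left _ _

include hi hv hα hγ in
theorem injective : Function.Injective f := by
  have := isAdicComplete hi
  have h : Function.Injective (D.jMap.comp f) := by
    refine injective_of_dvd (p := p) (D.jMap.comp f) (D.thetaAmax.comp f) (i M.T)
      (M.combinations i) (fun r hr => ?_) (M.theta_T f hα) (fun x hx => ?_)
      (fun x => p_mul_eq_zero_BdR)
      (fun x hx => (mul_eq_zero.1 hx).resolve_left (p_ne_zero_OC p))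
      (fun r => M.T_dvd_of_theta hi f hv hα hγ) ?_ (M.exists_expansion_completion hi)
    · rw [RingHom.comp_apply] at hr ⊢
      rw [thetaAmax_eq_zero_iff, hr]; exact dvd_zero _
    · rw [RingHom.comp_apply, M.map_T f hα, jMap_tAmax] at hx
      exact D.tBdR_mul_eq_zero hx
    · rintro _ ⟨c, rfl⟩ y h
      refine D.p_dvd_of_reduction_eq (Ideal.mem_span_singleton_self _) (i.comp M.α)
        (fun m => i (M.γ m)) (i M.T) (M.exists_expansion_completion' hi) (D.thetaAmax.comp f)
        (p_dvd_map _) (M.theta_T f hα) (M.theta_α f hα) (M.hasUniqueExpansions f hv hγ) ?_ c h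
      rw [RingHom.comp_apply, α, RingHom.comp_apply, ← M.p_mul_T, map_mul, map_natCast]
  exact Function.Injective.of_comp (f := D.jMap) h

include hi hv hα hγ in
lemma T_pow_dvd {n : ℕ} {r : R} (hr : D.eBdR ^ n ∣ D.jMap (f r)) : i M.T ^ n ∣ r := by
  induction n generalizing r with
  | zero => simp
  | succ n ih =>
    obtain ⟨r', rfl⟩ := M.T_dvd_of_theta hi f hv hα hγ
      (D.thetaAmax_eq_zero_iff.2 ((dvd_pow_self _ n.succ_ne_zero).trans hr))
    rw [← D.tBdR_pow_dvd_iff] at hr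
    obtain ⟨y, hy⟩ := hr
    rw [map_mul, map_mul, M.map_T f hα, jMap_tAmax, pow_succ', mul_assoc] at hy
    rw [pow_succ']
    apply mul_dvd_mul_left
    apply ih
    rw [← D.tBdR_pow_dvd_iff]
    refine ⟨y, ?_⟩
    rw [← sub_eq_zero]
    apply D.tBdR_mul_eq_zero
    rw [mul_sub, hy, sub_self]

include hi hv hα hγ in
-- Divisibility by `e` in `B_dR^+` is detected by `θ`, which on `R` has kernel `(T)`; cancelling `T`
-- and repeating gives `T ^ n ∣ r`. With `E = p T` this is divisibility by `E ^ n` after inverting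
-- `p`. For the converse, clear denominators and use that `p` is a unit in `B_dR^+`.
theorem mem_filBdR_iff {n : ℕ} {r : R} :
    D.jMap (f r) ∈ filBdR p OK K n ↔ r ∈ filMax p (i (M.α (eBK p D.E))) n := by
  rw [D.mem_filBdR, filMax, Ideal.mem_comap, Ideal.mem_span_singleton]
  have hE : i (M.α (eBK p D.E)) = p * i M.T := by
    rw [α, RingHom.comp_apply, ← M.p_mul_T, map_mul, map_natCast]
  constructor
  · intro h
    obtain ⟨r', rfl⟩ := M.T_pow_dvd hi f hv hα hγ h
    have h1 := IsLocalization.Away.algebraMap_isUnit (S := Localization.Away (p : R)) (p : R)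
    obtain ⟨u, hu⟩ := (h1.pow n).exists_left_inv
    refine ⟨u * algebraMap _ _ r', ?_⟩
    rw [hE, map_mul, map_mul, map_pow, mul_pow]
    linear_combination (-(algebraMap R (Localization.Away (p : R)) (i M.T)) ^ n *
      algebraMap R (Localization.Away (p : R)) r') * hu
  · rintro ⟨y, hy⟩
    obtain ⟨m, b, hb⟩ := IsLocalization.Away.surj (p : R) y
    have h1 : algebraMap R (Localization.Away (p : R)) (r * p ^ m) =
        algebraMap R (Localization.Away (p : R)) (i (M.α (eBK p D.E)) ^ n * b) := by
      rw [map_mul, map_mul, hy, map_pow, ← hb, map_pow]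
      ring
    obtain ⟨⟨_, k, rfl⟩, h2⟩ := (IsLocalization.eq_iff_exists (Submonoid.powers (p : R)) _).1 h1
    have h3 := congrArg (fun r => D.jMap (f r)) h2
    simp only [map_mul, map_pow, map_natCast, hα, bkToAinf_eBK, jMap_ainfToAmax] at h3
    have h4 : (p : BdR p OK K) ^ (k + m) * D.jMap (f r) =
        D.eBdR ^ n * (p ^ k * D.jMap (f b)) := by
      rw [pow_add, eBdR]
      linear_combination h3
    rw [← ((isUnit_p_BdR p OK K).pow (k + m)).dvd_mul_left, h4]
    exact Dvd.intro _ rfl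

include hi in
-- Inside the characteristic zero domain `L`, the images of `E/p` and of the divided powers are
-- determined by `p T = E` and `m! γ m = γ 1 ^ m`. They lie in the image of `A_max` because `A_max`
-- contains `e/p` and the divided powers of a period. The resulting map on `S` extends to the
-- completion.
lemma exists_hom {v : Ainf p OK K} (hv : D.IsPeriod v) {L : Type*} [CommRing L] [IsDomain L]
    [CharZero L] (J : Amax p D.e →+* L) (hJ : Function.Injective J) (h : S →+* L)
    (hβ : ∀ b, ∃ q, J q = h (M.β b))
    (hα : ∀ c, J (ainfToAmax p D.e (D.bkToAinf c)) = h (M.α c))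
    (hγ : J (ainfToAmax p D.e v) = h (M.γ 1)) :
    ∃ f : R →+* Amax p D.e, ∀ s, J (f (i s)) = h s := by
  have := D.isAdicComplete_Amax
  have htop : J.range.comap h = ⊤ := by
    refine M.gen _ hβ ⟨D.tAmax, ?_⟩ fun m => ?_
    · apply mul_left_cancel₀ (Nat.cast_ne_zero.2 hp.1.ne_zero : (p : L) ≠ 0)
      rw [← map_natCast J, ← map_mul, p_mul_tAmax', hα, map_natCast,
        ← map_natCast h, ← map_mul, M.p_mul_T]
      rfl
    · obtain ⟨s, hs⟩ := hv.pow
      obtain ⟨g, hg⟩ := factorial_dvd_pow hs m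
      refine ⟨g, ?_⟩
      apply mul_left_cancel₀ (Nat.cast_ne_zero.2 m.factorial_ne_zero : (m.factorial : L) ≠ 0)
      rw [← map_natCast J, ← map_mul, ← hg, map_pow, hγ, map_natCast, ← map_natCast h, ← map_mul,
        M.factorial, map_pow]
  obtain ⟨f₀, hf₀⟩ := exists_factor h J hJ fun s => by
    have : s ∈ J.range.comap h := htop ▸ Subring.mem_top s
    exact this
  obtain ⟨f, hf⟩ := hi.exists_lift (J := Ideal.span {(p : Amax p D.e)}) f₀ fun s hs => by
    have := map_dvd f₀ (Ideal.mem_span_singleton.1 hs)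
    rw [map_natCast] at this
    exact Ideal.mem_span_singleton.2 this
  exact ⟨f, fun s => by rw [hf, hf₀]⟩

include hi in
lemma hom_ext {f f' : R →+* Amax p D.e} (hβ : ∀ b, f (i (M.β b)) = f' (i (M.β b)))
    (hγ : f (i (M.γ 1)) = f' (i (M.γ 1))) : f = f' := by
  have := D.isAdicComplete_Amax
  have := D.isDomain_Amax
  have := D.charZero_Amax
  have htop : (f.comp i).eqLocus (f'.comp i) = ⊤ := by
    refine M.gen _ hβ ?_ fun m => ?_
    · apply mul_left_cancel₀ (Nat.cast_ne_zero.2 hp.1.ne_zero : (p : Amax p D.e) ≠ 0)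
      rw [← map_natCast (f.comp i), ← map_mul, M.p_mul_T, map_natCast, ← map_natCast (f'.comp i),
        ← map_mul, M.p_mul_T]
      exact hβ _
    · apply mul_left_cancel₀
        (Nat.cast_ne_zero.2 m.factorial_ne_zero : (m.factorial : Amax p D.e) ≠ 0)
      rw [← map_natCast (f.comp i), ← map_mul, M.factorial, map_natCast,
        ← map_natCast (f'.comp i), ← map_mul, M.factorial, map_pow, map_pow]
      exact congrArg (· ^ m) hγ
  refine hi.hom_ext (J := Ideal.span {(p : Amax p D.e)}) (fun s hs => ?_) fun s => ?_
  · have := map_dvd (f.comp i) (Ideal.mem_span_singleton.1 hs)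
    rw [map_natCast] at this
    exact Ideal.mem_span_singleton.2 this
  · have : s ∈ (f.comp i).eqLocus (f'.comp i) := htop ▸ Subring.mem_top s
    exact this

end Completion

end MaxPre

end BKData

end Max

/-- The map from a ring to its completion. -/
def completionHom {S : Type*} [CommRing S] (I : Ideal S) : S →+* AdicCompletion I S :=
  algebraMap _ _

lemma eq_top_of_adjoin {R A : Type*} [CommRing R] [CommRing A] [Algebra R A] {s : Set A}
    {S : Subalgebra R A} (hS : S = Algebra.adjoin R s) (Q : Subring S)
    (hR : ∀ r, algebraMap R S r ∈ Q) (hs : ∀ x : S, (x : A) ∈ s → x ∈ Q) : Q = ⊤ := by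
  subst hS
  rw [eq_top_iff]
  rintro ⟨x, hx⟩ -
  induction hx using Algebra.adjoin_induction with
  | mem x hx => exact hs ⟨x, _⟩ hx
  | algebraMap r => exact hR r
  | add x y _ _ hx hy => exact Q.add_mem hx hy
  | mul x y _ _ hx hy => exact Q.mul_mem hx hy

lemma eq_of_natCast_mul_eq {R : Type*} [CommRing R]
    (hR : ∀ n : ℕ, n ≠ 0 → ∀ x : R, (n : R) * x = 0 → x = 0) {n : ℕ} (hn : n ≠ 0) {x y z : R}
    (hx : (n : R) * x = z) (hy : (n : R) * y = z) : x = y :=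
  sub_eq_zero.1 (hR n hn _ (by rw [mul_sub, hx, hy, sub_self]))

/-! ### Generators of the divided power rings before completion -/

section General

variable (p : ℕ) [hp : Fact p.Prime]

section Crys

variable {A : Type*} [CommRing A]

/-- The completion map `A[E/p, γᵢ(z)] → A[E/p, γᵢ(z)]^∧`. -/
def ofPreMax (E : A) : preMax p E →+* MaxRing p E :=
  completionHom (Ideal.span {(p : preMax p E)})

lemma isCompletion_ofPreMax (E : A) :
    IsCompletion (Ideal.span {(p : preMax p E)}) (ofPreMax p E) :=
  isCompletion_adicCompletion (Submodule.fg_span_singleton _)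

lemma toMaxRing_C (E c : A) :
    toMaxRing p E (PowerSeries.C c) = ofPreMax p E (algebraMap A (preMax p E) c) :=
  evalAdic_C _ _ _ (mul_zMax_mem p E) c

lemma toMaxRing_X (E : A) : toMaxRing p E PowerSeries.X =
    ofPreMax p E (algebraMap A (preMax p E) E) * ofPreMax p E (zMax p E) := by
  rw [← map_mul]
  exact evalAdic_X _ _ _ (mul_zMax_mem p E)

lemma isUnit_p_away : IsUnit (p : Localization.Away (p : A)) := by
  have := IsLocalization.Away.algebraMap_isUnit (S := Localization.Away (p : A)) (p : A)
  rwa [map_natCast] at this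

lemma isUnit_natCast_away [IsAdicComplete (Ideal.span {(p : A)}) A] {n : ℕ} (hn : n ≠ 0) :
    IsUnit (n : Localization.Away (p : A)) := by
  obtain ⟨k, m, hm, rfl⟩ := Nat.exists_eq_pow_mul_and_not_dvd hn p hp.1.ne_one
  have h1 : IsUnit (m : A) :=
    isUnit_natCast_of_coprime (p := p) ((Nat.Prime.coprime_iff_not_dvd hp.1).2 hm).symm
  have h2 := h1.map (algebraMap _ (Localization.Away (p : A)))
  rw [map_natCast] at h2
  push_cast
  exact ((isUnit_p_away p).pow k).mul h2

variable [IsDomain A] [CharZero A]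

lemma away_injective : Function.Injective (algebraMap A (Localization.Away (p : A))) :=
  IsLocalization.injective _ (powers_le_nonZeroDivisors_of_noZeroDivisors
    (Nat.cast_ne_zero.2 hp.1.ne_zero))

lemma isDomain_away : IsDomain (Localization.Away (p : A)) :=
  IsLocalization.isDomain_localization (powers_le_nonZeroDivisors_of_noZeroDivisors
    (Nat.cast_ne_zero.2 hp.1.ne_zero))

lemma charZero_away : CharZero (Localization.Away (p : A)) :=
  charZero_of_injective_ringHom (away_injective p)

lemma exists_tMax (E : A) : ∃ g : preMax p E, (p : preMax p E) * g = algebraMap _ _ E := by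
  obtain ⟨u, hu⟩ := (isUnit_p_away (A := A) p).exists_right_inv
  have h : (p : Polynomial (Localization.Away (p : A))) * Polynomial.C (u * algebraMap _ _ E) =
      Polynomial.C (algebraMap _ _ E) := by
    rw [← Polynomial.C_eq_natCast, ← Polynomial.C_mul, ← mul_assoc, hu, one_mul]
  exact ⟨⟨_, Algebra.subset_adjoin (Or.inl h)⟩, Subtype.ext h⟩

/-- The element `E/p`. -/
def tMax (E : A) : preMax p E := (exists_tMax p E).choose

lemma p_mul_tMax (E : A) : (p : preMax p E) * tMax p E = algebraMap _ _ E :=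
  (exists_tMax p E).choose_spec

lemma preMax_torsionFree (E : A) (n : ℕ) (hn : n ≠ 0) (x : preMax p E)
    (hx : (n : preMax p E) * x = 0) : x = 0 := by
  have := isDomain_away (A := A) p
  have := charZero_away (A := A) p
  apply Subtype.ext
  have h := congrArg Subtype.val hx
  exact (mul_eq_zero.1 h).resolve_left (by simpa using hn)

variable [IsAdicComplete (Ideal.span {(p : A)}) A]

lemma exists_γMax (E : A) (i : ℕ) :
    ∃ g : preMax p E, (i.factorial : preMax p E) * g = zMax p E ^ i := by
  rcases Nat.eq_zero_or_pos i with rfl | hi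
  · exact ⟨1, by simp⟩
  obtain ⟨u, hu⟩ := (isUnit_natCast_away (A := A) p i.factorial_ne_zero).exists_right_inv
  have h : (i.factorial : Polynomial (Localization.Away (p : A))) *
      (Polynomial.C u * Polynomial.X ^ i) = Polynomial.X ^ i := by
    rw [← Polynomial.C_eq_natCast, ← mul_assoc, ← Polynomial.C_mul, hu, Polynomial.C_1, one_mul]
  exact ⟨⟨_, Algebra.subset_adjoin (Or.inr ⟨i, hi, h⟩)⟩, Subtype.ext h⟩

/-- The element `zⁱ/i!`. -/
def γMax (E : A) (i : ℕ) : preMax p E := (exists_γMax p E i).choose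

lemma factorial_mul_γMax (E : A) (i : ℕ) :
    (i.factorial : preMax p E) * γMax p E i = zMax p E ^ i := (exists_γMax p E i).choose_spec

lemma γMax_one (E : A) : γMax p E 1 = zMax p E := by
  simpa using factorial_mul_γMax p E 1

lemma preMax_gen (E : A) (Q : Subring (preMax p E)) (hβ : ∀ b, algebraMap A (preMax p E) b ∈ Q)
    (hT : tMax p E ∈ Q) (hγ : ∀ i, γMax p E i ∈ Q) : Q = ⊤ := by
  refine eq_top_of_adjoin (S := preMax p E) rfl Q hβ fun x hx => ?_
  rcases hx with hx' | ⟨i, hi, hx'⟩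
  · have h : (p : preMax p E) * x = algebraMap _ _ E := Subtype.ext hx'
    rwa [eq_of_natCast_mul_eq (R := preMax p E) (preMax_torsionFree p E) hp.1.ne_zero h
      (p_mul_tMax p E)]
  · have h : (i.factorial : preMax p E) * x = zMax p E ^ i := Subtype.ext hx'
    rw [eq_of_natCast_mul_eq (R := preMax p E) (preMax_torsionFree p E) i.factorial_ne_zero h
      (factorial_mul_γMax p E i)]
    exact hγ i

end Crys

section St

variable {B : Type*} [CommRing B] [IsDomain B]

/-- The completion map `B[w, E/p, γᵢ(w)] → B[w, E/p, γᵢ(w)]^∧`. -/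
def ofPreStMax (E t : B) : preStMax p E t →+* StMaxRing p E t :=
  completionHom (Ideal.span {(p : preStMax p E t)})

lemma isCompletion_ofPreStMax (E t : B) :
    IsCompletion (Ideal.span {(p : preStMax p E t)}) (ofPreStMax p E t) :=
  isCompletion_adicCompletion (Submodule.fg_span_singleton _)

/-- The element `E/p`. -/
def tSt (E t : B) : preStMax p E t := ⟨_, Algebra.subset_adjoin (Or.inl rfl)⟩

/-- The element `wⁱ/i!`. -/
def γSt (E t : B) (i : ℕ) : preStMax p E t := ⟨_, Algebra.subset_adjoin (Or.inr ⟨i, rfl⟩)⟩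

lemma coe_γSt_one (E t : B) : (γSt p E t 1 : FractionRing B) =
    algebraMap B (FractionRing B) t / algebraMap B (FractionRing B) E := by
  change (_ ^ 1 / ((Nat.factorial 1 : ℕ) : FractionRing B)) = _
  rw [Nat.factorial_one, Nat.cast_one, div_one, pow_one]

lemma mul_γSt_one {E : B} (hE : E ≠ 0) (t : B) :
    algebraMap B (preStMax p E t) E * γSt p E t 1 = algebraMap _ _ t := by
  apply Subtype.ext
  change algebraMap B (FractionRing B) E * (γSt p E t 1 : FractionRing B) = algebraMap _ _ t
  rw [coe_γSt_one, mul_div_cancel₀]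
  rwa [Ne, map_eq_zero_iff _ (IsFractionRing.injective _ _)]

variable [CharZero B]

lemma charZero_fractionRing : CharZero (FractionRing B) :=
  charZero_of_injective_ringHom (IsFractionRing.injective B (FractionRing B))

lemma p_mul_tSt (E t : B) : (p : preStMax p E t) * tSt p E t = algebraMap _ _ E :=
  have := charZero_fractionRing (B := B)
  Subtype.ext (mul_div_cancel₀ _ (Nat.cast_ne_zero.2 hp.1.ne_zero))

lemma preStMax_algebraMap_add {E : B} (hE : E ≠ 0) (t : B) {b c b' : B} (h : b = c + b' * t) :
    algebraMap B (preStMax p E t) b =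
      algebraMap _ _ c + p * (tSt p E t * γSt p E t 1 * algebraMap _ _ b') := by
  rw [h, map_add, map_mul, ← mul_γSt_one p hE, ← p_mul_tSt]
  ring

lemma preStMax_torsionFree (E t : B) (n : ℕ) (hn : n ≠ 0) (x : preStMax p E t)
    (hx : (n : preStMax p E t) * x = 0) : x = 0 := by
  have := charZero_fractionRing (B := B)
  apply Subtype.ext
  have h := congrArg Subtype.val hx
  exact (mul_eq_zero.1 h).resolve_left (by simpa using hn)

lemma factorial_mul_γSt (E t : B) (i : ℕ) :
    (i.factorial : preStMax p E t) * γSt p E t i = γSt p E t 1 ^ i := by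
  have := charZero_fractionRing (B := B)
  apply Subtype.ext
  change (i.factorial : FractionRing B) * (_ / _) = (γSt p E t 1 : FractionRing B) ^ i
  rw [coe_γSt_one]
  exact mul_div_cancel₀ _ (Nat.cast_ne_zero.2 i.factorial_ne_zero)

lemma preStMax_gen (E t : B) (Q : Subring (preStMax p E t))
    (hβ : ∀ b, algebraMap B (preStMax p E t) b ∈ Q)
    (hT : tSt p E t ∈ Q) (hγ : ∀ i, γSt p E t i ∈ Q) : Q = ⊤ := by
  refine eq_top_of_adjoin (S := preStMax p E t) rfl Q hβ ?_
  rintro ⟨x, hx'⟩ (rfl | ⟨i, rfl⟩)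
  · exact hT
  · exact hγ i

end St

end General

section Max

variable {p : ℕ} [hp : Fact p.Prime]
variable {OK : Type*} [CommRing OK] [IsDomain OK] [IsDiscreteValuationRing OK] [CharZero OK]
variable [CharP (IsLocalRing.ResidueField OK) p]
  [PerfectRing (IsLocalRing.ResidueField OK) p]
variable [IsAdicComplete (Ideal.span {(p : OK)}) OK]
variable {K : Type*} [Field K] [Algebra OK K] [IsFractionRing OK K]

variable (p OK) in
lemma charZero_BK : CharZero (BK p (IsLocalRing.ResidueField OK)) := by
  have := charZero_witt (p := p) (OK := OK)
  exact charZero_of_injective_ringHom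
    (PowerSeries.C_injective (R := WittVector p (IsLocalRing.ResidueField OK)))

variable (p OK) in
lemma charZero_BK2 : CharZero (BK2 p (IsLocalRing.ResidueField OK)) := by
  have := charZero_BK p OK
  exact charZero_of_injective_ringHom
    (PowerSeries.C_injective (R := BK p (IsLocalRing.ResidueField OK)))

namespace BKData

variable (D : BKData p OK K)

/-! ### The ring `A⁽²⁾_max` -/

/-- The generators of `A[E/p, γᵢ(z)]`. -/
def maxPreCrys : D.MaxPre (preMax p (eBK p D.E)) (BK p (IsLocalRing.ResidueField OK)) :=
  have := charZero_BK p OK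
  have := isAdicComplete_BK (p := p) (OK := OK)
  { β := algebraMap _ _
    ι := RingHom.id _
    T := tMax p (eBK p D.E)
    γ := γMax p (eBK p D.E)
    exists_eq := fun b => ⟨b, 0, by rw [mul_zero, add_zero]; rfl⟩
    p_mul_T := p_mul_tMax p _
    torsionFree := preMax_torsionFree p _
    factorial := fun i => by rw [factorial_mul_γMax, γMax_one]
    gen := preMax_gen p _ }

lemma maxPreCrys_γ_one : D.maxPreCrys.γ 1 = zMax p (eBK p D.E) := by
  have := charZero_BK p OK
  have := isAdicComplete_BK (p := p) (OK := OK)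
  exact γMax_one p _

lemma toA2max_C (c : BK p (IsLocalRing.ResidueField OK)) :
    toA2max p D.E (PowerSeries.C c) = ofPreMax p (eBK p D.E) (D.maxPreCrys.α c) :=
  toMaxRing_C p (eBK p D.E) c

lemma toA2max_X : toA2max p D.E PowerSeries.X =
    ofPreMax p (eBK p D.E) (D.maxPreCrys.α (eBK p D.E)) *
      ofPreMax p (eBK p D.E) (D.maxPreCrys.γ 1) := by
  rw [maxPreCrys_γ_one]
  exact toMaxRing_X p (eBK p D.E)

variable {D} in
lemma IsStd.comp_eq {κ : BK2 p (IsLocalRing.ResidueField OK) →+* Ainf p OK K} {v : Ainf p OK K}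
    (hκ : D.IsStd κ v) {g : BK2 p (IsLocalRing.ResidueField OK) →+* Amax p D.e}
    (hC : ∀ c, g (PowerSeries.C c) = ainfToAmax p D.e (D.bkToAinf c))
    (hX : g PowerSeries.X = ainfToAmax p D.e D.e * ainfToAmax p D.e v) :
    g = (ainfToAmax p D.e).comp κ := by
  have := D.isAdicComplete_Amax
  refine powerSeries_hom_ext (J := Ideal.span {(p : Amax p D.e)}) (fun c => ?_) ?_ ?_
  · rw [hC, RingHom.comp_apply, hκ.map_C]
  · rw [hX, RingHom.comp_apply, hκ.map_X, map_mul]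
  · rw [hX, ← p_mul_tAmax, mul_assoc]
    exact Ideal.mul_mem_right _ _ (Ideal.mem_span_singleton_self _)

variable {D} in
-- Since `p` is invertible in `B_dR^+`, the whole ring `A[1/p][z]` maps there by `z ↦ v`;
-- restricting to the divided power ring and factoring through `A_max` gives `f`. It is unique
-- because the image of `E z` is prescribed and `e` can be cancelled.
theorem IsStd.exists_hom_A2max {κ : BK2 p (IsLocalRing.ResidueField OK) →+* Ainf p OK K}
    {v : Ainf p OK K} (hκ : D.IsStd κ v) (hv : D.IsPeriod v) :
    ∃ f : A2max p D.E →+* Amax p D.e,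
      f.comp (toA2max p D.E) = (ainfToAmax p D.e).comp κ ∧
      (∀ f' : A2max p D.E →+* Amax p D.e,
        f'.comp (toA2max p D.E) = (ainfToAmax p D.e).comp κ → f' = f) ∧
      Function.Injective f ∧
      ∀ (i : ℕ) (b : A2max p D.E),
        D.jMap (f b) ∈ filBdR p OK K i ↔ b ∈ filMax p (toA2max p D.E (eBK2 p D.E)) i := by
  have := D.isDomain_BdR
  have := D.isDomain_Amax
  have : CharZero (BdR p OK K) := charZero_of_injective_ringHom D.ainfToBdR_injective
  let L := Localization.Away (p : BK p (IsLocalRing.ResidueField OK))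
  let l : L →+* BdR p OK K := IsLocalization.Away.lift (p : BK p (IsLocalRing.ResidueField OK))
    (g := (ainfToBdR p OK K).comp D.bkToAinf) (by
      rw [map_natCast]; exact isUnit_p_BdR p OK K)
  have hl : ∀ c, l (algebraMap _ _ c) = ainfToBdR p OK K (D.bkToAinf c) := fun c =>
    IsLocalization.Away.lift_eq _ _ c
  let h : preMax p (eBK p D.E) →+* BdR p OK K :=
    (Polynomial.eval₂RingHom l (ainfToBdR p OK K v)).comp (preMax p (eBK p D.E)).val.toRingHom
  have hα : ∀ c, D.jMap (ainfToAmax p D.e (D.bkToAinf c)) = h (D.maxPreCrys.α c) := by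
    intro c
    rw [jMap_ainfToAmax, ← hl]
    exact (Polynomial.eval₂_C _ _).symm
  obtain ⟨f, hf⟩ := D.maxPreCrys.exists_hom (isCompletion_ofPreMax p (eBK p D.E)) hv D.jMap
    D.jMap_injective h
    (fun b => ⟨_, hα b⟩) hα (by
      rw [maxPreCrys_γ_one, jMap_ainfToAmax]
      exact (Polynomial.eval₂_X _ _).symm)
  have hfα : ∀ c, f (ofPreMax p (eBK p D.E) (D.maxPreCrys.α c)) =
      ainfToAmax p D.e (D.bkToAinf c) := fun c =>
    D.jMap_injective (by rw [hf, hα])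
  have hfγ : f (ofPreMax p (eBK p D.E) (D.maxPreCrys.γ 1)) =
      ainfToAmax p D.e v := D.jMap_injective (by
    rw [hf, maxPreCrys_γ_one, jMap_ainfToAmax]
    exact Polynomial.eval₂_X _ _)
  have hcomp : f.comp (toA2max p D.E) = (ainfToAmax p D.e).comp κ :=
    hκ.comp_eq (fun c => by rw [RingHom.comp_apply, toA2max_C, hfα])
      (by rw [RingHom.comp_apply, toA2max_X, map_mul, hfα, hfγ, ← D.p_mul_tAmax', p_mul_tAmax])
  refine ⟨f, hcomp, fun f' hf' => ?_,
    D.maxPreCrys.injective (isCompletion_ofPreMax p (eBK p D.E)) f hv hfα hfγ, fun i b => ?_⟩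
  · have hf'α : ∀ c, f' (ofPreMax p (eBK p D.E) (D.maxPreCrys.α c)) =
        f (ofPreMax p (eBK p D.E) (D.maxPreCrys.α c)) := by
      intro c
      rw [← toA2max_C]
      exact RingHom.congr_fun (hf'.trans hcomp.symm) _
    refine D.maxPreCrys.hom_ext (isCompletion_ofPreMax p (eBK p D.E)) hf'α ?_
    have h1 := RingHom.congr_fun (hf'.trans hcomp.symm) PowerSeries.X
    rw [RingHom.comp_apply, RingHom.comp_apply, toA2max_X, map_mul, map_mul, hf'α, hfα,
      ← D.p_mul_tAmax', p_mul_tAmax] at h1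
    exact mul_left_cancel₀ D.ainfToAmax_e_ne_zero h1
  · rw [eBK2, toA2max_C]
    exact D.maxPreCrys.mem_filBdR_iff (isCompletion_ofPreMax p (eBK p D.E)) f hv hfα hfγ

/-! ### The ring `A⁽²⁾_st,max` -/

lemma eBK2_ne_zero : eBK2 p D.E ≠ 0 := by
  rw [eBK2, Ne, map_eq_zero_iff _ PowerSeries.C_injective]
  intro h
  apply D.e_ne_zero
  rw [← bkToAinf_eBK, h, map_zero]

/-- The generators of `W(k)⟦x, 𝔶⟧[w, E/p, γᵢ(w)]`. -/
def maxPreSt : D.MaxPre (preStMax p (eBK2 p D.E) (tVar p (IsLocalRing.ResidueField OK)))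
    (BK2 p (IsLocalRing.ResidueField OK)) :=
  have := charZero_BK2 p OK
  { β := algebraMap _ _
    ι := PowerSeries.C
    T := tSt p (eBK2 p D.E) (tVar p _)
    γ := γSt p (eBK2 p D.E) (tVar p _)
    exists_eq := fun b => by
      obtain ⟨b', hb⟩ := exists_eq_add_trunc b 1
      rw [pow_one, Finset.sum_range_one, pow_zero, mul_one, mul_comm, add_comm] at hb
      exact ⟨PowerSeries.coeff 0 b, _, preStMax_algebraMap_add p D.eBK2_ne_zero (tVar p _) hb⟩
    p_mul_T := p_mul_tSt p _ _
    torsionFree := preStMax_torsionFree p _ _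
    factorial := factorial_mul_γSt p _ _
    gen := preStMax_gen p _ _ }

lemma maxPreSt_relation : D.maxPreSt.β PowerSeries.X =
    D.maxPreSt.α (eBK p D.E) * D.maxPreSt.γ 1 :=
  (mul_γSt_one p D.eBK2_ne_zero (tVar p _)).symm

variable {D} in
-- The generators now live in the fraction field of `W(k)⟦x⟧⟦t⟧`. It maps to the fraction field of
-- `B_dR^+` only because `κ` is injective, which is where transcendence enters the existence of the
-- map.
theorem MaxPre.exists_hom_of_fractionRing {S : Type*} [CommRing S]
    (M : D.MaxPre S (BK2 p (IsLocalRing.ResidueField OK))) (hι : M.ι = PowerSeries.C)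
    (hX : M.β PowerSeries.X = M.α (eBK p D.E) * M.γ 1)
    (s : S →+* FractionRing (BK2 p (IsLocalRing.ResidueField OK)))
    (hs : ∀ b, s (M.β b) = algebraMap _ _ b)
    {R : Type*} [CommRing R] {i : S →+* R} (hi : IsCompletion (Ideal.span {(p : S)}) i)
    {κ : BK2 p (IsLocalRing.ResidueField OK) →+* Ainf p OK K}
    {v : Ainf p OK K} (hκ : D.IsStd κ v) (hv : D.IsPeriod v) :
    ∃ f : R →+* Amax p D.e,
      f.comp (i.comp M.β) = (ainfToAmax p D.e).comp κ ∧
      (∀ f' : R →+* Amax p D.e,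
        f'.comp (i.comp M.β) = (ainfToAmax p D.e).comp κ → f' = f) ∧
      Function.Injective f ∧
      ∀ (n : ℕ) (b : R),
        D.jMap (f b) ∈ filBdR p OK K n ↔ b ∈ filMax p (i (M.α (eBK p D.E))) n := by
  have := D.isDomain_BdR
  have := D.isDomain_Amax
  let L := FractionRing (BdR p OK K)
  have : CharZero (BdR p OK K) := charZero_of_injective_ringHom D.ainfToBdR_injective
  have : CharZero L := charZero_fractionRing
  let J : Amax p D.e →+* L := (algebraMap (BdR p OK K) L).comp D.jMap
  have hJ : Function.Injective J := (IsFractionRing.injective (BdR p OK K) L).comp D.jMap_injective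
  have hκJ : Function.Injective (J.comp ((ainfToAmax p D.e).comp κ)) :=
    hJ.comp (D.ainfToAmax_injective.comp (hκ.injective hv.transcendental))
  let h : S →+* L := (IsFractionRing.lift hκJ).comp s
  have hβ : ∀ b, J (ainfToAmax p D.e (κ b)) = h (M.β b) := fun b =>
    ((congrArg _ (hs b)).trans (IsFractionRing.lift_algebraMap hκJ b)).symm
  have hακ : ∀ c, M.α c = M.β (PowerSeries.C c) := fun c => by rw [α, hι]; rfl
  have hα : ∀ c, J (ainfToAmax p D.e (D.bkToAinf c)) = h (M.α c) := fun c => by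
    rw [← hκ.map_C, hακ]; exact hβ _
  have hγ : J (ainfToAmax p D.e v) = h (M.γ 1) := by
    have h1 := hβ PowerSeries.X
    rw [hX, map_mul, ← hα, hκ.map_X, map_mul, map_mul, ← D.p_mul_tAmax', p_mul_tAmax] at h1
    exact mul_left_cancel₀ (fun h0 => D.ainfToAmax_e_ne_zero (hJ (h0.trans (map_zero J).symm))) h1
  obtain ⟨f, hf⟩ := M.exists_hom hi hv J hJ h (fun b => ⟨_, hβ b⟩) hα hγ
  have hfα : ∀ c, f (i (M.α c)) = ainfToAmax p D.e (D.bkToAinf c) := fun c =>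
    hJ (by rw [hf, hα])
  have hfγ : f (i (M.γ 1)) = ainfToAmax p D.e v := hJ (by rw [hf, hγ])
  have hcomp : f.comp (i.comp M.β) = (ainfToAmax p D.e).comp κ :=
    RingHom.ext fun b => hJ ((hf _).trans (hβ b).symm)
  refine ⟨f, hcomp, fun f' hf' => ?_, M.injective hi f hv hfα hfγ,
    fun n b => M.mem_filBdR_iff hi f hv hfα hfγ⟩
  have hf'β : ∀ b, f' (i (M.β b)) = f (i (M.β b)) :=
    fun b => RingHom.congr_fun (hf'.trans hcomp.symm) b
  refine M.hom_ext hi hf'β ?_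
  have h1 := hf'β PowerSeries.X
  rw [hX, map_mul, map_mul, map_mul, hακ, hf'β, ← hακ, hfα, ← D.p_mul_tAmax', p_mul_tAmax] at h1
  exact mul_left_cancel₀ D.ainfToAmax_e_ne_zero h1

variable {D} in
theorem IsStd.exists_hom_A2stmax {κ : BK2 p (IsLocalRing.ResidueField OK) →+* Ainf p OK K}
    {v : Ainf p OK K} (hκ : D.IsStd κ v) (hv : D.IsPeriod v) :
    ∃ f : A2stmax p D.E →+* Amax p D.e,
      f.comp (toA2stmax p D.E) = (ainfToAmax p D.e).comp κ ∧
      (∀ f' : A2stmax p D.E →+* Amax p D.e,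
        f'.comp (toA2stmax p D.E) = (ainfToAmax p D.e).comp κ → f' = f) ∧
      Function.Injective f ∧
      ∀ (i : ℕ) (b : A2stmax p D.E),
        D.jMap (f b) ∈ filBdR p OK K i ↔ b ∈ filMax p (toA2stmax p D.E (eBK2 p D.E)) i :=
  D.maxPreSt.exists_hom_of_fractionRing rfl D.maxPreSt_relation
    (preStMax p (eBK2 p D.E) (tVar p (IsLocalRing.ResidueField OK))).val.toRingHom (fun _ => rfl)
    (isCompletion_ofPreStMax p (eBK2 p D.E) (tVar p _)) hκ hv

end BKData

end Max

/-! ### Frobenius lifts on torsion free rings -/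

/-- A Frobenius lift on a `p`-torsion free ring, with the associated `δ`. -/
structure FrobLift (p : ℕ) (P : Type*) [CommRing P] where
  /-- The Frobenius lift. -/
  φ : P →+* P
  /-- The map `(φ(f) - f ^ p) / p`. -/
  δ : P → P
  φ_eq : ∀ f, φ f = f ^ p + p * δ f
  torsionFree : ∀ f : P, (p : P) * f = 0 → f = 0

namespace FrobLift

variable {p : ℕ} [hp : Fact p.Prime] {P : Type*} [CommRing P] (X : FrobLift p P)

include X in
lemma cancel {f g : P} (h : (p : P) * f = p * g) : f = g :=
  sub_eq_zero.1 (X.torsionFree _ (by rw [mul_sub, h, sub_self]))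

lemma δ_eq_of_mul_eq {f g : P} (h : (p : P) * g = X.φ f - f ^ p) : X.δ f = g :=
  X.cancel (by rw [h, X.φ_eq]; ring)

lemma δ_mul (f g : P) : X.δ (f * g) = f ^ p * X.δ g + X.φ g * X.δ f := by
  apply X.δ_eq_of_mul_eq
  rw [map_mul, X.φ_eq f, X.φ_eq g]
  ring

lemma δ_zero : X.δ 0 = 0 := by
  apply X.δ_eq_of_mul_eq
  rw [map_zero, zero_pow hp.1.ne_zero, mul_zero, sub_zero]

lemma δ_φ (f : P) : X.δ (X.φ f) = X.φ (X.δ f) := by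
  apply X.δ_eq_of_mul_eq
  have h := congrArg X.φ (X.φ_eq f)
  rw [map_add, map_mul, map_pow, map_natCast] at h
  linear_combination -h

lemma iterate_δ_φ (f : P) (n : ℕ) : X.δ^[n] (X.φ f) = X.φ (X.δ^[n] f) := by
  induction n with
  | zero => rfl
  | succ n ih => rw [Function.iterate_succ_apply', Function.iterate_succ_apply', ih, δ_φ]

lemma δ_add_mem {W : Ideal P} {f g : P} (hf : f ∈ W) (hf' : X.δ f ∈ W) (hg' : X.δ g ∈ W) :
    X.δ (f + g) ∈ W := by
  obtain ⟨r, hr⟩ := exists_add_pow_prime_eq hp.1 f g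
  have h : X.δ (f + g) = X.δ f + X.δ g - f * (g * r) := by
    apply X.δ_eq_of_mul_eq
    rw [map_add, hr, X.φ_eq f, X.φ_eq g]
    ring
  rw [h]
  exact W.sub_mem (W.add_mem hf' hg') (W.mul_mem_right _ hf)

lemma φ_mem {I : Ideal P} (hI : ∀ f ∈ I, X.δ f ∈ I) {f : P} (hf : f ∈ I) : X.φ f ∈ I := by
  rw [X.φ_eq]
  exact I.add_mem (I.pow_mem_of_mem hf _ hp.1.pos) (I.mul_mem_left _ (hI f hf))

/-- The elements `f` of an ideal for which `δ(f)` lies in the ideal. -/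
def prolong (W : Ideal P) : Ideal P where
  carrier := {f | f ∈ W ∧ X.δ f ∈ W}
  add_mem' hf hg := ⟨W.add_mem hf.1 hg.1, X.δ_add_mem hf.1 hf.2 hg.2⟩
  zero_mem' := ⟨W.zero_mem, by rw [δ_zero]; exact W.zero_mem⟩
  smul_mem' c f hf := ⟨W.mul_mem_left c hf.1, by
    rw [smul_eq_mul, mul_comm, δ_mul]
    exact W.add_mem (W.mul_mem_right _ (W.pow_mem_of_mem hf.1 _ hp.1.pos)) (W.mul_mem_left _ hf.2)⟩

lemma iterate_δ_mem {W : Ideal P} {f : P} {n : ℕ} (hf : f ∈ X.prolong^[n] W) :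
    X.δ^[n] f ∈ W := by
  induction n generalizing f with
  | zero => exact hf
  | succ n ih =>
    rw [Function.iterate_succ_apply'] at hf
    exact ih hf.2

lemma le_iterate_prolong {I W : Ideal P} (hI : ∀ f ∈ I, X.δ f ∈ I) (h : I ≤ W) (n : ℕ) :
    I ≤ X.prolong^[n] W := by
  induction n with
  | zero => exact h
  | succ n ih =>
    rw [Function.iterate_succ_apply']
    exact fun f hf => ⟨ih hf, ih (hI f hf)⟩

lemma φ_mem_iterate_prolong {W : Ideal P} (hW : ∀ f ∈ W, X.φ f ∈ W) (n : ℕ) :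
    ∀ f ∈ X.prolong^[n] W, X.φ f ∈ X.prolong^[n] W := by
  induction n with
  | zero => exact hW
  | succ n ih =>
    rw [Function.iterate_succ_apply']
    exact fun f hf => ⟨ih f hf.1, by rw [δ_φ]; exact ih _ hf.2⟩

/-- If `g = p ^ k δ^k(f)` is in `W`, so is `φ(g) = p ^ k δ^k(f) ^ p + p ^ (k + 1) δ^(k+1)(f)`, and
the first summand is a multiple of `g`. -/
lemma pow_mul_iterate_δ_mem {W : Ideal P} (hW : ∀ f ∈ W, X.φ f ∈ W) {f : P} (hf : f ∈ W) (k : ℕ) :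
    (p : P) ^ k * X.δ^[k] f ∈ W := by
  induction k with
  | zero => simpa using hf
  | succ k ih =>
    have h := hW _ ih
    rw [map_mul, map_pow, map_natCast, X.φ_eq] at h
    rw [Function.iterate_succ_apply']
    have h2 := W.mul_mem_right ((X.δ^[k] f) ^ (p - 1)) ih
    rw [mul_assoc, mul_pow_sub_one hp.1.ne_zero] at h2
    convert W.sub_mem h h2 using 1
    ring

/-- From `δ(E a) = E ^ p δ(a) + φ(a) δ(E)` and the invertibility of `δ(E)`, it suffices to place `E
^ p δ(a)` in every prolongation of `W`. This is proved for all `E ^ p ^ k δ^k(a)` at once, by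
induction on `n`: applying `δ` produces the element for `k + 1` and the error `φ(δ^k a) δ(E ^ p ^
k)`. The factor `p ^ k` of `δ(E ^ p ^ k)` turns that error into a multiple of `p ^ k δ^k(φ a)`,
which is already known to lie there. -/
lemma φ_mem_iterate_prolong_of_mul_mem {I W : Ideal P} (hI : ∀ f ∈ I, X.δ f ∈ I) (hIW : I ≤ W)
    (hW : ∀ f ∈ W, X.φ f ∈ W) {E a : P} (hEW : E ∈ W) (hE : IsUnit (X.δ E)) (ha : E * a ∈ I)
    (n : ℕ) : X.φ a ∈ X.prolong^[n] W := by
  have step : ∀ n, E ^ p * X.δ a ∈ X.prolong^[n] W → X.φ a ∈ X.prolong^[n] W := by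
    intro n h
    have h1 := X.le_iterate_prolong hI hIW n (hI _ ha)
    rw [δ_mul] at h1
    have h2 := Ideal.sub_mem _ h1 h
    rw [add_sub_cancel_left] at h2
    exact (Ideal.mul_unit_mem_iff_mem _ hE).1 h2
  have key : ∀ n k, E ^ p ^ k * X.δ^[k] a ∈ X.prolong^[n] W := by
    intro n
    induction n with
    | zero => exact fun k => W.mul_mem_right _ (W.pow_mem_of_mem hEW _ (pow_pos hp.1.pos _))
    | succ n ih =>
      intro k
      rw [Function.iterate_succ_apply']
      refine ⟨ih k, ?_⟩
      rw [δ_mul, ← pow_mul, ← pow_succ, ← Function.iterate_succ_apply' X.δ]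
      refine Ideal.add_mem _ (ih (k + 1)) ?_
      have h1 : X.φ a ∈ X.prolong^[n] W := step n (by simpa using ih 1)
      have h2 := X.pow_mul_iterate_δ_mem (X.φ_mem_iterate_prolong hW n) h1 k
      rw [iterate_δ_φ] at h2
      -- From `φ(E) ≡ E ^ p` modulo `p`, the `p ^ k`-th powers agree modulo `p ^ (k + 1)`, and `δ`
      -- divides by one `p`.
      have h3 : (p : P) ^ k ∣ X.δ (E ^ p ^ k) := by
        obtain ⟨c, hc⟩ := dvd_sub_pow_of_dvd_sub (p := p) (a := X.φ E) (b := E ^ p)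
          ⟨X.δ E, by rw [X.φ_eq]; ring⟩ k
        refine ⟨c, X.δ_eq_of_mul_eq ?_⟩
        rw [map_pow, ← pow_mul, mul_comm (p ^ k), pow_mul, hc]
        ring
      obtain ⟨c, hc⟩ := h3
      rw [hc]
      convert Ideal.mul_mem_right c _ h2 using 1
      ring
  exact step n (by simpa using key n 1)

/-- If `E` is distinguished and `E a` lies in a `δ`-ideal, then the `p`-th powers of the elements
`δⁿ(a)` vanish modulo `p`, `E` and the ideal. -/
theorem iterate_δ_pow_mem {I : Ideal P} (hI : ∀ f ∈ I, X.δ f ∈ I) {E a : P}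
    (hE : IsUnit (X.δ E)) (ha : E * a ∈ I) (n : ℕ) :
    (X.δ^[n] a) ^ p ∈ I ⊔ Ideal.span {(p : P), E} := by
  have hp' : (p : P) ∈ I ⊔ Ideal.span {(p : P), E} :=
    Ideal.mem_sup_right (Ideal.subset_span (by simp))
  have hE' : E ∈ I ⊔ Ideal.span {(p : P), E} :=
    Ideal.mem_sup_right (Ideal.subset_span (by simp))
  have hW : I ⊔ Ideal.span {(p : P), E} ≤ (I ⊔ Ideal.span {(p : P), E}).comap X.φ := by
    refine sup_le (fun f hf => Ideal.mem_sup_left (X.φ_mem hI hf)) (Ideal.span_le.2 ?_)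
    rintro x hx
    change X.φ x ∈ I ⊔ Ideal.span {(p : P), E}
    rcases hx with hx | hx
    · rwa [hx, map_natCast]
    · rw [Set.mem_singleton_iff.1 hx, X.φ_eq]
      exact Ideal.add_mem _ (Ideal.pow_mem_of_mem _ hE' _ hp.1.pos) (Ideal.mul_mem_right _ _ hp')
  have h := X.iterate_δ_mem
    (X.φ_mem_iterate_prolong_of_mul_mem hI le_sup_left hW hE' hE ha n)
  rw [iterate_δ_φ, X.φ_eq] at h
  exact (Ideal.add_mem_iff_left _ (Ideal.mul_mem_right _ _ hp')).1 h

/-- Adding a multiple of an element `t` with `t ∣ δ(t)` to a `δ`-ideal. -/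
lemma δ_mem_sup_span {I : Ideal P} (hI : ∀ f ∈ I, X.δ f ∈ I) {t : P} (ht : t ∣ X.δ t) :
    ∀ f ∈ I ⊔ Ideal.span {t}, X.δ f ∈ I ⊔ Ideal.span {t} := by
  intro f hf
  obtain ⟨g, hg, _, hh, rfl⟩ := Submodule.mem_sup.1 hf
  obtain ⟨c, rfl⟩ := Ideal.mem_span_singleton.1 hh
  have ht' : ∀ x, t ∣ x → x ∈ I ⊔ Ideal.span {t} := fun x hx =>
    Ideal.mem_sup_right (Ideal.mem_span_singleton.2 hx)
  refine X.δ_add_mem (Ideal.mem_sup_left hg) (Ideal.mem_sup_left (hI g hg)) (ht' _ ?_)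
  rw [δ_mul]
  exact dvd_add ((dvd_pow_self _ hp.1.ne_zero).mul_right _) (ht.mul_left _)

end FrobLift

/-! ### The Frobenius lifts on power series rings and on Witt vectors -/

/-- The elements at which a ring endomorphism is a Frobenius lift. -/
def frobLiftLocus (p : ℕ) [hp : Fact p.Prime] {P : Type*} [CommRing P] (φ : P →+* P) :
    Subsemiring P where
  carrier := {x | (p : P) ∣ φ x - x ^ p}
  zero_mem' := by simp [hp.1.ne_zero]
  one_mem' := by simp
  add_mem' {x y} hx hy := by
    obtain ⟨r, hr⟩ := exists_add_pow_prime_eq hp.1 x y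
    change (p : P) ∣ φ (x + y) - (x + y) ^ p
    rw [hr, map_add]
    convert dvd_sub (dvd_add hx hy) (Dvd.intro (x * y * r) rfl) using 1
    ring
  mul_mem' {x y} hx hy := by
    change (p : P) ∣ φ (x * y) - (x * y) ^ p
    rw [map_mul]
    convert dvd_add (hx.mul_right (φ y)) (hy.mul_left (x ^ p)) using 1
    ring

/-- The elements at which `φ` is a Frobenius lift form a subsemiring containing constants and `X`,
hence all polynomials. As `X` divides `φ X`, the coefficient of index `i` involves only a truncation
of the series. -/
lemma dvd_frobenius_sub_pow {A : Type*} [CommRing A] {p : ℕ} [hp : Fact p.Prime]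
    (φ : PowerSeries A →+* PowerSeries A)
    (hC : ∀ a, (p : PowerSeries A) ∣ φ (PowerSeries.C a) - PowerSeries.C a ^ p)
    (hX : (p : PowerSeries A) ∣ φ PowerSeries.X - PowerSeries.X ^ p)
    (hX' : PowerSeries.X ∣ φ PowerSeries.X) (b : PowerSeries A) :
    (p : PowerSeries A) ∣ φ b - b ^ p := by
  rw [← map_natCast PowerSeries.C, C_dvd_iff_coeff]
  intro i
  obtain ⟨b', hb⟩ := exists_eq_add_trunc b (i + 1)
  set s := ∑ n ∈ Finset.range (i + 1), PowerSeries.C (PowerSeries.coeff n b) * PowerSeries.X ^ n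
  have hs : s ∈ frobLiftLocus p φ :=
    sum_mem fun n _ => mul_mem (show _ ∈ frobLiftLocus p φ from hC _)
      (pow_mem (show _ ∈ frobLiftLocus p φ from hX) n)
  obtain ⟨c, hc⟩ := hs
  obtain ⟨r, hr⟩ := exists_add_pow_prime_eq hp.1 (PowerSeries.X ^ (i + 1) * b') s
  obtain ⟨h, hh⟩ := hX'
  have key : φ b - b ^ p = PowerSeries.C (p : A) *
      (c - PowerSeries.X ^ (i + 1) * b' * s * r) + PowerSeries.X ^ (i + 1) *
      (h ^ (i + 1) * φ b' - PowerSeries.X ^ ((i + 1) * (p - 1)) * b' ^ p) := by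
    have h1 : (PowerSeries.X : PowerSeries A) ^ (i + 1) * PowerSeries.X ^ ((i + 1) * (p - 1)) =
        (PowerSeries.X ^ (i + 1)) ^ p := by
      rw [pow_mul, mul_pow_sub_one hp.1.ne_zero]
    rw [hb, hr, map_add, map_mul, map_pow, hh, map_natCast]
    linear_combination hc + b' ^ p * h1
  rw [key, map_add, PowerSeries.coeff_C_mul, PowerSeries.coeff_X_pow_mul',
    if_neg (by omega), add_zero]
  exact dvd_mul_right _ _

namespace FrobLift

variable {p : ℕ} [hp : Fact p.Prime] {P : Type*} [CommRing P]

/-- A Frobenius lift on a torsion free ring. -/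
def ofDvd (φ : P →+* P) (h : ∀ f, (p : P) ∣ φ f - f ^ p)
    (h0 : ∀ f : P, (p : P) * f = 0 → f = 0) : FrobLift p P where
  φ := φ
  δ f := (h f).choose
  φ_eq f := by rw [← (h f).choose_spec]; ring
  torsionFree := h0

end FrobLift

section Witt

variable (p : ℕ) [hp : Fact p.Prime] (k : Type*) [CommRing k] [CharP k p] [PerfectRing k p]

/-- The Frobenius of `W(k)`. -/
def wittFrobLift : FrobLift p (WittVector p k) :=
  .ofDvd WittVector.frobenius
    (fun f => by
      rw [← Ideal.mem_span_singleton, ← WittVector.ker_constantCoeff, RingHom.mem_ker, map_sub,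
        map_pow, sub_eq_zero]
      exact WittVector.coeff_frobenius_charP (p := p) f 0)
    (fun f hf => WittVector.eq_zero_of_p_mul_eq_zero f ((mul_comm _ _).trans hf))

lemma natCast_mul_powerSeries {A : Type*} [CommRing A] (h : ∀ f : A, (p : A) * f = 0 → f = 0)
    (f : PowerSeries A) (hf : (p : PowerSeries A) * f = 0) : f = 0 := by
  ext i
  rw [map_zero]
  apply h
  rw [← PowerSeries.coeff_C_mul, map_natCast, hf, map_zero]

omit hp [CharP k p] [PerfectRing k p] in
lemma frobSubst_C {A : Type*} [CommRing A] (φ : A →+* A) (s : PowerSeries A)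
    (hs : PowerSeries.HasSubst s) (a : A) :
    frobSubst φ s hs (PowerSeries.C a) = PowerSeries.C (φ a) := by
  rw [frobSubst, RingHom.comp_apply, PowerSeries.map_C, AlgHom.toRingHom_eq_coe, RingHom.coe_coe,
    PowerSeries.coe_substAlgHom]
  exact PowerSeries.subst_C _

lemma frobSubst_X {A : Type*} [CommRing A] (φ : A →+* A) (s : PowerSeries A)
    (hs : PowerSeries.HasSubst s) : frobSubst φ s hs PowerSeries.X = s := by
  rw [frobSubst, RingHom.comp_apply, PowerSeries.map_X, AlgHom.toRingHom_eq_coe, RingHom.coe_coe,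
    PowerSeries.substAlgHom_X]

lemma frobBK_C (a : WittVector p k) :
    frobBK p k (PowerSeries.C a) = PowerSeries.C (WittVector.frobenius a) := by
  rw [frobBK, RingHom.comp_apply, PowerSeries.map_C]
  exact PowerSeries.expand_C _ _ _

lemma frobBK_X : frobBK p k PowerSeries.X = PowerSeries.X ^ p := by
  rw [frobBK, RingHom.comp_apply, PowerSeries.map_X]
  exact PowerSeries.expand_X _ _

/-- The Frobenius of `W(k)⟦x⟧`. -/
def bkFrobLift : FrobLift p (BK p k) :=
  .ofDvd (frobBK p k)
    (dvd_frobenius_sub_pow _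
      (fun a => by
        rw [frobBK_C, show WittVector.frobenius a = _ from (wittFrobLift p k).φ_eq a, ← map_pow,
          ← map_sub, add_sub_cancel_left, map_mul, map_natCast]
        exact dvd_mul_right _ _)
      (by rw [frobBK_X, sub_self]; exact dvd_zero _)
      (by rw [frobBK_X]; exact dvd_pow_self _ hp.1.ne_zero))
    (natCast_mul_powerSeries p (wittFrobLift p k).torsionFree)

/-- The Frobenius of `W(k)⟦x⟧⟦t⟧` with a given value at `t`. -/
def bk2FrobLift (s : BK2 p k) (hs : PowerSeries.HasSubst s)
    (h1 : (p : BK2 p k) ∣ s - tVar p k ^ p) (h2 : tVar p k ∣ s) : FrobLift p (BK2 p k) :=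
  .ofDvd (frobSubst (frobBK p k) s hs)
    (dvd_frobenius_sub_pow _
      (fun a => by
        rw [frobSubst_C, show frobBK p k a = _ from (bkFrobLift p k).φ_eq a, ← map_pow, ← map_sub,
          add_sub_cancel_left, map_mul, map_natCast]
        exact dvd_mul_right _ _)
      (by rwa [frobSubst_X])
      (by rwa [frobSubst_X]))
    (natCast_mul_powerSeries p (bkFrobLift p k).torsionFree)

/-- The Frobenius of `W(k)⟦x, y⟧`. -/
def crysFrobLift : FrobLift p (BK2 p k) :=
  bk2FrobLift p k (frobT p k) (hasSubst_frobT p k)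
    (by
      obtain ⟨r, hr⟩ := exists_add_pow_prime_eq hp.1 (xVar p k) (tVar p k)
      exact ⟨xVar p k * tVar p k * r, by rw [frobT, hr]; ring⟩)
    (by
      have := sub_dvd_pow_sub_pow (xVar p k + tVar p k) (xVar p k) p
      rwa [add_sub_cancel_left] at this)

/-- The Frobenius of `W(k)⟦x, 𝔶⟧`. -/
def stFrobLift : FrobLift p (BK2 p k) :=
  bk2FrobLift p k (frobTst p k) (hasSubst_frobTst p k)
    (by
      obtain ⟨r, hr⟩ := exists_add_pow_prime_eq hp.1 1 (tVar p k)
      exact ⟨tVar p k * r, by rw [frobTst, hr]; ring⟩)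
    (by
      have := sub_dvd_pow_sub_pow (1 + tVar p k) 1 p
      rwa [add_sub_cancel_left, one_pow] at this)

end Witt

/-! ### Frobenius on `W(k)⟦x⟧` and on `A_inf`; `E` is distinguished -/

section BKData

variable {p : ℕ} [hp : Fact p.Prime]
variable {OK : Type*} [CommRing OK] [IsDomain OK] [IsDiscreteValuationRing OK] [CharZero OK]
variable [CharP (IsLocalRing.ResidueField OK) p]
  [PerfectRing (IsLocalRing.ResidueField OK) p]
variable [IsAdicComplete (Ideal.span {(p : OK)}) OK]
variable {K : Type*} [Field K] [Algebra OK K] [IsFractionRing OK K]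

variable (p OK K) in
/-- The Frobenius of `A_inf`. -/
def ainfFrobLift : FrobLift p (Ainf p OK K) := wittFrobLift p (PreTilt (OC p OK K) p)

namespace BKData

variable (D : BKData p OK K)

/-- The polynomial `E` is distinguished. -/
lemma isUnit_δ_eBK :
    IsUnit ((bkFrobLift p (IsLocalRing.ResidueField OK)).δ (eBK p D.E)) := by
  set X := bkFrobLift p (IsLocalRing.ResidueField OK) with hX
  set Y := wittFrobLift p (IsLocalRing.ResidueField OK)
  have hφ : ∀ f, PowerSeries.constantCoeff (X.φ f) =
      WittVector.frobenius (PowerSeries.constantCoeff f) := by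
    intro f
    change PowerSeries.constantCoeff (PowerSeries.expand p hp.1.ne_zero (PowerSeries.map _ f)) = _
    rw [PowerSeries.constantCoeff_expand, ← PowerSeries.coeff_zero_eq_constantCoeff_apply,
      PowerSeries.coeff_map, PowerSeries.coeff_zero_eq_constantCoeff_apply]
  have hE : PowerSeries.constantCoeff (eBK p D.E) = p * D.F.coeff 0 := by
    rw [eBK_eq, map_add, map_pow, PowerSeries.constantCoeff_X, zero_pow D.deg_ne_zero, zero_add,
      map_mul, map_natCast, ← PowerSeries.coeff_zero_eq_constantCoeff_apply, Polynomial.coeff_coe]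
  have h1 := congrArg PowerSeries.constantCoeff (X.φ_eq (eBK p D.E))
  rw [hφ, map_add, map_pow, map_mul, hE, map_mul, map_natCast, map_natCast] at h1
  -- As `E(0) = p F(0)` with `F(0)` a unit, the constant term of `δ(E)` is the Frobenius of a unit
  -- up to a multiple of `p ^ (p - 1)`.
  have h2 : PowerSeries.constantCoeff (X.δ (eBK p D.E)) =
      WittVector.frobenius (D.F.coeff 0) - p ^ (p - 1) * D.F.coeff 0 ^ p := by
    apply Y.cancel
    rw [mul_sub, h1, ← mul_assoc, mul_pow_sub_one hp.1.ne_zero, ← mul_pow, add_sub_cancel_left]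
  rw [PowerSeries.isUnit_iff_constantCoeff, h2]
  apply WittVector.isUnit_of_coeff_zero_ne_zero
  have h3 : ((p : WittVector p (IsLocalRing.ResidueField OK)) ^ (p - 1) * D.F.coeff 0 ^ p).coeff 0
      = 0 := by
    rw [← WittVector.mem_span_p_iff_coeff_zero_eq_zero]
    exact Ideal.mul_mem_right _ _ (Ideal.pow_mem_of_mem _ (Ideal.mem_span_singleton_self _) _
      (Nat.sub_pos_of_lt hp.1.one_lt))
  rw [← WittVector.constantCoeff_apply] at h3
  rw [← WittVector.constantCoeff_apply, map_sub, h3, sub_zero, WittVector.constantCoeff_apply]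
  change (WittVector.frobenius (D.F.coeff 0)).coeff 0 ≠ 0
  rw [WittVector.coeff_frobenius_charP]
  apply pow_ne_zero
  exact ((WittVector.constantCoeff (p := p)).isUnit_map D.isUnit_F_coeff).ne_zero

lemma frobenius_bkToAinf (c : BK p (IsLocalRing.ResidueField OK)) :
    D.bkToAinf (frobBK p _ c) = WittVector.frobenius (D.bkToAinf c) := by
  have := D.isAdicComplete_p_u
  have hu : WittVector.frobenius D.u = D.u ^ p := by
    rw [WittVector.frobenius_eq_map_frobenius, u, WittVector.map_teichmuller, ← map_pow]
    rfl
  have h : D.bkToAinf.comp (frobBK p _) =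
      (WittVector.frobenius (p := p)).comp D.bkToAinf := by
    refine powerSeries_hom_ext (J := Ideal.span {(p : Ainf p OK K), D.u}) (fun a => ?_) ?_ ?_
    · rw [RingHom.comp_apply, RingHom.comp_apply, frobBK_C, bkToAinf_C, bkToAinf_C,
        WittVector.frobenius_eq_map_frobenius, WittVector.frobenius_eq_map_frobenius]
      ext n
      rw [wittToAinf, WittVector.map_coeff, WittVector.map_coeff, WittVector.map_coeff,
        WittVector.map_coeff]
      exact map_pow _ _ _
    · rw [RingHom.comp_apply, RingHom.comp_apply, frobBK_X, map_pow, bkToAinf_X, hu]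
    · rw [RingHom.comp_apply, frobBK_X, map_pow, bkToAinf_X]
      exact Ideal.pow_mem_of_mem _ (Ideal.subset_span (by simp)) _ hp.1.pos
  exact RingHom.congr_fun h c

end BKData

end BKData

/-! ### The free `δ`-ring and the `δ`-ideal of the envelope -/

namespace FrobLift

variable {p : ℕ} [hp : Fact p.Prime] {B : Type*} [CommRing B] (X : FrobLift p B)

/-- The Frobenius of `B{z}`. -/
def free : FrobLift p (MvPolynomial ℕ B) :=
  .ofDvd (freeDeltaFrob p X.φ)
    (fun f => by
      have hX : ∀ n, MvPolynomial.X n ∈ frobLiftLocus p (freeDeltaFrob p X.φ) := fun n =>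
        ⟨MvPolynomial.X (n + 1), by
          rw [freeDeltaFrob, MvPolynomial.coe_eval₂Hom, MvPolynomial.eval₂_X, add_sub_cancel_left]⟩
      have hC : ∀ b, MvPolynomial.C b ∈ frobLiftLocus p (freeDeltaFrob p X.φ) := fun b =>
        ⟨MvPolynomial.C (X.δ b), by
          rw [freeDeltaFrob, MvPolynomial.coe_eval₂Hom, MvPolynomial.eval₂_C, RingHom.comp_apply,
            X.φ_eq, map_add, map_mul, map_pow, map_natCast, add_sub_cancel_left]⟩
      have h : f ∈ frobLiftLocus p (freeDeltaFrob p X.φ) := by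
        induction f using MvPolynomial.induction_on with
        | C b => exact hC b
        | add f g hf hg => exact add_mem hf hg
        | mul_X f n hf => exact mul_mem hf (hX n)
      exact h)
    (fun f hf => by
      ext m
      rw [MvPolynomial.coeff_zero]
      apply X.torsionFree
      rw [← MvPolynomial.coeff_C_mul, map_natCast, hf, MvPolynomial.coeff_zero])

lemma free_φ : X.free.φ = freeDeltaFrob p X.φ := rfl

lemma free_φ_C (b : B) : X.free.φ (MvPolynomial.C b) = MvPolynomial.C (X.φ b) := by
  rw [free_φ, freeDeltaFrob, MvPolynomial.coe_eval₂Hom, MvPolynomial.eval₂_C, RingHom.comp_apply]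

lemma free_φ_X (n : ℕ) : X.free.φ (MvPolynomial.X n) =
    MvPolynomial.X n ^ p + (p : MvPolynomial ℕ B) * MvPolynomial.X (n + 1) := by
  rw [free_φ, freeDeltaFrob, MvPolynomial.coe_eval₂Hom, MvPolynomial.eval₂_X]

lemma free_δ_C (b : B) : X.free.δ (MvPolynomial.C b) = MvPolynomial.C (X.δ b) := by
  apply X.free.δ_eq_of_mul_eq
  rw [free_φ_C, X.φ_eq, map_add, map_mul, map_pow, map_natCast, add_sub_cancel_left]

lemma free_iterate_δ_X (n : ℕ) :
    X.free.δ^[n] (MvPolynomial.X 0 : MvPolynomial ℕ B) = MvPolynomial.X n := by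
  induction n with
  | zero => rfl
  | succ n ih =>
    rw [Function.iterate_succ_apply', ih]
    apply X.free.δ_eq_of_mul_eq
    rw [free_φ_X, add_sub_cancel_left]

variable (E t : B)

lemma mem_deltaIdeal :
    MvPolynomial.C E * MvPolynomial.X 0 - MvPolynomial.C t ∈ deltaIdeal p X.φ E t :=
  Ideal.mem_sInf.2 fun {_} h => h.1

lemma δ_mem_deltaIdeal {f : MvPolynomial ℕ B} (hf : f ∈ deltaIdeal p X.φ E t) :
    X.free.δ f ∈ deltaIdeal p X.φ E t :=
  Ideal.mem_sInf.2 fun {I} hI => hI.2 f (Ideal.mem_sInf.1 hf hI) _ (by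
    rw [← free_φ, X.free.φ_eq, add_sub_cancel_left])

lemma deltaIdeal_le {I : Ideal (MvPolynomial ℕ B)}
    (h : MvPolynomial.C E * MvPolynomial.X 0 - MvPolynomial.C t ∈ I)
    (hI : ∀ f ∈ I, X.free.δ f ∈ I) : deltaIdeal p X.φ E t ≤ I :=
  sInf_le ⟨h, fun f hf _ hg => X.free.δ_eq_of_mul_eq hg ▸ hI f hf⟩

/-- Adjoining `t` to the `δ`-ideal leaves it stable under `δ`, and then it contains `E z`, so
`iterate_δ_pow_mem` applies. Enlarging the ideal is harmless, because `t` is `E z` modulo the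
original ideal. -/
lemma X_pow_mem {E t : B} (hE : IsUnit (X.δ E)) (ht : t ∣ X.δ t) (n : ℕ) :
    (MvPolynomial.X n : MvPolynomial ℕ B) ^ p ∈ deltaIdeal p X.φ E t ⊔
      Ideal.span {(p : MvPolynomial ℕ B), MvPolynomial.C E} := by
  have hgen := X.mem_deltaIdeal E t
  have h := X.free.iterate_δ_pow_mem (E := MvPolynomial.C E) (a := MvPolynomial.X 0)
    (X.free.δ_mem_sup_span (fun f => X.δ_mem_deltaIdeal E t)
      (by rw [free_δ_C]; exact map_dvd MvPolynomial.C ht))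
    (by rw [free_δ_C]; exact hE.map MvPolynomial.C)
    (by
      convert Ideal.add_mem _ (Ideal.mem_sup_left hgen)
        (Ideal.mem_sup_right (Ideal.mem_span_singleton_self (MvPolynomial.C t))) using 1
      ring) n
  rw [free_iterate_δ_X] at h
  refine (sup_le (sup_le le_sup_left ?_) le_sup_right :
    _ ≤ deltaIdeal p X.φ E t ⊔ Ideal.span {(p : MvPolynomial ℕ B), MvPolynomial.C E}) h
  rw [Ideal.span_singleton_le_iff_mem]
  convert Ideal.sub_mem _ (Ideal.mem_sup_right (Ideal.mul_mem_right (MvPolynomial.X 0) _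
    (Ideal.subset_span (Set.mem_insert_of_mem _ rfl) :
      MvPolynomial.C E ∈ Ideal.span {(p : MvPolynomial ℕ B), MvPolynomial.C E})))
    (Ideal.mem_sup_left hgen) using 1
  ring

end FrobLift

/-! ### Products indexed by digits -/

section Digits

variable {p : ℕ} [hp : Fact p.Prime] {S : Type*} [CommRing S]

/-- The product of the `xᵢ ^ mᵢ`, where the `mᵢ` are the digits of `m` in base `p`. -/
def digitProd (p : ℕ) (x : ℕ → S) (m : ℕ) : S := ∏ i ∈ Finset.range m, x i ^ (m / p ^ i % p)

lemma digitProd_eq (x : ℕ → S) {m N : ℕ} (h : m ≤ N) :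
    digitProd p x m = ∏ i ∈ Finset.range N, x i ^ (m / p ^ i % p) := by
  refine Finset.prod_subset (Finset.range_subset_range.2 h) fun i _ hi => ?_
  rw [Nat.div_eq_of_lt, Nat.zero_mod, pow_zero]
  rw [Finset.mem_range, not_lt] at hi
  exact hi.trans_lt (Nat.lt_pow_self hp.1.one_lt)

lemma digitProd_zero (x : ℕ → S) : digitProd p x 0 = 1 := by
  rw [digitProd, Finset.prod_range_zero]

lemma map_digitProd {R : Type*} [CommRing R] (f : S →+* R) (x : ℕ → S) (m : ℕ) :
    f (digitProd p x m) = digitProd p (fun i => f (x i)) m := by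
  simp only [digitProd, map_prod, map_pow]

lemma digit_add_pow {m j : ℕ} (h : m / p ^ j % p + 1 < p) (i : ℕ) :
    (m + p ^ j) / p ^ i % p = m / p ^ i % p + if i = j then 1 else 0 := by
  have hpos : ∀ i, 0 < p ^ i := fun i => pow_pos hp.1.pos i
  have hj : (m + p ^ j) / p ^ j = m / p ^ j + 1 := Nat.add_div_right _ (hpos j)
  rcases lt_trichotomy i j with hij | rfl | hij
  · rw [if_neg hij.ne, add_zero]
    obtain ⟨d, rfl⟩ := Nat.exists_eq_add_of_lt hij
    rw [show p ^ (i + d + 1) = p ^ i * (p * p ^ d) by ring, Nat.add_mul_div_left _ _ (hpos i),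
      Nat.add_mul_mod_self_left]
  · rw [if_pos rfl, hj, Nat.add_mod, Nat.mod_eq_of_lt hp.1.one_lt, Nat.mod_eq_of_lt h]
  · rw [if_neg hij.ne', add_zero]
    obtain ⟨d, rfl⟩ := Nat.exists_eq_add_of_lt hij
    have h1 : ∀ n, n / p ^ (j + d + 1) = n / p ^ j / p / p ^ d := fun n => by
      rw [Nat.div_div_eq_div_mul, Nat.div_div_eq_div_mul]
      congr 1
      ring
    rw [h1, h1, hj]
    congr 2
    have h2 := Nat.div_add_mod (m / p ^ j) p
    rw [← h2, add_assoc, Nat.mul_add_div hp.1.pos, Nat.mul_add_div hp.1.pos,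
      Nat.div_eq_of_lt h, Nat.div_eq_of_lt (Nat.mod_lt _ hp.1.pos)]

/-- Multiplication by `x j` raises the digit at place `j` by one. Without a carry this is the
product for `m + p ^ j`; with a carry a full `p`-th power of `x j` appears. -/
lemma mul_digitProd (x : ℕ → S) (m j : ℕ) :
    x j * digitProd p x m = digitProd p x (m + p ^ j) ∨ x j ^ p ∣ x j * digitProd p x m := by
  set N := m + p ^ j + j + 1
  have hj : j ∈ Finset.range N := Finset.mem_range.2 (by omega)
  rw [digitProd_eq (p := p) x (show m ≤ N by omega),
    digitProd_eq (p := p) x (show m + p ^ j ≤ N by omega)]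
  by_cases h : m / p ^ j % p + 1 < p
  · left
    simp only [digit_add_pow h, pow_add, Finset.prod_mul_distrib]
    rw [mul_comm]
    congr 1
    rw [Finset.prod_eq_single_of_mem j hj fun i _ hi => by rw [if_neg hi, pow_zero], if_pos rfl,
      pow_one]
  · right
    have h1 := Nat.mod_lt (m / p ^ j) hp.1.pos
    have h2 : p = m / p ^ j % p + 1 := by omega
    conv_lhs => rw [h2, pow_succ']
    exact mul_dvd_mul_left _ (Finset.dvd_prod_of_mem (fun i => x i ^ (m / p ^ i % p)) hj)

/-- A ring which is generated, modulo an ideal, by the image of `A` and by elements whose `p`-th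
powers lie in the ideal. -/
lemma exists_digit_expansion {A : Type*} [CommRing A] (α : A →+* S) (x : ℕ → S) (J : Ideal S)
    (hx : ∀ n, x n ^ p ∈ J)
    (hgen : ∀ Q : Subring S, (∀ a, α a ∈ Q) → (∀ n, x n ∈ Q) → (∀ s ∈ J, s ∈ Q) → Q = ⊤) (s : S) :
    ∃ c : ℕ →₀ A, s - (c.sum fun m a => α a * digitProd p x m) ∈ J := by
  let _ : Algebra A S := α.toAlgebra
  let N : Submodule A S := Submodule.span A (Set.range (digitProd p x)) ⊔ J.restrictScalars A
  -- The ring of multipliers of `N`. Since `1` lies in `N`, it is enough that the generators of `S`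
  -- preserve `N`.
  let Q : Subring S :=
    { carrier := {s | ∀ y ∈ N, s * y ∈ N}
      mul_mem' := fun ha hb y hy => by rw [mul_assoc]; exact ha _ (hb y hy)
      one_mem' := fun y hy => by rwa [one_mul]
      add_mem' := fun ha hb y hy => by rw [add_mul]; exact N.add_mem (ha y hy) (hb y hy)
      zero_mem' := fun y _ => by rw [zero_mul]; exact N.zero_mem
      neg_mem' := fun ha y hy => by rw [neg_mul]; exact N.neg_mem (ha y hy) }
  have hJN : ∀ s ∈ J, s ∈ N := fun s hs => Submodule.mem_sup_right hs
  have hQ : Q = ⊤ := by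
    refine hgen Q (fun a y hy => ?_) (fun n w hw => ?_) fun s hs y _ => hJN _ (J.mul_mem_right _ hs)
    · have := N.smul_mem a hy
      rwa [Algebra.smul_def] at this
    · obtain ⟨y, hy, z, hz, rfl⟩ := Submodule.mem_sup.1 hw
      rw [mul_add]
      refine N.add_mem ?_ (hJN _ (J.mul_mem_left _ hz))
      clear hw
      induction hy using Submodule.span_induction with
      | mem y hy =>
        obtain ⟨m, rfl⟩ := hy
        rcases mul_digitProd (p := p) x m n with h | h
        · rw [h]
          exact Submodule.mem_sup_left (Submodule.subset_span ⟨_, rfl⟩)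
        · obtain ⟨c, hc⟩ := h
          rw [hc]
          exact hJN _ (J.mul_mem_right _ (hx n))
      | zero => rw [mul_zero]; exact N.zero_mem
      | add y y' _ _ h h' => rw [mul_add]; exact N.add_mem h h'
      | smul a y _ h => rw [mul_smul_comm]; exact N.smul_mem a h
  have hs : s ∈ Q := hQ ▸ Subring.mem_top s
  have h1 := hs 1 (Submodule.mem_sup_left (Submodule.subset_span ⟨0, digitProd_zero x⟩))
  rw [mul_one] at h1
  obtain ⟨y, hy, z, hz, rfl⟩ := Submodule.mem_sup.1 h1
  obtain ⟨c, rfl⟩ := Finsupp.mem_span_range_iff_exists_finsupp.1 hy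
  refine ⟨c, ?_⟩
  have h2 : (c.sum fun m a => α a * digitProd p x m) = c.sum fun m a => a • digitProd p x m := rfl
  rw [h2, add_sub_cancel_left]
  exact hz

/-- By iteration `ω 0 ^ p ^ i` is, up to sign, `ω i` times the power of `p` with exponent `(p ^ i -
1) / (p - 1)`. Multiplying over the digits of `m` shows that the digit products are divided powers
of `ω 0` up to units. -/
lemma exists_mul_digitProd {ω : ℕ → S} (h : ∀ n, (p : S) * ω (n + 1) = -ω n ^ p) (m : ℕ) :
    ∃ a n, n * (p - 1) ≤ m ∧ ω 0 ^ m = (-1) ^ a * p ^ n * digitProd p ω m := by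
  have hω : ∀ i, ∃ a n, n * (p - 1) + 1 = p ^ i ∧ ω 0 ^ p ^ i = (-1) ^ a * p ^ n * ω i := by
    intro i
    induction i with
    | zero => exact ⟨0, 0, by simp, by simp⟩
    | succ i ih =>
      obtain ⟨a, n, hn, h1⟩ := ih
      refine ⟨a * p + 1, n * p + 1, ?_, ?_⟩
      · obtain ⟨q, hq⟩ := Nat.exists_eq_add_of_le' hp.1.one_le
        rw [pow_succ, ← hn, hq, Nat.add_sub_cancel]
        ring
      · rw [pow_succ, pow_mul, h1, mul_pow, mul_pow, ← pow_mul, ← pow_mul, pow_succ (-1 : S),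
          pow_succ (p : S)]
        linear_combination (-1 : S) ^ (a * p) * p ^ (n * p) * h i
  have key : ∀ N, ∃ a n, n * (p - 1) ≤ m % p ^ N ∧
      ω 0 ^ (m % p ^ N) = (-1) ^ a * p ^ n * ∏ i ∈ Finset.range N, ω i ^ (m / p ^ i % p) := by
    intro N
    induction N with
    | zero => exact ⟨0, 0, by simp, by simp [Nat.mod_one]⟩
    | succ N ih =>
      obtain ⟨a, n, hn, h1⟩ := ih
      obtain ⟨b, l, hl, h2⟩ := hω N
      set d := m / p ^ N % p
      refine ⟨a + b * d, n + l * d, ?_, ?_⟩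
      · have hl' : l * (p - 1) ≤ p ^ N := by omega
        rw [Nat.mod_pow_succ]
        calc (n + l * d) * (p - 1) = n * (p - 1) + l * (p - 1) * d := by ring
          _ ≤ _ := add_le_add hn (Nat.mul_le_mul_right d hl')
      · rw [Nat.mod_pow_succ, pow_add, pow_mul, h1, h2, Finset.prod_range_succ]
        ring
  obtain ⟨a, n, hn, h1⟩ := key m
  rw [Nat.mod_eq_of_lt (Nat.lt_pow_self hp.1.one_lt)] at hn h1
  exact ⟨a, n, hn, h1⟩

end Digits

/-! ### Existence and uniqueness of the map from the envelope to `A_inf` -/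

section Envelope

variable {p : ℕ} [hp : Fact p.Prime]
variable {OK : Type*} [CommRing OK] [IsDomain OK] [IsDiscreteValuationRing OK] [CharZero OK]
variable [CharP (IsLocalRing.ResidueField OK) p]
  [PerfectRing (IsLocalRing.ResidueField OK) p]
variable [IsAdicComplete (Ideal.span {(p : OK)}) OK]
variable {K : Type*} [Field K] [Algebra OK K] [IsFractionRing OK K]

lemma isCompletion_ofPreEnvelope (p : ℕ) [Fact p.Prime] {B : Type*} [CommRing B] (φ : B →+* B)
    (E t : B) :
    IsCompletion (Ideal.span {(p : PreEnvelope p φ E t), algebraMap B (PreEnvelope p φ E t) E})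
      (ofPreEnvelope p φ E t) :=
  isCompletion_adicCompletion (Submodule.fg_span (Set.toFinite _))

namespace BKData

variable (D : BKData p OK K)

/-- A Frobenius lift on `W(k)⟦x⟧⟦t⟧` which is compatible with a map to `A_inf`. -/
structure IsFrobCompatible (X : FrobLift p (BK2 p (IsLocalRing.ResidueField OK)))
    (κ : BK2 p (IsLocalRing.ResidueField OK) →+* Ainf p OK K) (v : Ainf p OK K) : Prop where
  std : D.IsStd κ v
  φ_C : ∀ c, X.φ (PowerSeries.C c) = PowerSeries.C (frobBK p _ c)
  dvd : tVar p _ ∣ X.φ (tVar p _)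
  map_φ : ∀ b, κ (X.φ b) = WittVector.frobenius (κ b)

/-- The Frobenius lift of `A_inf` and the Frobenius lift of `W(k)⟦x⟧⟦t⟧` agree if they agree
at `t`. -/
lemma isFrobCompatible_of_map_X {X : FrobLift p (BK2 p (IsLocalRing.ResidueField OK))}
    {κ : BK2 p (IsLocalRing.ResidueField OK) →+* Ainf p OK K} {v : Ainf p OK K}
    (std : D.IsStd κ v) (φ_C : ∀ c, X.φ (PowerSeries.C c) = PowerSeries.C (frobBK p _ c))
    (dvd : tVar p _ ∣ X.φ (tVar p _))
    (h : κ (X.φ (tVar p _)) = WittVector.frobenius (κ (tVar p _))) :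
    D.IsFrobCompatible X κ v where
  std := std
  φ_C := φ_C
  dvd := dvd
  map_φ b := by
    have := D.isAdicComplete_p_e
    have h1 : κ.comp X.φ = (WittVector.frobenius (p := p)).comp κ := by
      refine powerSeries_hom_ext (J := Ideal.span {(p : Ainf p OK K), D.e}) (fun c => ?_) h ?_
      · rw [RingHom.comp_apply, RingHom.comp_apply, φ_C, std.map_C, std.map_C,
          frobenius_bkToAinf]
      · obtain ⟨g, hg⟩ := dvd
        rw [RingHom.comp_apply, show X.φ PowerSeries.X = _ from hg, map_mul, tVar, std.map_X,
          mul_assoc]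
        exact Ideal.mul_mem_right _ _ (Ideal.subset_span (by simp))
    exact RingHom.congr_fun h1 b

namespace IsFrobCompatible

variable {D} {X : FrobLift p (BK2 p (IsLocalRing.ResidueField OK))}
  {κ : BK2 p (IsLocalRing.ResidueField OK) →+* Ainf p OK K} {v : Ainf p OK K}
  (h : D.IsFrobCompatible X κ v)

include h

lemma isUnit_δ_eBK2 : IsUnit (X.δ (eBK2 p D.E)) := by
  have h1 : X.δ (eBK2 p D.E) =
      PowerSeries.C ((bkFrobLift p (IsLocalRing.ResidueField OK)).δ (eBK p D.E)) := by
    apply X.δ_eq_of_mul_eq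
    rw [eBK2, h.φ_C, show frobBK p _ _ = _ from (bkFrobLift p _).φ_eq _, map_add, map_mul, map_pow,
      map_natCast, add_sub_cancel_left]
  rw [h1]
  exact D.isUnit_δ_eBK.map PowerSeries.C

lemma t_dvd_δ : tVar p _ ∣ X.δ (tVar p _) := by
  rw [tVar, PowerSeries.X_dvd_iff]
  apply (bkFrobLift p (IsLocalRing.ResidueField OK)).torsionFree
  have h1 : (PowerSeries.X : BK2 p (IsLocalRing.ResidueField OK)) ∣
      (p : BK2 p _) * X.δ PowerSeries.X := by
    have h2 := dvd_sub h.dvd (dvd_pow_self (tVar p _) hp.1.ne_zero)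
    rwa [X.φ_eq, add_sub_cancel_left] at h2
  rw [PowerSeries.X_dvd_iff, map_mul, map_natCast] at h1
  exact h1

lemma map_δ (b : BK2 p (IsLocalRing.ResidueField OK)) :
    κ (X.δ b) = (ainfFrobLift p OK K).δ (κ b) := by
  symm
  apply (ainfFrobLift p OK K).δ_eq_of_mul_eq
  have h1 := h.map_φ b
  rw [X.φ_eq, map_add, map_mul, map_pow, map_natCast] at h1
  rw [show (ainfFrobLift p OK K).φ (κ b) = _ from h1.symm, add_sub_cancel_left]

lemma map_eBK2 : κ (eBK2 p D.E) = D.e := by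
  rw [eBK2, h.std.map_C, bkToAinf_eBK]

/-! #### The map to `A_inf` -/

omit h in
/-- The map from the free `δ`-ring. -/
def freeHom (κ : BK2 p (IsLocalRing.ResidueField OK) →+* Ainf p OK K) (v : Ainf p OK K) :
    MvPolynomial ℕ (BK2 p (IsLocalRing.ResidueField OK)) →+* Ainf p OK K :=
  MvPolynomial.eval₂Hom κ fun n => (ainfFrobLift p OK K).δ^[n] v

omit h in
lemma freeHom_C (b : BK2 p (IsLocalRing.ResidueField OK)) :
    freeHom κ v (MvPolynomial.C b) = κ b := MvPolynomial.eval₂_C _ _ _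

omit h in
lemma freeHom_X (n : ℕ) : freeHom κ v (MvPolynomial.X n) = (ainfFrobLift p OK K).δ^[n] v :=
  MvPolynomial.eval₂_X _ _ _

lemma freeHom_φ (f : MvPolynomial ℕ (BK2 p (IsLocalRing.ResidueField OK))) :
    freeHom κ v (X.free.φ f) = (ainfFrobLift p OK K).φ (freeHom κ v f) := by
  have h1 : (freeHom κ v).comp X.free.φ = (ainfFrobLift p OK K).φ.comp (freeHom κ v) := by
    refine MvPolynomial.ringHom_ext (fun b => ?_) fun n => ?_
    · rw [RingHom.comp_apply, RingHom.comp_apply, X.free_φ_C, freeHom_C, freeHom_C]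
      exact h.map_φ b
    · rw [RingHom.comp_apply, RingHom.comp_apply, X.free_φ_X, map_add, map_mul, map_pow,
        map_natCast, freeHom_X, freeHom_X, (ainfFrobLift p OK K).φ_eq,
        Function.iterate_succ_apply']
  exact RingHom.congr_fun h1 f

/-- The kernel of a Frobenius-compatible map to a `p`-torsion free ring is stable under `δ`, so it
suffices that it contain the generator. -/
lemma deltaIdeal_le_ker :
    deltaIdeal p X.φ (eBK2 p D.E) (tVar p _) ≤ RingHom.ker (freeHom κ v) := by
  refine X.deltaIdeal_le _ _ ?_ fun f hf => ?_
  · rw [RingHom.mem_ker, map_sub, map_mul, freeHom_C, freeHom_C, freeHom_X, h.map_eBK2, tVar,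
      h.std.map_X, Function.iterate_zero_apply, sub_self]
  · rw [RingHom.mem_ker] at hf ⊢
    apply (ainfFrobLift p OK K).torsionFree
    have h1 := h.freeHom_φ f
    rw [X.free.φ_eq, map_add, map_mul, map_pow, map_natCast, hf, map_zero,
      zero_pow hp.1.ne_zero, zero_add] at h1
    exact h1

/-- The map from `B{t/E}`. -/
def preHom : PreEnvelope p X.φ (eBK2 p D.E) (tVar p _) →+* Ainf p OK K :=
  Ideal.Quotient.lift _ (freeHom κ v) fun _ hf => h.deltaIdeal_le_ker hf

lemma preHom_mk (f : MvPolynomial ℕ (BK2 p (IsLocalRing.ResidueField OK))) :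
    h.preHom (Ideal.Quotient.mk _ f) = freeHom κ v f := Ideal.Quotient.lift_mk _ _ _

lemma preHom_mem : ∀ s ∈ Ideal.span {(p : PreEnvelope p X.φ (eBK2 p D.E) (tVar p _)),
      algebraMap _ (PreEnvelope p X.φ (eBK2 p D.E) (tVar p _)) (eBK2 p D.E)},
    h.preHom s ∈ Ideal.span {(p : Ainf p OK K), D.e} := by
  intro s hs
  have h1 := Ideal.mem_map_of_mem h.preHom hs
  have h2 : h.preHom (algebraMap (BK2 p (IsLocalRing.ResidueField OK)) _ (eBK2 p D.E)) = D.e :=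
    (h.preHom_mk (MvPolynomial.C _)).trans (by rw [freeHom_C, h.map_eBK2])
  rwa [Ideal.map_span, Set.image_pair, map_natCast, h2] at h1

lemma exists_hom : ∃ ι : Envelope p X.φ (eBK2 p D.E) (tVar p _) →+* Ainf p OK K,
    ∀ s, ι (ofPreEnvelope p _ _ _ s) = h.preHom s :=
  have := D.isAdicComplete_p_e
  (isCompletion_ofPreEnvelope p _ _ _).exists_lift h.preHom h.preHom_mem

/-- No compatibility with `δ` is assumed of `f`. The `δ`-ideal contains all `φⁿ(E z - t)`, so `f` is
determined on `φⁿ(z)` by cancelling `φⁿ(e) ≠ 0`, and then on each `φⁱ(δⁿ z)` by induction on `n`,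
cancelling `p` in the definition of `δ`. -/
lemma hom_ext_free {f : MvPolynomial ℕ (BK2 p (IsLocalRing.ResidueField OK)) →+* Ainf p OK K}
    (hf : ∀ x ∈ deltaIdeal p X.φ (eBK2 p D.E) (tVar p _), f x = 0)
    (hC : ∀ b, f (MvPolynomial.C b) = κ b) : f = freeHom κ v := by
  set Y := ainfFrobLift p OK K
  have hinj : Function.Injective Y.φ :=
    (WittVector.frobenius_bijective p (PreTilt (OC p OK K) p)).1
  have hXC : ∀ n b, (X.free.φ ^ n) (MvPolynomial.C b) = MvPolynomial.C ((X.φ ^ n) b) := by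
    intro n b
    induction n generalizing b with
    | zero => rfl
    | succ n ih => rw [pow_succ, pow_succ, RingHom.mul_def, RingHom.mul_def, RingHom.comp_apply,
        RingHom.comp_apply, X.free_φ_C, ih]
  have hI : ∀ n, (X.free.φ ^ n) (MvPolynomial.C (eBK2 p D.E) * MvPolynomial.X 0 -
      MvPolynomial.C (tVar p _)) ∈ deltaIdeal p X.φ (eBK2 p D.E) (tVar p _) := by
    intro n
    induction n with
    | zero => exact X.mem_deltaIdeal _ _
    | succ n ih =>
      rw [pow_succ', RingHom.mul_def, RingHom.comp_apply]
      exact X.free.φ_mem (fun _ => X.δ_mem_deltaIdeal _ _) ih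
  have hκ : ∀ n b, κ ((X.φ ^ n) b) = (Y.φ ^ n) (κ b) := by
    intro n b
    induction n generalizing b with
    | zero => rfl
    | succ n ih =>
      rw [pow_succ, pow_succ, RingHom.mul_def, RingHom.mul_def, RingHom.comp_apply,
        RingHom.comp_apply, ih, h.map_φ]
      rfl
  have he : ∀ n, (Y.φ ^ n) D.e ≠ 0 := fun n =>
    (map_ne_zero_iff _ (by rw [RingHom.coe_pow]; exact hinj.iterate n)).2 D.e_ne_zero
  have h0 : ∀ n, f ((X.free.φ ^ n) (MvPolynomial.X 0)) =
      freeHom κ v ((X.free.φ ^ n) (MvPolynomial.X 0)) := by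
    intro n
    have h1 := hf _ (hI n)
    have h2 := RingHom.mem_ker.1 (h.deltaIdeal_le_ker (hI n))
    rw [map_sub, map_mul, hXC, hXC, map_sub, map_mul, sub_eq_zero, hC, hC, hκ, hκ,
      h.map_eBK2] at h1
    rw [map_sub, map_mul, hXC, hXC, map_sub, map_mul, sub_eq_zero, freeHom_C, freeHom_C, hκ, hκ,
      h.map_eBK2, ← h1] at h2
    exact (mul_left_cancel₀ (he n) h2).symm
  have key : ∀ n i, f ((X.free.φ ^ i) (MvPolynomial.X n)) =
      freeHom κ v ((X.free.φ ^ i) (MvPolynomial.X n)) := by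
    intro n
    induction n with
    | zero => exact h0
    | succ n ih =>
      intro i
      apply Y.cancel
      have h1 := ih (i + 1)
      rw [pow_succ, RingHom.mul_def, RingHom.comp_apply, X.free_φ_X] at h1
      simp only [map_add, map_mul, map_pow, map_natCast, ih i] at h1
      exact add_left_cancel h1
  refine MvPolynomial.ringHom_ext (fun b => ?_) fun n => key n 0
  rw [hC, freeHom_C]

lemma hom_ext {ι ι' : Envelope p X.φ (eBK2 p D.E) (tVar p _) →+* Ainf p OK K}
    (hι : ι.comp (toEnvelope p X.φ (eBK2 p D.E) (tVar p _)) = κ)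
    (hι' : ι'.comp (toEnvelope p X.φ (eBK2 p D.E) (tVar p _)) = κ) : ι' = ι := by
  have := D.isAdicComplete_p_e
  have key : ∀ ι : Envelope p X.φ (eBK2 p D.E) (tVar p _) →+* Ainf p OK K,
      ι.comp (toEnvelope p X.φ (eBK2 p D.E) (tVar p _)) = κ →
      ∀ s, ι (ofPreEnvelope p _ _ _ s) = h.preHom s := by
    intro ι hι s
    obtain ⟨f, rfl⟩ := Ideal.Quotient.mk_surjective s
    rw [preHom_mk]
    have h1 := h.hom_ext_free
      (f := (ι.comp (ofPreEnvelope p X.φ (eBK2 p D.E) (tVar p _))).comp (Ideal.Quotient.mk _))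
      (fun x hx => by
        rw [RingHom.comp_apply, Ideal.Quotient.eq_zero_iff_mem.2 hx, map_zero])
      (fun b => RingHom.congr_fun hι b)
    exact RingHom.congr_fun h1 f
  refine (isCompletion_ofPreEnvelope p X.φ (eBK2 p D.E) (tVar p _)).hom_ext
    (J := Ideal.span {(p : Ainf p OK K), D.e}) (fun s hs => ?_) fun s => ?_
  · rw [key ι' hι']
    exact h.preHom_mem s hs
  · rw [key ι' hι', key ι hι]

end IsFrobCompatible

end BKData

end Envelope

/-! ### Expansions in the envelope and injectivity of the map to `A_inf` -/

section Envelope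

variable {p : ℕ} [hp : Fact p.Prime]
variable {OK : Type*} [CommRing OK] [IsDomain OK] [IsDiscreteValuationRing OK] [CharZero OK]
variable [CharP (IsLocalRing.ResidueField OK) p]
  [PerfectRing (IsLocalRing.ResidueField OK) p]
variable [IsAdicComplete (Ideal.span {(p : OK)}) OK]
variable {K : Type*} [Field K] [Algebra OK K] [IsFractionRing OK K]

namespace BKData

variable (D : BKData p OK K)

namespace IsFrobCompatible

variable {D} {X : FrobLift p (BK2 p (IsLocalRing.ResidueField OK))}
  {κ : BK2 p (IsLocalRing.ResidueField OK) →+* Ainf p OK K} {v : Ainf p OK K}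
  (h : D.IsFrobCompatible X κ v)

include h

lemma isUnit_δ_e : IsUnit ((ainfFrobLift p OK K).δ D.e) := by
  rw [← h.map_eBK2, ← h.map_δ]
  exact h.isUnit_δ_eBK2.map κ

/-- In `φⁿ⁺¹(e) = φⁿ(e) ^ p + p φⁿ(δ e)` the image of `φⁿ(e)` under `θ` is a multiple of `p` by
induction and `δ e` is a unit. So the value is `p` times the sum of a unit and a multiple of `p`. -/
lemma theta_frobenius_e_ne_zero (n : ℕ) :
    theta p OK K (((ainfFrobLift p OK K).φ ^ (n + 1)) D.e) ≠ 0 := by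
  set Y := ainfFrobLift p OK K
  have hs : ∀ n, theta p OK K ((Y.φ ^ (n + 1)) D.e) =
      theta p OK K ((Y.φ ^ n) D.e) ^ p + p * theta p OK K ((Y.φ ^ n) (Y.δ D.e)) := fun n => by
    rw [pow_succ, RingHom.mul_def, RingHom.comp_apply, Y.φ_eq]
    simp only [map_add, map_mul, map_pow, map_natCast]
  have hd : ∀ n, (p : OC p OK K) ∣ theta p OK K ((Y.φ ^ n) D.e) := by
    intro n
    induction n with
    | zero => rw [pow_zero, RingHom.one_def, RingHom.id_apply, D.theta_e]; exact dvd_zero _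
    | succ n ih =>
      rw [hs]
      exact dvd_add (dvd_pow ih hp.1.ne_zero) (dvd_mul_right _ _)
  intro h0
  obtain ⟨c, hc⟩ := hd n
  have hu : IsUnit (theta p OK K ((Y.φ ^ n) (Y.δ D.e))) :=
    (h.isUnit_δ_e.map (Y.φ ^ n)).map (theta p OK K)
  rw [hs, hc, mul_pow, ← mul_pow_sub_one hp.1.ne_zero, mul_assoc, ← mul_add] at h0
  have h1 := (mul_eq_zero.1 h0).resolve_left (p_ne_zero_OC p)
  have h2 : (p : OC p OK K) ∣ theta p OK K ((Y.φ ^ n) (Y.δ D.e)) := by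
    rw [← neg_eq_iff_add_eq_zero.2 h1]
    exact ((dvd_pow_self _ (Nat.sub_pos_of_lt hp.1.one_lt).ne').mul_right _).neg_right
  exact (fact_OC p OK K).out (isUnit_of_dvd_unit h2 hu)

/-- As `t` divides `φ(t)`, the element `e` divides every `φⁿ(e v) = φⁿ(e) φⁿ(v)`, whereas for
positive `n` the factor `φⁿ(e)` is not killed by `θ`. -/
lemma theta_frobenius_v (n : ℕ) :
    theta p OK K (((ainfFrobLift p OK K).φ ^ (n + 1)) v) = 0 := by
  set Y := ainfFrobLift p OK K
  obtain ⟨g, hg⟩ := h.dvd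
  have hev : ∀ n, D.e ∣ (Y.φ ^ n) (D.e * v) := by
    intro n
    induction n with
    | zero => exact dvd_mul_right _ _
    | succ n ih =>
      rw [pow_succ, RingHom.mul_def, RingHom.comp_apply, ← h.std.map_X,
        show Y.φ (κ _) = _ from (h.map_φ _).symm, show X.φ PowerSeries.X = _ from hg, map_mul,
        tVar, h.std.map_X, map_mul]
      exact ih.mul_right _
  have h1 := D.theta_eq_zero_iff.2 (hev (n + 1))
  rw [map_mul, map_mul] at h1
  exact (mul_eq_zero.1 h1).resolve_left (h.theta_frobenius_e_ne_zero n)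

/-- All `φⁱ(φ(v))` with `i ≥ 0` lie in `ker θ`. Since `p δ(f) = φ(f) - f ^ p` and `𝒪_ℂ` is
`p`-torsion free, the same holds for `φⁱ(δⁿ(φ v))`. For `i = 0` this says `θ(φ(δⁿ v)) = 0`, which is
the relation. -/
lemma theta_iterate_δ (n : ℕ) :
    (p : OC p OK K) * theta p OK K ((ainfFrobLift p OK K).δ^[n + 1] v) =
      -theta p OK K ((ainfFrobLift p OK K).δ^[n] v) ^ p := by
  set Y := ainfFrobLift p OK K
  have key : ∀ n i, theta p OK K ((Y.φ ^ i) (Y.δ^[n] (Y.φ v))) = 0 := by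
    intro n
    induction n with
    | zero =>
      intro i
      have := h.theta_frobenius_v i
      rwa [pow_succ] at this
    | succ n ih =>
      intro i
      rw [Function.iterate_succ_apply']
      have h1 := ih (i + 1)
      rw [pow_succ, RingHom.mul_def, RingHom.comp_apply, Y.φ_eq, map_add, map_mul, map_pow,
        map_natCast, map_add, map_mul, map_pow, ih i, zero_pow hp.1.ne_zero, zero_add,
        map_natCast] at h1
      exact (mul_eq_zero.1 h1).resolve_left (p_ne_zero_OC p)
  have h1 := key n 0
  rw [pow_zero, RingHom.one_def, RingHom.id_apply, Y.iterate_δ_φ, Y.φ_eq, map_add, map_pow,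
    map_mul, map_natCast] at h1
  rw [Function.iterate_succ_apply']
  linear_combination h1

/-! #### Expansions -/

/-- Modulo `(p, E)` the element `t = E z` vanishes, so the ring is generated by `W(k)⟦x⟧` and the
`δⁿ(z)`. Their `p`-th powers vanish as well, so products with exponents below `p` span. -/
lemma exists_preEnvelope_expansion (s : PreEnvelope p X.φ (eBK2 p D.E) (tVar p _)) :
    ∃ c : ℕ →₀ BK p (IsLocalRing.ResidueField OK),
      s - (c.sum fun m a => algebraMap _ (PreEnvelope p X.φ (eBK2 p D.E) (tVar p _))
        (PowerSeries.C a) * digitProd p (fun n => Ideal.Quotient.mk _ (MvPolynomial.X n)) m) ∈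
      Ideal.span {(p : PreEnvelope p X.φ (eBK2 p D.E) (tVar p _)),
        algebraMap _ (PreEnvelope p X.φ (eBK2 p D.E) (tVar p _)) (eBK2 p D.E)} := by
  set I := deltaIdeal p X.φ (eBK2 p D.E) (tVar p (IsLocalRing.ResidueField OK))
  set J := Ideal.span {(p : PreEnvelope p X.φ (eBK2 p D.E) (tVar p _)),
        algebraMap _ (PreEnvelope p X.φ (eBK2 p D.E) (tVar p _)) (eBK2 p D.E)} with hJ
  have hmap : (I ⊔ Ideal.span {(p : MvPolynomial ℕ (BK2 p (IsLocalRing.ResidueField OK))),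
      MvPolynomial.C (eBK2 p D.E)}).map (Ideal.Quotient.mk I) ≤ J := by
    rw [Ideal.map_sup, Ideal.map_quotient_self, bot_sup_eq, Ideal.map_span, Set.image_pair,
      map_natCast]
    exact le_rfl
  have ht : algebraMap (BK2 p (IsLocalRing.ResidueField OK))
      (PreEnvelope p X.φ (eBK2 p D.E) (tVar p _)) (tVar p _) ∈ J := by
    have h1 := Ideal.Quotient.eq.2 (X.mem_deltaIdeal (eBK2 p D.E) (tVar p _))
    have h2 : algebraMap (BK2 p (IsLocalRing.ResidueField OK))
        (PreEnvelope p X.φ (eBK2 p D.E) (tVar p _)) (tVar p _) = algebraMap (BK2 p (IsLocalRing.ResidueField OK))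
        (PreEnvelope p X.φ (eBK2 p D.E) (tVar p _)) (eBK2 p D.E) * Ideal.Quotient.mk I (MvPolynomial.X 0) :=
      h1.symm.trans (map_mul _ _ _)
    rw [h2]
    exact Ideal.mul_mem_right _ _ (Ideal.subset_span (by simp))
  refine exists_digit_expansion ((algebraMap (BK2 p (IsLocalRing.ResidueField OK))
    (PreEnvelope p X.φ (eBK2 p D.E) (tVar p _))).comp
    PowerSeries.C) _ J (fun n => ?_) (fun Q hA hX hQ => ?_) s
  · rw [← map_pow]
    exact hmap (Ideal.mem_map_of_mem _ (X.X_pow_mem h.isUnit_δ_eBK2 h.t_dvd_δ n))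
  · rw [eq_top_iff]
    intro q _
    obtain ⟨f, rfl⟩ := Ideal.Quotient.mk_surjective q
    induction f using MvPolynomial.induction_on with
    | C b =>
      obtain ⟨b', hb⟩ := exists_eq_add_trunc b 1
      rw [pow_one, Finset.sum_range_one, pow_zero, mul_one] at hb
      have h1 : Ideal.Quotient.mk I (MvPolynomial.C b) =
          algebraMap _ (PreEnvelope p X.φ (eBK2 p D.E) (tVar p _)) b := rfl
      rw [h1, hb, map_add, map_mul]
      exact Q.add_mem (hQ _ (J.mul_mem_right _ ht)) (hA _)
    | add f g hf hg => rw [map_add]; exact Q.add_mem (hf trivial) (hg trivial)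
    | mul_X f n hf => rw [map_mul]; exact Q.mul_mem (hf trivial) (hX n)

section

variable {ι : Envelope p X.φ (eBK2 p D.E) (tVar p _) →+* Ainf p OK K}
  (hι : ∀ s, ι (ofPreEnvelope p _ _ _ s) = h.preHom s)

include hι

lemma map_toEnvelope (b : BK2 p (IsLocalRing.ResidueField OK)) :
    ι (toEnvelope p X.φ (eBK2 p D.E) (tVar p _) b) = κ b :=
  (hι _).trans ((h.preHom_mk (MvPolynomial.C b)).trans (freeHom_C b))

lemma map_envelopeDelta (n : ℕ) :
    ι (envelopeDelta p X.φ (eBK2 p D.E) (tVar p _) n) = (ainfFrobLift p OK K).δ^[n] v :=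
  (hι _).trans ((h.preHom_mk (MvPolynomial.X n)).trans (freeHom_X n))

lemma frobenius_envelopeDelta (n : ℕ) :
    WittVector.frobenius (ι (envelopeDelta p X.φ (eBK2 p D.E) (tVar p _) n)) =
      ι (envelopeDelta p X.φ (eBK2 p D.E) (tVar p _) n) ^ p +
        p * ι (envelopeDelta p X.φ (eBK2 p D.E) (tVar p _) (n + 1)) := by
  rw [h.map_envelopeDelta hι, h.map_envelopeDelta hι, Function.iterate_succ_apply']
  exact (ainfFrobLift p OK K).φ_eq _

/-- Here `T` is `E` itself. The digit products of the `δⁿ(z)` reduce to divided powers of `θ(v)` up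
to sign, so unique expansions give the kernel of `θ ∘ ι` as `(E)`. An element killed by `ι` is thus
`E` times another such element, as `A_inf` is a domain, and it lies in every power of `(p, E)`. -/
theorem injective (hv : D.IsPeriod v) : Function.Injective ι := by
  set Y := ainfFrobLift p OK K
  set T := toEnvelope p X.φ (eBK2 p D.E) (tVar p _) (eBK2 p D.E) with hTdef
  set ψ := (theta p OK K).comp ι
  set α := (toEnvelope p X.φ (eBK2 p D.E) (tVar p _)).comp PowerSeries.C with hαdef
  set z := envelopeDelta p X.φ (eBK2 p D.E) (tVar p _)
  have hi := isCompletion_ofPreEnvelope p X.φ (eBK2 p D.E) (tVar p _)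
  have hmap : (Ideal.span {(p : PreEnvelope p X.φ (eBK2 p D.E) (tVar p _)),
      algebraMap _ (PreEnvelope p X.φ (eBK2 p D.E) (tVar p _)) (eBK2 p D.E)}).map
        (ofPreEnvelope p X.φ (eBK2 p D.E) (tVar p _)) =
      Ideal.span {(p : Envelope p X.φ (eBK2 p D.E) (tVar p _)), T} := by
    rw [Ideal.map_span, Set.image_pair, map_natCast]
    rfl
  have := hi.complete
  rw [hmap] at this
  set J := Ideal.span {(p : Envelope p X.φ (eBK2 p D.E) (tVar p _)), T} with hJdef
  have hιT : ι T = D.e := by rw [hTdef, h.map_toEnvelope hι, h.map_eBK2]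
  have hT : ψ T = 0 := by rw [RingHom.comp_apply, hιT, D.theta_e]
  have hψJ : ∀ x ∈ J, (p : OC p OK K) ∣ ψ x := by
    intro x hx
    have h1 := Ideal.mem_map_of_mem ψ hx
    rw [hJdef, Ideal.map_span, Set.image_pair, map_natCast, hT, Ideal.span_pair_zero] at h1
    exact Ideal.mem_span_singleton.1 h1
  have H : ∀ r, ∃ (c : ℕ →₀ BK p (IsLocalRing.ResidueField OK)) (r₁ r₂ : _),
      r = (c.sum fun m a => α a * digitProd p z m) + T * r₁ + p * r₂ := by
    intro r
    obtain ⟨s, hs⟩ := hi.dense r 1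
    obtain ⟨c, hc⟩ := h.exists_preEnvelope_expansion s
    have h1 := Ideal.mem_map_of_mem (ofPreEnvelope p X.φ (eBK2 p D.E) (tVar p _)) hc
    rw [hmap] at hs h1
    rw [pow_one] at hs
    obtain ⟨a, b, hab⟩ := Ideal.mem_span_pair.1 (Ideal.add_mem _ hs h1)
    refine ⟨c, b, a, ?_⟩
    have h2 : ofPreEnvelope p X.φ (eBK2 p D.E) (tVar p _) (c.sum fun m a =>
        algebraMap _ (PreEnvelope p X.φ (eBK2 p D.E) (tVar p _)) (PowerSeries.C a) *
          digitProd p (fun n => Ideal.Quotient.mk _ (MvPolynomial.X n)) m) =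
        c.sum fun m a => α a * digitProd p z m := by
      rw [map_finsuppSum]
      refine Finset.sum_congr rfl fun m _ => ?_
      refine (map_mul _ _ _).trans ?_
      rw [map_digitProd]
      rfl
    rw [map_sub, h2] at hab
    linear_combination -hab
  have hα : ∀ c, ψ (α c) = okToOC p OK K (D.evϖ c) := fun c => by
    rw [RingHom.comp_apply, hαdef, RingHom.comp_apply, h.map_toEnvelope hι, h.std.map_C,
      theta_bkToAinf]
  have hψz : ∀ n, ψ (z n) = theta p OK K (Y.δ^[n] v) := fun n => by
    rw [RingHom.comp_apply, h.map_envelopeDelta hι]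
  have hθ : HasUniqueExpansions fun m => ψ (digitProd p z m) := by
    refine D.hasUniqueExpansions hv.transcendental hv.dvd fun m => ?_
    obtain ⟨a, n, hn, h1⟩ := exists_mul_digitProd (p := p)
      (ω := fun n => theta p OK K (Y.δ^[n] v)) h.theta_iterate_δ m
    refine ⟨(-1) ^ a, (isUnit_neg_one).pow a, n, hn, ?_⟩
    rw [map_pow, map_neg, map_one, map_digitProd]
    simp only [hψz]
    exact h1.symm
  have hdvd : ∀ r, ι r = 0 → ∃ r', r = T * r' ∧ ι r' = 0 := by
    intro r hr
    obtain ⟨r', rfl⟩ := D.dvd_of_reduction_eq_zero (J := J) (Ideal.subset_span (by simp)) α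
      (digitProd p z) T H ψ hψJ hT hα hθ dvd_rfl (r := r)
      (by rw [RingHom.comp_apply, hr, map_zero])
    refine ⟨r', rfl, ?_⟩
    rw [map_mul, hιT] at hr
    exact (mul_eq_zero.1 hr).resolve_left D.e_ne_zero
  rw [injective_iff_map_eq_zero]
  intro r hr
  refine eq_zero_of_forall_mem_pow (I := J) fun n => ?_
  have key : ∀ n, ∃ r', r = T ^ n * r' ∧ ι r' = 0 := by
    intro n
    induction n with
    | zero => exact ⟨r, by simp, hr⟩
    | succ n ih =>
      obtain ⟨r', hr', h0⟩ := ih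
      obtain ⟨r'', rfl, h0'⟩ := hdvd r' h0
      exact ⟨r'', by rw [hr']; ring, h0'⟩
  obtain ⟨r', hr', -⟩ := key n
  rw [hr']
  exact Ideal.mul_mem_right _ _ (Ideal.pow_mem_pow (Ideal.subset_span (by simp)) n)

end

theorem exists_envelope_hom (hv : D.IsPeriod v) :
    ∃ ι : Envelope p X.φ (eBK2 p D.E) (tVar p _) →+* Ainf p OK K,
      ι.comp (toEnvelope p X.φ (eBK2 p D.E) (tVar p _)) = κ ∧
      (∀ ι' : Envelope p X.φ (eBK2 p D.E) (tVar p _) →+* Ainf p OK K,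
        ι'.comp (toEnvelope p X.φ (eBK2 p D.E) (tVar p _)) = κ → ι' = ι) ∧
      (∀ n : ℕ, WittVector.frobenius (ι (envelopeDelta p X.φ (eBK2 p D.E) (tVar p _) n)) =
        ι (envelopeDelta p X.φ (eBK2 p D.E) (tVar p _) n) ^ p +
          p * ι (envelopeDelta p X.φ (eBK2 p D.E) (tVar p _) (n + 1))) ∧
      Function.Injective ι := by
  obtain ⟨ι, hι⟩ := h.exists_hom
  have hκ : ι.comp (toEnvelope p X.φ (eBK2 p D.E) (tVar p _)) = κ :=
    RingHom.ext (h.map_toEnvelope hι)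
  exact ⟨ι, hκ, fun ι' hι' => h.hom_ext hκ hι', h.frobenius_envelopeDelta hι, h.injective hι hv⟩

end IsFrobCompatible

end BKData

end Envelope

/-! ### Frobenius compatibility of the two maps from power series -/

section Envelope

variable {p : ℕ} [hp : Fact p.Prime]
variable {OK : Type*} [CommRing OK] [IsDomain OK] [IsDiscreteValuationRing OK] [CharZero OK]
variable [CharP (IsLocalRing.ResidueField OK) p]
  [PerfectRing (IsLocalRing.ResidueField OK) p]
variable [IsAdicComplete (Ideal.span {(p : OK)}) OK]
variable {K : Type*} [Field K] [Algebra OK K] [IsFractionRing OK K]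

lemma frobenius_teichmuller {R : Type*} [CommRing R] [CharP R p] (x : R) :
    WittVector.frobenius (WittVector.teichmuller p x) = WittVector.teichmuller p x ^ p := by
  rw [WittVector.frobenius_eq_map_frobenius, WittVector.map_teichmuller, ← map_pow]
  rfl

namespace BKData

variable (D : BKData p OK K) {κ : BK2 p (IsLocalRing.ResidueField OK) →+* Ainf p OK K}

lemma isFrobCompatible_crys (hκ : D.IsStd κ (D.u * D.w)) :
    D.IsFrobCompatible (crysFrobLift p _) κ (D.u * D.w) := by
  have hX : (crysFrobLift p (IsLocalRing.ResidueField OK)).φ (tVar p _) = frobT p _ :=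
    frobSubst_X _ _ (hasSubst_frobT p _)
  refine D.isFrobCompatible_of_map_X hκ (frobSubst_C _ _ (hasSubst_frobT p _)) ?_ ?_
  · rw [hX, frobT]
    have := sub_dvd_pow_sub_pow (xVar p (IsLocalRing.ResidueField OK) + tVar p _) (xVar p _) p
    rwa [add_sub_cancel_left] at this
  · have h1 : κ (tVar p _) = D.ε * D.u - D.u := by
      rw [tVar, hκ.map_X]
      linear_combination D.u * D.e_mul_w
    have h2 : κ (xVar p _) = D.u := by rw [xVar, hκ.map_C, bkToAinf_X]
    rw [hX, frobT, map_sub, map_pow, map_pow, map_add, h1, h2, map_sub, map_mul, u, ε,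
      frobenius_teichmuller, frobenius_teichmuller]
    ring

lemma isFrobCompatible_st (hκ : D.IsStd κ D.w) :
    D.IsFrobCompatible (stFrobLift p _) κ D.w := by
  have hX : (stFrobLift p (IsLocalRing.ResidueField OK)).φ (tVar p _) = frobTst p _ :=
    frobSubst_X _ _ (hasSubst_frobTst p _)
  refine D.isFrobCompatible_of_map_X hκ (frobSubst_C _ _ (hasSubst_frobTst p _)) ?_ ?_
  · rw [hX, frobTst]
    have := sub_dvd_pow_sub_pow (1 + tVar p (IsLocalRing.ResidueField OK)) 1 p
    rwa [add_sub_cancel_left, one_pow] at this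
  · have h1 : κ (tVar p _) = D.ε - 1 := by rw [tVar, hκ.map_X, e_mul_w]
    rw [hX, frobTst, map_sub, map_pow, map_add, map_one, h1, map_sub, map_one, ε,
      frobenius_teichmuller]
    ring

end BKData

end Envelope

end PrismEmb

end

/-! ### The theorem, with period `u w` for `A⁽²⁾` and `w` for `A⁽²⁾_st` -/

theorem corollary2p17
    (p : ℕ) [Fact p.Prime]
    (OK : Type*) [CommRing OK] [IsDomain OK] [IsDiscreteValuationRing OK] [CharZero OK]
    [CharP (IsLocalRing.ResidueField OK) p] [PerfectRing (IsLocalRing.ResidueField OK) p]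
    [IsAdicComplete (Ideal.span {(p : OK)}) OK]
    (K : Type*) [Field K] [Algebra OK K] [IsFractionRing OK K]
    -- a uniformizer and its Eisenstein polynomial
    (ϖ : OK) (hϖ : Irreducible ϖ)
    (E : Polynomial (WittVector p (IsLocalRing.ResidueField OK)))
    (hmonic : E.Monic)
    (hEis : E.IsEisensteinAt
      (Ideal.span {(p : WittVector p (IsLocalRing.ResidueField OK))}))
    (hroot : E.eval₂ (wittToOK p OK) ϖ = 0)
    -- compatible systems of `p ^ n`-th roots of `ϖ` and of primitive `p ^ n`-th roots of unity
    (a : ℕ → OKbar OK K) (ha0 : a 0 = algebraMap OK (OKbar OK K) ϖ)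
    (ha : ∀ n, a (n + 1) ^ p = a n)
    (ζ : ℕ → OKbar OK K) (hζ : ∀ n, ζ (n + 1) ^ p = ζ n)
    (hprim : ∀ n, IsPrimitiveRoot (ζ n) (p ^ n))
    -- `u = [ϖ^♭]`, `ε = [ζ^♭]` and `E = E(u)` in `A_inf`
    (u ε e : Ainf p OK K)
    (hu : u = WittVector.teichmuller p (flatOfSeq p a ha))
    (hε : ε = WittVector.teichmuller p (flatOfSeq p ζ hζ))
    (he : e = eAinf p E (flatOfSeq p a ha)) :
    -- the natural maps `W(k)⟦x, y⟧ → A_inf`, `W(k)⟦x, 𝔶⟧ → A_inf` and `A_max → B_dR^+`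
    (∃! κ : BK2 p (IsLocalRing.ResidueField OK) →+* Ainf p OK K,
      IsEval p κ u (xVar p _ + tVar p _) (ε * u)) ∧
    (∃! κst : BK2 p (IsLocalRing.ResidueField OK) →+* Ainf p OK K,
      IsEval p κst u (tVar p _) (ε - 1)) ∧
    (∃! j : Amax p e →+* BdR p OK K, IsBdRInclusion p e j) ∧
    -- `θ((ε - 1) / E)` is transcendental
    (∃ w : Ainf p OK K, e * w = ε - 1 ∧
      Transcendental OK (WittVector.fontaineTheta (OC p OK K) p w)) ∧
    ∀ (κ κst : BK2 p (IsLocalRing.ResidueField OK) →+* Ainf p OK K)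
      (j : Amax p e →+* BdR p OK K),
      IsEval p κ u (xVar p _ + tVar p _) (ε * u) →
      IsEval p κst u (tVar p _) (ε - 1) →
      IsBdRInclusion p e j →
      Function.Injective κ ∧ Function.Injective κst ∧
      Function.Injective (ainfToAmax p e) ∧ Function.Injective j ∧
      -- `A⁽²⁾_max → A_max`
      (∃ f : A2max p E →+* Amax p e,
        f.comp (toA2max p E) = (ainfToAmax p e).comp κ ∧
        (∀ f' : A2max p E →+* Amax p e,
          f'.comp (toA2max p E) = (ainfToAmax p e).comp κ → f' = f) ∧
        Function.Injective f ∧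
        ∀ (i : ℕ) (b : A2max p E),
          j (f b) ∈ filBdR p OK K i ↔ b ∈ filMax p (toA2max p E (eBK2 p E)) i) ∧
      -- `A⁽²⁾_st,max → A_max`
      (∃ f : A2stmax p E →+* Amax p e,
        f.comp (toA2stmax p E) = (ainfToAmax p e).comp κst ∧
        (∀ f' : A2stmax p E →+* Amax p e,
          f'.comp (toA2stmax p E) = (ainfToAmax p e).comp κst → f' = f) ∧
        Function.Injective f ∧
        ∀ (i : ℕ) (b : A2stmax p E),
          j (f b) ∈ filBdR p OK K i ↔ b ∈ filMax p (toA2stmax p E (eBK2 p E)) i) ∧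
      -- `ι_A : A⁽²⁾ → A_inf`
      (∃ ι : A2 p E →+* Ainf p OK K,
        ι.comp (toA2 p E) = κ ∧
        (∀ ι' : A2 p E →+* Ainf p OK K,
          ι'.comp (toA2 p E) = κ → ι' = ι) ∧
        (∀ n : ℕ, WittVector.frobenius (ι (deltaZ p E n)) =
          ι (deltaZ p E n) ^ p +
            p * ι (deltaZ p E (n + 1))) ∧
        Function.Injective ι) ∧
      -- `ι_st : A⁽²⁾_st → A_inf`
      (∃ ι : A2st p E →+* Ainf p OK K,
        ι.comp (toA2st p E) = κst ∧
        (∀ ι' : A2st p E →+* Ainf p OK K,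
          ι'.comp (toA2st p E) = κst → ι' = ι) ∧
        (∀ n : ℕ, WittVector.frobenius (ι (deltaW p E n)) =
          ι (deltaW p E n) ^ p +
            p * ι (deltaW p E (n + 1))) ∧
        Function.Injective ι) := by
  subst hu hε he
  let D : BKData p OK K := ⟨ϖ, hϖ, E, hmonic, hEis, hroot, a, ha0, ha, ζ, hζ, hprim⟩
  have hcrys : ∀ κ : BK2 p (IsLocalRing.ResidueField OK) →+* Ainf p OK K,
      D.IsStd κ (D.u * D.w) ↔ IsEval p κ D.u (xVar p _ + tVar p _) (D.ε * D.u) :=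
    fun _ => D.isStd_iff_isEval_crys
  have hst : ∀ κ : BK2 p (IsLocalRing.ResidueField OK) →+* Ainf p OK K,
      D.IsStd κ D.w ↔ IsEval p κ D.u (tVar p _) (D.ε - 1) := fun κ => by
    rw [D.isStd_iff_isEval, D.e_mul_w]
  refine ⟨?_, ?_, ⟨D.jMap, D.isBdRInclusion_jMap, fun j hj =>
    D.isBdRInclusion_unique hj D.isBdRInclusion_jMap⟩,
    ⟨D.w, D.e_mul_w, D.isPeriod_w.transcendental⟩, ?_⟩
  · obtain ⟨κ, hκ⟩ := D.exists_isStd (D.u * D.w)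
    exact ⟨κ, (hcrys κ).1 hκ, fun κ' hκ' => ((hcrys κ').2 hκ').unique hκ⟩
  · obtain ⟨κ, hκ⟩ := D.exists_isStd D.w
    exact ⟨κ, (hst κ).1 hκ, fun κ' hκ' => ((hst κ').2 hκ').unique hκ⟩
  intro κ κst j h1 h2 hj
  have hκ := (hcrys κ).2 h1
  have hκst := (hst κst).2 h2
  obtain rfl : j = D.jMap := D.isBdRInclusion_unique hj D.isBdRInclusion_jMap
  exact ⟨hκ.injective D.isPeriod_u_mul_w.transcendental,
    hκst.injective D.isPeriod_w.transcendental, D.ainfToAmax_injective, D.jMap_injective,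
    hκ.exists_hom_A2max D.isPeriod_u_mul_w, hκst.exists_hom_A2stmax D.isPeriod_w,
    (D.isFrobCompatible_crys hκ).exists_envelope_hom D.isPeriod_u_mul_w,
    (D.isFrobCompatible_st hκst).exists_envelope_hom D.isPeriod_w⟩
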